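/- **Setting.** Let $d,M\ge 1$ be integers, $w>0$ and $\epsilon>0$ real, $Q_1,\dots,Q_M\in\mathbb C^{d\times d}$ with operator norm $\|Q_i\|_{\mathrm{op}}\le w$, and $p\in\mathbb C^M$ with $|p_i|\le w$ for all $i$. Let $D$ be the set of density operators (positive semidefinite, trace $1$) on $\mathbb C^d$, $\langle A,B\rangle=\operatorname{Tr}(A^*B)$, $q(\rho)=(\langle Q_1,\rho\rangle,\dots,\langle Q_M,\rho\rangle)$, and let the $\mathcal Q$-space be $\{q(\rho):\rho\in D\}$. Put $\mathrm{dis}(p)=\min_{\rho\in D}\|p-q(\rho)\|_1$. **Algorithm.** Let $\gamma=\frac{\epsilon}{8Mw}$ and $T=\max\{1,\lceil \ln d/\gamma^2\rceil\}$. For $t=1,\dots,T$: - let $W^{(t)}=\exp\bigl(-\frac{\gamma}{4Mw}\sum_{\tau<t}N^{(\tau)}\bigr)$ and $\rho^{(t)}=W^{(t)}/\operatorname{Tr}W^{(t)}$; - write $p_i-q_i(\rho^{(t)})=c_ie^{\mathrm i\phi_i}$ with $c_i\ge 0$ and $\phi_i$ real (any $\phi_i$ is allowed if $c_i=0$); -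 let $S=\sum_i e^{\mathrm i\phi_i}Q_i$ and $N^{(t)}=\operatorname{Re}\bigl(\sum_i p_ie^{-\mathrm i\phi_i}\bigr)\mathbb 1-\tfrac12(S+S^*)+2Mw\,\mathbb 1$. Return $\tilde d=\frac1T\sum_{t=1}^T\langle\rho^{(t)},N^{(t)}-2Mw\,\mathbb 1\rangle$. An *$\eta$-precision run* is defined in the same way, except that every entry of $\rho^{(t)}$ and of $N^{(t)}$, every coordinate of the polar decomposition of $p-q(\rho^{(t)})$ and the return value may be off by at most $\eta$ in modulus from the value that these formulas assign to the previously computed quantities. **Machine model.** Programs are those of a parallel random access machine over the integers with logarithmic cost: expressions are built from constants, private registers, cells of shared arrays, $+,-,\times$, integer division and bit length; programs are built from assignments to registers and array cells, sequencing, branching on positivity, sequential for-loops and parallel for-loops. The branches of a parallel loop start from the same state and do not see each other's changes; at the end, a cell that some branches have changed takes the value given by the one with the largest index. Every operation is charged the bit lengths of the numbers involved. The running time (work) is the total cost of all operations, and the parallel time (depth) is the cost when the branches of each parallel loop are executed simultaneously. A program is *in NC* on a family of inputs of sizes $n\ge 2$ if its work is at most $Cn^k$ and its depth at most $C(\ln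 n)^k$ for some constants $C,k$. **Lemma.** (1) The minimum in $\mathrm{dis}(p)$ is attained, the algorithm can be executed, and for every choice of the phases its return value satisfies $\tilde d-\epsilon\le \mathrm{dis}(p)\le\tilde d+\epsilon$. (2) There are a single program $P$ and a constant $c\in\mathbb N$ with the following properties. The input of $P$ consists of the integers $d,M,\lceil w\rceil,\lceil1/\epsilon\rceil$ and of the real and imaginary parts of all entries of $Q_1,\dots,Q_M,p$, each given with $b=c\cdot\mathrm{size}(d+M+\lceil w\rceil+\lceil 1/\epsilon\rceil)$ binary places after the point, up to an error of at most $2^{-b}$, where $\mathrm{size}$ is the binary length. - (a) $P$ returns a rational number $\tilde d$ (as a numerator and a positive denominator) with $\tilde d-\epsilon\le\mathrm{dis}(p)\le\tilde d+\epsilon$, and $\tilde d$ is the return value of an $\eta$-precision run of the algorithm above, where in the algorithm $w$ is replaced by $\lceil w\rceil$, $\epsilon$ by $\frac{1}{2\lceil 1/\epsilon\rceil}$, and the resulting $T$ possibly by $T+1$, and where $\eta=\frac{1}{100\,d^2M\lceil w\rceil\lceil1/\epsilon\rceil}$. - (b) There are constants $C,k$ such that for all $d,M,w,\epsilon$ and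 all such inputs the running time of $P$ is at most $C(d+M+w+1/\epsilon)^k$. - (c) If $M,w,\epsilon$ are functions of $d$ (with $M\ge1$ and $w,\epsilon>0$) such that $M$, $w$ and $1/\epsilon$ are each $O((\ln d)^a)$ for some $a\in\mathbb N$, then $P$ is in NC on the inputs with these parameters, where the input size is $d$. -/

import Mathlib

open scoped Matrix BigOperators ComplexOrder

namespace QDist

section Distance

variable {d M : ℕ}

/-- Density operators on `ℂ^d`. -/
def IsDensity (ρ : Matrix (Fin d) (Fin d) ℂ) : Prop :=
  ρ.PosSemidef ∧ ρ.trace = 1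

/-- The operator norm of a matrix acting on the Euclidean space `ℂ^d`. -/
noncomputable def opNorm (A : Matrix (Fin d) (Fin d) ℂ) : ℝ :=
  ‖Matrix.toEuclideanCLM (n := Fin d) (𝕜 := ℂ) A‖

/-- `q(ρ) = (⟨Q₁, ρ⟩, …, ⟨Q_M, ρ⟩)` with the inner product `⟨A, B⟩ = Tr (A* B)`. -/
def qvec (Q : Fin M → Matrix (Fin d) (Fin d) ℂ) (ρ : Matrix (Fin d) (Fin d) ℂ) : Fin M → ℂ :=
  fun k => ((Q k)ᴴ * ρ).trace

/-- The `Q`-space, the set of all `q(ρ)` for density operators `ρ`. -/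
def qSpace (Q : Fin M → Matrix (Fin d) (Fin d) ℂ) : Set (Fin M → ℂ) :=
  qvec Q '' {ρ | IsDensity ρ}

/-- The raw set of vectors all of whose coordinates have modulus at most `w`. -/
def raw (M : ℕ) (w : ℝ) : Set (Fin M → ℂ) := {p | ∀ k, ‖p k‖ ≤ w}

/-- The `ℓ₁` norm on `ℂ^M`. -/
noncomputable def l1 (x : Fin M → ℂ) : ℝ := ∑ k, ‖x k‖

/-- The `ℓ₁` distance from `p` to the `Q`-space. -/
noncomputable def dis (Q : Fin M → Matrix (Fin d) (Fin d) ℂ) (p : Fin M → ℂ) : ℝ :=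
  sInf ((fun q => l1 (p - q)) '' qSpace Q)

end Distance

section Algorithm

variable {d M : ℕ}

/-- The learning rate `γ = ε / (8 M w)`. -/
noncomputable def rate (M : ℕ) (w ε : ℝ) : ℝ := ε / (8 * M * w)

/-- The number of rounds `T = ⌈ln d / γ²⌉`; the maximum with `1` matters only for `d = 1`. -/
noncomputable def rounds (d M : ℕ) (w ε : ℝ) : ℕ :=
  max 1 ⌈Real.log d / rate M w ε ^ 2⌉₊

/-- The loss matrix for the phases `φ`: with `z = (e^{-iφ₁}, …, e^{-iφ_M})` and
`S = ∑ e^{iφ_k} Q_k`, it is `Re ⟨p, z⟩ 1 - (S + S*)/2 + 2 M w 1`, where `⟨p, z⟩ = ∑ p_k z_k`. -/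
noncomputable def loss (Q : Fin M → Matrix (Fin d) (Fin d) ℂ) (p : Fin M → ℂ) (w : ℝ)
    (φ : Fin M → ℝ) : Matrix (Fin d) (Fin d) ℂ :=
  let S : Matrix (Fin d) (Fin d) ℂ := ∑ k, Complex.exp (φ k * Complex.I) • Q k
  (((∑ k, p k * Complex.exp (-(φ k * Complex.I))).re : ℝ) : ℂ) • 1
    - (1 / 2 : ℂ) • (S + Sᴴ) + ((2 * M * w : ℝ) : ℂ) • 1

/-- `e^A / Tr e^A`. -/
noncomputable def gibbs (A : Matrix (Fin d) (Fin d) ℂ) : Matrix (Fin d) (Fin d) ℂ :=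
  (NormedSpace.exp A).trace⁻¹ • NormedSpace.exp A

/-- An execution, with `T` rounds and all quantities computed up to an absolute error `η`, of the
matrix multiplicative weights algorithm for `Q`, `p`, `w`, `ε`; the execution is exact if `η = 0`.
In round `t` (counted from `0`) the algorithm has the density operator `ρ t`, the phases `φ t` of
the polar form of `p - q(ρ t)` (any phase may be taken for a coordinate that vanishes) and the loss
matrix `N t`. It returns `v`. The losses lie between `0` and `4 M w`, and enter the weights
`exp (-γ ∑ N / (4 M w))` divided by that bound. -/
structure IsRun (Q : Fin M → Matrix (Fin d) (Fin d) ℂ) (p : Fin M → ℂ) (w ε : ℝ)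
    (T : ℕ) (η : ℝ) (ρ : ℕ → Matrix (Fin d) (Fin d) ℂ) (φ : ℕ → Fin M → ℝ)
    (N : ℕ → Matrix (Fin d) (Fin d) ℂ) (v : ℝ) : Prop where
  density : ∀ t < T, ∀ i j,
    ‖(ρ t - gibbs (-((rate M w ε / (4 * M * w) : ℝ) : ℂ) • ∑ s ∈ Finset.range t, N s)) i j‖ ≤ η
  polar : ∀ t < T, ∀ k,
    ‖(p - qvec Q (ρ t)) k
      - ‖(p - qvec Q (ρ t)) k‖ * Complex.exp (φ t k * Complex.I)‖ ≤ η
  loss : ∀ t < T, ∀ i j, ‖(N t - loss Q p w (φ t)) i j‖ ≤ η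
  result : |v - (1 / (T : ℝ)) * ∑ t ∈ Finset.range T,
    (((ρ t)ᴴ * (N t - ((2 * M * w : ℝ) : ℂ) • 1)).trace).re| ≤ η

end Algorithm

/-! The machine model: a parallel random access machine over the integers with logarithmic cost,
in the work and depth presentation. Every elementary operation is charged the bit lengths of the
numbers involved. The work is the total cost of all operations, i.e. the running time if the
parallel branches are executed one after the other, and the depth is the parallel time. -/

section Machine

/-- The number of binary digits of `|n|`. -/
def bits (n : ℤ) : ℕ := n.natAbs.size

/-- Private registers, and a shared memory of integer arrays, where `mem a i j k` is the content
of cell `(i, j, k)` of array `a`. -/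
structure State where
  reg : ℕ → ℤ
  mem : ℕ → ℤ → ℤ → ℤ → ℤ

/-- Write `v` into register `x`. -/
def State.setReg (s : State) (x : ℕ) (v : ℤ) : State :=
  { s with reg := Function.update s.reg x v }

/-- Write `v` into cell `(i, j, k)` of array `a`. -/
def State.setMem (s : State) (a : ℕ) (i j k v : ℤ) : State :=
  { s with mem := fun a' i' j' k' =>
      if a' = a ∧ i' = i ∧ j' = j ∧ k' = k then v else s.mem a' i' j' k' }

/-- Integer expressions. `div` is integer division, and `len` is the bit length. -/
inductive Expr where
  | const (n : ℤ)
  | reg (x : ℕ)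
  | load (a : ℕ) (i j k : Expr)
  | add (e f : Expr)
  | sub (e f : Expr)
  | mul (e f : Expr)
  | div (e f : Expr)
  | len (e : Expr)

/-- The value of an expression. -/
def Expr.eval (s : State) : Expr → ℤ
  | .const n => n
  | .reg x => s.reg x
  | .load a i j k => s.mem a (i.eval s) (j.eval s) (k.eval s)
  | .add e f => e.eval s + f.eval s
  | .sub e f => e.eval s - f.eval s
  | .mul e f => e.eval s * f.eval s
  | .div e f => e.eval s / f.eval s
  | .len e => (bits (e.eval s) : ℤ)

/-- The cost of evaluating an expression: for every node, one plus the bit length of its value. -/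
def Expr.cost (s : State) : Expr → ℕ
  | .const n => 1 + bits n
  | .reg x => 1 + bits (s.reg x)
  | .load a i j k =>
      1 + bits ((Expr.load a i j k).eval s) + i.cost s + j.cost s + k.cost s
  | .add e f => 1 + bits ((Expr.add e f).eval s) + e.cost s + f.cost s
  | .sub e f => 1 + bits ((Expr.sub e f).eval s) + e.cost s + f.cost s
  | .mul e f => 1 + bits ((Expr.mul e f).eval s) + e.cost s + f.cost s
  | .div e f => 1 + bits ((Expr.div e f).eval s) + e.cost s + f.cost s
  | .len e => 1 + bits ((Expr.len e).eval s) + e.cost s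

/-- Programs. `loop x e c` executes `c` one after the other for `x = 0, …, e - 1`, and `par x e c`
executes `c` simultaneously for `x = 0, …, e - 1`. -/
inductive Cmd where
  | skip
  | set (x : ℕ) (e : Expr)
  | store (a : ℕ) (i j k e : Expr)
  | seq (c c' : Cmd)
  | ifPos (e : Expr) (c c' : Cmd)
  | loop (x : ℕ) (e : Expr) (c : Cmd)
  | par (x : ℕ) (e : Expr) (c : Cmd)

/-- The shared memory after `n` simultaneous branches: a cell changed by some branch gets the
value that the branch with the largest index among those has given to it. -/
def merge (m : ℕ → ℤ → ℤ → ℤ → ℤ) (f : ℕ → ℕ → ℤ → ℤ → ℤ → ℤ) : ℕ → ℕ → ℤ → ℤ → ℤ → ℤ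
  | 0 => m
  | n + 1 => fun a i j k => if f n a i j k = m a i j k then merge m f n a i j k else f n a i j k

/-- The final state, the work and the depth of an execution. -/
structure Outcome where
  state : State
  work : ℕ
  depth : ℕ

/-- The execution of a program. The branches of `par` start from the same state, do not see each
other's changes, and have their own registers, which are discarded when the branches join. -/
def Cmd.run : Cmd → State → Outcome
  | .skip, s => ⟨s, 1, 1⟩
  | .set x e, s => ⟨s.setReg x (e.eval s), 1 + e.cost s, 1 + e.cost s⟩
  | .store a i j k e, s =>
      let t := 1 + i.cost s + j.cost s + k.cost s + e.cost s
      ⟨s.setMem a (i.eval s) (j.eval s) (k.eval s) (e.eval s), t, t⟩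
  | .seq c c', s =>
      let r := c.run s
      let r' := c'.run r.state
      ⟨r'.state, r.work + r'.work, r.depth + r'.depth⟩
  | .ifPos e c c', s =>
      let r := if 0 < e.eval s then c.run s else c'.run s
      ⟨r.state, 1 + e.cost s + r.work, 1 + e.cost s + r.depth⟩
  | .loop x e c, s =>
      Nat.rec (motive := fun _ => Outcome) ⟨s, 1 + e.cost s, 1 + e.cost s⟩
        (fun i r =>
          let r' := c.run (r.state.setReg x i)
          ⟨r'.state, r.work + (1 + bits i) + r'.work, r.depth + (1 + bits i) + r'.depth⟩)
        (e.eval s).toNat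
  | .par x e c, s =>
      let n := (e.eval s).toNat
      let r := fun i : ℕ => c.run (s.setReg x i)
      ⟨⟨s.reg, merge s.mem (fun i => (r i).state.mem) n⟩,
        1 + e.cost s + ∑ i ∈ Finset.range n, ((1 + bits i) + (r i).work),
        1 + e.cost s + (Finset.range n).sup fun i => (1 + bits i) + (r i).depth⟩

/-- The rational number that a program returns: register `0` divided by register `1`. -/
noncomputable def Outcome.value (r : Outcome) : ℝ :=
  (r.state.reg 0 : ℝ) / (r.state.reg 1 : ℝ)

/-- The program is efficient in parallel on the given inputs, where `inputs n` are the inputs of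
size `n`: its work is polynomial and its depth is polylogarithmic in `n`. The problems that have
such programs are those in the class NC. -/
def Cmd.RunsInNC (P : Cmd) (inputs : ℕ → Set State) : Prop :=
  ∃ (C : ℝ) (k : ℕ), ∀ n : ℕ, 2 ≤ n → ∀ s ∈ inputs n,
    ((P.run s).work : ℝ) ≤ C * (n : ℝ) ^ k ∧ ((P.run s).depth : ℝ) ≤ C * Real.log n ^ k

end Machine

/-- `f ∈ O(polylog)`. -/
def PolyLog (f : ℕ → ℝ) : Prop :=
  ∃ a : ℕ, f =O[Filter.atTop] fun n : ℕ => Real.log n ^ a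

/-- `(Q, p)` is an instance with bound `w`: the operators have norm at most `w`, and the point
is in the raw set. -/
def IsInstance {d M : ℕ} (w : ℝ) (Q : Fin M → Matrix (Fin d) (Fin d) ℂ) (p : Fin M → ℂ) : Prop :=
  (∀ k, opNorm (Q k) ≤ w) ∧ p ∈ raw M w

/-- The initial state `s` presents the input `(Q, p)` with the parameters `d`, `M`, `⌈w⌉`,
`⌈1/ε⌉` in the registers `0, …, 3`, and with the real and imaginary parts of all entries, rounded
to `c * size (d + M + ⌈w⌉ + ⌈1/ε⌉)` binary places after the point, as integers in the arrays
`0, …, 3`. -/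
structure Encodes {d M : ℕ} (c : ℕ) (w ε : ℝ) (Q : Fin M → Matrix (Fin d) (Fin d) ℂ)
    (p : Fin M → ℂ) (s : State) : Prop where
  reg0 : s.reg 0 = d
  reg1 : s.reg 1 = M
  reg2 : s.reg 2 = (⌈w⌉₊ : ℤ)
  reg3 : s.reg 3 = (⌈1 / ε⌉₊ : ℤ)
  reg_rest : ∀ x, 4 ≤ x → s.reg x = 0
  re_Q : ∀ (k : Fin M) (i j : Fin d),
    |(s.mem 0 k i j : ℝ) - 2 ^ (c * (d + M + ⌈w⌉₊ + ⌈1 / ε⌉₊).size) * (Q k i j).re| ≤ 1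
  im_Q : ∀ (k : Fin M) (i j : Fin d),
    |(s.mem 1 k i j : ℝ) - 2 ^ (c * (d + M + ⌈w⌉₊ + ⌈1 / ε⌉₊).size) * (Q k i j).im| ≤ 1
  re_p : ∀ k : Fin M,
    |(s.mem 2 k 0 0 : ℝ) - 2 ^ (c * (d + M + ⌈w⌉₊ + ⌈1 / ε⌉₊).size) * (p k).re| ≤ 1
  im_p : ∀ k : Fin M,
    |(s.mem 3 k 0 0 : ℝ) - 2 ^ (c * (d + M + ⌈w⌉₊ + ⌈1 / ε⌉₊).size) * (p k).im| ≤ 1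
  mem_rest : ∀ a i j k, 4 ≤ a → s.mem a i j k = 0

/-- All initial states that present an instance with the parameters `d`, `M`, `w`, `ε`. -/
def inputs (c d M : ℕ) (w ε : ℝ) : Set State :=
  {s | ∃ (Q : Fin M → Matrix (Fin d) (Fin d) ℂ) (p : Fin M → ℂ),
    IsInstance w Q p ∧ Encodes c w ε Q p s}

end QDist

/-! Exact algorithm. The problem is a zero-sum game between density operators and phases. Against
phases φ, a density operator ρ pays ⟨ρ, centred loss⟩ = Re ∑ (p − q(ρ))_k e^{-iφ_k}
(`rtr_density_mul_centeredLoss`). This is at most ‖p − q(ρ)‖₁, with equality for the polar phases of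
p − q(ρ). Each round answers ρ_t with its own polar phases, so it pays ‖p − q(ρ_t)‖₁ ≥ dis(p), and
the average is an upper bound for dis(p). A minimiser σ pays at most dis(p) in every round, and the
regret bound `multiplicative_weights` says that the Gibbs states ρ_t pay on average at most ε more
than σ for this γ and T. The minimiser exists because the density operators form a compact set. The
regret bound follows the potential Tr exp(−∑ Y_t) of the scaled losses Y_t. The inequality
`golden_thompson` bounds its growth from above in each round, and Jensen's inequality bounds it from
below by exp(−⟨σ, ∑ Y_t⟩). Golden–Thompson comes from Tr (AB)^{2^k} ≤ Tr A^{2^k} B^{2^k} and the Lie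
product formula. Finite precision. The losses that the program computes are exactly Hermitian, so
the regret bound applies unchanged to the exact Gibbs states of the computed losses. Rounding enters
only when ρ_t, φ_t, N_t are compared with their ideal values, and η is small enough to pay for the
factors d², M and w that appear there (`IsRun.dis_le`, `IsRun.le_dis`, `IsRun.approx_bounds`).
Program. Everything is fixed-point integer arithmetic. The exponential is (1 + A/λ)^λ with λ = 2^l,
obtained by l squarings (`expCmd_spec`); matrix products use parallel multiplications and tree sums;
moduli come from Newton's method for square roots. Only the numbers e^{iφ} are needed, never φ, and
they are quotients of residuals by moduli. The sum of the moduli also replaces the trace ⟨ρ, N −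
2Mw⟩ in the return value (`abs_sum_norm_sub_rtr_le`). The number of rounds is read off from the bit
length of the integer d^{1/γ²} and a series for ln 2, which explains the possible T + 1
(`numRounds_bounds`). Cost. Correctness and cost are separated. Every value that the main part
computes is reduced modulo 2 `cap` into a symmetric range, so bit lengths are bounded whatever is
computed (`Cheap`), and the correctness lemmas show that the reduction does not affect the results.
Sequential loops of the main part have lengths T, l or M, and the numbers have O(l²) bits. Hence the
depth is polynomial in M, ⌈w⌉, ⌈1/ε⌉ and the bit length of d, and the work has one more factor (d +
M + 1)³ (`program_cost`). Polynomial time and membership in NC are both read off from this bound. -/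

namespace QDist

/-! ### Powers and exponentials in Banach algebras. -/

section Analysis

open scoped Matrix.Norms.L2Operator
open Filter Topology

section BanachAlgebra

variable {𝔸 : Type*} [NormedRing 𝔸] [NormOneClass 𝔸]

/-- Telescoping x^n − y^n into the terms x^j (x − y) y^{n−1−j}. Bounding the n-th powers of the
norms, rather than the norms, suits x and y at distance O(1/n) from 1, where c does not grow with n.
-/
theorem norm_pow_sub_pow_le {c : ℝ} (hc : 1 ≤ c) {x y : 𝔸} {n : ℕ} (hx : ‖x‖ ^ n ≤ c)
    (hy : ‖y‖ ^ n ≤ c) : ‖x ^ n - y ^ n‖ ≤ n * c ^ 2 * ‖x - y‖ := by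
  have pow_le : ∀ z : 𝔸, ‖z‖ ^ n ≤ c → ∀ j ≤ n, ‖z ^ j‖ ≤ c := by
    intro z hz j hj
    refine (norm_pow_le z j).trans ?_
    rcases le_total ‖z‖ 1 with h | h
    · exact (pow_le_one₀ (norm_nonneg _) h).trans hc
    · exact (pow_le_pow_right₀ h hj).trans hz
  have key : ∀ j ≤ n, ‖x ^ j * y ^ (n - j) - y ^ n‖ ≤ j * c ^ 2 * ‖x - y‖ := by
    intro j
    induction j with
    | zero => intro _; simp
    | succ j ih =>
      intro hj
      have e : x ^ (j + 1) * y ^ (n - (j + 1)) - y ^ n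
          = x ^ j * (x - y) * y ^ (n - (j + 1)) + (x ^ j * y ^ (n - j) - y ^ n) := by
        have : n - j = (n - (j + 1)) + 1 := by omega
        rw [this, pow_succ' y, pow_succ x]; noncomm_ring
      rw [e]
      refine (norm_add_le _ _).trans ?_
      have h1 : ‖x ^ j * (x - y) * y ^ (n - (j + 1))‖ ≤ c * ‖x - y‖ * c := by
        refine (norm_mul_le _ _).trans ?_
        refine mul_le_mul ((norm_mul_le _ _).trans ?_) (pow_le y hy _ (Nat.sub_le _ _))
          (norm_nonneg _) (by positivity)
        exact mul_le_mul_of_nonneg_right (pow_le x hx _ (by omega)) (norm_nonneg _)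
      have h2 := ih (by omega)
      push_cast
      nlinarith
  simpa using key n le_rfl

variable [NormedAlgebra ℝ 𝔸] [CompleteSpace 𝔸]

/-- The power series from degree two on is compared termwise with that of the real exponential. -/
theorem norm_exp_sub_le (x : 𝔸) :
    ‖NormedSpace.exp x - 1 - x‖ ≤ Real.exp ‖x‖ - 1 - ‖x‖ := by
  have h := NormedSpace.exp_series_hasSum_exp' (𝕂 := ℝ) x
  have h1 := NormedSpace.exp_series_hasSum_exp' (𝕂 := ℝ) ‖x‖
  have h2 := (hasSum_nat_add_iff' 2).2 h
  have h3 := (hasSum_nat_add_iff' 2).2 h1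
  simp [Finset.sum_range_succ, ← Real.exp_eq_exp_ℝ] at h2 h3
  rw [sub_sub, sub_sub, ← h2.tsum_eq]
  refine tsum_of_norm_bounded h3 fun n => ?_
  rw [norm_smul, Real.norm_of_nonneg (by positivity)]
  exact mul_le_mul_of_nonneg_left (norm_pow_le _ _) (by positivity)

theorem norm_exp_sub_le_sq {x : 𝔸} (hx : ‖x‖ ≤ 1) :
    ‖NormedSpace.exp x - 1 - x‖ ≤ ‖x‖ ^ 2 :=
  (norm_exp_sub_le x).trans <| (le_abs_self _).trans <|
    Real.abs_exp_sub_one_sub_id_le (by rwa [abs_of_nonneg (norm_nonneg _)])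

theorem norm_exp_le (x : 𝔸) : ‖NormedSpace.exp x‖ ≤ Real.exp ‖x‖ := by
  have h := norm_exp_sub_le x
  have : NormedSpace.exp x = (NormedSpace.exp x - 1 - x) + (1 + x) := by abel
  rw [this]
  refine (norm_add_le _ _).trans ?_
  have := norm_add_le (1 : 𝔸) x
  rw [norm_one] at this
  linarith

/-- Quantitative form of `(1 + x / n) ^ n → exp x`. -/
theorem norm_one_add_pow_sub_exp_le {x : 𝔸} {n : ℕ} (hn : 0 < n) (hx : ‖x‖ ≤ n) :
    ‖(1 + (n : ℝ)⁻¹ • x) ^ n - NormedSpace.exp x‖ ≤ Real.exp ‖x‖ ^ 2 * ‖x‖ ^ 2 / n := by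
  let _ := NormedAlgebra.restrictScalars ℚ ℝ 𝔸
  have hn' : (0 : ℝ) < n := by exact_mod_cast hn
  set y := (n : ℝ)⁻¹ • x with hy
  have ny : ‖y‖ = ‖x‖ / n := by
    rw [hy, norm_smul, Real.norm_of_nonneg (by positivity)]; ring
  -- Both sides become n-th powers, and their bases 1 + y and exp y differ only by ‖y‖² = ‖x‖²/n².
  have e : NormedSpace.exp x = NormedSpace.exp y ^ n := by
    rw [← NormedSpace.exp_nsmul, hy, ← Nat.cast_smul_eq_nsmul ℝ, smul_smul,
      mul_inv_cancel₀ hn'.ne', one_smul]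
  have b2 : Real.exp ‖y‖ ^ n = Real.exp ‖x‖ := by
    rw [← Real.exp_nat_mul, ny]; congr 1; field_simp
  rw [e]
  refine (norm_pow_sub_pow_le (c := Real.exp ‖x‖) (Real.one_le_exp (norm_nonneg _)) ?_ ?_).trans ?_
  · rw [← b2]
    refine pow_le_pow_left₀ (norm_nonneg _) ((norm_add_le _ _).trans ?_) _
    rw [norm_one, add_comm]; exact Real.add_one_le_exp _
  · rw [← b2]
    exact pow_le_pow_left₀ (norm_nonneg _) (norm_exp_le _) _
  · have h1 : ‖y‖ ≤ 1 := by rw [ny]; exact (div_le_one hn').2 hx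
    have h2 : ‖1 + y - NormedSpace.exp y‖ ≤ (‖x‖ / n) ^ 2 := by
      rw [← ny, norm_sub_rev, ← sub_sub]; exact norm_exp_sub_le_sq h1
    calc _ ≤ n * Real.exp ‖x‖ ^ 2 * (‖x‖ / n) ^ 2 := by gcongr
      _ = _ := by field_simp

end BanachAlgebra

end Analysis

/-! ### Trace inequalities and the Golden–Thompson inequality. -/

section GoldenThompson

open scoped Matrix.Norms.L2Operator
open Filter Topology Matrix

variable {d : ℕ}

/-- The real part of the trace. -/
noncomputable def rtr (A : Matrix (Fin d) (Fin d) ℂ) : ℝ := A.trace.re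

theorem rtr_add (A B : Matrix (Fin d) (Fin d) ℂ) : rtr (A + B) = rtr A + rtr B := by
  simp [rtr, Matrix.trace_add]

theorem rtr_sub (A B : Matrix (Fin d) (Fin d) ℂ) : rtr (A - B) = rtr A - rtr B := by
  simp [rtr, Matrix.trace_sub]

theorem rtr_neg (A : Matrix (Fin d) (Fin d) ℂ) : rtr (-A) = -rtr A := by
  simp [rtr, Matrix.trace_neg]

theorem rtr_smul (a : ℝ) (A : Matrix (Fin d) (Fin d) ℂ) : rtr ((a : ℂ) • A) = a * rtr A := by
  simp [rtr, Matrix.trace_smul]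

theorem rtr_sum {ι : Type*} (s : Finset ι) (A : ι → Matrix (Fin d) (Fin d) ℂ) :
    rtr (∑ i ∈ s, A i) = ∑ i ∈ s, rtr (A i) := by
  simp [rtr, Matrix.trace_sum]

theorem rtr_conjTranspose (A : Matrix (Fin d) (Fin d) ℂ) : rtr Aᴴ = rtr A := by
  simp [rtr, Matrix.trace_conjTranspose]

theorem rtr_mul_comm (A B : Matrix (Fin d) (Fin d) ℂ) : rtr (A * B) = rtr (B * A) := by
  simp [rtr, Matrix.trace_mul_comm A B]

theorem continuous_rtr : Continuous (rtr : Matrix (Fin d) (Fin d) ℂ → ℝ) :=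
  Complex.continuous_re.comp (continuous_id.matrix_trace)

theorem rtr_conjTranspose_mul_self_nonneg (A : Matrix (Fin d) (Fin d) ℂ) : 0 ≤ rtr (Aᴴ * A) :=
  (Complex.le_def.1 (Matrix.posSemidef_conjTranspose_mul_self A).trace_nonneg).1

/-- Cauchy–Schwarz in additive form: expand the nonnegative trace of (A − B*)*(A − B*). -/
theorem two_mul_rtr_mul_le (A B : Matrix (Fin d) (Fin d) ℂ) :
    2 * rtr (A * B) ≤ rtr (Aᴴ * A) + rtr (B * Bᴴ) := by
  have h := rtr_conjTranspose_mul_self_nonneg (A - Bᴴ)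
  have e : (A - Bᴴ)ᴴ * (A - Bᴴ) = Aᴴ * A - Aᴴ * Bᴴ - B * A + B * Bᴴ := by
    rw [conjTranspose_sub, conjTranspose_conjTranspose]; noncomm_ring
  rw [e, rtr_add, rtr_sub, rtr_sub, ← conjTranspose_mul, rtr_conjTranspose,
    rtr_mul_comm B A] at h
  linarith

theorem rtr_mul_pow_comm (A B : Matrix (Fin d) (Fin d) ℂ) (n : ℕ) :
    rtr ((A * B) ^ n) = rtr ((B * A) ^ n) := by
  cases n with
  | zero => simp
  | succ n =>
    have h : A * (B * A) ^ n = (A * B) ^ n * A := by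
      have : SemiconjBy A (B * A) (A * B) := by simp [SemiconjBy, mul_assoc]
      exact this.pow_right n
    rw [pow_succ (A * B), ← mul_assoc, ← h, mul_assoc, rtr_mul_comm, mul_assoc, ← pow_succ]

/-- The two claims feed each other in the induction. The first is applied to X², a cyclic shift
produces the product of the Hermitian matrices X*X and XX*, and the second claim with Cauchy–Schwarz
finishes. The second follows from the first for X = AB: cyclicity turns (B A² B)^{2^k} into (A²
B²)^{2^k}, to which the induction hypothesis for A², B² applies. -/
theorem rtr_pow_two_pow (k : ℕ) :
    (∀ X : Matrix (Fin d) (Fin d) ℂ, rtr (X ^ 2 ^ (k + 1)) ≤ rtr ((Xᴴ * X) ^ 2 ^ k)) ∧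
    (∀ A B : Matrix (Fin d) (Fin d) ℂ, A.IsHermitian → B.IsHermitian →
      rtr ((A * B) ^ 2 ^ k) ≤ rtr (A ^ 2 ^ k * B ^ 2 ^ k)) := by
  induction k with
  | zero =>
    refine ⟨fun X => ?_, fun A B _ _ => by simp⟩
    have h := two_mul_rtr_mul_le X X
    rw [rtr_mul_comm X Xᴴ] at h
    simp only [zero_add, pow_one, pow_zero, sq]
    linarith
  | succ k ih =>
    obtain ⟨ih1, ih2⟩ := ih
    refine ⟨fun X => ?_, fun A B hA hB => ?_⟩
    · have hP : (Xᴴ * X).IsHermitian := isHermitian_conjTranspose_mul_self X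
      have hR : (X * Xᴴ).IsHermitian := isHermitian_mul_conjTranspose_self X
      have e : ((X ^ 2)ᴴ * X ^ 2) ^ 2 ^ k = (Xᴴ * (Xᴴ * X * X)) ^ 2 ^ k := by
        rw [conjTranspose_pow, sq, sq]; simp only [mul_assoc]
      have e' : Xᴴ * X * X * Xᴴ = (Xᴴ * X) * (X * Xᴴ) := by simp only [mul_assoc]
      have h1 := ih1 (X ^ 2)
      rw [← pow_mul, ← pow_succ', e, rtr_mul_pow_comm, e'] at h1
      have h2 := ih2 _ _ hP hR
      have h3 := two_mul_rtr_mul_le ((Xᴴ * X) ^ 2 ^ k) ((X * Xᴴ) ^ 2 ^ k)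
      rw [(hP.pow _).eq, (hR.pow _).eq, ← pow_add, ← pow_add, rtr_mul_pow_comm X] at h3
      have e2 : 2 ^ (k + 1) = 2 ^ k + 2 ^ k := by ring
      rw [e2]
      linarith
    · have h1 := ih1 (A * B)
      have e : (A * B)ᴴ * (A * B) = B * (A ^ 2 * B) := by
        rw [conjTranspose_mul, hA.eq, hB.eq, sq]; simp only [mul_assoc]
      have e' : A ^ 2 * B * B = A ^ 2 * B ^ 2 := by rw [mul_assoc, sq B]
      rw [e, rtr_mul_pow_comm B, e'] at h1
      have h2 := ih2 _ _ (hA.pow 2) (hB.pow 2)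
      rw [← pow_mul, ← pow_mul, ← pow_succ'] at h2
      linarith


/-- The preceding trace inequality for e^{A/2^n} and e^{B/2^n} has the constant right-hand side
Tr(e^A e^B), and its left-hand side tends to Tr e^{A+B} by the Lie product formula. For the latter,
f(t) = e^{tA} e^{tB} − e^{t(A+B)} vanishes to first order at 0, so 2^n f(2^{-n}) → 0, and
telescoping transfers this to the 2^n-th powers. -/
theorem golden_thompson {A B : Matrix (Fin d) (Fin d) ℂ} (hA : A.IsHermitian)
    (hB : B.IsHermitian) :
    rtr (NormedSpace.exp (A + B)) ≤ rtr (NormedSpace.exp A * NormedSpace.exp B) := by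
  rcases Nat.eq_zero_or_pos d with rfl | hd
  · simp [rtr, Matrix.trace]
  have : Nonempty (Fin d) := ⟨⟨0, hd⟩⟩
  set f : ℝ → Matrix (Fin d) (Fin d) ℂ := fun t =>
    NormedSpace.exp (t • A) * NormedSpace.exp (t • B) - NormedSpace.exp (t • (A + B)) with hf
  have f0 : f 0 = 0 := by simp [hf]
  have hder : HasDerivAt f 0 0 := by
    have h := fun X : Matrix (Fin d) (Fin d) ℂ => hasDerivAt_exp_smul_const (𝕂 := ℝ) X (0 : ℝ)
    have h1 := ((h A).mul (h B)).sub (h (A + B))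
    have e : (NormedSpace.exp ((0 : ℝ) • A) * A * NormedSpace.exp ((0 : ℝ) • B) +
        NormedSpace.exp ((0 : ℝ) • A) * (NormedSpace.exp ((0 : ℝ) • B) * B)) -
        NormedSpace.exp ((0 : ℝ) • (A + B)) * (A + B) = 0 := by simp
    exact h1.congr_deriv e
  have hlim : Tendsto (fun n : ℕ => (2 ^ n : ℝ) • f ((2 ^ n : ℝ)⁻¹)) atTop (𝓝 0) := by
    have h2 : Tendsto (fun n : ℕ => ((2 : ℝ) ^ n)⁻¹) atTop (𝓝[≠] 0) := by
      refine tendsto_nhdsWithin_iff.2 ⟨?_, Eventually.of_forall fun n => by simp⟩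
      exact tendsto_inv_atTop_zero.comp (tendsto_pow_atTop_atTop_of_one_lt one_lt_two)
    have := (hasDerivAt_iff_tendsto_slope.1 hder).comp h2
    refine this.congr fun n => ?_
    simp [slope_def_module, f0]
  set c := Real.exp (‖A‖ + ‖B‖) with hc
  have c1 : 1 ≤ c := Real.one_le_exp (by positivity)
  have hE : ∀ n : ℕ, ∀ X : Matrix (Fin d) (Fin d) ℂ,
      NormedSpace.exp (((2 : ℝ) ^ n)⁻¹ • X) ^ 2 ^ n = NormedSpace.exp X := by
    intro n X
    rw [← Matrix.exp_nsmul, ← Nat.cast_smul_eq_nsmul ℝ, smul_smul]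
    push_cast
    rw [mul_inv_cancel₀ (by positivity), one_smul]
  have nE : ∀ n : ℕ, ∀ X : Matrix (Fin d) (Fin d) ℂ,
      ‖NormedSpace.exp (((2 : ℝ) ^ n)⁻¹ • X)‖ ^ 2 ^ n ≤ Real.exp ‖X‖ := by
    intro n X
    have h1 := norm_exp_le (((2 : ℝ) ^ n)⁻¹ • X)
    calc _ ≤ Real.exp ‖((2 : ℝ) ^ n)⁻¹ • X‖ ^ 2 ^ n := pow_le_pow_left₀ (norm_nonneg _) h1 _
      _ = _ := by
        rw [← Real.exp_nat_mul, norm_smul, Real.norm_of_nonneg (by positivity)]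
        congr 1; push_cast; field_simp
  have hconv : Tendsto (fun n : ℕ => (NormedSpace.exp (((2 : ℝ) ^ n)⁻¹ • A) *
      NormedSpace.exp (((2 : ℝ) ^ n)⁻¹ • B)) ^ 2 ^ n) atTop (𝓝 (NormedSpace.exp (A + B))) := by
    rw [tendsto_iff_norm_sub_tendsto_zero]
    have hz : Tendsto (fun n : ℕ => c ^ 2 * ‖(2 ^ n : ℝ) • f ((2 ^ n : ℝ)⁻¹)‖) atTop (𝓝 0) := by
      simpa using (hlim.norm).const_mul (c ^ 2)
    refine squeeze_zero (fun _ => norm_nonneg _) (fun n => ?_) hz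
    rw [← hE n (A + B)]
    refine (norm_pow_sub_pow_le c1 (n := 2 ^ n) ?_ ?_).trans_eq ?_
    · calc _ ≤ (‖NormedSpace.exp (((2 : ℝ) ^ n)⁻¹ • A)‖ *
            ‖NormedSpace.exp (((2 : ℝ) ^ n)⁻¹ • B)‖) ^ 2 ^ n :=
            pow_le_pow_left₀ (norm_nonneg _) (norm_mul_le _ _) _
        _ ≤ c := by
          rw [mul_pow, hc, Real.exp_add]
          exact mul_le_mul (nE n A) (nE n B) (by positivity) (by positivity)
    · exact (nE n _).trans (Real.exp_le_exp.2 (norm_add_le _ _))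
    · rw [norm_smul, Real.norm_of_nonneg (by positivity)]
      push_cast; ring
  refine le_of_tendsto ((continuous_rtr.tendsto _).comp hconv) (Eventually.of_forall fun n => ?_)
  have hherm : ∀ X : Matrix (Fin d) (Fin d) ℂ, X.IsHermitian →
      (NormedSpace.exp (((2 : ℝ) ^ n)⁻¹ • X)).IsHermitian := fun X hX =>
    Matrix.IsHermitian.exp (by
      rw [Matrix.IsHermitian, conjTranspose_smul, hX.eq]; simp)
  have := (rtr_pow_two_pow n).2 _ _ (hherm A hA) (hherm B hB)
  rwa [hE, hE] at this

/-- One eigenbasis serves A and exp A; the trace inequalities that follow thereby become scalar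
inequalities for eigenvalues. -/
theorem IsHermitian.exists_diag {A : Matrix (Fin d) (Fin d) ℂ} (hA : A.IsHermitian) :
    ∃ (U : Matrix (Fin d) (Fin d) ℂ) (a : Fin d → ℝ), U * Uᴴ = 1 ∧ Uᴴ * U = 1 ∧
      A = U * diagonal (fun i => (a i : ℂ)) * Uᴴ ∧
      NormedSpace.exp A = U * diagonal (fun i => (Real.exp (a i) : ℂ)) * Uᴴ ∧
      ∀ i, |a i| ≤ ‖A‖ := by
  set U : Matrix (Fin d) (Fin d) ℂ := hA.eigenvectorUnitary.1 with hU
  have h1 : U * Uᴴ = 1 := (Matrix.mem_unitaryGroup_iff).1 hA.eigenvectorUnitary.2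
  have h2 : Uᴴ * U = 1 := (Matrix.mem_unitaryGroup_iff').1 hA.eigenvectorUnitary.2
  have h3 : A = U * diagonal (fun i => (hA.eigenvalues i : ℂ)) * Uᴴ := by
    conv_lhs => rw [hA.spectral_theorem, Unitary.conjStarAlgAut_apply]
    rfl
  have hUi : U⁻¹ = Uᴴ := Matrix.inv_eq_right_inv h1
  refine ⟨U, hA.eigenvalues, h1, h2, h3, ?_, fun i => ?_⟩
  · have hu : IsUnit U := ⟨⟨U, Uᴴ, h1, h2⟩, rfl⟩
    conv_lhs => rw [h3, ← hUi, Matrix.exp_conj _ _ hu, Matrix.exp_diagonal, hUi]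
    congr 3
    ext i
    rw [Pi.coe_exp, ← Complex.exp_eq_exp_ℂ, Complex.ofReal_exp]
  · have h4 : diagonal (fun i => (hA.eigenvalues i : ℂ)) = Uᴴ * A * U := by
      conv_rhs => rw [h3]
      rw [show Uᴴ * (U * diagonal (fun i => (hA.eigenvalues i : ℂ)) * Uᴴ) * U
        = (Uᴴ * U) * diagonal (fun i => (hA.eigenvalues i : ℂ)) * (Uᴴ * U) by
          simp only [mul_assoc], h2]; simp
    have h5 : ‖(diagonal (fun i => (hA.eigenvalues i : ℂ)) : Matrix (Fin d) (Fin d) ℂ)‖ ≤ ‖A‖ := by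
      rcases Nat.eq_zero_or_pos d with rfl | hd
      · exact i.elim0
      have : Nonempty (Fin d) := ⟨i⟩
      rw [h4]
      have n1 : ‖U‖ = 1 := CStarRing.norm_of_mem_unitary hA.eigenvectorUnitary.2
      have n2 : ‖Uᴴ‖ = 1 := by rw [l2_opNorm_conjTranspose, n1]
      calc _ ≤ ‖Uᴴ‖ * ‖A‖ * ‖U‖ := (norm_mul_le _ _).trans
            (mul_le_mul_of_nonneg_right (norm_mul_le _ _) (norm_nonneg _))
        _ = ‖A‖ := by rw [n1, n2]; ring
    rw [l2_opNorm_diagonal] at h5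
    have h6 := (norm_le_pi_norm (fun i => (hA.eigenvalues i : ℂ)) i).trans h5
    simpa using h6

end GoldenThompson

/-! ### Gibbs states and the regret bound. -/

section MultiplicativeWeights

open scoped Matrix.Norms.L2Operator
open Matrix

variable {d : ℕ}

/-- The weights are the diagonal entries of U*PU; the total weight is the case f = 1. -/
theorem PosSemidef.exists_weights {P U : Matrix (Fin d) (Fin d) ℂ} (hP : P.PosSemidef)
    (hU : U * Uᴴ = 1) :
    ∃ p : Fin d → ℝ, (∀ i, 0 ≤ p i) ∧ ∑ i, p i = rtr P ∧
      ∀ f : Fin d → ℝ, rtr (P * (U * diagonal (fun i => (f i : ℂ)) * Uᴴ)) = ∑ i, p i * f i := by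
  have hQ := hP.conjTranspose_mul_mul_same U
  have key : ∀ f : Fin d → ℝ, rtr (P * (U * diagonal (fun i => (f i : ℂ)) * Uᴴ))
      = ∑ i, ((Uᴴ * P * U) i i).re * f i := by
    intro f
    rw [← mul_assoc, rtr_mul_comm, ← mul_assoc, ← mul_assoc]
    simp only [rtr, trace, diag_apply, mul_diagonal, Complex.re_sum, Complex.re_mul_ofReal]
  refine ⟨fun i => ((Uᴴ * P * U) i i).re, fun i => (Complex.le_def.1 hQ.diag_nonneg).1, ?_, key⟩
  have := key 1
  simp only [Pi.one_apply, Complex.ofReal_one, diagonal_one, mul_one, hU] at this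
  exact this.symm

theorem IsHermitian.exp_posSemidef {A : Matrix (Fin d) (Fin d) ℂ} (hA : A.IsHermitian) :
    (NormedSpace.exp A).PosSemidef := by
  obtain ⟨U, a, -, -, -, h, -⟩ := IsHermitian.exists_diag hA
  rw [h]
  refine PosSemidef.mul_mul_conjTranspose_same (PosSemidef.diagonal fun i => ?_) U
  simpa using (Complex.zero_le_real.2 (Real.exp_pos (a i)).le)

/-- Every eigenvalue is at least −‖A‖. This makes the normalisation of Gibbs states legitimate, and
quantitatively so in the fixed-point division by the trace. -/
theorem IsHermitian.exp_neg_norm_le {A : Matrix (Fin d) (Fin d) ℂ} (hA : A.IsHermitian)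
    (hd : 1 ≤ d) : Real.exp (-‖A‖) ≤ rtr (NormedSpace.exp A) := by
  obtain ⟨U, a, hU, -, -, h, ha⟩ := IsHermitian.exists_diag hA
  obtain ⟨p, hp, hs, hf⟩ := PosSemidef.exists_weights (PosSemidef.one (n := Fin d) (R := ℂ)) hU
  have h1 := hf fun i => Real.exp (a i)
  rw [one_mul, ← h] at h1
  have h2 : rtr (1 : Matrix (Fin d) (Fin d) ℂ) = d := by simp [rtr]
  have h3 : (1 : ℝ) ≤ d := by exact_mod_cast hd
  rw [h1]
  calc Real.exp (-‖A‖) ≤ (∑ i, p i) * Real.exp (-‖A‖) := by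
        rw [hs, h2]; nlinarith [Real.exp_pos (-‖A‖)]
    _ ≤ _ := by
        rw [Finset.sum_mul]
        exact Finset.sum_le_sum fun i _ => mul_le_mul_of_nonneg_left
          (Real.exp_le_exp.2 (neg_le_of_abs_le (ha i))) (hp i)

theorem PosSemidef.trace_eq {P : Matrix (Fin d) (Fin d) ℂ} (hP : P.PosSemidef) :
    P.trace = (rtr P : ℂ) := by
  have := Complex.le_def.1 hP.trace_nonneg
  exact Complex.ext (by simp [rtr]) (by simpa using this.2.symm)

theorem isDensity_gibbs {A : Matrix (Fin d) (Fin d) ℂ} (hA : A.IsHermitian) (hd : 1 ≤ d) :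
    IsDensity (gibbs A) := by
  have hP := IsHermitian.exp_posSemidef hA
  have h0 : 0 < rtr (NormedSpace.exp A) := (Real.exp_pos _).trans_le
    (IsHermitian.exp_neg_norm_le hA hd)
  have ht := PosSemidef.trace_eq hP
  refine ⟨?_, ?_⟩
  · rw [gibbs, ht, ← Complex.ofReal_inv]
    exact hP.smul (Complex.zero_le_real.2 (inv_nonneg.2 h0.le))
  · rw [gibbs, trace_smul, smul_eq_mul, ht, inv_mul_cancel₀]
    exact_mod_cast h0.ne'

theorem rtr_exp_mul {A : Matrix (Fin d) (Fin d) ℂ} (hA : A.IsHermitian) (hd : 1 ≤ d)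
    (Y : Matrix (Fin d) (Fin d) ℂ) :
    rtr (NormedSpace.exp A * Y) = rtr (NormedSpace.exp A) * rtr (gibbs A * Y) := by
  have hP := IsHermitian.exp_posSemidef hA
  have h0 : 0 < rtr (NormedSpace.exp A) := (Real.exp_pos _).trans_le
    (IsHermitian.exp_neg_norm_le hA hd)
  rw [gibbs, PosSemidef.trace_eq hP, smul_mul_assoc, ← Complex.ofReal_inv, rtr_smul,
    mul_inv_cancel_left₀ h0.ne']

/-- A multiple of the identity contributes a scalar factor to the exponential, which the
normalisation cancels. This allows the losses to be centred at zero in the regret argument. -/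
theorem gibbs_add_smul_one (A : Matrix (Fin d) (Fin d) ℂ) (a : ℂ) :
    gibbs (A + a • 1) = gibbs A := by
  have h : NormedSpace.exp (A + a • (1 : Matrix (Fin d) (Fin d) ℂ))
      = Complex.exp a • NormedSpace.exp A := by
    rw [Matrix.exp_add_of_commute _ _ ((Commute.one_right A).smul_right a)]
    have : a • (1 : Matrix (Fin d) (Fin d) ℂ) = diagonal fun _ => a := by
      rw [smul_one_eq_diagonal]
    rw [this, Matrix.exp_diagonal]
    have h2 : NormedSpace.exp (fun _ : Fin d => a) = fun _ => Complex.exp a := by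
      ext i; rw [Pi.coe_exp, Complex.exp_eq_exp_ℂ]
    rw [h2, ← smul_one_eq_diagonal, mul_smul_comm, mul_one]
  rw [gibbs, gibbs, h, trace_smul, smul_smul, smul_eq_mul, mul_inv, mul_right_comm,
    inv_mul_cancel₀ (Complex.exp_ne_zero a), one_mul]

/-- The scalar inequality e^a ≤ 1 + a + a² for |a| ≤ 1, averaged over the eigenbasis of −Y. -/
theorem rtr_mul_exp_neg_le {P Y : Matrix (Fin d) (Fin d) ℂ} (hP : P.PosSemidef)
    (hY : Y.IsHermitian) (hn : ‖Y‖ ≤ 1) :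
    rtr (P * NormedSpace.exp (-Y)) ≤ rtr P - rtr (P * Y) + ‖Y‖ ^ 2 * rtr P := by
  obtain ⟨U, a, hU, -, h1, h2, ha⟩ := IsHermitian.exists_diag hY.neg
  obtain ⟨p, hp, hs, hf⟩ := PosSemidef.exists_weights hP hU
  have e1 := hf a
  have e2 := hf fun i => Real.exp (a i)
  rw [← h1, mul_neg, rtr_neg] at e1
  rw [← h2] at e2
  rw [norm_neg] at ha
  rw [e2, sub_eq_add_neg, e1, ← hs, Finset.mul_sum, ← Finset.sum_add_distrib,
    ← Finset.sum_add_distrib]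
  refine Finset.sum_le_sum fun i _ => ?_
  have h3 := (abs_le.1 (Real.abs_exp_sub_one_sub_id_le ((ha i).trans hn))).2
  have h4 : a i ^ 2 ≤ ‖Y‖ ^ 2 := by
    rw [← sq_abs]; exact pow_le_pow_left₀ (abs_nonneg _) (ha i) 2
  nlinarith [hp i]

/-- Jensen's inequality for the weights of ρ in the eigenbasis of B; each weight is at most one, so
the weighted sum of the e^{a_i} is at most the trace. -/
theorem exp_rtr_mul_le {ρ B : Matrix (Fin d) (Fin d) ℂ} (hρ : IsDensity ρ)
    (hB : B.IsHermitian) : Real.exp (rtr (ρ * B)) ≤ rtr (NormedSpace.exp B) := by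
  obtain ⟨U, a, hU, hU', h1, h2, -⟩ := IsHermitian.exists_diag hB
  obtain ⟨p, hp, hs, hf⟩ := PosSemidef.exists_weights hρ.1 hU
  have hs1 : ∑ i, p i = 1 := by rw [hs, rtr, hρ.2]; simp
  have e1 := hf a
  rw [← h1] at e1
  have e3 : rtr (NormedSpace.exp B) = ∑ i, Real.exp (a i) := by
    rw [h2, rtr_mul_comm, ← mul_assoc, hU', one_mul]
    simp only [rtr, trace, diag_apply, diagonal_apply_eq, Complex.re_sum, Complex.ofReal_re]
  rw [e1, e3]
  have hJ := convexOn_exp.map_sum_le (t := Finset.univ) (w := p) (p := a) (fun i _ => hp i) hs1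
    (fun i _ => Set.mem_univ _)
  simp only [smul_eq_mul] at hJ
  refine hJ.trans (Finset.sum_le_sum fun i _ => ?_)
  have : p i ≤ 1 := hs1 ▸ Finset.single_le_sum (fun j _ => hp j) (Finset.mem_univ i)
  exact mul_le_of_le_one_left (Real.exp_pos _).le this

theorem abs_rtr_density_mul_le {ρ B : Matrix (Fin d) (Fin d) ℂ} (hρ : IsDensity ρ)
    (hB : B.IsHermitian) : |rtr (ρ * B)| ≤ ‖B‖ := by
  obtain ⟨U, a, hU, -, h1, -, ha⟩ := IsHermitian.exists_diag hB
  obtain ⟨p, hp, hs, hf⟩ := PosSemidef.exists_weights hρ.1 hU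
  have hs1 : ∑ i, p i = 1 := by rw [hs, rtr, hρ.2]; simp
  have e1 := hf a
  rw [← h1] at e1
  rw [e1]
  refine (Finset.abs_sum_le_sum_abs _ _).trans ?_
  calc _ ≤ ∑ i, p i * ‖B‖ := Finset.sum_le_sum fun i _ => by
        rw [abs_mul, abs_of_nonneg (hp i)]
        exact mul_le_mul_of_nonneg_left (ha i) (hp i)
    _ = ‖B‖ := by rw [← Finset.sum_mul, hs1, one_mul]

/-- The regret bound of the matrix multiplicative weights method. -/
theorem multiplicative_weights {T : ℕ} {Y : ℕ → Matrix (Fin d) (Fin d) ℂ}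
    {ρ : Matrix (Fin d) (Fin d) ℂ} (hd : 1 ≤ d) (hY : ∀ t < T, (Y t).IsHermitian)
    (hn : ∀ t < T, ‖Y t‖ ≤ 1) (hρ : IsDensity ρ) :
    ∑ t ∈ Finset.range T, rtr (gibbs (-∑ s ∈ Finset.range t, Y s) * Y t)
      ≤ rtr (ρ * ∑ t ∈ Finset.range T, Y t) + Real.log d + ∑ t ∈ Finset.range T, ‖Y t‖ ^ 2 := by
  have hS : ∀ t ≤ T, (-∑ s ∈ Finset.range t, Y s).IsHermitian := fun t ht => by
    rw [IsHermitian, conjTranspose_neg, conjTranspose_sum]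
    exact congrArg _ (Finset.sum_congr rfl fun s hs =>
      (hY s ((Finset.mem_range.1 hs).trans_le ht)).eq)
  -- The potential starts at d. By Golden–Thompson a round multiplies it by at most 1 − x + ‖Y_t‖²,
  -- where x is the payoff of the Gibbs state, and 1 + u ≤ e^u.
  have key : ∀ t ≤ T, rtr (NormedSpace.exp (-∑ s ∈ Finset.range t, Y s)) ≤ d * Real.exp
      (-(∑ s ∈ Finset.range t, rtr (gibbs (-∑ r ∈ Finset.range s, Y r) * Y s))
        + ∑ s ∈ Finset.range t, ‖Y s‖ ^ 2) := by
    intro t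
    induction t with
    | zero => intro _; simp [rtr]
    | succ t ih =>
      intro ht
      have ht' : t < T := ht
      have h1 := ih ht'.le
      have hA := hS t ht'.le
      set A := -∑ s ∈ Finset.range t, Y s with hAdef
      have h2 := golden_thompson hA (hY t ht').neg
      rw [Finset.sum_range_succ, neg_add, ← hAdef]
      have h23 := h2.trans (rtr_mul_exp_neg_le (IsHermitian.exp_posSemidef hA) (hY t ht') (hn t ht'))
      rw [rtr_exp_mul hA hd (Y t)] at h23
      refine h23.trans ?_
      have h0 : 0 ≤ rtr (NormedSpace.exp A) := (Real.exp_pos _).le.trans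
        (IsHermitian.exp_neg_norm_le hA hd)
      have h4 := Real.add_one_le_exp (-rtr (gibbs A * Y t) + ‖Y t‖ ^ 2)
      rw [Finset.sum_range_succ, Finset.sum_range_succ, ← hAdef]
      calc _ = rtr (NormedSpace.exp A) * (-rtr (gibbs A * Y t) + ‖Y t‖ ^ 2 + 1) := by ring
        -- The second factor cannot be negative: its product with a positive trace dominates the
        -- trace of an exponential.
        _ ≤ _ := mul_le_mul h1 h4 (by
          have h6 := h23
          have h7 : 0 ≤ rtr (NormedSpace.exp (A + -Y t)) := (Real.exp_pos _).le.trans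
            (IsHermitian.exp_neg_norm_le (hA.add (hY t ht').neg) hd)
          have h8 : 0 < rtr (NormedSpace.exp A) := (Real.exp_pos _).trans_le
            (IsHermitian.exp_neg_norm_le hA hd)
          by_contra hneg
          push Not at hneg
          nlinarith) (by positivity)
        _ = _ := by rw [mul_assoc, ← Real.exp_add]; congr 2; ring
  have h1 := key T le_rfl
  have h2 := exp_rtr_mul_le hρ (hS T le_rfl)
  have hd' : (0 : ℝ) < d := by exact_mod_cast hd
  have h3 := Real.log_le_log (Real.exp_pos _) (h2.trans h1)
  rw [Real.log_exp, Real.log_mul hd'.ne' (Real.exp_pos _).ne', Real.log_exp, mul_neg,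
    rtr_neg] at h3
  linarith

end MultiplicativeWeights

/-! ### Entries versus operator norm. -/

section Norms

open scoped Matrix.Norms.L2Operator
open Matrix

variable {d M : ℕ}

theorem norm_entry_le_norm (A : Matrix (Fin d) (Fin d) ℂ) (i j : Fin d) : ‖A i j‖ ≤ ‖A‖ := by
  have h := l2_opNorm_mulVec A (EuclideanSpace.single j (1 : ℂ))
  rw [PiLp.norm_single, norm_one, mul_one] at h
  refine le_trans ?_ ((PiLp.norm_apply_le _ i).trans h)
  simp

/-- Triangle inequality over the d² matrix units. The factor d² is affordable because the required
accuracy η contains d^{-2}. -/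
theorem norm_le_of_entry_le {A : Matrix (Fin d) (Fin d) ℂ} {c : ℝ} (h : ∀ i j, ‖A i j‖ ≤ c) :
    ‖A‖ ≤ d ^ 2 * c := by
  have e : A = ∑ i, ∑ j, Matrix.single i j (A i j) := Matrix.matrix_eq_sum_single A
  have hs : ∀ (i j : Fin d) (a : ℂ), ‖Matrix.single i j a‖ ≤ ‖a‖ := by
    intro i j a
    have h2 := l2_opNorm_conjTranspose_mul_self (Matrix.single i j a)
    rw [conjTranspose_single, single_mul_single_same, ← diagonal_single, l2_opNorm_diagonal] at h2
    have h3 : ‖(Pi.single j (star a * a) : Fin d → ℂ)‖ ≤ ‖a‖ * ‖a‖ := by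
      refine (pi_norm_le_iff_of_nonneg (by positivity)).2 fun k => ?_
      by_cases hk : k = j
      · subst hk; simp
      · simp [hk]; positivity
    rw [h2] at h3
    exact abs_le_of_sq_le_sq' (by nlinarith) (norm_nonneg a) |>.2
  conv_lhs => rw [e]
  calc _ ≤ ∑ i : Fin d, ∑ j : Fin d, c := (norm_sum_le _ _).trans <| Finset.sum_le_sum fun i _ =>
        (norm_sum_le _ _).trans <| Finset.sum_le_sum fun j _ => (hs i j _).trans (h i j)
    _ = _ := by simp; ring

theorem norm_trace_conjTranspose_mul_le {A B : Matrix (Fin d) (Fin d) ℂ} {a b : ℝ}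
    (hA : ∀ i j, ‖A i j‖ ≤ a) (hB : ∀ i j, ‖B i j‖ ≤ b) :
    ‖(Aᴴ * B).trace‖ ≤ d ^ 2 * (a * b) := by
  simp only [trace, diag_apply, mul_apply, conjTranspose_apply]
  calc _ ≤ ∑ i : Fin d, ∑ j : Fin d, a * b := (norm_sum_le _ _).trans <|
        Finset.sum_le_sum fun i _ => (norm_sum_le _ _).trans <| Finset.sum_le_sum fun j _ => by
          rw [norm_mul, norm_star]
          exact mul_le_mul (hA j i) (hB j i) (norm_nonneg _) ((norm_nonneg _).trans (hA j i))
    _ = _ := by simp; ring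

end Norms

/-! ### Compactness of the density operators and attainment of the distance. -/

section Attained

open Matrix
variable {d M : ℕ}

open scoped Matrix.Norms.L2Operator MatrixOrder in
theorem PosSemidef.exists_eq_conjTranspose_mul_self {P : Matrix (Fin d) (Fin d) ℂ}
    (hP : P.PosSemidef) : ∃ B, P = Bᴴ * B :=
  CStarAlgebra.nonneg_iff_eq_star_mul_self.1 hP.nonneg

/-- The set is the image of the Frobenius unit sphere under the continuous map B ↦ B*B. -/
theorem isCompact_density : IsCompact {ρ : Matrix (Fin d) (Fin d) ℂ | IsDensity ρ} := by
  set K : Set (Fin d → Fin d → ℂ) := {B | ∑ i, ∑ j, ‖B i j‖ ^ 2 = 1} with hK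
  have hKc : IsCompact K := by
    refine Metric.isCompact_of_isClosed_isBounded ?_ ?_
    · exact isClosed_eq (by fun_prop) continuous_const
    · refine (Metric.isBounded_closedBall (x := 0) (r := 1)).subset fun B hB => ?_
      rw [mem_closedBall_zero_iff]
      refine (pi_norm_le_iff_of_nonneg zero_le_one).2 fun i =>
        (pi_norm_le_iff_of_nonneg zero_le_one).2 fun j => ?_
      have h1 : ‖B i j‖ ^ 2 ≤ 1 := by
        have hB' : ∑ i, ∑ j, ‖B i j‖ ^ 2 = 1 := hB
        rw [← hB']
        refine le_trans ?_ (Finset.single_le_sum (f := fun i => ∑ j, ‖B i j‖ ^ 2)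
          (fun i _ => by positivity) (Finset.mem_univ i))
        exact Finset.single_le_sum (f := fun j => ‖B i j‖ ^ 2)
          (fun j _ => by positivity) (Finset.mem_univ j)
      exact (sq_le_one_iff₀ (norm_nonneg _)).1 h1
  have himg : {ρ : Matrix (Fin d) (Fin d) ℂ | IsDensity ρ}
      = (fun B : Fin d → Fin d → ℂ => (Matrix.of B)ᴴ * Matrix.of B) '' K := by
    have htr : ∀ B : Matrix (Fin d) (Fin d) ℂ,
        (Bᴴ * B).trace = ((∑ i, ∑ j, ‖B i j‖ ^ 2 : ℝ) : ℂ) := by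
      intro B
      simp only [trace, diag_apply, mul_apply, conjTranspose_apply]
      rw [Finset.sum_comm]
      push_cast
      refine Finset.sum_congr rfl fun i _ => Finset.sum_congr rfl fun j _ => ?_
      rw [← Complex.conj_mul']; rfl
    ext ρ
    constructor
    · rintro ⟨h1, h2⟩
      obtain ⟨B, rfl⟩ := PosSemidef.exists_eq_conjTranspose_mul_self h1
      refine ⟨B, ?_, rfl⟩
      rw [htr] at h2
      exact_mod_cast h2
    · rintro ⟨B, hB, rfl⟩
      refine ⟨posSemidef_conjTranspose_mul_self _, ?_⟩
      rw [htr]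
      exact_mod_cast hB
  rw [himg]
  refine hKc.image ?_
  have : Continuous fun B : Fin d → Fin d → ℂ => (Matrix.of B : Matrix (Fin d) (Fin d) ℂ) :=
    continuous_id
  exact this.matrix_conjTranspose.matrix_mul this

theorem continuous_qvec (Q : Fin M → Matrix (Fin d) (Fin d) ℂ) : Continuous (qvec Q) :=
  continuous_pi fun _ => (continuous_const.matrix_mul continuous_id).matrix_trace

theorem exists_isDensity (hd : 1 ≤ d) : ∃ ρ : Matrix (Fin d) (Fin d) ℂ, IsDensity ρ :=
  ⟨gibbs 0, isDensity_gibbs isHermitian_zero hd⟩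

theorem isLeast_dis (hd : 1 ≤ d) (Q : Fin M → Matrix (Fin d) (Fin d) ℂ) (p : Fin M → ℂ) :
    IsLeast ((fun q => l1 (p - q)) '' qSpace Q) (dis Q p) := by
  have hc : IsCompact ((fun q => l1 (p - q)) '' qSpace Q) := by
    refine (isCompact_density.image (continuous_qvec Q)).image ?_
    unfold l1
    simp only [Pi.sub_apply]
    fun_prop
  obtain ⟨ρ, hρ⟩ := exists_isDensity hd
  exact hc.isLeast_sInf ⟨_, _, ⟨ρ, hρ, rfl⟩, rfl⟩

theorem l1_nonneg (x : Fin M → ℂ) : 0 ≤ l1 x := Finset.sum_nonneg fun _ _ => norm_nonneg _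

theorem dis_nonneg (hd : 1 ≤ d) (Q : Fin M → Matrix (Fin d) (Fin d) ℂ) (p : Fin M → ℂ) :
    0 ≤ dis Q p := by
  obtain ⟨q, -, hq⟩ := (isLeast_dis hd Q p).1
  rw [← hq]; exact l1_nonneg _

theorem dis_le (hd : 1 ≤ d) (Q : Fin M → Matrix (Fin d) (Fin d) ℂ) (p : Fin M → ℂ)
    {ρ : Matrix (Fin d) (Fin d) ℂ} (hρ : IsDensity ρ) : dis Q p ≤ l1 (p - qvec Q ρ) :=
  (isLeast_dis hd Q p).2 ⟨_, ⟨ρ, hρ, rfl⟩, rfl⟩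

theorem exists_dis_eq (hd : 1 ≤ d) (Q : Fin M → Matrix (Fin d) (Fin d) ℂ) (p : Fin M → ℂ) :
    ∃ ρ, IsDensity ρ ∧ dis Q p = l1 (p - qvec Q ρ) := by
  obtain ⟨q, ⟨ρ, hρ, rfl⟩, hq⟩ := (isLeast_dis hd Q p).1
  exact ⟨ρ, hρ, hq.symm⟩

end Attained

/-! ### Error analysis of exact and approximate runs. -/

section Runs

open scoped Matrix.Norms.L2Operator
open Matrix

variable {d M : ℕ}

/-- The loss matrix without the shift by `2 M w`. -/
noncomputable def centeredLoss (Q : Fin M → Matrix (Fin d) (Fin d) ℂ) (p : Fin M → ℂ)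
    (φ : Fin M → ℝ) : Matrix (Fin d) (Fin d) ℂ :=
  (((∑ k, p k * Complex.exp (-(φ k * Complex.I))).re : ℝ) : ℂ) • 1
    - (1 / 2 : ℂ) • ((∑ k, Complex.exp (φ k * Complex.I) • Q k)
      + (∑ k, Complex.exp (φ k * Complex.I) • Q k)ᴴ)

theorem loss_eq (Q : Fin M → Matrix (Fin d) (Fin d) ℂ) (p : Fin M → ℂ) (w : ℝ) (φ : Fin M → ℝ) :
    loss Q p w φ = centeredLoss Q p φ + ((2 * M * w : ℝ) : ℂ) • 1 := rfl

theorem isHermitian_ofReal_smul_one (a : ℝ) :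
    ((a : ℂ) • (1 : Matrix (Fin d) (Fin d) ℂ)).IsHermitian := by
  rw [IsHermitian, conjTranspose_smul]; simp

theorem isHermitian_centeredLoss (Q : Fin M → Matrix (Fin d) (Fin d) ℂ) (p : Fin M → ℂ)
    (φ : Fin M → ℝ) : (centeredLoss Q p φ).IsHermitian := by
  refine (isHermitian_ofReal_smul_one _).sub ?_
  have h : (1 / 2 : ℂ) = ((1 / 2 : ℝ) : ℂ) := by push_cast; rfl
  rw [IsHermitian, h, conjTranspose_smul, (isHermitian_add_transpose_self _).eq]
  simp

theorem norm_exp_mul_I (x : ℝ) : ‖Complex.exp (-(x * Complex.I))‖ = 1 := by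
  have := Complex.norm_exp_ofReal_mul_I (-x)
  rwa [Complex.ofReal_neg, neg_mul] at this

theorem norm_smul_one_le (a : ℂ) : ‖a • (1 : Matrix (Fin d) (Fin d) ℂ)‖ ≤ ‖a‖ := by
  rw [norm_smul]
  refine mul_le_of_le_one_right (norm_nonneg _) ?_
  rcases Nat.eq_zero_or_pos d with rfl | hd
  · rw [Subsingleton.elim (1 : Matrix (Fin 0) (Fin 0) ℂ) 0, norm_zero]; exact zero_le_one
  · have : Nonempty (Fin d) := ⟨⟨0, hd⟩⟩
    exact norm_one.le

theorem norm_centeredLoss_le {Q : Fin M → Matrix (Fin d) (Fin d) ℂ} {p : Fin M → ℂ} {w : ℝ}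
    (h : IsInstance w Q p) (φ : Fin M → ℝ) : ‖centeredLoss Q p φ‖ ≤ 2 * M * w := by
  set S : Matrix (Fin d) (Fin d) ℂ := ∑ k, Complex.exp (φ k * Complex.I) • Q k with hS
  have h1 : ‖S‖ ≤ M * w := by
    refine (norm_sum_le _ _).trans ?_
    calc _ ≤ ∑ k : Fin M, w := Finset.sum_le_sum fun k _ => by
          rw [norm_smul, Complex.norm_exp_ofReal_mul_I, one_mul]; exact h.1 k
      _ = _ := by simp
  have h2 : |(∑ k, p k * Complex.exp (-(φ k * Complex.I))).re| ≤ M * w := by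
    refine (Complex.abs_re_le_norm _).trans ((norm_sum_le _ _).trans ?_)
    calc _ ≤ ∑ k : Fin M, w := Finset.sum_le_sum fun k _ => by
          rw [norm_mul, norm_exp_mul_I, mul_one]; exact h.2 k
      _ = _ := by simp
  have h3 : ‖(1 / 2 : ℂ) • (S + Sᴴ)‖ ≤ M * w := by
    rw [norm_smul]
    have := norm_add_le S Sᴴ
    rw [l2_opNorm_conjTranspose] at this
    norm_num
    linarith
  rw [centeredLoss, ← hS]
  refine (norm_sub_le _ _).trans ?_
  have h4 := (norm_smul_one_le (d := d)
    (((∑ k, p k * Complex.exp (-(φ k * Complex.I))).re : ℝ) : ℂ))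
  rw [Complex.norm_real, Real.norm_eq_abs] at h4
  linarith

/-- The link between the losses and the distance. As ρ is Hermitian, S and S* have the same real
trace against it, so symmetrising S costs nothing. -/
theorem rtr_density_mul_centeredLoss {Q : Fin M → Matrix (Fin d) (Fin d) ℂ} {p : Fin M → ℂ}
    {ρ : Matrix (Fin d) (Fin d) ℂ} (hρ : IsDensity ρ) (φ : Fin M → ℝ) :
    rtr (ρ * centeredLoss Q p φ)
      = (∑ k, (p - qvec Q ρ) k * Complex.exp (-(φ k * Complex.I))).re := by
  set S : Matrix (Fin d) (Fin d) ℂ := ∑ k, Complex.exp (φ k * Complex.I) • Q k with hS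
  have h1 : rtr (ρ * Sᴴ) = rtr (ρ * S) := by
    rw [← rtr_conjTranspose, conjTranspose_mul, conjTranspose_conjTranspose, hρ.1.1.eq,
      rtr_mul_comm]
  have h2 : rtr ρ = 1 := by rw [rtr, hρ.2]; simp
  have h3 : rtr (ρ * Sᴴ) = (∑ k, qvec Q ρ k * Complex.exp (-(φ k * Complex.I))).re := by
    rw [rtr_mul_comm, rtr, hS, conjTranspose_sum, Finset.sum_mul, trace_sum]
    congr 1
    refine Finset.sum_congr rfl fun k _ => ?_
    rw [conjTranspose_smul, smul_mul_assoc, trace_smul, smul_eq_mul, mul_comm, qvec]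
    congr 1
    rw [← starRingEnd_apply, ← Complex.exp_conj]
    simp
  have h4 : (1 / 2 : ℂ) = ((1 / 2 : ℝ) : ℂ) := by push_cast; rfl
  rw [centeredLoss, ← hS, mul_sub, mul_smul_comm, mul_smul_comm, mul_one, mul_add, rtr_sub, h4,
    rtr_smul, rtr_smul, rtr_add, ← h1, h2, h3]
  simp only [Pi.sub_apply, sub_mul, Finset.sum_sub_distrib, Complex.sub_re]
  ring

theorem re_sum_le_l1 (x : Fin M → ℂ) (φ : Fin M → ℝ) :
    (∑ k, x k * Complex.exp (-(φ k * Complex.I))).re ≤ l1 x := by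
  refine (Complex.re_le_norm _).trans ((norm_sum_le _ _).trans (Finset.sum_le_sum fun k _ => ?_))
  rw [norm_mul, norm_exp_mul_I, mul_one]

/-- Rotating z back by e^{-ix} gives ‖z‖ up to the polar error. -/
theorem norm_sub_le_re_of_polar {z : ℂ} {x δ : ℝ}
    (h : ‖z - ‖z‖ * Complex.exp (x * Complex.I)‖ ≤ δ) :
    ‖z‖ - δ ≤ (z * Complex.exp (-(x * Complex.I))).re := by
  have e : z * Complex.exp (-(x * Complex.I))
      = (z - ‖z‖ * Complex.exp (x * Complex.I)) * Complex.exp (-(x * Complex.I)) + ‖z‖ := by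
    rw [sub_mul, mul_assoc, ← Complex.exp_add]; simp
  have h2 := Complex.abs_re_le_norm
    ((z - ‖z‖ * Complex.exp (x * Complex.I)) * Complex.exp (-(x * Complex.I)))
  rw [norm_mul, norm_exp_mul_I, mul_one] at h2
  rw [e, Complex.add_re, Complex.ofReal_re]
  linarith [(abs_le.1 (h2.trans h)).1]

variable {Q : Fin M → Matrix (Fin d) (Fin d) ℂ} {p : Fin M → ℂ} {w ε η v : ℝ} {T : ℕ}
  {ρ : ℕ → Matrix (Fin d) (Fin d) ℂ} {φ : ℕ → Fin M → ℝ} {N : ℕ → Matrix (Fin d) (Fin d) ℂ}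

/-- The exact Gibbs state of round `t`. -/
noncomputable def runGibbs (d M : ℕ) (w ε : ℝ) (N : ℕ → Matrix (Fin d) (Fin d) ℂ) (t : ℕ) :
    Matrix (Fin d) (Fin d) ℂ :=
  gibbs (-((rate M w ε / (4 * M * w) : ℝ) : ℂ) • ∑ s ∈ Finset.range t, N s)

theorem isDensity_runGibbs (hd : 1 ≤ d) (hN : ∀ t < T, (N t).IsHermitian) {t : ℕ} (ht : t < T) :
    IsDensity (runGibbs d M w ε N t) := by
  refine isDensity_gibbs ?_ hd
  have : (∑ s ∈ Finset.range t, N s).IsHermitian := by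
    rw [IsHermitian, conjTranspose_sum]
    exact Finset.sum_congr rfl fun s hs => (hN s ((Finset.mem_range.1 hs).trans ht)).eq
  rw [IsHermitian, conjTranspose_smul, this.eq]
  simp

theorem IsRun.norm_centered_le (hrun : IsRun Q p w ε T η ρ φ N v) (hQ : IsInstance w Q p)
    {t : ℕ} (ht : t < T) : ‖N t - ((2 * M * w : ℝ) : ℂ) • 1‖ ≤ 2 * M * w + d ^ 2 * η := by
  have h1 := norm_le_of_entry_le (hrun.loss t ht)
  rw [loss_eq] at h1
  have e : N t - ((2 * M * w : ℝ) : ℂ) • 1 = (N t - (centeredLoss Q p (φ t) +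
      ((2 * M * w : ℝ) : ℂ) • 1)) + centeredLoss Q p (φ t) := by abel
  rw [e]
  refine (norm_add_le _ _).trans ?_
  linarith [norm_centeredLoss_le hQ (φ t)]

theorem IsRun.abs_rtr_sub_le (hrun : IsRun Q p w ε T η ρ φ N v)
    (hN : ∀ t < T, (N t).IsHermitian) {t : ℕ} (ht : t < T) {σ : Matrix (Fin d) (Fin d) ℂ}
    (hσ : IsDensity σ) :
    |rtr (σ * (N t - ((2 * M * w : ℝ) : ℂ) • 1)) - rtr (σ * centeredLoss Q p (φ t))|
      ≤ d ^ 2 * η := by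
  rw [← rtr_sub, ← mul_sub]
  refine (abs_rtr_density_mul_le hσ ?_).trans (norm_le_of_entry_le fun i j => ?_)
  · exact ((hN t ht).sub (isHermitian_ofReal_smul_one _)).sub (isHermitian_centeredLoss _ _ _)
  · have := hrun.loss t ht i j
    rw [loss_eq] at this
    rwa [sub_sub, add_comm (_ • 1)]

theorem avg_le {T : ℕ} (hT : 1 ≤ T) {a : ℕ → ℝ} {c : ℝ} (h : ∀ t < T, a t ≤ c) :
    1 / (T : ℝ) * ∑ t ∈ Finset.range T, a t ≤ c := by
  have hT' : (0 : ℝ) < T := by exact_mod_cast hT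
  have : ∑ t ∈ Finset.range T, a t ≤ ∑ t ∈ Finset.range T, c :=
    Finset.sum_le_sum fun t ht => h t (Finset.mem_range.1 ht)
  rw [Finset.sum_const, Finset.card_range, nsmul_eq_mul] at this
  rw [one_div, inv_mul_le_iff₀ hT']
  exact this

theorem le_avg {T : ℕ} (hT : 1 ≤ T) {a : ℕ → ℝ} {c : ℝ} (h : ∀ t < T, c ≤ a t) :
    c ≤ 1 / (T : ℝ) * ∑ t ∈ Finset.range T, a t := by
  have := avg_le hT (a := fun t => -a t) (c := -c) fun t ht => neg_le_neg (h t ht)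
  rw [Finset.sum_neg_distrib, mul_neg] at this
  linarith

/-- Moves the return value from the computed ρ t, which need not be a density operator, to the exact
Gibbs states of the computed losses, which are. -/
theorem IsRun.abs_avg_sub_le (hrun : IsRun Q p w ε T η ρ φ N v) (hQ : IsInstance w Q p)
    (hd : 1 ≤ d) (hT : 1 ≤ T) (hN : ∀ t < T, (N t).IsHermitian) :
    |v - 1 / T * ∑ t ∈ Finset.range T,
        rtr (runGibbs d M w ε N t * (N t - ((2 * M * w : ℝ) : ℂ) • 1))|
      ≤ η + d ^ 2 * (η * (2 * M * w + d ^ 2 * η)) := by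
  have key : ∀ t < T, |((ρ t)ᴴ * (N t - ((2 * M * w : ℝ) : ℂ) • 1)).trace.re -
      rtr (runGibbs d M w ε N t * (N t - ((2 * M * w : ℝ) : ℂ) • 1))|
      ≤ d ^ 2 * (η * (2 * M * w + d ^ 2 * η)) := by
    intro t ht
    set G := N t - ((2 * M * w : ℝ) : ℂ) • (1 : Matrix (Fin d) (Fin d) ℂ) with hG
    have hh := (isDensity_runGibbs (M := M) (w := w) (ε := ε) hd hN ht).1.1
    have e : ((ρ t)ᴴ * G).trace.re - rtr (runGibbs d M w ε N t * G)
        = (((ρ t - runGibbs d M w ε N t)ᴴ) * G).trace.re := by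
      rw [conjTranspose_sub, hh.eq, sub_mul, trace_sub, Complex.sub_re, rtr]
    rw [e]
    refine (Complex.abs_re_le_norm _).trans (norm_trace_conjTranspose_mul_le (hrun.density t ht) ?_)
    exact fun i j => (norm_entry_le_norm _ i j).trans (hrun.norm_centered_le hQ ht)
  have hr := abs_le.1 hrun.result
  have h1 := avg_le hT fun t ht => (abs_le.1 (key t ht)).2
  have h2 := le_avg hT fun t ht => (abs_le.1 (key t ht)).1
  rw [Finset.sum_sub_distrib, mul_sub] at h1 h2
  rw [abs_le]
  constructor <;> linarith

/-- In each round the exact Gibbs state is a competitor for the minimum. The phases are nearly polar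
for the computed state, hence nearly polar for the Gibbs state, so its payoff is almost its ℓ₁
distance. -/
theorem IsRun.dis_le (hrun : IsRun Q p w ε T η ρ φ N v) (hQ : IsInstance w Q p) (hd : 1 ≤ d)
    (hT : 1 ≤ T) (hN : ∀ t < T, (N t).IsHermitian) :
    dis Q p ≤ v + (η + d ^ 2 * (η * (2 * M * w + d ^ 2 * η)) + d ^ 2 * η
      + M * (η + 2 * (d ^ 2 * (w * η)))) := by
  have key : ∀ t < T, dis Q p - M * (η + 2 * (d ^ 2 * (w * η))) - d ^ 2 * η
      ≤ rtr (runGibbs d M w ε N t * (N t - ((2 * M * w : ℝ) : ℂ) • 1)) := by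
    intro t ht
    have hρ := isDensity_runGibbs (M := M) (w := w) (ε := ε) hd hN ht
    have h1 := (abs_le.1 (hrun.abs_rtr_sub_le hN ht hρ)).1
    rw [rtr_density_mul_centeredLoss hρ, Complex.re_sum] at h1
    have h2 := QDist.dis_le hd Q p hρ
    set σ := runGibbs d M w ε N t with hσ
    have h3 : ∀ k, ‖(p - qvec Q σ) k‖ - (η + 2 * (d ^ 2 * (w * η)))
        ≤ ((p - qvec Q σ) k * Complex.exp (-(φ t k * Complex.I))).re := by
      intro k
      refine norm_sub_le_re_of_polar ?_
      set z := (p - qvec Q (ρ t)) k with hz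
      set y := (p - qvec Q σ) k with hy
      have hzy : ‖y - z‖ ≤ d ^ 2 * (w * η) := by
        have : y - z = ((Q k)ᴴ * (ρ t - σ)).trace := by
          rw [mul_sub, trace_sub, hy, hz]
          simp only [Pi.sub_apply, qvec]
          ring
        rw [this]
        exact norm_trace_conjTranspose_mul_le
          (fun i j => (norm_entry_le_norm _ i j).trans (hQ.1 k)) (hrun.density t ht)
      have hp := hrun.polar t ht k
      rw [← hz] at hp
      -- Polar error for z, change of the residual from z to y, and change of its modulus; the last
      -- two are at most d²wη each.
      have e : y - ‖y‖ * Complex.exp (φ t k * Complex.I)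
          = (z - ‖z‖ * Complex.exp (φ t k * Complex.I)) + ((y - z)
            + ((‖z‖ - ‖y‖ : ℝ) : ℂ) * Complex.exp (φ t k * Complex.I)) := by
        push_cast; ring
      rw [e]
      refine (norm_add_le _ _).trans ?_
      have h5 := norm_add_le (y - z) (((‖z‖ - ‖y‖ : ℝ) : ℂ) * Complex.exp (φ t k * Complex.I))
      rw [norm_mul, Complex.norm_exp_ofReal_mul_I, mul_one, Complex.norm_real,
        Real.norm_eq_abs] at h5
      have h6 := abs_norm_sub_norm_le z y
      rw [norm_sub_rev] at h6
      linarith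
    have h4 := Finset.sum_le_sum fun k (_ : k ∈ Finset.univ) => h3 k
    rw [Finset.sum_sub_distrib, Finset.sum_const, Finset.card_univ, Fintype.card_fin,
      nsmul_eq_mul] at h4
    simp only [l1] at h2
    linarith
  have h1 := (abs_le.1 (hrun.abs_avg_sub_le hQ hd hT hN)).1
  have h2 := le_avg hT key
  linarith

/-- The regret bound against a minimiser σ. It is applied to the centred losses, whose norm is about
2Mw instead of 4Mw. The condition on ε means γ ≤ 1, so that the scaled losses have norm at most one.
-/
theorem IsRun.le_dis (hrun : IsRun Q p w ε T η ρ φ N v) (hQ : IsInstance w Q p) (hd : 1 ≤ d)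
    (hM : 1 ≤ M) (hT : rounds d M w ε ≤ T) (hw : 0 < w) (hε : 0 < ε)
    (hN : ∀ t < T, (N t).IsHermitian) (hη' : d ^ 2 * η ≤ M * w / 4) (hγ : ε ≤ 8 * M * w) :
    v ≤ dis Q p + 5 / 6 * ε + (η + d ^ 2 * (η * (2 * M * w + d ^ 2 * η)) + d ^ 2 * η) := by
  have hM' : (0 : ℝ) < M := by exact_mod_cast hM
  have hT1 : 1 ≤ T := (le_max_left _ _).trans hT
  have hT' : (0 : ℝ) < T := by exact_mod_cast hT1
  obtain ⟨σ, hσ, hdis⟩ := exists_dis_eq hd Q p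
  set γ := rate M w ε with hγdef
  have hMw : 0 < M * w := mul_pos hM' hw
  have hγe : 8 * (M * w) * γ = ε := by rw [hγdef, rate]; field_simp
  have hγ0 : 0 < γ := by rw [hγdef, rate]; positivity
  have hγ1 : γ ≤ 1 := by
    rw [hγdef, rate, div_le_one (by positivity)]; exact hγ
  set a : ℝ := γ / (4 * M * w) with ha
  have ha0 : 0 < a := by positivity
  have haK : a * (4 * (M * w)) = γ := by rw [ha]; field_simp
  set G : ℕ → Matrix (Fin d) (Fin d) ℂ := fun t => N t - ((2 * M * w : ℝ) : ℂ) • 1 with hG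
  have hGh : ∀ t < T, (G t).IsHermitian := fun t ht =>
    (hN t ht).sub (isHermitian_ofReal_smul_one _)
  have hYh : ∀ t < T, ((a : ℂ) • G t).IsHermitian := fun t ht => by
    rw [IsHermitian, conjTranspose_smul, (hGh t ht).eq]; simp
  -- The centred loss has norm at most 2Mw + Mw/4, and a · 4Mw = γ.
  have hYn : ∀ t < T, ‖(a : ℂ) • G t‖ ≤ 9 / 16 * γ := fun t ht => by
    rw [norm_smul, Complex.norm_real, Real.norm_of_nonneg ha0.le]
    calc _ ≤ a * (9 / 4 * (M * w)) := mul_le_mul_of_nonneg_left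
          ((hrun.norm_centered_le hQ ht).trans (by linarith)) ha0.le
      _ = 9 / 16 * (a * (4 * (M * w))) := by ring
      _ = _ := by rw [haK]
  have hmw := multiplicative_weights (T := T) (Y := fun t => (a : ℂ) • G t) hd hYh
    (fun t ht => (hYn t ht).trans (by linarith)) hσ
  -- Centring shifts the exponent by the multiple t · a · 2Mw of the identity, which the Gibbs state
  -- does not see.
  have hgib : ∀ t, gibbs (-∑ s ∈ Finset.range t, (a : ℂ) • G s) = runGibbs d M w ε N t := by
    intro t
    rw [runGibbs, ← hγdef, ← ha, ← gibbs_add_smul_one (-(a : ℂ) • ∑ s ∈ Finset.range t, N s)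
      ((t * (a * (2 * M * w)) : ℝ) : ℂ)]
    congr 1
    simp only [hG, smul_sub, Finset.sum_sub_distrib, Finset.sum_const, Finset.card_range,
      Finset.smul_sum, neg_smul, Finset.sum_neg_distrib, smul_smul, ← Nat.cast_smul_eq_nsmul ℂ]
    push_cast
    abel
  simp only [hgib, mul_smul_comm, Finset.mul_sum, rtr_smul, rtr_sum] at hmw
  have h1 : ∀ t < T, rtr (σ * G t) ≤ dis Q p + d ^ 2 * η := fun t ht => by
    have h := (abs_le.1 (hrun.abs_rtr_sub_le hN ht hσ)).2
    rw [rtr_density_mul_centeredLoss hσ] at h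
    have := re_sum_le_l1 (p - qvec Q σ) (φ t)
    rw [← hdis] at this
    linarith
  have h2 := avg_le hT1 h1
  -- (9/16)² = 81/256 is below 1/3.
  have h3 : ∑ t ∈ Finset.range T, ‖(a : ℂ) • G t‖ ^ 2 ≤ T * (1 / 3 * γ ^ 2) := by
    have : ∑ t ∈ Finset.range T, ‖(a : ℂ) • G t‖ ^ 2 ≤ ∑ t ∈ Finset.range T, 1 / 3 * γ ^ 2 := by
      refine Finset.sum_le_sum fun t ht => ?_
      have := pow_le_pow_left₀ (norm_nonneg _) (hYn t (Finset.mem_range.1 ht)) 2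
      nlinarith
    simpa using this
  have h4 : Real.log d ≤ T * γ ^ 2 := by
    have h5 : Real.log d / γ ^ 2 ≤ T :=
      (Nat.le_ceil _).trans (by exact_mod_cast (le_max_right _ _).trans hT)
    rwa [div_le_iff₀ (by positivity)] at h5
  rw [← Finset.mul_sum, ← Finset.mul_sum] at hmw
  -- The choice of T gives ln d ≤ Tγ², so the regret is at most (4/3)Tγ²; dividing by aT with a =
  -- γ/(4Mw) leaves (16/3)Mwγ = (2/3)ε.
  have h5 : 1 / (T : ℝ) * ∑ t ∈ Finset.range T, rtr (runGibbs d M w ε N t * G t)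
      ≤ 1 / (T : ℝ) * ∑ t ∈ Finset.range T, rtr (σ * G t) + 2 / 3 * ε := by
    have hε' : 2 / 3 * ε = 2 / 3 * (8 * (M * w) * γ) := by rw [hγe]
    rw [hε', one_div, inv_mul_le_iff₀ hT', mul_add, mul_inv_cancel_left₀ hT'.ne']
    have h6 : a * (∑ t ∈ Finset.range T, rtr (runGibbs d M w ε N t * G t)) ≤
        a * ((∑ t ∈ Finset.range T, rtr (σ * G t)) + T * (2 / 3 * (8 * (M * w) * γ))) := by
      have : a * (T * (2 / 3 * (8 * (M * w) * γ))) = T * (4 / 3 * γ ^ 2) := by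
        rw [show a * (T * (2 / 3 * (8 * (M * w) * γ))) = T * (4 / 3 * γ * (a * (4 * (M * w)))) by
          ring, haK]; ring
      rw [mul_add, this]
      linarith
    exact le_of_mul_le_mul_left h6 ha0
  have h6 : |v - 1 / (T : ℝ) * ∑ t ∈ Finset.range T, rtr (runGibbs d M w ε N t * G t)|
      ≤ η + d ^ 2 * (η * (2 * M * w + d ^ 2 * η)) := hrun.abs_avg_sub_le hQ hd hT1 hN
  have h7 := (abs_le.1 h6).2
  clear_value G
  linarith

theorem IsRun.isHermitian_of_exact (hrun : IsRun Q p w ε T 0 ρ φ N v) {t : ℕ} (ht : t < T) :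
    (N t).IsHermitian := by
  have : N t = QDist.loss Q p w (φ t) := by
    ext i j
    simpa [sub_eq_zero] using hrun.loss t ht i j
  rw [this, loss_eq]
  exact (isHermitian_centeredLoss _ _ _).add (isHermitian_ofReal_smul_one _)

theorem IsRun.exact_bounds (hd : 1 ≤ d) (hM : 1 ≤ M) (hw : 0 < w) (hε : 0 < ε)
    (hQ : IsInstance w Q p) (hrun : IsRun Q p w ε (rounds d M w ε) 0 ρ φ N v) :
    v - ε ≤ dis Q p ∧ dis Q p ≤ v + ε := by
  have hN : ∀ t < rounds d M w ε, (N t).IsHermitian := fun t ht => hrun.isHermitian_of_exact ht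
  have hT : 1 ≤ rounds d M w ε := le_max_left _ _
  constructor
  · rcases le_total ε (8 * M * w) with h | h
    · have := hrun.le_dis hQ hd hM le_rfl hw hε hN (by simp; positivity) h
      simp at this
      linarith
    -- For ε ≥ 8Mw the claim is trivial: payoffs never exceed 2Mw, and dis(p) ≥ 0.
    · have h1 := (abs_le.1 (hrun.abs_avg_sub_le hQ hd hT hN)).2
      have h2 : ∀ t < rounds d M w ε, rtr (runGibbs d M w ε N t *
          (N t - ((2 * M * w : ℝ) : ℂ) • 1)) ≤ 2 * M * w := fun t ht => by
        have h3 := hrun.norm_centered_le hQ ht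
        have h4 := abs_rtr_density_mul_le (isDensity_runGibbs (M := M) (w := w) (ε := ε) hd hN ht)
          ((hN t ht).sub (isHermitian_ofReal_smul_one (2 * M * w)))
        simp only [mul_zero, add_zero] at h3
        exact (le_abs_self _).trans (h4.trans h3)
      have h3 := avg_le hT h2
      have h4 := dis_nonneg hd Q p
      simp only [mul_zero, add_zero, zero_mul] at h1
      have : 0 < M * w := mul_pos (by exact_mod_cast hM) hw
      linarith
  · have := hrun.dis_le hQ hd hT hN
    simp at this
    linarith

theorem exists_exact_run (Q : Fin M → Matrix (Fin d) (Fin d) ℂ) (p : Fin M → ℂ) (w ε : ℝ) (T : ℕ) :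
    ∃ ρ φ N v, IsRun Q p w ε T 0 ρ φ N v := by
  let ph : Matrix (Fin d) (Fin d) ℂ → Fin M → ℝ := fun ρ k => ((p - qvec Q ρ) k).arg
  let c : ℂ := -((rate M w ε / (4 * M * w) : ℝ) : ℂ)
  -- The accumulated loss alone determines the next round, so the recursion runs on it.
  let S : ℕ → Matrix (Fin d) (Fin d) ℂ := fun t =>
    Nat.rec 0 (fun _ S => S + loss Q p w (ph (gibbs (c • S)))) t
  have hS : ∀ t, S t = ∑ s ∈ Finset.range t, loss Q p w (ph (gibbs (c • S s))) := by
    intro t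
    induction t with
    | zero => rfl
    | succ t ih => rw [Finset.sum_range_succ, ← ih]
  refine ⟨fun t => gibbs (c • S t), fun t => ph (gibbs (c • S t)),
    fun t => loss Q p w (ph (gibbs (c • S t))),
    (1 / (T : ℝ)) * ∑ t ∈ Finset.range T, (((gibbs (c • S t))ᴴ *
      (loss Q p w (ph (gibbs (c • S t))) - ((2 * M * w : ℝ) : ℂ) • 1)).trace).re, ?_, ?_, ?_, ?_⟩
  rotate_left 3
  · rw [sub_self, abs_zero]
  · intro t _ i j
    rw [← hS]
    simp [c]
  · intro t _ k
    simp only [ph]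
    rw [Complex.norm_mul_exp_arg_mul_I, sub_self, norm_zero]
  · intro t _ i j
    simp

/-- The inner accuracy 1/(2E) leaves ample room for the rounding terms below the target 1/E. -/
theorem IsRun.approx_bounds {W E : ℕ} (hd : 1 ≤ d) (hM : 1 ≤ M) (hW : 1 ≤ W) (hE : 1 ≤ E)
    (hQ : IsInstance W Q p) (hT : rounds d M W (1 / (2 * E)) ≤ T)
    (hN : ∀ t < T, (N t).IsHermitian)
    (hrun : IsRun Q p W (1 / (2 * E)) T (1 / (100 * (d : ℝ) ^ 2 * M * W * E)) ρ φ N v) :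
    v - 1 / E ≤ dis Q p ∧ dis Q p ≤ v + 1 / E := by
  have hd' : (1 : ℝ) ≤ d := by exact_mod_cast hd
  have hM' : (1 : ℝ) ≤ M := by exact_mod_cast hM
  have hW' : (1 : ℝ) ≤ W := by exact_mod_cast hW
  have hE' : (1 : ℝ) ≤ E := by exact_mod_cast hE
  set η : ℝ := 1 / (100 * (d : ℝ) ^ 2 * M * W * E) with hη
  have hd2 : (1 : ℝ) ≤ (d : ℝ) ^ 2 := one_le_pow₀ hd'
  have hMW : (1 : ℝ) ≤ M * W := one_le_mul_of_one_le_of_one_le hM' hW'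
  have hη0 : 0 < η := by positivity
  -- All errors are measured in units of 1/(100E), which is what η d²MW amounts to; the accuracies
  -- 1/E and 1/(2E) are 100 and 50 units.
  have b1 : d ^ 2 * (M * W) * η = 1 / (100 * E) := by rw [hη]; field_simp
  have b0 : 1 / (100 * E) ≤ (1 / 100 : ℝ) := by
    rw [div_le_div_iff_of_pos_left] <;> linarith
  have hx : (1 : ℝ) ≤ d ^ 2 * (M * W) := one_le_mul_of_one_le_of_one_le hd2 hMW
  have b2 : η ≤ 1 / (100 * E) := by rw [← b1]; nlinarith
  have b3 : d ^ 2 * η ≤ 1 / (100 * E) := by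
    rw [← b1]; exact mul_le_mul_of_nonneg_right (by nlinarith) hη0.le
  have b4 : M * η ≤ 1 / (100 * E) := by
    rw [← b1]
    refine mul_le_mul_of_nonneg_right ?_ hη0.le
    nlinarith
  have b5 : d ^ 2 * (η * (2 * M * W + d ^ 2 * η)) ≤ 3 * (1 / (100 * E)) := by
    have : d ^ 2 * (η * (2 * M * W + d ^ 2 * η))
        = 2 * (d ^ 2 * (M * W) * η) + (d ^ 2 * η) * (d ^ 2 * η) := by ring
    rw [this, b1]
    have : 0 ≤ d ^ 2 * η := by positivity
    nlinarith
  have b6 : M * (η + 2 * (d ^ 2 * (W * η))) ≤ 3 * (1 / (100 * E)) := by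
    have : M * (η + 2 * (d ^ 2 * (W * η))) = M * η + 2 * (d ^ 2 * (M * W) * η) := by ring
    rw [this, b1]; linarith
  have b7 : (1 : ℝ) / E = 100 * (1 / (100 * E)) := by field_simp
  have b8 : (1 : ℝ) / (2 * E) = 50 * (1 / (100 * E)) := by field_simp; norm_num
  have hT1 : 1 ≤ T := (le_max_left _ _).trans hT
  have h1 := hrun.dis_le hQ hd hT1 hN
  have h2 := hrun.le_dis hQ hd hM hT (by linarith) (by positivity) hN
    (by linarith) (by rw [b8]; nlinarith)
  have : 0 < 1 / (100 * (E : ℝ)) := by positivity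
  rw [b7]
  rw [b8] at h2
  constructor <;> linarith

end Runs

/-! ### Semantics and costs of loops and parallel maps. -/

section Semantics

theorem bits_le_iff {n : ℤ} {k : ℕ} : bits n ≤ k ↔ n.natAbs < 2 ^ k := Nat.size_le

theorem bits_mono {a b : ℤ} (h : a.natAbs ≤ b.natAbs) : bits a ≤ bits b := Nat.size_le_size h

theorem bits_natCast_mono {a b : ℕ} (h : a ≤ b) : bits (a : ℤ) ≤ bits (b : ℤ) :=
  bits_mono (by simpa using h)

theorem bits_add_le (a b : ℤ) : bits (a + b) ≤ bits a + bits b + 1 := by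
  rw [bits_le_iff]
  have ha : a.natAbs < 2 ^ bits a := bits_le_iff.1 le_rfl
  have hb : b.natAbs < 2 ^ bits b := bits_le_iff.1 le_rfl
  have h1 : 2 ^ bits a ≤ 2 ^ (bits a + bits b) := Nat.pow_le_pow_right two_pos (by omega)
  have h2 : 2 ^ bits b ≤ 2 ^ (bits a + bits b) := Nat.pow_le_pow_right two_pos (by omega)
  have h3 := Int.natAbs_add_le a b
  rw [pow_succ]
  omega

theorem bits_neg (a : ℤ) : bits (-a) = bits a := by simp [bits]

theorem bits_sub_le (a b : ℤ) : bits (a - b) ≤ bits a + bits b + 1 := by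
  have := bits_add_le a (-b)
  rwa [bits_neg, ← sub_eq_add_neg] at this

theorem bits_mul_le (a b : ℤ) : bits (a * b) ≤ bits a + bits b := by
  rw [bits_le_iff, Int.natAbs_mul, pow_add]
  exact Nat.mul_lt_mul'' (bits_le_iff.1 le_rfl) (bits_le_iff.1 le_rfl)

theorem bits_div_le (a b : ℤ) : bits (a / b) ≤ bits a := bits_mono (Int.natAbs_ediv_le_natAbs a b)

theorem bits_bits_le (a : ℤ) : bits (bits a : ℤ) ≤ bits a := by
  rw [bits_le_iff]; exact Nat.lt_two_pow_self

/-- Without write conflicts the priority rule is irrelevant: at this cell only branch t₀ can differ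
from the initial memory. Detecting changes by comparing values is harmless, since an unchanged value
agrees with the initial one anyway. -/
theorem merge_eq {m : ℕ → ℤ → ℤ → ℤ → ℤ} {f : ℕ → ℕ → ℤ → ℤ → ℤ → ℤ} {a : ℕ} {i j k : ℤ} (t₀ n : ℕ)
    (h : ∀ t < n, t ≠ t₀ → f t a i j k = m a i j k) :
    merge m f n a i j k = if t₀ < n then f t₀ a i j k else m a i j k := by
  induction n with
  | zero => simp [merge]
  | succ n ih =>
    have ih' := ih fun t ht => h t (by omega)
    change (if f n a i j k = m a i j k then merge m f n a i j k else f n a i j k) = _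
    rw [ih']
    rcases eq_or_ne n t₀ with rfl | hn
    · simp only [lt_irrefl, if_false, Nat.lt_succ_self, if_true]
      split_ifs with h1
      · exact h1.symm
      · rfl
    · rw [if_pos (h n (Nat.lt_succ_self n) hn)]
      have : t₀ < n ↔ t₀ < n + 1 := by omega
      simp only [this]

/-- A parallel loop in which branch `t` writes only to cells that determine `t`. -/
theorem par_mem {x : ℕ} {e : Expr} {c : Cmd} {s : State} {a : ℕ} {i j k : ℤ} (t₀ : ℤ) {v : ℤ}
    (h0 : 0 ≤ t₀ → t₀ < e.eval s → (c.run (s.setReg x t₀)).state.mem a i j k = v)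
    (h : ∀ t : ℕ, (t : ℤ) ≠ t₀ →
      (c.run (s.setReg x t)).state.mem a i j k = s.mem a i j k) :
    ((Cmd.par x e c).run s).state.mem a i j k
      = if 0 ≤ t₀ ∧ t₀ < e.eval s then v else s.mem a i j k := by
  simp only [Cmd.run]
  rcases le_or_gt 0 t₀ with ht | ht
  · lift t₀ to ℕ using ht
    rw [merge_eq t₀ _ fun t _ hne => h t (by exact_mod_cast hne)]
    by_cases h1 : t₀ < (e.eval s).toNat
    · have h2 : (t₀ : ℤ) < e.eval s := by omega
      rw [if_pos h1, if_pos ⟨by omega, h2⟩, h0 (by omega) h2]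
    · rw [if_neg h1, if_neg (by omega)]
  -- No branch has a negative index, so an index outside of the range plays the part of the
  -- exceptional branch.
  · rw [merge_eq (e.eval s).toNat _ fun t _ _ => h t (by omega), if_neg (lt_irrefl _),
      if_neg (by omega)]

theorem par_cost {x : ℕ} {e : Expr} {c : Cmd} {s : State} {w δ X : ℕ}
    (hc : ∀ i < (e.eval s).toNat, (c.run (s.setReg x i)).work ≤ w ∧
      (c.run (s.setReg x i)).depth ≤ δ)
    (he : 1 + e.cost s ≤ X) (hX : ∀ i < (e.eval s).toNat, 1 + bits i ≤ X) :
    ((Cmd.par x e c).run s).work ≤ ((e.eval s).toNat + 1) * (X + w) ∧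
    ((Cmd.par x e c).run s).depth ≤ 2 * X + δ := by
  constructor
  · have : ∑ i ∈ Finset.range (e.eval s).toNat, ((1 + bits i) + (c.run (s.setReg x i)).work)
        ≤ ∑ i ∈ Finset.range (e.eval s).toNat, (X + w) :=
      Finset.sum_le_sum fun i hi => add_le_add (hX i (Finset.mem_range.1 hi))
        (hc i (Finset.mem_range.1 hi)).1
    rw [Finset.sum_const, Finset.card_range, smul_eq_mul] at this
    simp only [Cmd.run]
    rw [add_mul, one_mul]
    omega
  · have : ((Finset.range (e.eval s).toNat).sup
        fun i => (1 + bits i) + (c.run (s.setReg x i)).depth) ≤ X + δ :=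
      Finset.sup_le fun i hi => add_le_add (hX i (Finset.mem_range.1 hi))
        (hc i (Finset.mem_range.1 hi)).2
    simp only [Cmd.run]
    omega

/-- The state after `n` rounds of a loop with counter `x` and body `c`. -/
def loopState (x : ℕ) (c : Cmd) (s : State) : ℕ → State
  | 0 => s
  | n + 1 => (c.run ((loopState x c s n).setReg x n)).state

theorem loop_state (x : ℕ) (e : Expr) (c : Cmd) (s : State) :
    ((Cmd.loop x e c).run s).state = loopState x c s (e.eval s).toNat := by
  simp only [Cmd.run]
  induction (e.eval s).toNat with
  | zero => rfl
  | succ n ih => simp only [loopState, ← ih]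

theorem loop_cost {x : ℕ} {e : Expr} {c : Cmd} {s : State} {w δ : ℕ}
    (hc : ∀ i < (e.eval s).toNat,
      1 + bits i + (c.run ((loopState x c s i).setReg x i)).work ≤ w ∧
      1 + bits i + (c.run ((loopState x c s i).setReg x i)).depth ≤ δ) :
    ((Cmd.loop x e c).run s).work ≤ 1 + e.cost s + (e.eval s).toNat * w ∧
    ((Cmd.loop x e c).run s).depth ≤ 1 + e.cost s + (e.eval s).toNat * δ := by
  let r : ℕ → Outcome := fun n => Nat.rec (motive := fun _ => Outcome)
    ⟨s, 1 + e.cost s, 1 + e.cost s⟩ (fun i r =>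
      let r' := c.run (r.state.setReg x i)
      ⟨r'.state, r.work + (1 + bits i) + r'.work, r.depth + (1 + bits i) + r'.depth⟩) n
  have hsucc : ∀ n, (r (n + 1)).state = (c.run ((r n).state.setReg x n)).state ∧
      (r (n + 1)).work = (r n).work + (1 + bits n) + (c.run ((r n).state.setReg x n)).work ∧
      (r (n + 1)).depth = (r n).depth + (1 + bits n) + (c.run ((r n).state.setReg x n)).depth :=
    fun n => ⟨rfl, rfl, rfl⟩
  have hrun : (Cmd.loop x e c).run s = r (e.eval s).toNat := rfl
  have hzero : (r 0).state = s ∧ (r 0).work = 1 + e.cost s ∧ (r 0).depth = 1 + e.cost s :=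
    ⟨rfl, rfl, rfl⟩
  clear_value r
  have key : ∀ n ≤ (e.eval s).toNat, (r n).state = loopState x c s n ∧
      (r n).work ≤ 1 + e.cost s + n * w ∧ (r n).depth ≤ 1 + e.cost s + n * δ := by
    intro n
    induction n with
    | zero => intro _; simp [loopState, hzero]
    | succ n ih =>
      intro hn
      obtain ⟨h1, h2, h3⟩ := ih (by omega)
      obtain ⟨h4, h5⟩ := hc n (by omega)
      obtain ⟨s1, s2, s3⟩ := hsucc n
      rw [h1] at s1 s2 s3
      refine ⟨s1, ?_, ?_⟩
      · rw [s2, add_mul, one_mul]; omega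
      · rw [s3, add_mul, one_mul]; omega
  rw [hrun]
  exact (key _ le_rfl).2

/-- The extent of an array in one coordinate: `1`, or the contents of register `0` or `1`. -/
inductive Dim where
  | one
  | dim
  | num

def Dim.expr : Dim → Expr
  | .one => .const 1
  | .dim => .reg 0
  | .num => .reg 1

/-- The state seen by the branch `(i, j, k)` of a parallel map. -/
def State.branch (s : State) (i j k : ℤ) : State := ((s.setReg 4 i).setReg 5 j).setReg 6 k

/-- `a[i, j, k] := e` for all `i, j, k` in the given ranges, simultaneously. -/
def pmap (a : ℕ) (n₁ n₂ n₃ : Dim) (e : Expr) : Cmd :=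
  .par 4 n₁.expr (.par 5 n₂.expr (.par 6 n₃.expr (.store a (.reg 4) (.reg 5) (.reg 6) e)))

theorem Dim.eval_setReg (n : Dim) (s : State) {x : ℕ} (hx : 4 ≤ x) (v : ℤ) :
    n.expr.eval (s.setReg x v) = n.expr.eval s := by
  cases n
  · rfl
  · simp [Dim.expr, Expr.eval, State.setReg, Function.update_of_ne (show (0 : ℕ) ≠ x by omega)]
  · simp [Dim.expr, Expr.eval, State.setReg, Function.update_of_ne (show (1 : ℕ) ≠ x by omega)]

theorem pmap_reg (a : ℕ) (n₁ n₂ n₃ : Dim) (e : Expr) (s : State) :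
    ((pmap a n₁ n₂ n₃ e).run s).state.reg = s.reg := rfl

/-- Branch (i, j, k) writes only to the cell (i, j, k), so each of the three nested loops is free of
conflicts; they are resolved from the inside out. -/
theorem pmap_mem (a : ℕ) (n₁ n₂ n₃ : Dim) (e : Expr) (s : State) (a' : ℕ) (i j k : ℤ) :
    ((pmap a n₁ n₂ n₃ e).run s).state.mem a' i j k
      = if a' = a ∧ (0 ≤ i ∧ i < n₁.expr.eval s) ∧ (0 ≤ j ∧ j < n₂.expr.eval s) ∧
          (0 ≤ k ∧ k < n₃.expr.eval s) then e.eval (s.branch i j k) else s.mem a' i j k := by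
  have h3 : ∀ u v : ℤ, ((Cmd.par 6 n₃.expr (.store a (.reg 4) (.reg 5) (.reg 6) e)).run
      ((s.setReg 4 u).setReg 5 v)).state.mem a' i j k
      = if (a' = a ∧ i = u ∧ j = v) ∧ (0 ≤ k ∧ k < n₃.expr.eval s) then
        e.eval (s.branch i j k) else s.mem a' i j k := by
    intro u v
    have hst : ∀ t : ℤ, ((Cmd.store a (.reg 4) (.reg 5) (.reg 6) e).run
        (((s.setReg 4 u).setReg 5 v).setReg 6 t)).state.mem a' i j k
        = if a' = a ∧ i = u ∧ j = v ∧ k = t then e.eval (s.branch u v t)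
          else s.mem a' i j k := by
      intro t
      simp [Cmd.run, State.setMem, Expr.eval, State.setReg, State.branch]
    by_cases hc : a' = a ∧ i = u ∧ j = v
    · rw [par_mem k (v := e.eval (s.branch i j k))]
      · rw [Dim.eval_setReg _ _ (by norm_num), Dim.eval_setReg _ _ (by norm_num)]
        simp only [hc, true_and, and_true]
        rfl
      · intro _ _
        rw [hst, if_pos ⟨hc.1, hc.2.1, hc.2.2, rfl⟩, hc.2.1, hc.2.2]
      · intro t ht
        rw [hst, if_neg fun h => ht h.2.2.2.symm]; rfl
    -- The cell belongs to no branch of this inner loop; −1 is a dummy owner.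
    · rw [par_mem (-1) (v := 0), if_neg (by omega), if_neg (by tauto)]
      · rfl
      · intro h; omega
      · intro t _
        rw [hst, if_neg (by tauto)]; rfl
  have h2 : ∀ u : ℤ, ((Cmd.par 5 n₂.expr (.par 6 n₃.expr
      (.store a (.reg 4) (.reg 5) (.reg 6) e))).run (s.setReg 4 u)).state.mem a' i j k
      = if (a' = a ∧ i = u) ∧ (0 ≤ j ∧ j < n₂.expr.eval s) ∧ (0 ≤ k ∧ k < n₃.expr.eval s) then
        e.eval (s.branch i j k) else s.mem a' i j k := by
    intro u
    rw [par_mem j (fun _ _ => h3 u j)]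
    · rw [Dim.eval_setReg _ _ (by norm_num)]
      by_cases h : 0 ≤ j ∧ j < n₂.expr.eval s
      · simp only [h, true_and, and_true, if_true]
      · rw [if_neg h, if_neg (by tauto)]; rfl
    · intro t ht
      rw [h3, if_neg fun h => ht h.1.2.2.symm]; rfl
  rw [pmap, par_mem i (fun _ _ => h2 i)]
  · by_cases h : 0 ≤ i ∧ i < n₁.expr.eval s
    · simp only [h, true_and, and_true, if_true]
    · rw [if_neg h, if_neg (by tauto)]
  · intro t ht
    rw [h2, if_neg fun h => ht h.1.2.symm]

/-- The work is multiplied by at most N + 1 at each of the three levels, whereas the depth only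
gains the cost of opening a loop. -/
theorem pmap_cost {a : ℕ} {n₁ n₂ n₃ : Dim} {e : Expr} {s : State} {X w N : ℕ}
    (h0 : 2 + bits (s.reg 0) ≤ X) (h1 : 2 + bits (s.reg 1) ≤ X) (hX : 3 ≤ X)
    (hn₁ : (n₁.expr.eval s).toNat ≤ N) (hn₂ : (n₂.expr.eval s).toNat ≤ N)
    (hn₃ : (n₃.expr.eval s).toNat ≤ N)
    (he : ∀ i j k : ℕ, i < (n₁.expr.eval s).toNat → j < (n₂.expr.eval s).toNat →
      k < (n₃.expr.eval s).toNat → e.cost (s.branch i j k) ≤ w) :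
    ((pmap a n₁ n₂ n₃ e).run s).work ≤ (N + 1) ^ 3 * (7 * X + w) ∧
    ((pmap a n₁ n₂ n₃ e).run s).depth ≤ 10 * X + w := by
  have hdim : ∀ (n : Dim) (s' : State), s'.reg 0 = s.reg 0 → s'.reg 1 = s.reg 1 →
      1 + n.expr.cost s' ≤ X ∧ ∀ i < (n.expr.eval s').toNat, 1 + bits i ≤ X := by
    intro n s' e0 e1
    cases n
    · refine ⟨?_, fun i hi => ?_⟩
      · have : bits 1 = 1 := by decide
        simp [Dim.expr, Expr.cost, this]; omega
      · simp [Dim.expr, Expr.eval] at hi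
        subst hi
        have : bits ((0 : ℕ) : ℤ) = 0 := by decide
        omega
    · refine ⟨?_, fun i hi => ?_⟩
      · simp only [Dim.expr, Expr.cost, e0]; omega
      · simp only [Dim.expr, Expr.eval, e0] at hi
        have : bits (i : ℤ) ≤ bits (s.reg 0) := bits_mono (by omega)
        omega
    · refine ⟨?_, fun i hi => ?_⟩
      · simp only [Dim.expr, Expr.cost, e1]; omega
      · simp only [Dim.expr, Expr.eval, e1] at hi
        have : bits (i : ℤ) ≤ bits (s.reg 1) := bits_mono (by omega)
        omega
  have hst : ∀ i j k : ℕ, i < (n₁.expr.eval s).toNat → j < (n₂.expr.eval s).toNat →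
      k < (n₃.expr.eval s).toNat →
      ((Cmd.store a (.reg 4) (.reg 5) (.reg 6) e).run (s.branch i j k)).work ≤ 4 * X + w ∧
      ((Cmd.store a (.reg 4) (.reg 5) (.reg 6) e).run (s.branch i j k)).depth ≤ 4 * X + w := by
    intro i j k hi hj hk
    have b1 := (hdim n₁ s rfl rfl).2 i hi
    have b2 := (hdim n₂ s rfl rfl).2 j hj
    have b3 := (hdim n₃ s rfl rfl).2 k hk
    have b4 := he i j k hi hj hk
    have e4 : (s.branch i j k).reg 4 = i := rfl
    have e5 : (s.branch i j k).reg 5 = j := rfl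
    have e6 : (s.branch i j k).reg 6 = k := rfl
    simp only [Cmd.run, Expr.cost, e4, e5, e6]
    omega
  have l3 : ∀ i j : ℕ, i < (n₁.expr.eval s).toNat → j < (n₂.expr.eval s).toNat →
      ((Cmd.par 6 n₃.expr (.store a (.reg 4) (.reg 5) (.reg 6) e)).run
        ((s.setReg 4 i).setReg 5 j)).work ≤ (N + 1) * (5 * X + w) ∧
      ((Cmd.par 6 n₃.expr (.store a (.reg 4) (.reg 5) (.reg 6) e)).run
        ((s.setReg 4 i).setReg 5 j)).depth ≤ 6 * X + w := by
    intro i j hi hj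
    have hd := hdim n₃ ((s.setReg 4 i).setReg 5 j) rfl rfl
    have he : n₃.expr.eval ((s.setReg 4 i).setReg 5 j) = n₃.expr.eval s := by
      rw [Dim.eval_setReg _ _ (by norm_num), Dim.eval_setReg _ _ (by norm_num)]
    have := par_cost (x := 6) (e := n₃.expr) (c := .store a (.reg 4) (.reg 5) (.reg 6) e)
      (s := (s.setReg 4 i).setReg 5 j) (w := 4 * X + w) (δ := 4 * X + w) (X := X)
      (fun k hk => hst i j k hi hj (he ▸ hk)) hd.1 hd.2
    rw [he] at this
    refine ⟨this.1.trans (Nat.mul_le_mul (by omega) (by omega)), this.2.trans (by omega)⟩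
  have l2 : ∀ i : ℕ, i < (n₁.expr.eval s).toNat →
      ((Cmd.par 5 n₂.expr (.par 6 n₃.expr (.store a (.reg 4) (.reg 5) (.reg 6) e))).run
        (s.setReg 4 i)).work ≤ (N + 1) * (X + (N + 1) * (5 * X + w)) ∧
      ((Cmd.par 5 n₂.expr (.par 6 n₃.expr (.store a (.reg 4) (.reg 5) (.reg 6) e))).run
        (s.setReg 4 i)).depth ≤ 8 * X + w := by
    intro i hi
    have hd := hdim n₂ (s.setReg 4 i) rfl rfl
    have he : n₂.expr.eval (s.setReg 4 i) = n₂.expr.eval s := Dim.eval_setReg _ _ (by norm_num) _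
    have := par_cost (x := 5) (e := n₂.expr)
      (c := .par 6 n₃.expr (.store a (.reg 4) (.reg 5) (.reg 6) e))
      (s := s.setReg 4 i) (X := X) (fun j hj => l3 i j hi (he ▸ hj)) hd.1 hd.2
    rw [he] at this
    exact ⟨this.1.trans (Nat.mul_le_mul (by omega) le_rfl), this.2.trans (by omega)⟩
  have hd := hdim n₁ s rfl rfl
  have := par_cost (x := 4) (e := n₁.expr)
    (c := .par 5 n₂.expr (.par 6 n₃.expr (.store a (.reg 4) (.reg 5) (.reg 6) e)))
    (s := s) (X := X) (fun i hi => l2 i hi) hd.1 hd.2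
  refine ⟨this.1.trans ?_, this.2.trans (by omega)⟩
  calc _ ≤ (N + 1) * (X + (N + 1) * (X + (N + 1) * (5 * X + w))) :=
        Nat.mul_le_mul (by omega) le_rfl
    _ ≤ _ := by nlinarith [Nat.zero_le (N * N * X), Nat.zero_le (N * X), Nat.zero_le (N * N * N * X),
        Nat.zero_le X, Nat.zero_le N]

end Semantics

/-! ### The invariant, clamping, and the calculus of cheap programs. -/

section Costs

/-- The parameters of the main part of the program: dimension, number of operators, bounds,
number of rounds, number of squarings, and scale of the input. -/
structure Par where
  d : ℕ
  M : ℕ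
  W : ℕ
  E : ℕ
  T : ℕ
  l : ℕ
  sg : ℕ

/-- `exp A` is approximated by `(1 + A / P.lam) ^ P.lam`. -/
def Par.lam (P : Par) : ℕ := 2 ^ P.l

/-- The scale of the matrices in the computation of the exponential. -/
def Par.scale (P : Par) : ℕ := P.lam ^ (2 * P.l)

/-- The bound for all numbers that occur. -/
def Par.cap (P : Par) : ℕ := P.scale ^ 4

/-- The bit length of the bound for all numbers that occur. -/
def Par.len (P : Par) : ℕ := bits ((2 * P.cap : ℕ) : ℤ)

/-- All parameters are at most `lam`, hence below `cap`, so registers that hold them have at most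
`len` bits. The bound on d also ensures that l rounds of pairwise addition exhaust a row. -/
structure Par.Ok (P : Par) : Prop where
  d_pos : 1 ≤ P.d
  M_pos : 1 ≤ P.M
  W_pos : 1 ≤ P.W
  E_pos : 1 ≤ P.E
  T_pos : 1 ≤ P.T
  l_pos : 1 ≤ P.l
  sg_pos : 1 ≤ P.sg
  d_le : P.d ≤ P.lam
  M_le : P.M ≤ P.lam
  W_le : P.W ≤ P.lam
  E_le : P.E ≤ P.lam
  T_le : P.T ≤ P.lam
  sg_le : P.sg ≤ P.lam

theorem Par.lam_pos (P : Par) : 1 ≤ P.lam := Nat.one_le_two_pow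

theorem Par.scale_pos (P : Par) : 1 ≤ P.scale := Nat.one_le_pow _ _ P.lam_pos

theorem Par.cap_pos (P : Par) : 1 ≤ P.cap := Nat.one_le_pow _ _ P.scale_pos

theorem Par.Ok.lam_le_scale {P : Par} (hP : P.Ok) : P.lam ≤ P.scale :=
  Nat.le_self_pow (by have := hP.l_pos; omega) _

theorem Par.scale_le_cap (P : Par) : P.scale ≤ P.cap := Nat.le_self_pow (by norm_num) _

theorem Par.l_le_lam (P : Par) : P.l ≤ P.lam := Nat.lt_two_pow_self.le

/-- What holds throughout the main part of the program: the parameters are in the registers `0` to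
`3` and `11` to `17`, all numbers are bounded, and the cells outside of the arrays vanish. -/
structure Inv (P : Par) (s : State) : Prop where
  r0 : s.reg 0 = P.d
  r1 : s.reg 1 = P.M
  r2 : s.reg 2 = P.W
  r3 : s.reg 3 = P.E
  r11 : s.reg 11 = P.T
  r12 : s.reg 12 = P.l
  r13 : s.reg 13 = P.sg
  r14 : s.reg 14 = P.lam
  r15 : s.reg 15 = P.scale
  r16 : s.reg 16 = P.cap
  r17 : s.reg 17 = 2 * P.cap
  idx : ∀ x, 4 ≤ x → x ≤ 10 → bits (s.reg x) ≤ P.len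
  mem_le : ∀ a, 4 ≤ a → ∀ i j k, bits (s.mem a i j k) ≤ P.len
  mem_zero : ∀ a, 4 ≤ a → ∀ i j k, (P.d : ℤ) ≤ k → s.mem a i j k = 0

theorem Par.bits_le_len {P : Par} {n : ℕ} (h : n ≤ P.cap) : bits n ≤ P.len :=
  bits_natCast_mono (by omega)

theorem Par.Ok.bits_le_len {P : Par} (hP : P.Ok) {n : ℕ} (h : n ≤ P.lam) : bits n ≤ P.len :=
  Par.bits_le_len (h.trans (hP.lam_le_scale.trans P.scale_le_cap))

theorem Inv.reg_le {P : Par} {s : State} (h : Inv P s) (hP : P.Ok) {x : ℕ} (hx : x < 18) :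
    bits (s.reg x) ≤ P.len := by
  rcases le_or_gt x 3 with h3 | h3
  · interval_cases x
    · rw [h.r0]; exact hP.bits_le_len hP.d_le
    · rw [h.r1]; exact hP.bits_le_len hP.M_le
    · rw [h.r2]; exact hP.bits_le_len hP.W_le
    · rw [h.r3]; exact hP.bits_le_len hP.E_le
  rcases le_or_gt x 10 with h10 | h10
  · exact h.idx x h3 h10
  · interval_cases x
    · rw [h.r11]; exact hP.bits_le_len hP.T_le
    · rw [h.r12]; exact hP.bits_le_len P.l_le_lam
    · rw [h.r13]; exact hP.bits_le_len hP.sg_le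
    · rw [h.r14]; exact hP.bits_le_len le_rfl
    · rw [h.r15]; exact Par.bits_le_len P.scale_le_cap
    · rw [h.r16]; exact Par.bits_le_len le_rfl
    · rw [h.r17]; exact_mod_cast le_rfl

theorem Inv.setReg {P : Par} {s : State} (h : Inv P s) {x : ℕ} (h4 : 4 ≤ x) (h10 : x ≤ 10)
    {v : ℤ} (hv : bits v ≤ P.len) : Inv P (s.setReg x v) := by
  have e : ∀ y, y ≠ x → (s.setReg x v).reg y = s.reg y := fun y hy => by
    simp [State.setReg, Function.update_of_ne hy]
  refine ⟨?_, ?_, ?_, ?_, ?_, ?_, ?_, ?_, ?_, ?_, ?_, fun y hy hy' => ?_, h.mem_le, h.mem_zero⟩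
  · rw [e _ (by omega), h.r0]
  · rw [e _ (by omega), h.r1]
  · rw [e _ (by omega), h.r2]
  · rw [e _ (by omega), h.r3]
  · rw [e _ (by omega), h.r11]
  · rw [e _ (by omega), h.r12]
  · rw [e _ (by omega), h.r13]
  · rw [e _ (by omega), h.r14]
  · rw [e _ (by omega), h.r15]
  · rw [e _ (by omega), h.r16]
  · rw [e _ (by omega), h.r17]
  · rcases eq_or_ne y x with rfl | hne
    · simpa [State.setReg] using hv
    · rw [e _ hne]; exact h.idx y hy hy'

theorem Inv.branch {P : Par} {s : State} (h : Inv P s) {i j k : ℤ} (hi : bits i ≤ P.len)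
    (hj : bits j ≤ P.len) (hk : bits k ≤ P.len) : Inv P (s.branch i j k) :=
  ((h.setReg (by norm_num) (by norm_num) hi).setReg (by norm_num) (by norm_num) hj).setReg
    (by norm_num) (by norm_num) hk

/-- Expressions that only refer to registers below `18` and to arrays from `4` on. -/
def Expr.Safe : Expr → Bool
  | .const _ => true
  | .reg x => decide (x < 18)
  | .load a i j k => decide (4 ≤ a) && i.Safe && j.Safe && k.Safe
  | .add e f => e.Safe && f.Safe
  | .sub e f => e.Safe && f.Safe
  | .mul e f => e.Safe && f.Safe
  | .div e f => e.Safe && f.Safe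
  | .len e => e.Safe

/-- A bound for the cost in units of `len + 1` that does not depend on the state. The factor 2 pays
for the bit length of the result, which is at most one more than the sum of those of the operands
and so is covered by their costs. -/
def Expr.weight : Expr → ℕ
  | .const n => 1 + bits n
  | .reg _ => 1
  | .load _ i j k => 1 + i.weight + j.weight + k.weight
  | .add e f => 2 * (e.weight + f.weight)
  | .sub e f => 2 * (e.weight + f.weight)
  | .mul e f => 2 * (e.weight + f.weight)
  | .div e f => 2 * (e.weight + f.weight)
  | .len e => 2 * e.weight

theorem Expr.one_add_bits_eval_le_cost (s : State) (e : Expr) : 1 + bits (e.eval s) ≤ e.cost s := by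
  cases e <;> simp only [Expr.cost, Expr.eval] <;> omega

theorem Expr.cost_le {P : Par} (hP : P.Ok) {s : State} (h : Inv P s) (e : Expr)
    (he : e.Safe = true) : e.cost s ≤ e.weight * (P.len + 1) := by
  induction e with
  | const n => simp only [Expr.cost, Expr.weight]; nlinarith [Nat.zero_le (bits n * P.len)]
  | reg x =>
    simp only [Expr.Safe, decide_eq_true_eq] at he
    have := h.reg_le hP he
    simp only [Expr.cost, Expr.weight]; omega
  | load a i j k hi hj hk =>
    simp only [Expr.Safe, Bool.and_eq_true, decide_eq_true_eq] at he
    have := h.mem_le a he.1.1.1 (i.eval s) (j.eval s) (k.eval s)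
    have h1 := hi he.1.1.2
    have h2 := hj he.1.2
    have h3 := hk he.2
    simp only [Expr.cost, Expr.weight, Expr.eval, add_mul, one_mul] at *
    omega
  | add e f h1 h2 =>
    simp only [Expr.Safe, Bool.and_eq_true] at he
    have h1 := h1 he.1
    have h2 := h2 he.2
    have b1 := e.one_add_bits_eval_le_cost s
    have b2 := f.one_add_bits_eval_le_cost s
    have := bits_add_le (e.eval s) (f.eval s)
    simp only [Expr.cost, Expr.weight, Expr.eval]
    rw [mul_assoc, add_mul]; omega
  | sub e f h1 h2 =>
    simp only [Expr.Safe, Bool.and_eq_true] at he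
    have h1 := h1 he.1
    have h2 := h2 he.2
    have b1 := e.one_add_bits_eval_le_cost s
    have b2 := f.one_add_bits_eval_le_cost s
    have := bits_sub_le (e.eval s) (f.eval s)
    simp only [Expr.cost, Expr.weight, Expr.eval]
    rw [mul_assoc, add_mul]; omega
  | mul e f h1 h2 =>
    simp only [Expr.Safe, Bool.and_eq_true] at he
    have h1 := h1 he.1
    have h2 := h2 he.2
    have b1 := e.one_add_bits_eval_le_cost s
    have b2 := f.one_add_bits_eval_le_cost s
    have := bits_mul_le (e.eval s) (f.eval s)
    simp only [Expr.cost, Expr.weight, Expr.eval]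
    rw [mul_assoc, add_mul]; omega
  | div e f h1 h2 =>
    simp only [Expr.Safe, Bool.and_eq_true] at he
    have h1 := h1 he.1
    have h2 := h2 he.2
    have b1 := e.one_add_bits_eval_le_cost s
    have b2 := f.one_add_bits_eval_le_cost s
    have := bits_div_le (e.eval s) (f.eval s)
    simp only [Expr.cost, Expr.weight, Expr.eval]
    rw [mul_assoc, add_mul]; omega
  | len e h1 =>
    simp only [Expr.Safe] at he
    have h1 := h1 he
    have b1 := e.one_add_bits_eval_le_cost s
    have := bits_bits_le (e.eval s)
    simp only [Expr.cost, Expr.weight, Expr.eval]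
    rw [mul_assoc]; omega

/-- The representative of `x` modulo `2 h` in `[-h, h)`. -/
def clamp (h x : ℤ) : ℤ := x - 2 * h * ((x + h) / (2 * h))

theorem clamp_eq_emod (h x : ℤ) : clamp h x = (x + h) % (2 * h) - h := by
  have := Int.emod_add_mul_ediv (x + h) (2 * h)
  rw [clamp]; linarith

theorem natAbs_clamp_le {h : ℤ} (hh : 0 < h) (x : ℤ) : (clamp h x).natAbs ≤ h.natAbs := by
  rw [clamp_eq_emod]
  have h1 := Int.emod_nonneg (x + h) (show 2 * h ≠ 0 by omega)
  have h2 := Int.emod_lt_of_pos (x + h) (show 0 < 2 * h by omega)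
  omega

theorem clamp_eq_self {h x : ℤ} (hx : |x| < h) : clamp h x = x := by
  rw [abs_lt] at hx
  rw [clamp, Int.ediv_eq_zero_of_lt (by omega) (by omega)]; ring

theorem clamp_zero {h : ℤ} (hh : 0 < h) : clamp h 0 = 0 := clamp_eq_self (by simpa using hh)

/-- Reduction modulo 2h is additive, so a sum that is clamped after every partial addition is still
right once its final value is in range. -/
theorem clamp_add_clamp (h x y : ℤ) : clamp h (clamp h x + clamp h y) = clamp h (x + y) := by
  simp only [clamp_eq_emod]
  congr 1
  have : (x + h) % (2 * h) - h + ((y + h) % (2 * h) - h) + h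
      = ((x + h) % (2 * h) + (y + h) % (2 * h)) - h := by ring
  rw [this, Int.sub_emod, ← Int.add_emod, ← Int.sub_emod]
  congr 1; ring

theorem clamp_clamp (h x : ℤ) : clamp h (clamp h x) = clamp h x := by
  simp only [clamp_eq_emod]; simp

def clampExpr (e : Expr) : Expr :=
  .sub e (.mul (.reg 17) (.div (.add e (.reg 16)) (.reg 17)))

theorem Inv.eval_clampExpr {P : Par} {s : State} (h : Inv P s) (e : Expr) :
    (clampExpr e).eval s = clamp P.cap (e.eval s) := by
  simp only [clampExpr, Expr.eval, h.r16, h.r17, clamp]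

/-- Programs whose work is polynomial, and whose depth is polynomial in the number of rounds of the
sequential loops. -/
def Cheap (c : Cmd) : Prop :=
  ∃ K q : ℕ, ∀ (P : Par), P.Ok → ∀ s, Inv P s → Inv P (c.run s).state ∧
    (c.run s).work ≤ K * (P.len + 1) * (P.d + P.M + 1) ^ 3 * (P.T + P.l + P.M + 1) ^ q ∧
    (c.run s).depth ≤ K * (P.len + 1) * (P.T + P.l + P.M + 1) ^ q

theorem Cheap.inv {c : Cmd} (h : Cheap c) {P : Par} (hP : P.Ok) {s : State} (hs : Inv P s) :
    Inv P (c.run s).state := by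
  obtain ⟨K, q, hc⟩ := h
  exact (hc P hP s hs).1

theorem Cheap.seq {c c' : Cmd} (h : Cheap c) (h' : Cheap c') : Cheap (.seq c c') := by
  obtain ⟨K, q, hc⟩ := h
  obtain ⟨K', q', hc'⟩ := h'
  refine ⟨K + K', q + q', fun P hP s hs => ?_⟩
  obtain ⟨i1, w1, d1⟩ := hc P hP s hs
  obtain ⟨i2, w2, d2⟩ := hc' P hP _ i1
  have p1 : (P.T + P.l + P.M + 1) ^ q ≤ (P.T + P.l + P.M + 1) ^ (q + q') :=
    Nat.pow_le_pow_right (by omega) (by omega)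
  have p2 : (P.T + P.l + P.M + 1) ^ q' ≤ (P.T + P.l + P.M + 1) ^ (q + q') :=
    Nat.pow_le_pow_right (by omega) (by omega)
  refine ⟨i2, ?_, ?_⟩
  · simp only [Cmd.run]
    refine (add_le_add (w1.trans (Nat.mul_le_mul_left _ p1))
      (w2.trans (Nat.mul_le_mul_left _ p2))).trans (le_of_eq ?_)
    ring
  · simp only [Cmd.run]
    refine (add_le_add (d1.trans (Nat.mul_le_mul_left _ p1))
      (d2.trans (Nat.mul_le_mul_left _ p2))).trans (le_of_eq ?_)
    ring

theorem Dim.eval_le {P : Par} {s : State} (h : Inv P s) (n : Dim) :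
    (n.expr.eval s).toNat ≤ P.d + P.M + 1 := by
  cases n <;> simp [Dim.expr, Expr.eval, h.r0, h.r1] <;> omega

/-- Clamping preserves the invariant whatever the expression evaluates to, so no information on the
values is needed for the cost. The third extent must not be M because cells with third index at
least d have to stay zero. -/
theorem Cheap.pmap {a : ℕ} {n₁ n₂ n₃ : Dim} {e : Expr} (hn : n₃ ≠ .num)
    (he : e.Safe = true) : Cheap (pmap a n₁ n₂ n₃ (clampExpr e)) := by
  refine ⟨8 * (40 + (clampExpr e).weight), 0, fun P hP s hs => ?_⟩
  have hcl : (clampExpr e).Safe = true := by simp [clampExpr, Expr.Safe, he]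
  have bd : ∀ (n : Dim) (i : ℕ), i < (n.expr.eval s).toNat → bits i ≤ P.len := by
    intro n i hi
    cases n
    · simp [Dim.expr, Expr.eval] at hi
      exact hP.bits_le_len (by omega)
    · simp [Dim.expr, Expr.eval, hs.r0] at hi
      exact hP.bits_le_len (hi.le.trans hP.d_le)
    · simp [Dim.expr, Expr.eval, hs.r1] at hi
      exact hP.bits_le_len (hi.le.trans hP.M_le)
  have hcost := pmap_cost (a := a) (n₁ := n₁) (n₂ := n₂) (n₃ := n₃) (e := clampExpr e) (s := s)
    (X := 3 + P.len) (w := (clampExpr e).weight * (P.len + 1)) (N := P.d + P.M + 1)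
    (by have := hs.reg_le hP (x := 0) (by norm_num); omega)
    (by have := hs.reg_le hP (x := 1) (by norm_num); omega) (by omega)
    (n₁.eval_le hs) (n₂.eval_le hs) (n₃.eval_le hs)
    (fun i j k hi hj hk => Expr.cost_le hP
      (hs.branch (bd _ _ hi) (bd _ _ hj) (bd _ _ hk)) _ hcl)
  refine ⟨?_, hcost.1.trans ?_, hcost.2.trans ?_⟩
  · have hreg := pmap_reg a n₁ n₂ n₃ (clampExpr e) s
    refine ⟨?_, ?_, ?_, ?_, ?_, ?_, ?_, ?_, ?_, ?_, ?_, ?_, fun a' ha' i j k => ?_,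
      fun a' ha' i j k hk => ?_⟩
    · rw [hreg]; exact hs.r0
    · rw [hreg]; exact hs.r1
    · rw [hreg]; exact hs.r2
    · rw [hreg]; exact hs.r3
    · rw [hreg]; exact hs.r11
    · rw [hreg]; exact hs.r12
    · rw [hreg]; exact hs.r13
    · rw [hreg]; exact hs.r14
    · rw [hreg]; exact hs.r15
    · rw [hreg]; exact hs.r16
    · rw [hreg]; exact hs.r17
    · rw [hreg]; exact hs.idx
    · rw [pmap_mem]
      split_ifs with hc
      · obtain ⟨-, ⟨h1, h2⟩, ⟨h3, h4⟩, h5, h6⟩ := hc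
        lift i to ℕ using h1
        lift j to ℕ using h3
        lift k to ℕ using h5
        rw [(hs.branch (bd n₁ i (by omega)) (bd n₂ j (by omega))
          (bd n₃ k (by omega))).eval_clampExpr]
        refine (bits_mono (natAbs_clamp_le (by exact_mod_cast P.cap_pos) _)).trans ?_
        exact Par.bits_le_len le_rfl
      · exact hs.mem_le a' ha' i j k
    · rw [pmap_mem, if_neg, hs.mem_zero a' ha' i j k hk]
      rintro ⟨-, -, -, h5, h6⟩
      have hd := hP.d_pos
      cases n₃
      · simp [Dim.expr, Expr.eval] at h6; omega
      · simp [Dim.expr, Expr.eval, hs.r0] at h6; omega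
      · exact hn rfl
  · rw [pow_zero, mul_one]
    have : (P.d + P.M + 1 + 1) ^ 3 ≤ 8 * (P.d + P.M + 1) ^ 3 := by
      calc _ ≤ (2 * (P.d + P.M + 1)) ^ 3 := Nat.pow_le_pow_left (by omega) 3
        _ = _ := by ring
    calc _ ≤ (8 * (P.d + P.M + 1) ^ 3) * ((40 + (clampExpr e).weight) * (P.len + 1)) :=
          Nat.mul_le_mul this (by rw [add_mul]; omega)
      _ = _ := by ring
  · rw [pow_zero, mul_one, mul_assoc, add_mul]
    have := Nat.zero_le ((clampExpr e).weight * (P.len + 1))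
    omega

/-- The admissible lengths are the registers of M, T and l, so a loop raises the exponent of T + l +
M + 1 by one. The counters `7` to `10` are registers whose contents the invariant leaves free up to
their size. -/
theorem Cheap.loop {x r : ℕ} {c : Cmd} (hx : 7 ≤ x) (hx' : x ≤ 10) (hr : r = 1 ∨ r = 11 ∨ r = 12)
    (h : Cheap c) : Cheap (.loop x (.reg r) c) := by
  obtain ⟨K, q, hc⟩ := h
  refine ⟨K + 3, q + 1, fun P hP s hs => ?_⟩
  set L := P.T + P.l + P.M + 1 with hL
  set N := (P.d + P.M + 1) ^ 3 with hN
  have hN1 : 1 ≤ N := Nat.one_le_pow _ _ (by omega)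
  have hLq : 1 ≤ L ^ q := Nat.one_le_pow _ _ (by omega)
  obtain ⟨n, hn, hnL, hnl⟩ : ∃ n : ℕ, s.reg r = n ∧ n + 1 ≤ L ∧ n ≤ P.lam := by
    rcases hr with rfl | rfl | rfl
    · exact ⟨_, hs.r1, by omega, hP.M_le⟩
    · exact ⟨_, hs.r11, by omega, hP.T_le⟩
    · exact ⟨_, hs.r12, by omega, P.l_le_lam⟩
  have he : (Expr.reg r).eval s = n := hn
  have hbits : ∀ i ≤ n, bits i ≤ P.len := fun i hi => hP.bits_le_len (hi.trans hnl)
  have hinv : ∀ i ≤ n, Inv P (loopState x c s i) := by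
    intro i
    induction i with
    | zero => intro _; exact hs
    | succ i ih =>
      intro hi
      exact (hc P hP _ ((ih (by omega)).setReg (by omega) hx' (hbits i (by omega)))).1
  have hcost := loop_cost (x := x) (e := .reg r) (c := c) (s := s)
    (w := (K + 1) * (P.len + 1) * N * L ^ q) (δ := (K + 1) * (P.len + 1) * L ^ q) (by
      intro i hi
      rw [he, Int.toNat_natCast] at hi
      obtain ⟨-, h2, h3⟩ := hc P hP _ ((hinv i hi.le).setReg (by omega) hx' (hbits i hi.le))
      have hb := hbits i hi.le
      have e1 : (K + 1) * (P.len + 1) * N * L ^ q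
          = (P.len + 1) * (N * L ^ q) + K * (P.len + 1) * N * L ^ q := by ring
      have e2 : (K + 1) * (P.len + 1) * L ^ q
          = (P.len + 1) * L ^ q + K * (P.len + 1) * L ^ q := by ring
      have e3 : P.len + 1 ≤ (P.len + 1) * (N * L ^ q) :=
        Nat.le_mul_of_pos_right _ (Nat.mul_pos hN1 hLq)
      have e4 : P.len + 1 ≤ (P.len + 1) * L ^ q := Nat.le_mul_of_pos_right _ hLq
      rw [← hL, ← hN] at h2
      rw [← hL] at h3
      rw [e1, e2]
      exact ⟨by linarith, by linarith⟩)
  rw [he, Int.toNat_natCast] at hcost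
  have hce : (Expr.reg r).cost s ≤ 1 + P.len := by
    simp only [Expr.cost, hn]
    have := hbits n le_rfl
    omega
  refine ⟨?_, hcost.1.trans ?_, hcost.2.trans ?_⟩
  · rw [loop_state, he, Int.toNat_natCast]
    exact hinv n le_rfl
  · have e1 : (K + 3) * (P.len + 1) * N * L ^ (q + 1)
        = 2 * ((P.len + 1) * (N * L ^ (q + 1))) + L * ((K + 1) * (P.len + 1) * N * L ^ q) := by
      ring
    have e3 : P.len + 1 ≤ (P.len + 1) * (N * L ^ (q + 1)) :=
      Nat.le_mul_of_pos_right _ (Nat.mul_pos hN1 (Nat.one_le_pow _ _ (by omega)))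
    have e4 : n * ((K + 1) * (P.len + 1) * N * L ^ q) ≤ L * ((K + 1) * (P.len + 1) * N * L ^ q) :=
      Nat.mul_le_mul_right _ (by omega)
    rw [e1]; omega
  · have e1 : (K + 3) * (P.len + 1) * L ^ (q + 1)
        = 2 * ((P.len + 1) * L ^ (q + 1)) + L * ((K + 1) * (P.len + 1) * L ^ q) := by
      ring
    have e3 : P.len + 1 ≤ (P.len + 1) * L ^ (q + 1) :=
      Nat.le_mul_of_pos_right _ (Nat.one_le_pow _ _ (by omega))
    have e4 : n * ((K + 1) * (P.len + 1) * L ^ q) ≤ L * ((K + 1) * (P.len + 1) * L ^ q) :=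
      Nat.mul_le_mul_right _ (by omega)
    rw [e1]; omega

end Costs

/-! ### Clamped parallel maps and tree sums. -/

section Program

instance : Add Expr := ⟨.add⟩
instance : Sub Expr := ⟨.sub⟩
instance : Mul Expr := ⟨.mul⟩
instance : Div Expr := ⟨.div⟩
instance (n : ℕ) : OfNat Expr n := ⟨.const n⟩

@[simp] theorem Expr.eval_add (s : State) (e f : Expr) : (e + f).eval s = e.eval s + f.eval s := rfl
@[simp] theorem Expr.eval_sub (s : State) (e f : Expr) : (e - f).eval s = e.eval s - f.eval s := rfl
@[simp] theorem Expr.eval_mul (s : State) (e f : Expr) : (e * f).eval s = e.eval s * f.eval s := rfl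
@[simp] theorem Expr.eval_div (s : State) (e f : Expr) : (e / f).eval s = e.eval s / f.eval s := rfl
@[simp] theorem Expr.eval_reg (s : State) (x : ℕ) : (Expr.reg x).eval s = s.reg x := rfl
@[simp] theorem Expr.eval_load (s : State) (a : ℕ) (i j k : Expr) :
    (Expr.load a i j k).eval s = s.mem a (i.eval s) (j.eval s) (k.eval s) := rfl

@[simp] theorem State.branch_mem (s : State) (i j k : ℤ) : (s.branch i j k).mem = s.mem := rfl
@[simp] theorem State.branch_reg4 (s : State) (i j k : ℤ) : (s.branch i j k).reg 4 = i := rfl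
@[simp] theorem State.branch_reg5 (s : State) (i j k : ℤ) : (s.branch i j k).reg 5 = j := rfl
@[simp] theorem State.branch_reg6 (s : State) (i j k : ℤ) : (s.branch i j k).reg 6 = k := rfl
theorem State.branch_reg (s : State) (i j k : ℤ) {x : ℕ} (hx : x ≠ 4 ∧ x ≠ 5 ∧ x ≠ 6) :
    (s.branch i j k).reg x = s.reg x := by
  simp [State.branch, State.setReg, Function.update_of_ne, hx]
@[simp] theorem State.setReg_mem (s : State) (x : ℕ) (v : ℤ) : (s.setReg x v).mem = s.mem := rfl

theorem run_seq_state (c c' : Cmd) (s : State) :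
    ((Cmd.seq c c').run s).state = (c'.run (c.run s).state).state := rfl

/-- The first index of a parallel map. -/
abbrev ix1 : Expr := .reg 4
/-- The second index of a parallel map. -/
abbrev ix2 : Expr := .reg 5
/-- The third index of a parallel map. -/
abbrev ix3 : Expr := .reg 6

/-- A parallel map whose results are clamped. -/
def pm (a : ℕ) (n₁ n₂ n₃ : Dim) (e : Expr) : Cmd := pmap a n₁ n₂ n₃ (clampExpr e)

/-- The extent that a `Dim` stands for. -/
def Dim.size (P : Par) : Dim → ℕ
  | .one => 1
  | .dim => P.d
  | .num => P.M

theorem Dim.eval_eq {P : Par} {s : State} (h : Inv P s) (n : Dim) :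
    n.expr.eval s = n.size P := by
  cases n
  · rfl
  · exact h.r0
  · exact h.r1

variable {P : Par} {s : State}

theorem pm_mem (h : Inv P s) (a : ℕ) (n₁ n₂ n₃ : Dim) (e : Expr) (a' : ℕ) (i j k : ℤ) :
    ((pm a n₁ n₂ n₃ e).run s).state.mem a' i j k
      = if a' = a ∧ (0 ≤ i ∧ i < n₁.size P) ∧ (0 ≤ j ∧ j < n₂.size P) ∧ (0 ≤ k ∧ k < n₃.size P) then
          clamp P.cap (e.eval (s.branch i j k)) else s.mem a' i j k := by
  rw [pm, pmap_mem, Dim.eval_eq h, Dim.eval_eq h, Dim.eval_eq h]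
  have : (clampExpr e).eval (s.branch i j k) = clamp P.cap (e.eval (s.branch i j k)) := by
    simp only [clampExpr, Expr.eval, clamp, State.branch_reg _ _ _ _ (show 16 ≠ 4 ∧ _ by decide),
      State.branch_reg _ _ _ _ (show 17 ≠ 4 ∧ _ by decide), h.r16, h.r17]
  rw [this]

theorem pm_apply (h : Inv P s) (a : ℕ) {n₁ n₂ n₃ : Dim} (e : Expr) {i j k : ℕ}
    (hi : i < n₁.size P) (hj : j < n₂.size P) (hk : k < n₃.size P) :
    ((pm a n₁ n₂ n₃ e).run s).state.mem a i j k = clamp P.cap (e.eval (s.branch i j k)) := by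
  rw [pm_mem h, if_pos ⟨rfl, by omega, by omega, by omega⟩]

theorem pm_of_ne (h : Inv P s) {a a' : ℕ} (n₁ n₂ n₃ : Dim) (e : Expr) (ha : a' ≠ a) :
    ((pm a n₁ n₂ n₃ e).run s).state.mem a' = s.mem a' := by
  funext i j k
  rw [pm_mem h, if_neg fun h => ha h.1]

theorem Cheap.pm {a : ℕ} {n₁ n₂ n₃ : Dim} {e : Expr} (hn : n₃ ≠ .num) (he : e.Safe = true) :
    Cheap (pm a n₁ n₂ n₃ e) := Cheap.pmap hn he

/-- Sums the cells `a[i, j, k]` over `k` into `a[i, j, 0]`, in logarithmically many rounds. -/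
def treeSum (a : ℕ) (n₁ n₂ : Dim) : Cmd :=
  .loop 8 (.reg 12) (pm a n₁ n₂ .dim (.load a ix1 ix2 (ix3 + ix3) + .load a ix1 ix2 (ix3 + ix3 + 1)))

theorem Cheap.treeSum {a : ℕ} (ha : 4 ≤ a) (n₁ n₂ : Dim) : Cheap (treeSum a n₁ n₂) := by
  refine Cheap.loop (by norm_num) (by norm_num) (by norm_num) (Cheap.pm (by simp) ?_)
  change (((decide (4 ≤ a)) && _ && _ && _) && ((decide (4 ≤ a)) && _ && _ && _)) = true
  simp [ha]; decide

theorem Inv.loopState (h : Inv P s) (hP : P.Ok) {x : ℕ} {c : Cmd} (hc : Cheap c) (hx : 4 ≤ x)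
    (hx' : x ≤ 10) {n : ℕ} (hn : n ≤ P.lam) {i : ℕ} (hi : i ≤ n) : Inv P (loopState x c s i) := by
  induction i with
  | zero => exact h
  | succ i ih => exact hc.inv hP ((ih (by omega)).setReg hx hx' (hP.bits_le_len (by omega)))

/-- Pairwise addition in place works because all branches of a round read the old memory. No
intermediate sum has to be in range, since clamping is compatible with addition. -/
theorem treeSum_spec (hP : P.Ok) (h : Inv P s) {a : ℕ} (ha : 4 ≤ a) {n₁ n₂ : Dim} :
    (∀ i j : ℕ, i < n₁.size P → j < n₂.size P →
      ((treeSum a n₁ n₂).run s).state.mem a i j 0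
        = clamp P.cap (∑ k ∈ Finset.range P.d, s.mem a i j k)) ∧
    ∀ a', a' ≠ a → ((treeSum a n₁ n₂).run s).state.mem a' = s.mem a' := by
  set c := pm a n₁ n₂ .dim (.load a ix1 ix2 (ix3 + ix3) + .load a ix1 ix2 (ix3 + ix3 + 1)) with hc
  have hcheap : Cheap c := by
    refine Cheap.pm (by simp) ?_
    change (((decide (4 ≤ a)) && _ && _ && _) && ((decide (4 ≤ a)) && _ && _ && _)) = true
    simp [ha]; decide
  have hinv : ∀ m ≤ P.l, Inv P (loopState 8 c s m) := fun m hm =>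
    h.loopState hP hcheap (by norm_num) (by norm_num) P.l_le_lam hm
  have hcap : (0 : ℤ) < P.cap := by exact_mod_cast P.cap_pos
  have hrun : ((treeSum a n₁ n₂).run s).state = loopState 8 c s P.l := by
    rw [treeSum, loop_state]
    have : (Expr.reg 12).eval s = P.l := h.r12
    rw [this, Int.toNat_natCast]
  rw [hrun]
  have hstep : ∀ m < P.l, Inv P ((loopState 8 c s m).setReg 8 m) := fun m hm =>
    (hinv m hm.le).setReg (by norm_num) (by norm_num)
      (hP.bits_le_len (hm.le.trans P.l_le_lam))
  constructor
  · intro i j hi hj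
    -- After m rounds cell k holds, up to clamping, the sum of the original cells from 2^m k to 2^m
    -- (k + 1) − 1. The second clause excludes m = 0, where the cell need not be clamped yet.
    have key : ∀ m ≤ P.l, ∀ k : ℕ,
        clamp P.cap ((loopState 8 c s m).mem a i j k)
          = clamp P.cap (∑ t ∈ Finset.range (2 ^ m), s.mem a i j ((2 ^ m * k + t : ℕ) : ℤ)) ∧
        (m ≠ 0 → clamp P.cap ((loopState 8 c s m).mem a i j k) = (loopState 8 c s m).mem a i j k) := by
      intro m
      induction m with
      | zero => intro _ k; simp [loopState]
      | succ m ih =>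
        intro hm k
        have hI := hstep m hm
        have ih := ih (by omega)
        rcases lt_or_ge k P.d with hk | hk
        · have e1 : (loopState 8 c s (m + 1)).mem a i j k
              = clamp P.cap ((loopState 8 c s m).mem a i j ((2 * k : ℕ) : ℤ)
                + (loopState 8 c s m).mem a i j ((2 * k + 1 : ℕ) : ℤ)) := by
            change (c.run ((loopState 8 c s m).setReg 8 m)).state.mem a i j k = _
            rw [hc, pm_apply hI a _ hi hj hk]
            simp only [Expr.eval_add, Expr.eval_load, State.branch_mem, Expr.eval_reg,
              State.branch_reg4, State.branch_reg5, State.branch_reg6, State.setReg_mem]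
            congr 3
            · push_cast; ring
            · change (k : ℤ) + k + 1 = _
              push_cast; ring
          rw [e1]
          refine ⟨?_, fun _ => clamp_clamp _ _⟩
          rw [clamp_clamp, ← clamp_add_clamp, (ih (2 * k)).1, (ih (2 * k + 1)).1, clamp_add_clamp,
            pow_succ, mul_two, Finset.sum_range_add]
          congr 2
          · refine Finset.sum_congr rfl fun t _ => ?_
            congr 2; ring
          · refine Finset.sum_congr rfl fun t _ => ?_
            congr 2; ring
        -- Cells beyond d are never written and stay zero, and the blocks that they stand for lie
        -- beyond d as well.
        · have hI' := hinv (m + 1) hm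
          have e1 := hI'.mem_zero a ha i j k (by exact_mod_cast hk)
          have e2 : ∑ t ∈ Finset.range (2 ^ (m + 1)),
              s.mem a i j ((2 ^ (m + 1) * k + t : ℕ) : ℤ) = 0 := by
            refine Finset.sum_eq_zero fun t _ => h.mem_zero a ha i j _ ?_
            have : 1 * k ≤ 2 ^ (m + 1) * k := Nat.mul_le_mul_right _ Nat.one_le_two_pow
            exact_mod_cast (by omega : P.d ≤ 2 ^ (m + 1) * k + t)
          rw [e1, e2]
          exact ⟨rfl, fun _ => clamp_zero hcap⟩
    have h0 := key P.l le_rfl 0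
    have h1 := h0.2 (by have := hP.l_pos; omega)
    rw [h0.1] at h1
    simp only [Nat.cast_zero, mul_zero, zero_add] at h1
    rw [← h1]
    congr 1
    -- After l rounds the block of cell 0 has length 2^l ≥ d; the excess cells are zero.
    rw [← Finset.sum_range_add_sum_Ico _ (show P.d ≤ 2 ^ P.l from hP.d_le)]
    rw [Finset.sum_eq_zero (s := Finset.Ico P.d (2 ^ P.l)), add_zero]
    intro t ht
    exact h.mem_zero a ha i j t (by exact_mod_cast (Finset.mem_Ico.1 ht).1)
  · intro a' ha'
    have : ∀ m ≤ P.l, (loopState 8 c s m).mem a' = s.mem a' := by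
      intro m
      induction m with
      | zero => intro _; rfl
      | succ m ih =>
        intro hm
        change (c.run ((loopState 8 c s m).setReg 8 m)).state.mem a' = _
        rw [hc, pm_of_ne (hstep m hm) _ _ _ _ ha', State.setReg_mem]
        exact ih (by omega)
    exact this _ le_rfl

end Program

/-! ### Fixed-point matrices and one squaring. -/

section Exponential

/-- The complex number with real part `x / D` and imaginary part `y / D`. -/
noncomputable def fx (D : ℝ) (x y : ℤ) : ℂ := ⟨x / D, y / D⟩

@[simp] theorem fx_re (D : ℝ) (x y : ℤ) : (fx D x y).re = x / D := rfl
@[simp] theorem fx_im (D : ℝ) (x y : ℤ) : (fx D x y).im = y / D := rfl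

theorem abs_intDiv_sub_le (x : ℤ) {b : ℤ} (hb : 0 < b) : |((x / b : ℤ) : ℝ) - x / b| ≤ 1 := by
  have hb' : (0 : ℝ) < b := by exact_mod_cast hb
  have h1 := Int.emod_add_mul_ediv x b
  have h2 := Int.emod_nonneg x hb.ne'
  have h3 := Int.emod_lt_of_pos x hb
  have e : (x : ℝ) = (x % b : ℤ) + b * (x / b : ℤ) := by exact_mod_cast h1.symm
  have h2' : (0 : ℝ) ≤ (x % b : ℤ) := by exact_mod_cast h2
  have h3' : ((x % b : ℤ) : ℝ) ≤ b := by exact_mod_cast h3.le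
  have e2 : ((x / b : ℤ) : ℝ) - x / b = -(((x % b : ℤ) : ℝ) / b) := by
    field_simp; linarith
  rw [e2, abs_neg, abs_of_nonneg (by positivity)]
  exact div_le_one_of_le₀ h3' hb'.le

theorem abs_intDiv_le (x : ℤ) (b : ℤ) : |x / b| ≤ |x| := by
  rw [Int.abs_eq_natAbs, Int.abs_eq_natAbs]
  exact_mod_cast Int.natAbs_ediv_le_natAbs x b

theorem norm_fx_sub_le {D : ℝ} (hD : 0 < D) {x y : ℤ} {z : ℂ} {c : ℝ}
    (hx : |(x : ℝ) - D * z.re| ≤ c) (hy : |(y : ℝ) - D * z.im| ≤ c) :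
    ‖fx D x y - z‖ ≤ 2 * c / D := by
  refine (Complex.norm_le_abs_re_add_abs_im _).trans ?_
  have e1 : (fx D x y - z).re = (x - D * z.re) / D := by
    rw [Complex.sub_re, fx_re]; field_simp
  have e2 : (fx D x y - z).im = (y - D * z.im) / D := by
    rw [Complex.sub_im, fx_im]; field_simp
  rw [e1, e2, abs_div, abs_div, abs_of_pos hD, ← add_div]
  gcongr
  linarith

/-- One integer division per coordinate loses at most one unit 1/D in each of the real and imaginary
parts. -/
theorem norm_fx_div_sub_le {D : ℝ} (hD : 0 < D) {x y b : ℤ} (hb : 0 < b) {z : ℂ}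
    (hx : (x : ℝ) = b * D * z.re) (hy : (y : ℝ) = b * D * z.im) :
    ‖fx D (x / b) (y / b) - z‖ ≤ 2 / D := by
  have hb' : (0 : ℝ) < b := by exact_mod_cast hb
  have h1 := abs_intDiv_sub_le x hb
  have h2 := abs_intDiv_sub_le y hb
  rw [hx, mul_assoc, mul_div_cancel_left₀ _ hb'.ne'] at h1
  rw [hy, mul_assoc, mul_div_cancel_left₀ _ hb'.ne'] at h2
  simpa using norm_fx_sub_le hD h1 h2

variable {P : Par} {s : State}

/-- The matrix whose real and imaginary parts are in the arrays `a` and `a + 1`, with scale `D`. -/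
noncomputable def mat (P : Par) (s : State) (a : ℕ) (D : ℝ) : Matrix (Fin P.d) (Fin P.d) ℂ :=
  fun i j => fx D (s.mem a i j 0) (s.mem (a + 1) i j 0)

theorem mat_congr {s' : State} {a : ℕ} {D : ℝ} (h : s'.mem a = s.mem a)
    (h' : s'.mem (a + 1) = s.mem (a + 1)) : mat P s' a D = mat P s a D := by
  funext i j; rw [mat, mat, h, h']

/-- Replaces the matrix in the arrays `10` and `11` by its square. -/
def sqStep : Cmd :=
  .seq (pm 12 .dim .dim .dim (.load 10 ix1 ix3 0 * .load 10 ix3 ix2 0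
    - .load 11 ix1 ix3 0 * .load 11 ix3 ix2 0)) <|
  .seq (pm 13 .dim .dim .dim (.load 10 ix1 ix3 0 * .load 11 ix3 ix2 0
    + .load 11 ix1 ix3 0 * .load 10 ix3 ix2 0)) <|
  .seq (treeSum 12 .dim .dim) <|
  .seq (treeSum 13 .dim .dim) <|
  .seq (pm 10 .dim .dim .one (.load 12 ix1 ix2 0 / .reg 15)) <|
  pm 11 .dim .dim .one (.load 13 ix1 ix2 0 / .reg 15)

theorem cheap_sqStep : Cheap sqStep :=
  (Cheap.pm (by simp) rfl).seq <| (Cheap.pm (by simp) rfl).seq <|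
  (Cheap.treeSum (by norm_num) _ _).seq <| (Cheap.treeSum (by norm_num) _ _).seq <|
  (Cheap.pm (by simp) rfl).seq (Cheap.pm (by simp) rfl)

/-- The size condition keeps products and row sums below `cap`, so that no clamp is felt. Dividing
by the scale after the summation leaves a single rounding per entry. -/
theorem sqStep_mem (hP : P.Ok) (h : Inv P s) {K : ℤ}
    (hK : ∀ i j : ℕ, i < P.d → j < P.d → |s.mem 10 i j 0| ≤ K ∧ |s.mem 11 i j 0| ≤ K)
    (hcap : 2 * P.d * K ^ 2 < P.cap) :
    (∀ i j : ℕ, i < P.d → j < P.d →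
      (sqStep.run s).state.mem 10 i j 0 = (∑ k ∈ Finset.range P.d,
        (s.mem 10 i k 0 * s.mem 10 k j 0 - s.mem 11 i k 0 * s.mem 11 k j 0)) / P.scale ∧
      (sqStep.run s).state.mem 11 i j 0 = (∑ k ∈ Finset.range P.d,
        (s.mem 10 i k 0 * s.mem 11 k j 0 + s.mem 11 i k 0 * s.mem 10 k j 0)) / P.scale) ∧
    ∀ a, a ≠ 10 → a ≠ 11 → a ≠ 12 → a ≠ 13 → (sqStep.run s).state.mem a = s.mem a := by
  have c1 : Cheap (pm 12 .dim .dim .dim (.load 10 ix1 ix3 0 * .load 10 ix3 ix2 0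
    - .load 11 ix1 ix3 0 * .load 11 ix3 ix2 0)) := Cheap.pm (by simp) rfl
  have c2 : Cheap (pm 13 .dim .dim .dim (.load 10 ix1 ix3 0 * .load 11 ix3 ix2 0
    + .load 11 ix1 ix3 0 * .load 10 ix3 ix2 0)) := Cheap.pm (by simp) rfl
  have c3 : Cheap (treeSum 12 .dim .dim) := Cheap.treeSum (by norm_num) _ _
  have c4 : Cheap (treeSum 13 .dim .dim) := Cheap.treeSum (by norm_num) _ _
  have c5 : Cheap (pm 10 .dim .dim .one (.load 12 ix1 ix2 0 / .reg 15)) := Cheap.pm (by simp) rfl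
  simp only [sqStep, run_seq_state]
  have i1 := c1.inv hP h
  set s1 := (Cmd.run _ s).state with hs1
  have i2 := c2.inv hP i1
  set s2 := (Cmd.run _ s1).state with hs2
  have i3 := c3.inv hP i2
  have t3 := treeSum_spec hP i2 (a := 12) (by norm_num) (n₁ := .dim) (n₂ := .dim)
  set s3 := (Cmd.run _ s2).state with hs3
  have i4 := c4.inv hP i3
  have t4 := treeSum_spec hP i3 (a := 13) (by norm_num) (n₁ := .dim) (n₂ := .dim)
  set s4 := (Cmd.run _ s3).state with hs4
  have i5 := c5.inv hP i4
  set s5 := (Cmd.run _ s4).state with hs5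
  have hK0 : 0 ≤ K := by
    have := (hK 0 0 hP.d_pos hP.d_pos).1
    exact (abs_nonneg _).trans this
  have f1 : ∀ a, a ≠ 12 → s1.mem a = s.mem a := fun a ha => pm_of_ne h _ _ _ _ ha
  have f2 : ∀ a, a ≠ 13 → s2.mem a = s1.mem a := fun a ha => pm_of_ne i1 _ _ _ _ ha
  have f5 : ∀ a, a ≠ 10 → s5.mem a = s4.mem a := fun a ha => pm_of_ne i4 _ _ _ _ ha
  have prod_le : ∀ {x y : ℤ}, |x| ≤ K → |y| ≤ K → |x * y| ≤ K ^ 2 := fun hx hy => by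
    rw [abs_mul, sq]; exact mul_le_mul hx hy (abs_nonneg _) hK0
  have two_le : 2 * K ^ 2 < P.cap := by
    have : (1 : ℤ) ≤ P.d := by exact_mod_cast hP.d_pos
    nlinarith [sq_nonneg K]
  have sum_le : ∀ f : ℕ → ℤ, (∀ k < P.d, |f k| ≤ 2 * K ^ 2) →
      |∑ k ∈ Finset.range P.d, f k| < P.cap := by
    intro f hf
    refine lt_of_le_of_lt ((Finset.abs_sum_le_sum_abs _ _).trans (Finset.sum_le_sum fun k hk =>
      hf k (Finset.mem_range.1 hk))) ?_
    rw [Finset.sum_const, Finset.card_range, nsmul_eq_mul]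
    linarith
  have b1 : ∀ i j k : ℕ, i < P.d → j < P.d → k < P.d →
      |s.mem 10 i k 0 * s.mem 10 k j 0 - s.mem 11 i k 0 * s.mem 11 k j 0| ≤ 2 * K ^ 2 := by
    intro i j k hi hj hk
    have h1 := prod_le (hK i k hi hk).1 (hK k j hk hj).1
    have h2 := prod_le (hK i k hi hk).2 (hK k j hk hj).2
    exact (abs_sub _ _).trans (by linarith)
  have b2 : ∀ i j k : ℕ, i < P.d → j < P.d → k < P.d →
      |s.mem 10 i k 0 * s.mem 11 k j 0 + s.mem 11 i k 0 * s.mem 10 k j 0| ≤ 2 * K ^ 2 := by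
    intro i j k hi hj hk
    have h1 := prod_le (hK i k hi hk).1 (hK k j hk hj).2
    have h2 := prod_le (hK i k hi hk).2 (hK k j hk hj).1
    exact (abs_add_le _ _).trans (by linarith)
  have v1 : ∀ i j k : ℕ, i < P.d → j < P.d → k < P.d → s1.mem 12 i j k =
      s.mem 10 i k 0 * s.mem 10 k j 0 - s.mem 11 i k 0 * s.mem 11 k j 0 := by
    intro i j k hi hj hk
    rw [hs1, pm_apply h 12 _ hi hj hk]
    exact clamp_eq_self ((b1 i j k hi hj hk).trans_lt two_le)
  have v2 : ∀ i j k : ℕ, i < P.d → j < P.d → k < P.d → s2.mem 13 i j k =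
      s.mem 10 i k 0 * s.mem 11 k j 0 + s.mem 11 i k 0 * s.mem 10 k j 0 := by
    intro i j k hi hj hk
    rw [hs2, pm_apply i1 13 _ hi hj hk]
    simp only [Expr.eval_add, Expr.eval_mul, Expr.eval_load, State.branch_mem]
    rw [f1 10 (by norm_num), f1 11 (by norm_num)]
    exact clamp_eq_self ((b2 i j k hi hj hk).trans_lt two_le)
  have v3 : ∀ i j : ℕ, i < P.d → j < P.d → s4.mem 12 i j 0 = ∑ k ∈ Finset.range P.d,
      (s.mem 10 i k 0 * s.mem 10 k j 0 - s.mem 11 i k 0 * s.mem 11 k j 0) := by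
    intro i j hi hj
    rw [t4.2 12 (by norm_num), t3.1 i j hi hj, f2 12 (by norm_num)]
    rw [Finset.sum_congr rfl fun k hk => v1 i j k hi hj (Finset.mem_range.1 hk)]
    exact clamp_eq_self (sum_le _ fun k hk => b1 i j k hi hj hk)
  have v4 : ∀ i j : ℕ, i < P.d → j < P.d → s4.mem 13 i j 0 = ∑ k ∈ Finset.range P.d,
      (s.mem 10 i k 0 * s.mem 11 k j 0 + s.mem 11 i k 0 * s.mem 10 k j 0) := by
    intro i j hi hj
    rw [t4.1 i j hi hj, t3.2 13 (by norm_num)]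
    rw [Finset.sum_congr rfl fun k hk => v2 i j k hi hj (Finset.mem_range.1 hk)]
    exact clamp_eq_self (sum_le _ fun k hk => b2 i j k hi hj hk)
  refine ⟨fun i j hi hj => ⟨?_, ?_⟩, fun a h10 h11 h12 h13 => ?_⟩
  · rw [pm_of_ne i5 _ _ _ _ (show 10 ≠ 11 by norm_num), hs5]
    have := pm_apply i4 10 (n₁ := .dim) (n₂ := .dim) (n₃ := .one) (.load 12 ix1 ix2 0 / .reg 15)
      hi hj (k := 0) (by exact Nat.one_pos)
    rw [Nat.cast_zero] at this
    rw [this]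
    have e : Expr.eval (s4.branch i j 0) (.load 12 ix1 ix2 0 / .reg 15)
        = s4.mem 12 i j 0 / P.scale := by
      rw [← i4.r15]; rfl
    rw [e, v3 i j hi hj]
    exact clamp_eq_self ((abs_intDiv_le _ _).trans_lt (sum_le _ fun k hk => b1 i j k hi hj hk))
  · have := pm_apply i5 11 (n₁ := .dim) (n₂ := .dim) (n₃ := .one) (.load 13 ix1 ix2 0 / .reg 15)
      hi hj (k := 0) (by exact Nat.one_pos)
    rw [Nat.cast_zero] at this
    rw [this]
    have e : Expr.eval (s5.branch i j 0) (.load 13 ix1 ix2 0 / .reg 15)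
        = s5.mem 13 i j 0 / P.scale := by
      rw [← i5.r15]; rfl
    rw [e, f5 13 (by norm_num), v4 i j hi hj]
    exact clamp_eq_self ((abs_intDiv_le _ _).trans_lt (sum_le _ fun k hk => b2 i j k hi hj hk))
  · rw [pm_of_ne i5 _ _ _ _ h11, f5 a h10, t4.2 a h13, t3.2 a h12, f2 a h13, f1 a h12]

theorem sqStep_spec (hP : P.Ok) (h : Inv P s) {K : ℝ}
    (hK : ∀ i j, ‖mat P s 10 P.scale i j‖ ≤ K) (hcap : 2 * P.d * (K * P.scale) ^ 2 < P.cap) :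
    (∀ i j, ‖mat P (sqStep.run s).state 10 P.scale i j
      - (mat P s 10 P.scale * mat P s 10 P.scale) i j‖ ≤ 2 / P.scale) ∧
    ∀ a, a ≠ 10 → a ≠ 11 → a ≠ 12 → a ≠ 13 → (sqStep.run s).state.mem a = s.mem a := by
  have hD : (0 : ℝ) < P.scale := by exact_mod_cast P.scale_pos
  have hK0 : 0 ≤ K := (norm_nonneg _).trans (hK ⟨0, hP.d_pos⟩ ⟨0, hP.d_pos⟩)
  have hbound : ∀ i j : ℕ, i < P.d → j < P.d →
      |s.mem 10 i j 0| ≤ ⌊K * P.scale⌋ ∧ |s.mem 11 i j 0| ≤ ⌊K * P.scale⌋ := by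
    intro i j hi hj
    have h1 := hK ⟨i, hi⟩ ⟨j, hj⟩
    constructor
    · rw [Int.le_floor]
      have h2 := (Complex.abs_re_le_norm _).trans h1
      rw [mat, fx_re, abs_div, abs_of_pos hD, div_le_iff₀ hD] at h2
      exact_mod_cast h2
    · rw [Int.le_floor]
      have h2 := (Complex.abs_im_le_norm _).trans h1
      rw [mat, fx_im, abs_div, abs_of_pos hD, div_le_iff₀ hD] at h2
      exact_mod_cast h2
  have hcap' : 2 * (P.d : ℤ) * ⌊K * P.scale⌋ ^ 2 < P.cap := by
    have h1 : (⌊K * P.scale⌋ : ℝ) ≤ K * P.scale := Int.floor_le _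
    have h0 : (0 : ℝ) ≤ ⌊K * P.scale⌋ := by exact_mod_cast Int.floor_nonneg.2 (by positivity)
    have h2 : (2 * P.d * ⌊K * P.scale⌋ ^ 2 : ℝ) ≤ 2 * P.d * (K * P.scale) ^ 2 := by gcongr
    exact_mod_cast h2.trans_lt hcap
  obtain ⟨h1, h2⟩ := sqStep_mem hP h hbound hcap'
  refine ⟨fun i j => ?_, h2⟩
  obtain ⟨e1, e2⟩ := h1 i j i.2 j.2
  have hs : (0 : ℤ) < P.scale := by exact_mod_cast P.scale_pos
  rw [mat, e1, e2]
  refine norm_fx_div_sub_le hD hs ?_ ?_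
  · rw [Matrix.mul_apply, Complex.re_sum, ← Fin.sum_univ_eq_sum_range (fun k => s.mem 10 i k 0 *
      s.mem 10 k j 0 - s.mem 11 i k 0 * s.mem 11 k j 0)]
    push_cast
    rw [Finset.mul_sum]
    refine Finset.sum_congr rfl fun k _ => ?_
    simp only [mat, Complex.mul_re, fx_re, fx_im]
    field_simp
  · rw [Matrix.mul_apply, Complex.im_sum, ← Fin.sum_univ_eq_sum_range (fun k => s.mem 10 i k 0 *
      s.mem 11 k j 0 + s.mem 11 i k 0 * s.mem 10 k j 0)]
    push_cast
    rw [Finset.mul_sum]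
    refine Finset.sum_congr rfl fun k _ => ?_
    simp only [mat, Complex.mul_im, fx_re, fx_im]
    field_simp

end Exponential

/-! ### The matrix exponential by repeated squaring. -/

section Exponential

open scoped Matrix.Norms.L2Operator

/-- The precision of the input and of the internal computations suffices: `n` bounds the
parameters, and the scale of the input is a large power of `n`. -/
structure Par.Fine (P : Par) (n : ℕ) : Prop extends P.Ok where
  d_le' : P.d ≤ n
  M_le' : P.M ≤ n
  W_le' : P.W ≤ n
  E_le' : P.E ≤ n
  n_ge : 8 ≤ n
  sg_eq : P.sg = n ^ 20
  lam_eq : P.lam = 2 ^ (16 * P.T) * P.sg ^ 8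
  l_ge : 16 * P.T + 8 ≤ P.l

variable {P : Par} {s : State} {n : ℕ}

theorem Par.Fine.scale_eq (_ : P.Fine n) : P.scale = 2 ^ (2 * P.l ^ 2) := by
  rw [Par.scale, Par.lam, ← pow_mul]; congr 1; ring

theorem exp_natCast_le (T : ℕ) : Real.exp T ≤ 4 ^ T := by
  rw [← mul_one (T : ℝ), Real.exp_nat_mul]
  gcongr
  linarith [Real.exp_one_lt_d9]

/-- The accuracy of the approximate matrix exponential. -/
noncomputable def Par.expErr (P : Par) : ℝ := (16 ^ P.T * P.T ^ 2 + 1) / P.lam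

/-- A squaring may amplify the error by 2e^T + 2 ≤ 2^l, so l squarings cost at most 2^{l²}. This is
why the scale is 2^{2l²}. -/
theorem Par.Fine.growth_le (hP : P.Fine n) :
    (2 * Real.exp P.T + 2) ^ P.l * (2 * P.d ^ 2 / P.scale) ≤ 1 / P.lam := by
  have h1 : 2 * Real.exp P.T + 2 ≤ 2 ^ P.l := by
    have h2 : 2 * Real.exp P.T + 2 ≤ 4 * 4 ^ P.T := by
      have := exp_natCast_le P.T
      have : (1 : ℝ) ≤ 4 ^ P.T := one_le_pow₀ (by norm_num)
      linarith
    have h3 : (4 : ℝ) * 4 ^ P.T = 2 ^ (2 * P.T + 2) := by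
      rw [pow_add, pow_mul]; norm_num; ring
    rw [h3] at h2
    exact h2.trans (pow_le_pow_right₀ (by norm_num) (by have := hP.l_ge; omega))
  have hd : (P.d : ℝ) ≤ 2 ^ P.l := by exact_mod_cast hP.d_le
  have hs : (P.scale : ℝ) = 2 ^ (2 * P.l ^ 2) := by exact_mod_cast hP.scale_eq
  have hlam : (P.lam : ℝ) = 2 ^ P.l := by rw [Par.lam]; push_cast; rfl
  rw [hs, hlam]
  have h0 : (0 : ℝ) < 2 ^ (2 * P.l ^ 2) := by positivity
  rw [le_div_iff₀ (by positivity), ← mul_div_assoc, div_mul_eq_mul_div, div_le_one h0]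
  calc (2 * Real.exp P.T + 2) ^ P.l * (2 * P.d ^ 2) * 2 ^ P.l
      ≤ (2 ^ P.l) ^ P.l * (2 * (2 ^ P.l) ^ 2) * 2 ^ P.l := by gcongr
    _ = 2 ^ (P.l * P.l + 3 * P.l + 1) := by
        rw [← pow_mul, ← pow_mul, pow_add, pow_add, mul_comm 3, pow_mul _ P.l 3]; ring
    _ ≤ _ := by
        refine pow_le_pow_right₀ (by norm_num) ?_
        have := hP.l_ge
        nlinarith

/-- Two factors of size about e^T · `scale`, summed over d terms, still fit below `cap` = `scale`⁴.
-/
theorem Par.Fine.square_le_cap (hP : P.Fine n) :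
    2 * P.d * ((Real.exp P.T + 1) * P.scale) ^ 2 < P.cap := by
  have hlam : (P.lam : ℝ) = 2 ^ P.l := by rw [Par.lam]; push_cast; rfl
  have h1 : Real.exp P.T + 1 ≤ P.lam := by
    rw [hlam]
    have := exp_natCast_le P.T
    have h1 : (1 : ℝ) ≤ 4 ^ P.T := one_le_pow₀ (by norm_num)
    have h3 : (2 : ℝ) * 4 ^ P.T = 2 ^ (2 * P.T + 1) := by
      rw [pow_add, pow_mul]; norm_num; ring
    have h4 : (2 : ℝ) ^ (2 * P.T + 1) ≤ 2 ^ P.l :=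
      pow_le_pow_right₀ (by norm_num) (by have := hP.l_ge; omega)
    linarith
  have hd : (P.d : ℝ) ≤ P.lam := by exact_mod_cast hP.d_le
  have hs : (P.scale : ℝ) = P.lam ^ (2 * P.l) := by rw [Par.scale]; push_cast; rfl
  have hl2 : (2 : ℝ) ≤ P.lam := by
    rw [hlam]
    calc (2 : ℝ) = 2 ^ 1 := by norm_num
      _ ≤ _ := pow_le_pow_right₀ (by norm_num) hP.l_pos
  have hs5 : (P.lam : ℝ) ^ 5 ≤ P.scale := by
    rw [hs]; exact pow_le_pow_right₀ (by linarith) (by have := hP.l_ge; omega)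
  have hs0 : (0 : ℝ) < P.scale := by exact_mod_cast P.scale_pos
  have hc : (P.cap : ℝ) = P.scale ^ 4 := by rw [Par.cap]; push_cast; rfl
  rw [hc]
  have hl0 : (0 : ℝ) < P.lam := by linarith
  calc (2 * P.d * ((Real.exp P.T + 1) * P.scale) ^ 2 : ℝ)
      ≤ P.lam * P.lam * (P.lam * P.scale) ^ 2 := by gcongr
    _ = (P.lam : ℝ) ^ 4 * 1 * (P.scale : ℝ) ^ 2 := by ring
    _ < (P.lam : ℝ) ^ 4 * P.lam * (P.scale : ℝ) ^ 2 := by gcongr; linarith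
    _ = (P.lam : ℝ) ^ 5 * (P.scale : ℝ) ^ 2 := by ring
    _ ≤ (P.scale : ℝ) * (P.scale : ℝ) ^ 2 := by gcongr
    _ = (P.scale : ℝ) ^ 3 := by ring
    _ ≤ (P.scale : ℝ) ^ 4 := pow_le_pow_right₀ (by exact_mod_cast P.scale_pos) (by norm_num)

/-- The expression that is `1` if `e` and `f` are equal, and `0` otherwise. -/
def eqExpr (e f : Expr) : Expr := 1 / (1 + (e - f) * (e - f))

theorem eval_eqExpr (s : State) (e f : Expr) :
    (eqExpr e f).eval s = if e.eval s = f.eval s then 1 else 0 := by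
  change (1 : ℤ) / (1 + (e.eval s - f.eval s) * (e.eval s - f.eval s)) = _
  split_ifs with h
  · rw [h]; norm_num
  · have : 0 < (e.eval s - f.eval s) * (e.eval s - f.eval s) :=
      mul_self_pos.2 (sub_ne_zero.2 h)
    exact Int.ediv_eq_zero_of_lt (by norm_num) (by omega)

/-- The quotient by which the sum of the losses enters the linear approximation. -/
def divisorExpr : Expr :=
  64 * .reg 3 * .reg 1 * .reg 1 * .reg 2 * .reg 2 * .reg 14 * (2 * .reg 13 * .reg 13)

/-- Computes the matrix exponential of the exponent of the weights. -/
def expCmd : Cmd :=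
  .seq (pm 10 .dim .dim .one (eqExpr ix1 ix2 * .reg 15
    - .load 8 ix1 ix2 0 * .reg 15 / divisorExpr)) <|
  .seq (pm 11 .dim .dim .one (0 - .load 9 ix1 ix2 0 * .reg 15 / divisorExpr)) <|
  .loop 10 (.reg 12) sqStep

theorem cheap_expCmd : Cheap expCmd :=
  (Cheap.pm (by simp) rfl).seq <| (Cheap.pm (by simp) rfl).seq <|
  Cheap.loop (by norm_num) (by norm_num) (by norm_num) cheap_sqStep

/-- The exponent of the weights. -/
noncomputable def exponent (P : Par) (s : State) : Matrix (Fin P.d) (Fin P.d) ℂ :=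
  -((1 / (64 * P.E * P.M ^ 2 * P.W ^ 2) : ℝ) : ℂ) • mat P s 8 (2 * P.sg ^ 2)

/-- The error obeys δ ↦ (‖X‖ + ‖Y‖)δ + r, where r is the rounding of one squaring. With ‖X‖ ≤ e^T +
1 and ‖Y‖ ≤ e^T it grows at most by the factor F per step. -/
theorem sqLoop_spec (hP : P.Fine n) (h : Inv P s) {Z : Matrix (Fin P.d) (Fin P.d) ℂ}
    (hZ : ∀ m ≤ P.l, ‖Z ^ 2 ^ m‖ ≤ Real.exp P.T)
    (h0 : ‖mat P s 10 P.scale - Z‖ ≤ 2 * P.d ^ 2 / P.scale) :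
    ‖mat P ((Cmd.loop 10 (.reg 12) sqStep).run s).state 10 P.scale - Z ^ P.lam‖ ≤ 1 / P.lam ∧
    ∀ a, a ≠ 10 → a ≠ 11 → a ≠ 12 → a ≠ 13 →
      ((Cmd.loop 10 (.reg 12) sqStep).run s).state.mem a = s.mem a := by
  have hOk := hP.toOk
  have hlam1 : (1 : ℝ) ≤ P.lam := by exact_mod_cast P.lam_pos
  have hrun : ((Cmd.loop 10 (.reg 12) sqStep).run s).state = loopState 10 sqStep s P.l := by
    rw [loop_state]
    have : (Expr.reg 12).eval s = P.l := h.r12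
    rw [this, Int.toNat_natCast]
  have hinv : ∀ m ≤ P.l, Inv P (loopState 10 sqStep s m) := fun m hm =>
    h.loopState hOk cheap_sqStep (by norm_num) (by norm_num) P.l_le_lam hm
  have hstep : ∀ m < P.l, Inv P ((loopState 10 sqStep s m).setReg 10 m) := fun m hm =>
    (hinv m hm.le).setReg (by norm_num) (by norm_num)
      (hOk.bits_le_len (hm.le.trans P.l_le_lam))
  set r : ℝ := 2 * P.d ^ 2 / P.scale with hr
  have hr0 : 0 ≤ r := by positivity
  set F : ℝ := 2 * Real.exp P.T + 2 with hF
  have hF1 : 1 ≤ F := by have := Real.exp_pos P.T; linarith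
  have hFr : F ^ P.l * r ≤ 1 / P.lam := hP.growth_le
  have key : ∀ m ≤ P.l, ‖mat P (loopState 10 sqStep s m) 10 P.scale - Z ^ 2 ^ m‖ ≤ F ^ m * r ∧
      ∀ a, a ≠ 10 → a ≠ 11 → a ≠ 12 → a ≠ 13 → (loopState 10 sqStep s m).mem a = s.mem a := by
    intro m
    induction m with
    | zero => intro _; simpa [loopState] using h0
    | succ m ih =>
      intro hm
      obtain ⟨ih1, ih2⟩ := ih (by omega)
      set X := mat P (loopState 10 sqStep s m) 10 P.scale with hX
      set Y := Z ^ 2 ^ m with hY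
      -- The error stays below one throughout, which keeps X bounded by e^T + 1 and thus rules out
      -- clamping in the next squaring.
      have hδ : ‖X - Y‖ ≤ 1 := by
        refine ih1.trans (le_trans ?_ (hFr.trans (div_le_one_of_le₀ hlam1 (by positivity))))
        exact mul_le_mul_of_nonneg_right (pow_le_pow_right₀ hF1 (by omega)) hr0
      have hYn : ‖Y‖ ≤ Real.exp P.T := hZ m (by omega)
      have hXn : ‖X‖ ≤ Real.exp P.T + 1 := by
        have := norm_add_le (X - Y) Y
        rw [sub_add_cancel] at this
        linarith
      have hspec := sqStep_spec hOk (hstep m hm) (K := Real.exp P.T + 1)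
        (fun i j => (norm_entry_le_norm _ i j).trans hXn) hP.square_le_cap
      refine ⟨?_, fun a h10 h11 h12 h13 => (hspec.2 a h10 h11 h12 h13).trans
        (ih2 a h10 h11 h12 h13)⟩
      have e1 : ‖mat P (loopState 10 sqStep s (m + 1)) 10 P.scale - X * X‖ ≤ r := by
        refine (norm_le_of_entry_le hspec.1).trans_eq ?_
        rw [hr]; ring
      have e2 : mat P (loopState 10 sqStep s (m + 1)) 10 P.scale - Z ^ 2 ^ (m + 1)
          = (mat P (loopState 10 sqStep s (m + 1)) 10 P.scale - X * X)
            + (X * (X - Y) + (X - Y) * Y) := by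
        rw [pow_succ 2 m, pow_mul, sq]; noncomm_ring
      rw [e2]
      refine (norm_add_le _ _).trans ?_
      -- F − 1 = 2e^T + 1 bounds ‖X‖ + ‖Y‖; the remaining unit of F absorbs r ≤ F^m r.
      have e3 : ‖X * (X - Y) + (X - Y) * Y‖ ≤ (F - 1) * (F ^ m * r) := by
        refine (norm_add_le _ _).trans ?_
        have h1 := (norm_mul_le X (X - Y)).trans
          (mul_le_mul hXn ih1 (norm_nonneg _) (by positivity))
        have h2 := (norm_mul_le (X - Y) Y).trans
          (mul_le_mul ih1 hYn (norm_nonneg _) (by positivity))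
        rw [hF]; linarith
      have e4 : r ≤ F ^ m * r := le_mul_of_one_le_left hr0 (one_le_pow₀ hF1)
      rw [pow_succ]
      linarith
  rw [hrun]
  refine ⟨?_, (key _ le_rfl).2⟩
  exact (key P.l le_rfl).1.trans hFr

/-- Two errors add up: (1 + A/λ)^λ misses exp A by at most e^{2T}T²/λ ≤ 16^T T²/λ, and the squarings
contribute at most 1/λ by rounding. -/
theorem expCmd_spec (hP : P.Fine n) (h : Inv P s) (hA : ‖exponent P s‖ ≤ P.T) :
    ‖mat P (expCmd.run s).state 10 P.scale - NormedSpace.exp (exponent P s)‖ ≤ P.expErr ∧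
    ∀ a, a ≠ 10 → a ≠ 11 → a ≠ 12 → a ≠ 13 → (expCmd.run s).state.mem a = s.mem a := by
  have hOk := hP.toOk
  have hs0 : (0 : ℝ) < P.scale := by exact_mod_cast P.scale_pos
  have hlam0 : (0 : ℝ) < P.lam := by exact_mod_cast P.lam_pos
  have hTlam : (P.T : ℝ) ≤ P.lam := by exact_mod_cast hP.T_le
  have : Nonempty (Fin P.d) := ⟨⟨0, hP.d_pos⟩⟩
  set A := exponent P s with hAdef
  -- The coefficient 64EM²W² of the exponent, the factor λ from A/λ, and the scale 2 sg² of the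
  -- accumulated losses.
  set D : ℤ := 64 * P.E * P.M * P.M * P.W * P.W * P.lam * (2 * P.sg * P.sg) with hD
  have hD0 : 0 < D := by
    have := hP.E_pos; have := hP.M_pos; have := hP.W_pos; have := hP.sg_pos; have := P.lam_pos
    positivity
  have hDr : (0 : ℝ) < D := by exact_mod_cast hD0
  have hDeval : ∀ s' : State, Inv P s' → ∀ i j k, divisorExpr.eval (s'.branch i j k) = D := by
    intro s' hs' i j k
    have b := fun x hx => State.branch_reg s' i j k (x := x) hx
    simp only [divisorExpr, Expr.eval_mul, Expr.eval_reg, b 3 (by decide), b 1 (by decide),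
      b 2 (by decide), b 14 (by decide), b 13 (by decide), hs'.r1, hs'.r2, hs'.r3, hs'.r13,
      hs'.r14]
    rfl
  have hentry : ∀ i j : Fin P.d, (A i j).re = -(s.mem 8 i j 0 * P.lam / D) ∧
      (A i j).im = -(s.mem 9 i j 0 * P.lam / D) := by
    intro i j
    have hE : (P.E : ℝ) ≠ 0 := by have := hP.E_pos; positivity
    have hM : (P.M : ℝ) ≠ 0 := by have := hP.M_pos; positivity
    have hW : (P.W : ℝ) ≠ 0 := by have := hP.W_pos; positivity
    have hsg : (P.sg : ℝ) ≠ 0 := by have := hP.sg_pos; positivity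
    have e : A i j = ((-(1 / (64 * P.E * P.M ^ 2 * P.W ^ 2)) : ℝ) : ℂ)
        * fx (2 * P.sg ^ 2) (s.mem 8 i j 0) (s.mem 9 i j 0) := by
      rw [hAdef, exponent, Complex.ofReal_neg]; rfl
    rw [e, Complex.re_ofReal_mul, Complex.im_ofReal_mul, hD]
    push_cast
    constructor
    · rw [fx_re]; field_simp
    · rw [fx_im]; field_simp
  -- Entries of A are at most T ≤ λ, so those of A/λ are at most one, i.e. at most `scale` in fixed
  -- point.
  have hquot : ∀ i j : Fin P.d, ∀ x : ℤ, |(x : ℝ) * P.lam / D| ≤ P.T →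
      |x * P.scale / D| ≤ P.scale := by
    intro i j x hx
    rw [Int.abs_eq_natAbs]
    have h1 := abs_intDiv_le (x * P.scale) D
    have h2 : |(x : ℝ) * P.scale / D| ≤ P.scale := by
      have e : (x : ℝ) * P.scale / D = x * P.lam / D * (P.scale / P.lam) := by field_simp
      rw [e, abs_mul, abs_of_pos (show (0 : ℝ) < P.scale / P.lam by positivity)]
      calc _ ≤ (P.T : ℝ) * (P.scale / P.lam) := by gcongr
        _ ≤ P.lam * (P.scale / P.lam) := by gcongr
        _ = _ := by field_simp
    rw [abs_div, abs_of_pos hDr, div_le_iff₀ hDr] at h2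
    have h3 : |x * P.scale| ≤ P.scale * D := by exact_mod_cast h2
    rw [← Int.abs_eq_natAbs, abs_le]
    rw [abs_le] at h3
    constructor
    · exact Int.le_ediv_of_mul_le hD0 (by linarith)
    · exact Int.ediv_le_of_le_mul hD0 (by linarith)
  have hcapsc : 2 * (P.scale : ℤ) < P.cap := by
    have h2 : 2 ≤ P.scale := by
      calc 2 = 2 ^ 1 := rfl
        _ ≤ P.lam := Nat.pow_le_pow_right (by norm_num) hP.l_pos
        _ ≤ P.scale := hOk.lam_le_scale
    have : 2 * P.scale < P.cap := by
      rw [Par.cap]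
      calc 2 * P.scale ≤ P.scale * P.scale := Nat.mul_le_mul_right _ h2
        _ = P.scale ^ 2 := by ring
        _ < P.scale ^ 4 := Nat.pow_lt_pow_right (by omega) (by norm_num)
    exact_mod_cast this
  have c1 : Cheap (pm 10 .dim .dim .one (eqExpr ix1 ix2 * .reg 15
    - .load 8 ix1 ix2 0 * .reg 15 / divisorExpr)) := Cheap.pm (by simp) rfl
  have c2 : Cheap (pm 11 .dim .dim .one (0 - .load 9 ix1 ix2 0 * .reg 15 / divisorExpr)) :=
    Cheap.pm (by simp) rfl
  simp only [expCmd, run_seq_state]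
  have i1 := c1.inv hOk h
  have v1 : ∀ i j : Fin P.d, (Cmd.run (pm 10 .dim .dim .one (eqExpr ix1 ix2 * .reg 15
      - .load 8 ix1 ix2 0 * .reg 15 / divisorExpr)) s).state.mem 10 i j 0
      = (if i = j then (P.scale : ℤ) else 0) - s.mem 8 i j 0 * P.scale / D := by
    intro i j
    have := pm_apply h 10 (n₁ := .dim) (n₂ := .dim) (n₃ := .one) (eqExpr ix1 ix2 * .reg 15
      - .load 8 ix1 ix2 0 * .reg 15 / divisorExpr) i.2 j.2 (k := 0) (by exact Nat.one_pos)
    rw [Nat.cast_zero] at this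
    rw [this]
    simp only [Expr.eval_sub, Expr.eval_mul, Expr.eval_div, hDeval s h, eval_eqExpr,
      Expr.eval_load, Expr.eval_reg, State.branch_mem, State.branch_reg4, State.branch_reg5,
      State.branch_reg s _ _ _ (show 15 ≠ 4 ∧ _ by decide), h.r15]
    have e0 : (OfNat.ofNat 0 : Expr).eval (s.branch i j 0) = 0 := rfl
    rw [e0]
    have hq := hquot i j (s.mem 8 i j 0) (by
      have := (Complex.abs_re_le_norm _).trans ((norm_entry_le_norm A i j).trans hA)
      rwa [(hentry i j).1, abs_neg] at this)
    rw [abs_le] at hq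
    have hij : ((i : ℕ) : ℤ) = ((j : ℕ) : ℤ) ↔ i = j := by rw [Nat.cast_inj, Fin.ext_iff]
    simp only [hij]
    rw [clamp_eq_self]
    · split_ifs <;> ring
    · rw [abs_lt]; split_ifs <;> constructor <;> linarith
  have f1 : ∀ a, a ≠ 10 → _ := fun a ha => pm_of_ne (a' := a) h .dim .dim .one (eqExpr ix1 ix2 * .reg 15
      - .load 8 ix1 ix2 0 * .reg 15 / divisorExpr) ha
  set s1 := (Cmd.run _ s).state with hs1
  have i2 := c2.inv hOk i1
  have v2 : ∀ i j : Fin P.d, (Cmd.run (pm 11 .dim .dim .one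
      (0 - .load 9 ix1 ix2 0 * .reg 15 / divisorExpr)) s1).state.mem 11 i j 0
      = 0 - s.mem 9 i j 0 * P.scale / D := by
    intro i j
    have := pm_apply i1 11 (n₁ := .dim) (n₂ := .dim) (n₃ := .one)
      (0 - .load 9 ix1 ix2 0 * .reg 15 / divisorExpr) i.2 j.2 (k := 0) (by exact Nat.one_pos)
    rw [Nat.cast_zero] at this
    rw [this]
    simp only [Expr.eval_sub, Expr.eval_mul, Expr.eval_div, hDeval s1 i1,
      Expr.eval_load, Expr.eval_reg, State.branch_mem, State.branch_reg4, State.branch_reg5,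
      State.branch_reg s1 _ _ _ (show 15 ≠ 4 ∧ _ by decide), i1.r15, f1 9 (by norm_num)]
    have e0 : (OfNat.ofNat 0 : Expr).eval (s1.branch i j 0) = 0 := rfl
    rw [e0]
    have hq := hquot i j (s.mem 9 i j 0) (by
      have := (Complex.abs_im_le_norm _).trans ((norm_entry_le_norm A i j).trans hA)
      rwa [(hentry i j).2, abs_neg] at this)
    rw [abs_le] at hq
    rw [clamp_eq_self]
    rw [abs_lt]; constructor <;> linarith
  have f2 : ∀ a, a ≠ 11 → _ := fun a ha => pm_of_ne (a' := a) i1 .dim .dim .one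
      (0 - .load 9 ix1 ix2 0 * .reg 15 / divisorExpr) ha
  set s2 := (Cmd.run _ s1).state with hs2
  set Z : Matrix (Fin P.d) (Fin P.d) ℂ := 1 + (P.lam : ℝ)⁻¹ • A with hZ
  have hZn : ‖Z‖ ≤ 1 + P.T / P.lam := by
    refine (norm_add_le _ _).trans ?_
    rw [norm_one, norm_smul, Real.norm_of_nonneg (by positivity), inv_mul_eq_div]
    gcongr
  -- All intermediate powers are controlled by the last one, (1 + T/λ)^λ ≤ e^T.
  have hZpow : ∀ m ≤ P.l, ‖Z ^ 2 ^ m‖ ≤ Real.exp P.T := by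
    intro m hm
    calc ‖Z ^ 2 ^ m‖ ≤ (1 + P.T / P.lam) ^ 2 ^ m :=
          (norm_pow_le _ _).trans (pow_le_pow_left₀ (norm_nonneg _) hZn _)
      _ ≤ (1 + P.T / P.lam) ^ P.lam := pow_le_pow_right₀ (by
          have : (0 : ℝ) ≤ P.T / P.lam := by positivity
          linarith) (Nat.pow_le_pow_right (by norm_num) hm)
      _ ≤ Real.exp (P.T / P.lam) ^ P.lam := by
          gcongr
          rw [add_comm]; exact Real.add_one_le_exp _
      _ = Real.exp P.T := by
          rw [← Real.exp_nat_mul]; congr 1; field_simp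
  have h0 : ‖mat P s2 10 P.scale - Z‖ ≤ 2 * P.d ^ 2 / P.scale := by
    refine (norm_le_of_entry_le (c := 2 / P.scale) fun i j => ?_).trans_eq (by ring)
    rw [Matrix.sub_apply, mat]
    have e1 : ∀ x : ℤ, ((P.scale : ℝ) * -((P.lam : ℝ)⁻¹ * (x * P.lam / D)))
        = -(((x * P.scale : ℤ) : ℝ) / D) := by
      intro x; push_cast; field_simp
    have hzre : (Z i j).re = (if i = j then 1 else 0) + (P.lam : ℝ)⁻¹ * (A i j).re := by
      rw [hZ, Matrix.add_apply, Matrix.smul_apply, Matrix.one_apply, Complex.add_re,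
        Complex.smul_re, smul_eq_mul]
      split_ifs <;> simp
    have hzim : (Z i j).im = (P.lam : ℝ)⁻¹ * (A i j).im := by
      rw [hZ, Matrix.add_apply, Matrix.smul_apply, Matrix.one_apply, Complex.add_im,
        Complex.smul_im, smul_eq_mul]
      split_ifs <;> simp
    have := norm_fx_sub_le hs0 (x := s2.mem 10 i j 0) (y := s2.mem 11 i j 0) (z := Z i j) (c := 1)
      ?_ ?_
    · rwa [mul_one] at this
    · rw [hs2, f2 10 (by norm_num), v1, hzre, (hentry i j).1, mul_add, mul_neg, e1]
      have := abs_intDiv_sub_le (s.mem 8 i j 0 * P.scale) hD0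
      rw [abs_sub_comm] at this
      refine le_trans (le_of_eq ?_) this
      congr 1
      rw [Int.cast_sub]
      split_ifs
      · rw [Int.cast_natCast]; ring
      · rw [Int.cast_zero]; ring
    · rw [v2, hzim, (hentry i j).2, mul_neg, e1]
      have := abs_intDiv_sub_le (s.mem 9 i j 0 * P.scale) hD0
      rw [abs_sub_comm] at this
      refine le_trans (le_of_eq ?_) this
      congr 1
      rw [Int.cast_sub, Int.cast_zero]
      ring
  obtain ⟨r1, r2⟩ := sqLoop_spec hP i2 hZpow h0
  refine ⟨?_, fun a h10 h11 h12 h13 => ?_⟩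
  · have h5 := norm_one_add_pow_sub_exp_le (x := A) P.lam_pos (hA.trans hTlam)
    have h6 : Real.exp ‖A‖ ^ 2 * ‖A‖ ^ 2 / P.lam ≤ 16 ^ P.T * P.T ^ 2 / P.lam := by
      have : Real.exp ‖A‖ ≤ 4 ^ P.T := (Real.exp_le_exp.2 hA).trans (exp_natCast_le _)
      have e16 : (16 : ℝ) ^ P.T = (4 ^ P.T) ^ 2 := by rw [← pow_mul, mul_comm, pow_mul]; norm_num
      rw [e16]
      gcongr
    rw [Par.expErr, add_div]
    refine (norm_sub_le_norm_sub_add_norm_sub _ (Z ^ P.lam) _).trans ?_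
    linarith
  · rw [r2 a h10 h11 h12 h13, f2 a h11, f1 a h10]

end Exponential

/-! ### Normalisation to trace one. -/

section GibbsState

open scoped Matrix.Norms.L2Operator

variable {P : Par} {s : State} {n : ℕ}

theorem pm_apply_zero (h : Inv P s) (a : ℕ) {n₁ n₂ : Dim} (e : Expr) {i j : ℕ}
    (hi : i < n₁.size P) (hj : j < n₂.size P) :
    ((pm a n₁ n₂ .one e).run s).state.mem a i j 0 = clamp P.cap (e.eval (s.branch i j 0)) := by
  have := pm_apply h a e hi hj (n₃ := .one) (k := 0) Nat.one_pos
  rwa [Nat.cast_zero] at this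

/-- For ρ = B*B the columns of B have norm at most one, and an entry of ρ is an inner product of two
columns. -/
theorem norm_density_entry_le {ρ : Matrix (Fin P.d) (Fin P.d) ℂ} (hρ : IsDensity ρ)
    (i j : Fin P.d) : ‖ρ i j‖ ≤ 1 := by
  obtain ⟨B, rfl⟩ := PosSemidef.exists_eq_conjTranspose_mul_self hρ.1
  have hcol : ∀ i, ∑ k, ‖B k i‖ ^ 2 ≤ 1 := by
    have h1 : ∑ i, ∑ k, ‖B k i‖ ^ 2 = 1 := by
      have h2 := hρ.2
      simp only [Matrix.trace, Matrix.diag_apply, Matrix.mul_apply, Matrix.conjTranspose_apply] at h2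
      have h3 : ∀ i k, star (B k i) * B k i = ((‖B k i‖ ^ 2 : ℝ) : ℂ) := fun i k => by
        push_cast; rw [← Complex.conj_mul']; rfl
      simp only [h3] at h2
      exact_mod_cast h2
    intro i
    rw [← h1]
    exact Finset.single_le_sum (f := fun i => ∑ k, ‖B k i‖ ^ 2)
      (fun i _ => Finset.sum_nonneg fun k _ => by positivity) (Finset.mem_univ i)
  rw [Matrix.mul_apply]
  refine (norm_sum_le _ _).trans ?_
  have : ∀ k, ‖Bᴴ i k * B k j‖ ≤ 1 / 2 * ‖B k i‖ ^ 2 + 1 / 2 * ‖B k j‖ ^ 2 := fun k => by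
    rw [norm_mul, Matrix.conjTranspose_apply, norm_star]
    nlinarith [sq_nonneg (‖B k i‖ - ‖B k j‖)]
  refine (Finset.sum_le_sum fun k _ => this k).trans ?_
  rw [Finset.sum_add_distrib, ← Finset.mul_sum, ← Finset.mul_sum]
  linarith [hcol i, hcol j]

/-- Normalizes the matrix exponential to trace one. -/
def rhoCmd : Cmd :=
  .seq (pm 12 .one .one .dim (.load 10 ix3 ix3 0)) <|
  .seq (treeSum 12 .one .one) <|
  .seq (pm 14 .dim .dim .one (.load 10 ix1 ix2 0 * .reg 13 / .load 12 0 0 0)) <|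
  pm 15 .dim .dim .one (.load 11 ix1 ix2 0 * .reg 13 / .load 12 0 0 0)

theorem cheap_rhoCmd : Cheap rhoCmd :=
  (Cheap.pm (by simp) rfl).seq <| (Cheap.treeSum (by norm_num) _ _).seq <|
  (Cheap.pm (by simp) rfl).seq (Cheap.pm (by simp) rfl)

theorem Par.Fine.n_le_sg (hP : P.Fine n) : n ≤ P.sg := by
  rw [hP.sg_eq]; exact Nat.le_self_pow (by norm_num) _

theorem Par.Fine.eight_le_sg (hP : P.Fine n) : 8 ≤ P.sg := hP.n_ge.trans hP.n_le_sg

theorem Par.Fine.sg_pow_le_lam (hP : P.Fine n) : P.sg ^ 8 ≤ P.lam := by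
  rw [hP.lam_eq]; exact Nat.le_mul_of_pos_left _ (by positivity)

theorem Par.Fine.lam_pow_le_scale (hP : P.Fine n) : P.lam ^ 16 ≤ P.scale := by
  rw [Par.scale]; exact Nat.pow_le_pow_right P.lam_pos (by have := hP.l_ge; omega)

theorem sq_le_four_pow (T : ℕ) : T ^ 2 ≤ 4 ^ T := by
  have : T ≤ 2 ^ T := Nat.lt_two_pow_self.le
  calc T ^ 2 ≤ (2 ^ T) ^ 2 := Nat.pow_le_pow_left this 2
    _ = 4 ^ T := by rw [← pow_mul, mul_comm, pow_mul]; norm_num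

/-- The factor 2^{16T} = 65536^T in λ beats the 64^T of the numerator. The remaining 1024^T pays for
the division by a trace that may be as small as 4^{-T}. -/
theorem Par.Fine.expErr_le (hP : P.Fine n) : P.expErr ≤ 2 / (1024 ^ P.T * P.sg ^ 8) := by
  have h1 : (P.lam : ℝ) = 65536 ^ P.T * P.sg ^ 8 := by
    rw [hP.lam_eq]; push_cast; rw [pow_mul]; norm_num
  have h2 : (16 : ℝ) ^ P.T * P.T ^ 2 + 1 ≤ 2 * 64 ^ P.T := by
    have h3 : (P.T : ℝ) ^ 2 ≤ 4 ^ P.T := by exact_mod_cast sq_le_four_pow P.T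
    have h4 : (16 : ℝ) ^ P.T * 4 ^ P.T = 64 ^ P.T := by rw [← mul_pow]; norm_num
    have h5 : (1 : ℝ) ≤ 64 ^ P.T := one_le_pow₀ (by norm_num)
    have h6 : (16 : ℝ) ^ P.T * P.T ^ 2 ≤ 16 ^ P.T * 4 ^ P.T := by gcongr
    linarith
  have hsg : (0 : ℝ) < P.sg := by exact_mod_cast hP.sg_pos
  rw [Par.expErr, h1, div_le_div_iff₀ (by positivity) (by positivity)]
  have h7 : (65536 : ℝ) ^ P.T = 64 ^ P.T * 1024 ^ P.T := by rw [← mul_pow]; norm_num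
  rw [h7]
  calc _ ≤ (2 * 64 ^ P.T) * (1024 ^ P.T * P.sg ^ 8 : ℝ) := by gcongr
    _ = _ := by ring

theorem rhoCmd_mem (hP : P.Fine n) (h : Inv P s)
    (hK : ∀ i j : ℕ, i < P.d → j < P.d → |s.mem 10 i j 0| ≤ P.lam * P.scale ∧
      |s.mem 11 i j 0| ≤ P.lam * P.scale) :
    (∀ i j : ℕ, i < P.d → j < P.d →
      (rhoCmd.run s).state.mem 14 i j 0
        = s.mem 10 i j 0 * P.sg / ∑ k ∈ Finset.range P.d, s.mem 10 k k 0 ∧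
      (rhoCmd.run s).state.mem 15 i j 0
        = s.mem 11 i j 0 * P.sg / ∑ k ∈ Finset.range P.d, s.mem 10 k k 0) ∧
    ∀ a, a ≠ 12 → a ≠ 14 → a ≠ 15 → (rhoCmd.run s).state.mem a = s.mem a := by
  have hOk := hP.toOk
  have c1 : Cheap (pm 12 .one .one .dim (.load 10 ix3 ix3 0)) := Cheap.pm (by simp) rfl
  have c2 : Cheap (treeSum 12 .one .one) := Cheap.treeSum (by norm_num) _ _
  have c3 : Cheap (pm 14 .dim .dim .one (.load 10 ix1 ix2 0 * .reg 13 / .load 12 0 0 0)) :=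
    Cheap.pm (by simp) rfl
  have hl3 : (P.lam : ℤ) ^ 3 * P.scale ≤ P.cap := by
    have h1 := hP.lam_pow_le_scale
    have h2 : P.lam ^ 3 ≤ P.lam ^ 16 := Nat.pow_le_pow_right P.lam_pos (by norm_num)
    have : P.lam ^ 3 * P.scale ≤ P.cap := by
      calc _ ≤ P.scale * P.scale := Nat.mul_le_mul_right _ (h2.trans h1)
        _ = P.scale ^ 2 := by ring
        _ ≤ _ := Nat.pow_le_pow_right P.scale_pos (by norm_num)
    exact_mod_cast this
  have hlam2 : (2 : ℤ) ≤ P.lam := by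
    have : 2 ^ 1 ≤ P.lam := Nat.pow_le_pow_right (by norm_num) hP.l_pos
    exact_mod_cast this
  have hsc : (1 : ℤ) ≤ P.scale := by exact_mod_cast P.scale_pos
  have hd : (P.d : ℤ) ≤ P.lam := by exact_mod_cast hP.d_le
  have hsg : (P.sg : ℤ) ≤ P.lam := by exact_mod_cast hP.sg_le
  have hlt : (P.lam : ℤ) * (P.lam * P.scale) < P.cap := by
    have h1 : (0 : ℤ) < P.lam * (P.lam * P.scale) := by positivity
    calc (P.lam : ℤ) * (P.lam * P.scale) < 2 * (P.lam * (P.lam * P.scale)) := by omega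
      _ ≤ P.lam * (P.lam * (P.lam * P.scale)) := by gcongr
      _ = P.lam ^ 3 * P.scale := by ring
      _ ≤ _ := hl3
  have b1 : (P.lam : ℤ) * P.scale < P.cap := by
    refine lt_of_le_of_lt ?_ hlt
    exact le_mul_of_one_le_left (by positivity) (by omega)
  simp only [rhoCmd, run_seq_state]
  have i1 := c1.inv hOk h
  have v1 : ∀ k : ℕ, k < P.d → (Cmd.run (pm 12 .one .one .dim (.load 10 ix3 ix3 0)) s).state.mem
      12 ((0 : ℕ) : ℤ) ((0 : ℕ) : ℤ) k = s.mem 10 k k 0 := fun k hk => by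
    rw [pm_apply h 12 (n₁ := .one) (n₂ := .one) (n₃ := .dim) _ Nat.one_pos Nat.one_pos hk]
    exact clamp_eq_self ((hK k k hk hk).1.trans_lt b1)
  have f1 : ∀ a, a ≠ 12 → _ := fun a ha =>
    pm_of_ne (a' := a) h .one .one .dim (.load 10 ix3 ix3 0) ha
  set s1 := (Cmd.run _ s).state with hs1
  have i2 := c2.inv hOk i1
  have t2 := treeSum_spec hOk i1 (a := 12) (by norm_num) (n₁ := .one) (n₂ := .one)
  have v2 : (Cmd.run (treeSum 12 .one .one) s1).state.mem 12 0 0 0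
      = ∑ k ∈ Finset.range P.d, s.mem 10 k k 0 := by
    have := t2.1 0 0 Nat.one_pos Nat.one_pos
    rw [Finset.sum_congr rfl fun k hk => v1 k (Finset.mem_range.1 hk)] at this
    rw [Nat.cast_zero] at this
    rw [this]
    refine clamp_eq_self (lt_of_le_of_lt ((Finset.abs_sum_le_sum_abs _ _).trans
      (Finset.sum_le_sum fun k hk => (hK k k (Finset.mem_range.1 hk) (Finset.mem_range.1 hk)).1))
      (lt_of_le_of_lt ?_ hlt))
    rw [Finset.sum_const, Finset.card_range, nsmul_eq_mul]
    gcongr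
  set s2 := (Cmd.run _ s1).state with hs2
  have i3 := c3.inv hOk i2
  have f3 : ∀ a, a ≠ 14 → _ := fun a ha =>
    pm_of_ne (a' := a) i2 .dim .dim .one (.load 10 ix1 ix2 0 * .reg 13 / .load 12 0 0 0) ha
  set s3 := (Cmd.run _ s2).state with hs3
  have hb : ∀ x t : ℤ, |x| ≤ P.lam * P.scale → |x * P.sg / t| < P.cap := fun x t hx => by
    refine (abs_intDiv_le _ _).trans_lt (lt_of_le_of_lt ?_ hlt)
    rw [abs_mul, Nat.abs_cast, mul_comm]
    gcongr
  refine ⟨fun i j hi hj => ⟨?_, ?_⟩, fun a h12 h14 h15 => ?_⟩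
  · rw [pm_of_ne i3 _ _ _ _ (by norm_num), pm_apply_zero i2 14 (n₁ := .dim) (n₂ := .dim) _ hi hj]
    have e : Expr.eval (s2.branch i j 0) (.load 10 ix1 ix2 0 * .reg 13 / .load 12 0 0 0)
        = s2.mem 10 i j 0 * s2.reg 13 / s2.mem 12 0 0 0 := rfl
    rw [e, i2.r13, v2, hs2, t2.2 10 (by norm_num), f1 10 (by norm_num)]
    exact clamp_eq_self (hb _ _ (hK i j hi hj).1)
  · rw [pm_apply_zero i3 15 (n₁ := .dim) (n₂ := .dim) _ hi hj]
    change clamp _ (s3.mem 11 i j 0 * s3.reg 13 / s3.mem 12 0 0 0) = _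
    rw [i3.r13, f3 12 (by norm_num), v2, f3 11 (by norm_num), hs2, t2.2 11 (by norm_num),
      f1 11 (by norm_num)]
    exact clamp_eq_self (hb _ _ (hK i j hi hj).2)
  · rw [pm_of_ne i3 _ _ _ _ h15, f3 a h14, hs2, t2.2 a h12, f1 a h12]

/-- The integer division contributes 2/sg, and the error of the exponential, magnified by the
reciprocal of the trace, at most 1/sg. -/
theorem rhoCmd_spec (hP : P.Fine n) (h : Inv P s) {A : Matrix (Fin P.d) (Fin P.d) ℂ}
    (hA : A.IsHermitian) (hAn : ‖A‖ ≤ P.T)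
    (hX : ‖mat P s 10 P.scale - NormedSpace.exp A‖ ≤ P.expErr) :
    (∀ i j, ‖mat P (rhoCmd.run s).state 14 P.sg i j - gibbs A i j‖ ≤ 3 / P.sg) ∧
    ∀ a, a ≠ 12 → a ≠ 14 → a ≠ 15 → (rhoCmd.run s).state.mem a = s.mem a := by
  have hd1 : (1 : ℝ) ≤ P.d := by exact_mod_cast hP.d_pos
  have hsc0 : (0 : ℝ) < P.scale := by exact_mod_cast P.scale_pos
  have hsg8 : (8 : ℝ) ≤ P.sg := by exact_mod_cast hP.eight_le_sg
  have hsg0 : (0 : ℝ) < P.sg := by linarith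
  have hdsg : (P.d : ℝ) ≤ P.sg := by exact_mod_cast hP.d_le'.trans hP.n_le_sg
  have : Nonempty (Fin P.d) := ⟨⟨0, hP.d_pos⟩⟩
  set X := mat P s 10 P.scale with hXdef
  set G := NormedSpace.exp A with hG
  set θ := P.expErr with hθdef
  have hθ0 : 0 ≤ θ := (norm_nonneg _).trans hX
  have hθ := hP.expErr_le
  rw [← hθdef] at hθ
  have hsg8' : (P.sg : ℝ) ^ 2 ≤ P.sg ^ 8 := pow_le_pow_right₀ (by linarith) (by norm_num)
  have hsgd : 8 * (P.d : ℝ) ≤ P.sg ^ 8 / P.sg := by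
    rw [le_div_iff₀ hsg0]
    have : (P.sg : ℝ) ^ 3 ≤ P.sg ^ 8 := pow_le_pow_right₀ (by linarith) (by norm_num)
    calc 8 * (P.d : ℝ) * P.sg ≤ P.sg * P.sg * P.sg := by gcongr
      _ = P.sg ^ 3 := by ring
      _ ≤ _ := this
  have hdθ : P.d * θ ≤ 1 / (4 * 1024 ^ P.T * P.sg) := by
    calc P.d * θ ≤ P.d * (2 / (1024 ^ P.T * P.sg ^ 8)) := by gcongr
      _ = 8 * P.d / (4 * 1024 ^ P.T * P.sg ^ 8) := by field_simp; norm_num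
      _ ≤ (P.sg ^ 8 / P.sg) / (4 * 1024 ^ P.T * P.sg ^ 8) := by gcongr
      _ = _ := by field_simp
  have hexp : Real.exp P.T ≤ 4 ^ P.T := exp_natCast_le _
  have h1024 : (1024 : ℝ) ^ P.T = 4 ^ P.T * 256 ^ P.T := by rw [← mul_pow]; norm_num
  have h256 : (256 : ℝ) ^ P.T = 4 ^ P.T * 64 ^ P.T := by rw [← mul_pow]; norm_num
  have h64 : (1 : ℝ) ≤ 64 ^ P.T := one_le_pow₀ (by norm_num)
  have h4 : (1 : ℝ) ≤ 4 ^ P.T := one_le_pow₀ (by norm_num)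
  have hGn : ‖G‖ ≤ 4 ^ P.T := (norm_exp_le A).trans ((Real.exp_le_exp.2 hAn).trans hexp)
  have hθ1 : θ ≤ 1 := by
    have h1 : θ ≤ P.d * θ := le_mul_of_one_le_left hθ0 hd1
    have h2 : (1 : ℝ) / (4 * 1024 ^ P.T * P.sg) ≤ 1 := by
      rw [div_le_one (by positivity)]
      have : (1 : ℝ) ≤ 1024 ^ P.T := one_le_pow₀ (by norm_num)
      nlinarith
    linarith
  have hXn : ‖X‖ ≤ P.lam := by
    have h1 := norm_add_le (X - G) G
    rw [sub_add_cancel] at h1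
    have h2 : (4 : ℝ) ^ P.T + 1 ≤ P.lam := by
      have : (P.lam : ℝ) = 65536 ^ P.T * P.sg ^ 8 := by
        rw [hP.lam_eq]; push_cast; rw [pow_mul]; norm_num
      rw [this]
      have h5 : (65536 : ℝ) ^ P.T = 4 ^ P.T * 16384 ^ P.T := by rw [← mul_pow]; norm_num
      have h6 : (1 : ℝ) ≤ 16384 ^ P.T := one_le_pow₀ (by norm_num)
      have h7 : (2 : ℝ) ≤ P.sg ^ 8 := by nlinarith
      rw [h5]
      calc (4 : ℝ) ^ P.T + 1 ≤ 4 ^ P.T * 1 * 2 := by linarith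
        _ ≤ _ := by gcongr
    linarith
  have hK : ∀ i j : ℕ, i < P.d → j < P.d → |s.mem 10 i j 0| ≤ P.lam * P.scale ∧
      |s.mem 11 i j 0| ≤ P.lam * P.scale := by
    intro i j hi hj
    have h1 := (norm_entry_le_norm X ⟨i, hi⟩ ⟨j, hj⟩).trans hXn
    constructor
    · have h2 := (Complex.abs_re_le_norm _).trans h1
      rw [hXdef, mat, fx_re, abs_div, abs_of_pos hsc0, div_le_iff₀ hsc0] at h2
      exact_mod_cast h2
    · have h2 := (Complex.abs_im_le_norm _).trans h1
      rw [hXdef, mat, fx_im, abs_div, abs_of_pos hsc0, div_le_iff₀ hsc0] at h2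
      exact_mod_cast h2
  obtain ⟨m1, m2⟩ := rhoCmd_mem hP h hK
  refine ⟨fun i j => ?_, m2⟩
  obtain ⟨e1, e2⟩ := m1 i j i.2 j.2
  set τ : ℤ := ∑ k ∈ Finset.range P.d, s.mem 10 k k 0 with hτ
  set t : ℝ := τ / P.scale with ht
  have htr : t = rtr X := by
    rw [ht, hτ, ← Fin.sum_univ_eq_sum_range (fun k => s.mem 10 k k 0)]
    push_cast
    rw [rtr, Matrix.trace, Complex.re_sum, Finset.sum_div]
    rfl
  set t₀ := rtr G with ht₀
  have ht₀G : G.trace = (t₀ : ℂ) := PosSemidef.trace_eq (IsHermitian.exp_posSemidef hA)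
  -- From ‖A‖ ≤ T and e < 4.
  have ht₀l : 1 / 4 ^ P.T ≤ t₀ := by
    refine le_trans ?_ (IsHermitian.exp_neg_norm_le hA hP.d_pos)
    rw [one_div, Real.exp_neg]
    exact inv_anti₀ (Real.exp_pos _) ((Real.exp_le_exp.2 hAn).trans hexp)
  have htt₀ : |t - t₀| ≤ P.d * θ := by
    rw [htr, ht₀, ← rtr_sub, rtr, Matrix.trace]
    refine (Complex.abs_re_le_norm _).trans ((norm_sum_le _ _).trans ?_)
    calc _ ≤ ∑ k : Fin P.d, θ := Finset.sum_le_sum fun k _ =>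
          (norm_entry_le_norm _ k k).trans hX
      _ = _ := by simp
  have hdθ' : P.d * θ ≤ 1 / (2 * 4 ^ P.T) := by
    refine hdθ.trans ?_
    rw [div_le_div_iff_of_pos_left one_pos (by positivity) (by positivity), h1024]
    have : (1 : ℝ) ≤ 256 ^ P.T := one_le_pow₀ (by norm_num)
    have h3 : (4 : ℝ) ^ P.T * 1 ≤ 4 ^ P.T * 256 ^ P.T := by gcongr
    nlinarith
  have htl : 1 / (2 * 4 ^ P.T) ≤ t := by
    have h1 := (abs_le.1 htt₀).1
    have : (1 : ℝ) / 4 ^ P.T = 1 / (2 * 4 ^ P.T) + 1 / (2 * 4 ^ P.T) := by field_simp; norm_num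
    linarith
  have ht0 : 0 < t := lt_of_lt_of_le (by positivity) htl
  have ht₀0 : 0 < t₀ := lt_of_lt_of_le (by positivity) ht₀l
  have hτ0 : 0 < τ := by
    have : (0 : ℝ) < τ := by
      have h1 : (τ : ℝ) = t * P.scale := by rw [ht]; field_simp
      rw [h1]; positivity
    exact_mod_cast this
  have r1 : ‖mat P (rhoCmd.run s).state 14 P.sg i j - ((t⁻¹ : ℝ) : ℂ) * X i j‖ ≤ 2 / P.sg := by
    rw [mat, e1, e2]
    refine norm_fx_div_sub_le hsg0 hτ0 ?_ ?_
    · rw [Complex.re_ofReal_mul, hXdef, mat, fx_re, ht]; push_cast; field_simp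
    · rw [Complex.im_ofReal_mul, hXdef, mat, fx_im, ht]; push_cast; field_simp
  have r2 : ‖((t⁻¹ : ℝ) : ℂ) * X i j - gibbs A i j‖ ≤ 1 / P.sg := by
    have hg : gibbs A i j = ((t₀⁻¹ : ℝ) : ℂ) * G i j := by
      rw [gibbs, ← hG, ht₀G, Complex.ofReal_inv]; rfl
    have hgn : ‖gibbs A i j‖ ≤ 1 := norm_density_entry_le (isDensity_gibbs hA hP.d_pos) i j
    -- Factoring out 1/t avoids a difference of reciprocals: what remains is the error of the
    -- exponential plus the trace error times an entry of the Gibbs state, which is at most one.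
    have e : ((t⁻¹ : ℝ) : ℂ) * X i j - gibbs A i j
        = ((t⁻¹ : ℝ) : ℂ) * ((X - G) i j + ((t₀ - t : ℝ) : ℂ) * gibbs A i j) := by
      rw [hg, Matrix.sub_apply]
      have h1 : (t : ℂ) ≠ 0 := by exact_mod_cast ht0.ne'
      have h2 : (t₀ : ℂ) ≠ 0 := by exact_mod_cast ht₀0.ne'
      push_cast
      field_simp
      ring
    rw [e, norm_mul, Complex.norm_real, Real.norm_of_nonneg (by positivity)]
    have h1 : ‖(X - G) i j + ((t₀ - t : ℝ) : ℂ) * gibbs A i j‖ ≤ 2 * (P.d * θ) := by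
      refine (norm_add_le _ _).trans ?_
      rw [norm_mul, Complex.norm_real, Real.norm_eq_abs, abs_sub_comm]
      have h2 := (norm_entry_le_norm (X - G) i j).trans hX
      have h3 : |t - t₀| * ‖gibbs A i j‖ ≤ P.d * θ * 1 :=
        mul_le_mul htt₀ hgn (norm_nonneg _) (by positivity)
      have h4 : θ ≤ P.d * θ := le_mul_of_one_le_left hθ0 hd1
      linarith
    have h2 : t⁻¹ ≤ 2 * 4 ^ P.T := by
      rw [inv_le_comm₀ ht0 (by positivity), ← one_div]; exact htl
    calc t⁻¹ * _ ≤ (2 * 4 ^ P.T) * (2 * (1 / (4 * 1024 ^ P.T * P.sg))) :=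
          mul_le_mul h2 (h1.trans (by linarith)) (norm_nonneg _) (by positivity)
      _ = 1 / (256 ^ P.T * P.sg) := by rw [h1024]; field_simp; norm_num
      _ ≤ 1 / P.sg := by
        rw [div_le_div_iff_of_pos_left one_pos (by positivity) hsg0]
        exact le_mul_of_one_le_left hsg0.le (one_le_pow₀ (by norm_num))
  refine (norm_sub_le_norm_sub_add_norm_sub _ (((t⁻¹ : ℝ) : ℂ) * X i j) _).trans ?_
  have : (3 : ℝ) / P.sg = 2 / P.sg + 1 / P.sg := by ring
  linarith

end GibbsState

/-! ### The residual p − q(ρ) in integer arithmetic. -/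

section Residual

variable {P : Par} {s : State} {n : ℕ}

theorem pm_step (hP : P.Ok) (h : Inv P s) (a : ℕ) (n₁ n₂ n₃ : Dim) (e : Expr) (hn : n₃ ≠ .num)
    (he : e.Safe = true) :
    ∃ s', ((pm a n₁ n₂ n₃ e).run s).state = s' ∧ Inv P s' ∧
      (∀ i j k : ℕ, i < n₁.size P → j < n₂.size P → k < n₃.size P →
        |e.eval (s.branch i j k)| < P.cap → s'.mem a i j k = e.eval (s.branch i j k)) ∧
      ∀ a', a' ≠ a → s'.mem a' = s.mem a' :=
  ⟨_, rfl, (Cheap.pm hn he).inv hP h, fun i j k hi hj hk hb => by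
    rw [pm_apply h a e hi hj hk, clamp_eq_self hb], fun a' ha => pm_of_ne h _ _ _ _ ha⟩

theorem treeSum_step (hP : P.Ok) (h : Inv P s) {a : ℕ} (ha : 4 ≤ a) (n₁ n₂ : Dim) :
    ∃ s', ((treeSum a n₁ n₂).run s).state = s' ∧ Inv P s' ∧
      (∀ i j : ℕ, i < n₁.size P → j < n₂.size P → |∑ k ∈ Finset.range P.d, s.mem a i j k| < P.cap →
        s'.mem a i j 0 = ∑ k ∈ Finset.range P.d, s.mem a i j k) ∧
      ∀ a', a' ≠ a → s'.mem a' = s.mem a' :=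
  ⟨_, rfl, (Cheap.treeSum ha _ _).inv hP h, fun i j hi hj hb => by
    rw [(treeSum_spec hP h ha).1 i j hi hj, clamp_eq_self hb], (treeSum_spec hP h ha).2⟩

/-- Computes the vector `p - q(ρ)`, with denominator `2 sg ^ 2`. The numerators of the real parts
are odd, so that no coordinate vanishes. -/
def zCmd : Cmd :=
  .seq (pm 16 .num .dim .dim (.load 4 ix1 ix2 ix3 * .load 14 ix2 ix3 0
    + .load 5 ix1 ix2 ix3 * .load 15 ix2 ix3 0)) <|
  .seq (pm 17 .num .dim .dim (.load 4 ix1 ix2 ix3 * .load 15 ix2 ix3 0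
    - .load 5 ix1 ix2 ix3 * .load 14 ix2 ix3 0)) <|
  .seq (treeSum 16 .num .dim) <|
  .seq (treeSum 17 .num .dim) <|
  -- The row sums are moved to the third index, the one along which a tree sum runs.
  .seq (pm 18 .num .one .dim (.load 16 ix1 ix3 0)) <|
  .seq (pm 19 .num .one .dim (.load 17 ix1 ix3 0)) <|
  .seq (treeSum 18 .num .one) <|
  .seq (treeSum 19 .num .one) <|
  .seq (pm 20 .num .one .one (2 * (.load 6 ix1 0 0 * .reg 13 - .load 18 ix1 0 0) + 1)) <|
  pm 21 .num .one .one (2 * (.load 7 ix1 0 0 * .reg 13 - .load 19 ix1 0 0))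

theorem cheap_zCmd : Cheap zCmd :=
  (Cheap.pm (by simp) rfl).seq <| (Cheap.pm (by simp) rfl).seq <|
  (Cheap.treeSum (by norm_num) _ _).seq <| (Cheap.treeSum (by norm_num) _ _).seq <|
  (Cheap.pm (by simp) rfl).seq <| (Cheap.pm (by simp) rfl).seq <|
  (Cheap.treeSum (by norm_num) _ _).seq <| (Cheap.treeSum (by norm_num) _ _).seq <|
  (Cheap.pm (by simp) rfl).seq (Cheap.pm (by simp) rfl)

theorem Par.Fine.sg_pow_lt_cap (hP : P.Fine n) : (P.sg : ℤ) ^ 8 < P.cap := by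
  have h1 := hP.lam_pow_le_scale
  have h2 : 2 ≤ P.lam := (show 2 ≤ P.sg ^ 8 from
    le_trans (by have := hP.eight_le_sg; omega) (Nat.le_self_pow (by norm_num) _)).trans
      hP.sg_pow_le_lam
  have : P.sg ^ 8 < P.cap := by
    calc P.sg ^ 8 ≤ P.lam ^ 1 := by simpa using hP.sg_pow_le_lam
      _ < P.lam ^ 16 := Nat.pow_lt_pow_right (by omega) (by norm_num)
      _ ≤ P.scale := h1
      _ ≤ _ := P.scale_le_cap
  exact_mod_cast this

theorem Par.Fine.pow_le_sg (hP : P.Fine n) {k : ℕ} (hk : k ≤ 20) : n ^ k ≤ P.sg := by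
  rw [hP.sg_eq]; exact Nat.pow_le_pow_right (by have := hP.n_ge; omega) hk

theorem Par.Fine.dim_le_sg (hP : P.Fine n) : 2 * (P.d : ℤ) ^ 2 ≤ P.sg := by
  have h1 := hP.pow_le_sg (k := 3) (by norm_num)
  have h2 := hP.d_le'
  have h3 := hP.n_ge
  have : 2 * P.d ^ 2 ≤ P.sg := by
    calc 2 * P.d ^ 2 ≤ n * n ^ 2 := by gcongr; omega
      _ = n ^ 3 := by ring
      _ ≤ _ := h1
  exact_mod_cast this

/-- All intermediate values are of the order of sg⁵ at most, far below sg⁸ < `cap`, so every clamp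
is the identity. -/
theorem zCmd_mem (hP : P.Fine n) (h : Inv P s)
    (hQ : ∀ k i j : ℕ, k < P.M → i < P.d → j < P.d →
      |s.mem 4 k i j| ≤ P.sg ^ 2 ∧ |s.mem 5 k i j| ≤ P.sg ^ 2)
    (hp : ∀ k : ℕ, k < P.M → |s.mem 6 k 0 0| ≤ P.sg ^ 2 ∧ |s.mem 7 k 0 0| ≤ P.sg ^ 2)
    (hρ : ∀ i j : ℕ, i < P.d → j < P.d →
      |s.mem 14 i j 0| ≤ P.sg ^ 2 ∧ |s.mem 15 i j 0| ≤ P.sg ^ 2) :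
    (∀ k : ℕ, k < P.M →
      (zCmd.run s).state.mem 20 k 0 0 = 2 * (s.mem 6 k 0 0 * P.sg
        - ∑ i ∈ Finset.range P.d, ∑ j ∈ Finset.range P.d,
          (s.mem 4 k i j * s.mem 14 i j 0 + s.mem 5 k i j * s.mem 15 i j 0)) + 1 ∧
      (zCmd.run s).state.mem 21 k 0 0 = 2 * (s.mem 7 k 0 0 * P.sg
        - ∑ i ∈ Finset.range P.d, ∑ j ∈ Finset.range P.d,
          (s.mem 4 k i j * s.mem 15 i j 0 - s.mem 5 k i j * s.mem 14 i j 0))) ∧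
    ∀ a, (a < 16 ∨ 21 < a) → (zCmd.run s).state.mem a = s.mem a := by
  have hOk := hP.toOk
  have hcap := hP.sg_pow_lt_cap
  have hsg8 : (8 : ℤ) ≤ P.sg := by exact_mod_cast hP.eight_le_sg
  have hd2 := hP.dim_le_sg
  have hd1 : (1 : ℤ) ≤ P.d := by exact_mod_cast hP.d_pos
  set g : ℤ := (P.sg : ℤ) with hg
  have hm : ∀ {x y : ℤ}, |x| ≤ g ^ 2 → |y| ≤ g ^ 2 → |x * y| ≤ g ^ 4 := fun {x y} hx hy => by
    rw [abs_mul, show g ^ 4 = g ^ 2 * g ^ 2 by ring]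
    exact mul_le_mul hx hy (abs_nonneg _) (by positivity)
  have hsum : ∀ (f : ℕ → ℤ) (c : ℤ), (∀ i < P.d, |f i| ≤ c) →
      |∑ i ∈ Finset.range P.d, f i| ≤ P.d * c := fun f c hf => by
    refine (Finset.abs_sum_le_sum_abs _ _).trans ((Finset.sum_le_sum fun i hi =>
      hf i (Finset.mem_range.1 hi)).trans ?_)
    simp
  -- Summation over d² products costs one power of sg, because 2d² ≤ sg.
  have hb1 : 2 * g ^ 4 * P.d ^ 2 ≤ g ^ 5 := by
    calc 2 * g ^ 4 * P.d ^ 2 = g ^ 4 * (2 * P.d ^ 2) := by ring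
      _ ≤ g ^ 4 * g := by gcongr
      _ = _ := by ring
  have hb2 : 2 * g ^ 4 * P.d ≤ g ^ 5 := by
    refine le_trans ?_ hb1
    gcongr
    nlinarith
  have hb3 : 2 * g ^ 4 ≤ g ^ 5 := by
    refine le_trans ?_ hb2
    exact le_mul_of_one_le_right (by positivity) hd1
  have h58 : 64 * g ^ 5 ≤ g ^ 8 := by
    calc 64 * g ^ 5 ≤ g * g * g ^ 5 := by gcongr; nlinarith
      _ = g ^ 7 := by ring
      _ ≤ g ^ 8 := pow_le_pow_right₀ (by omega) (by norm_num)
  have h35 : g ^ 3 ≤ g ^ 5 := pow_le_pow_right₀ (by omega) (by norm_num)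
  have h05 : 0 < g ^ 5 := by positivity
  simp only [zCmd, run_seq_state]
  obtain ⟨s1, e1, i1, v1, f1⟩ := pm_step hOk h 16 .num .dim .dim
    (.load 4 ix1 ix2 ix3 * .load 14 ix2 ix3 0 + .load 5 ix1 ix2 ix3 * .load 15 ix2 ix3 0)
    (by simp) rfl
  rw [e1]; clear e1
  obtain ⟨s2, e2, i2, v2, f2⟩ := pm_step hOk i1 17 .num .dim .dim
    (.load 4 ix1 ix2 ix3 * .load 15 ix2 ix3 0 - .load 5 ix1 ix2 ix3 * .load 14 ix2 ix3 0)
    (by simp) rfl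
  rw [e2]; clear e2
  obtain ⟨s3, e3, i3, v3, f3⟩ := treeSum_step hOk i2 (a := 16) (by norm_num) .num .dim
  rw [e3]; clear e3
  obtain ⟨s4, e4, i4, v4, f4⟩ := treeSum_step hOk i3 (a := 17) (by norm_num) .num .dim
  rw [e4]; clear e4
  obtain ⟨s5, e5, i5, v5, f5⟩ := pm_step hOk i4 18 .num .one .dim (.load 16 ix1 ix3 0)
    (by simp) rfl
  rw [e5]; clear e5
  obtain ⟨s6, e6, i6, v6, f6⟩ := pm_step hOk i5 19 .num .one .dim (.load 17 ix1 ix3 0)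
    (by simp) rfl
  rw [e6]; clear e6
  obtain ⟨s7, e7, i7, v7, f7⟩ := treeSum_step hOk i6 (a := 18) (by norm_num) .num .one
  rw [e7]; clear e7
  obtain ⟨s8, e8, i8, v8, f8⟩ := treeSum_step hOk i7 (a := 19) (by norm_num) .num .one
  rw [e8]; clear e8
  obtain ⟨s9, e9, i9, v9, f9⟩ := pm_step hOk i8 20 .num .one .one
    (2 * (.load 6 ix1 0 0 * .reg 13 - .load 18 ix1 0 0) + 1) (by simp) rfl
  rw [e9]; clear e9
  obtain ⟨s10, e10, -, v10, f10⟩ := pm_step hOk i9 21 .num .one .one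
    (2 * (.load 7 ix1 0 0 * .reg 13 - .load 19 ix1 0 0)) (by simp) rfl
  rw [e10]; clear e10
  set X : ℕ → ℕ → ℕ → ℤ := fun k i j =>
    s.mem 4 k i j * s.mem 14 i j 0 + s.mem 5 k i j * s.mem 15 i j 0 with hX
  set Y : ℕ → ℕ → ℕ → ℤ := fun k i j =>
    s.mem 4 k i j * s.mem 15 i j 0 - s.mem 5 k i j * s.mem 14 i j 0 with hY
  have bX : ∀ k i j : ℕ, k < P.M → i < P.d → j < P.d → |X k i j| ≤ 2 * g ^ 4 :=
    fun k i j hk hi hj => by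
      have h1 := hm (hQ k i j hk hi hj).1 (hρ i j hi hj).1
      have h2 := hm (hQ k i j hk hi hj).2 (hρ i j hi hj).2
      exact (abs_add_le _ _).trans (by linarith)
  have bY : ∀ k i j : ℕ, k < P.M → i < P.d → j < P.d → |Y k i j| ≤ 2 * g ^ 4 :=
    fun k i j hk hi hj => by
      have h1 := hm (hQ k i j hk hi hj).1 (hρ i j hi hj).2
      have h2 := hm (hQ k i j hk hi hj).2 (hρ i j hi hj).1
      exact (abs_sub _ _).trans (by linarith)
  have bX1 : ∀ k i : ℕ, k < P.M → i < P.d → |∑ j ∈ Finset.range P.d, X k i j| ≤ P.d * (2 * g ^ 4) :=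
    fun k i hk hi => hsum _ _ fun j hj => bX k i j hk hi hj
  have bY1 : ∀ k i : ℕ, k < P.M → i < P.d → |∑ j ∈ Finset.range P.d, Y k i j| ≤ P.d * (2 * g ^ 4) :=
    fun k i hk hi => hsum _ _ fun j hj => bY k i j hk hi hj
  have bX2 : ∀ k : ℕ, k < P.M →
      |∑ i ∈ Finset.range P.d, ∑ j ∈ Finset.range P.d, X k i j| ≤ P.d * (P.d * (2 * g ^ 4)) :=
    fun k hk => hsum _ _ fun j hj => bX1 k j hk hj
  have bY2 : ∀ k : ℕ, k < P.M →
      |∑ i ∈ Finset.range P.d, ∑ j ∈ Finset.range P.d, Y k i j| ≤ P.d * (P.d * (2 * g ^ 4)) :=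
    fun k hk => hsum _ _ fun j hj => bY1 k j hk hj
  have w1 : ∀ k i j : ℕ, k < P.M → i < P.d → j < P.d → s1.mem 16 k i j = X k i j :=
    fun k i j hk hi hj => v1 k i j hk hi hj (by
      change |X k i j| < _
      linarith [bX k i j hk hi hj])
  have w2 : ∀ k i j : ℕ, k < P.M → i < P.d → j < P.d → s2.mem 17 k i j = Y k i j :=
    fun k i j hk hi hj => by
      have e : Expr.eval (s1.branch k i j) (.load 4 ix1 ix2 ix3 * .load 15 ix2 ix3 0
          - .load 5 ix1 ix2 ix3 * .load 14 ix2 ix3 0) = Y k i j := by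
        change s1.mem 4 k i j * s1.mem 15 i j 0 - s1.mem 5 k i j * s1.mem 14 i j 0 = _
        rw [f1 4 (by norm_num), f1 5 (by norm_num), f1 14 (by norm_num), f1 15 (by norm_num)]
      rw [v2 k i j hk hi hj (by rw [e]; linarith [bY k i j hk hi hj]), e]
  have w3 : ∀ k i : ℕ, k < P.M → i < P.d → s3.mem 16 k i 0 = ∑ j ∈ Finset.range P.d, X k i j :=
    fun k i hk hi => by
      have e : ∑ j ∈ Finset.range P.d, s2.mem 16 k i j = ∑ j ∈ Finset.range P.d, X k i j :=
        Finset.sum_congr rfl fun j hj => by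
          rw [f2 16 (by norm_num), w1 k i j hk hi (Finset.mem_range.1 hj)]
      rw [v3 k i hk hi (by rw [e]; linarith [bX1 k i hk hi]), e]
  have w4 : ∀ k i : ℕ, k < P.M → i < P.d → s4.mem 17 k i 0 = ∑ j ∈ Finset.range P.d, Y k i j :=
    fun k i hk hi => by
      have e : ∑ j ∈ Finset.range P.d, s3.mem 17 k i j = ∑ j ∈ Finset.range P.d, Y k i j :=
        Finset.sum_congr rfl fun j hj => by
          rw [f3 17 (by norm_num), w2 k i j hk hi (Finset.mem_range.1 hj)]
      rw [v4 k i hk hi (by rw [e]; linarith [bY1 k i hk hi]), e]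
  have w5 : ∀ k i : ℕ, k < P.M → i < P.d →
      s5.mem 18 k (0 : ℕ) i = ∑ j ∈ Finset.range P.d, X k i j :=
    fun k i hk hi => by
      have e : Expr.eval (s4.branch k (0 : ℕ) i) (.load 16 ix1 ix3 0)
          = ∑ j ∈ Finset.range P.d, X k i j := by
        change s4.mem 16 k i 0 = _
        rw [f4 16 (by norm_num), w3 k i hk hi]
      rw [v5 k 0 i hk Nat.one_pos hi (by rw [e]; linarith [bX1 k i hk hi]), e]
  have w6 : ∀ k i : ℕ, k < P.M → i < P.d →
      s6.mem 19 k (0 : ℕ) i = ∑ j ∈ Finset.range P.d, Y k i j :=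
    fun k i hk hi => by
      have e : Expr.eval (s5.branch k (0 : ℕ) i) (.load 17 ix1 ix3 0)
          = ∑ j ∈ Finset.range P.d, Y k i j := by
        change s5.mem 17 k i 0 = _
        rw [f5 17 (by norm_num), w4 k i hk hi]
      rw [v6 k 0 i hk Nat.one_pos hi (by rw [e]; linarith [bY1 k i hk hi]), e]
  have w7 : ∀ k : ℕ, k < P.M → s7.mem 18 k (0 : ℕ) 0
      = ∑ i ∈ Finset.range P.d, ∑ j ∈ Finset.range P.d, X k i j :=
    fun k hk => by
      have e : ∑ i ∈ Finset.range P.d, s6.mem 18 k (0 : ℕ) i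
          = ∑ i ∈ Finset.range P.d, ∑ j ∈ Finset.range P.d, X k i j :=
        Finset.sum_congr rfl fun i hi => by
          rw [f6 18 (by norm_num), w5 k i hk (Finset.mem_range.1 hi)]
      rw [v7 k 0 hk Nat.one_pos (by rw [e]; linarith [bX2 k hk]), e]
  have w8 : ∀ k : ℕ, k < P.M → s8.mem 19 k (0 : ℕ) 0
      = ∑ i ∈ Finset.range P.d, ∑ j ∈ Finset.range P.d, Y k i j :=
    fun k hk => by
      have e : ∑ i ∈ Finset.range P.d, s7.mem 19 k (0 : ℕ) i
          = ∑ i ∈ Finset.range P.d, ∑ j ∈ Finset.range P.d, Y k i j :=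
        Finset.sum_congr rfl fun i hi => by
          rw [f7 19 (by norm_num), w6 k i hk (Finset.mem_range.1 hi)]
      rw [v8 k 0 hk Nat.one_pos (by rw [e]; linarith [bY2 k hk]), e]
  have fr : ∀ a, (a < 16 ∨ 19 < a) → s8.mem a = s.mem a := fun a ha => by
    rw [f8 a (by omega), f7 a (by omega), f6 a (by omega), f5 a (by omega), f4 a (by omega),
      f3 a (by omega), f2 a (by omega), f1 a (by omega)]
  have hfin : ∀ x y : ℤ, |x| ≤ g ^ 2 → |y| ≤ P.d * (P.d * (2 * g ^ 4)) →
      |2 * (x * g - y)| < P.cap - 1 := fun x y hx hy => by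
    rw [abs_mul, abs_two]
    have h1 := abs_sub (x * g) y
    rw [abs_mul, abs_of_nonneg (show 0 ≤ g by omega)] at h1
    have h2 : |x| * g ≤ g ^ 2 * g := by gcongr
    have h3 : g ^ 2 * g = g ^ 3 := by ring
    have h4 : P.d * (P.d * (2 * g ^ 4)) = 2 * g ^ 4 * P.d ^ 2 := by ring
    linarith
  have w9 : ∀ k : ℕ, k < P.M → s9.mem 20 k 0 0 = 2 * (s.mem 6 k 0 0 * g
      - ∑ i ∈ Finset.range P.d, ∑ j ∈ Finset.range P.d, X k i j) + 1 := fun k hk => by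
    have e : Expr.eval (s8.branch k (0 : ℕ) (0 : ℕ))
        (2 * (.load 6 ix1 0 0 * .reg 13 - .load 18 ix1 0 0) + 1) = 2 * (s.mem 6 k 0 0 * g
      - ∑ i ∈ Finset.range P.d, ∑ j ∈ Finset.range P.d, X k i j) + 1 := by
      change 2 * (s8.mem 6 k 0 0 * s8.reg 13 - s8.mem 18 k (0 : ℕ) 0) + 1 = _
      rw [fr 6 (by norm_num), i8.r13, f8 18 (by norm_num), w7 k hk]
    have hb := hfin _ _ (hp k hk).1 (bX2 k hk)
    have := v9 k 0 0 hk Nat.one_pos Nat.one_pos (by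
      rw [e]
      refine (abs_add_le _ _).trans_lt ?_
      rw [abs_one]
      linarith)
    rw [e] at this
    exact this
  refine ⟨fun k hk => ⟨?_, ?_⟩, fun a ha => ?_⟩
  · rw [f10 20 (by norm_num)]; exact w9 k hk
  · have e : Expr.eval (s9.branch k (0 : ℕ) (0 : ℕ))
        (2 * (.load 7 ix1 0 0 * .reg 13 - .load 19 ix1 0 0)) = 2 * (s.mem 7 k 0 0 * g
      - ∑ i ∈ Finset.range P.d, ∑ j ∈ Finset.range P.d, Y k i j) := by
      change 2 * (s9.mem 7 k 0 0 * s9.reg 13 - s9.mem 19 k (0 : ℕ) 0) = _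
      rw [f9 7 (by norm_num), fr 7 (by norm_num), i9.r13, f9 19 (by norm_num), w8 k hk]
    have hb := hfin _ _ (hp k hk).2 (bY2 k hk)
    have := v10 k 0 0 hk Nat.one_pos Nat.one_pos (by rw [e]; linarith)
    rw [e] at this
    exact this
  · rw [f10 a (by omega), f9 a (by omega), fr a (by omega)]

end Residual

/-! ### Accuracy of the residual. -/

section ResidualSpec

open scoped Matrix.Norms.L2Operator

variable {P : Par} {s : State} {n : ℕ}

/-- The arrays `4` to `7` contain `Q` and `p`, with scale `sg`. -/
structure Holds (P : Par) (Q : Fin P.M → Matrix (Fin P.d) (Fin P.d) ℂ) (p : Fin P.M → ℂ)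
    (s : State) : Prop where
  re_Q : ∀ (k : Fin P.M) (i j : Fin P.d), |(s.mem 4 k i j : ℝ) - P.sg * (Q k i j).re| ≤ 1
  im_Q : ∀ (k : Fin P.M) (i j : Fin P.d), |(s.mem 5 k i j : ℝ) - P.sg * (Q k i j).im| ≤ 1
  re_p : ∀ k : Fin P.M, |(s.mem 6 k 0 0 : ℝ) - P.sg * (p k).re| ≤ 1
  im_p : ∀ k : Fin P.M, |(s.mem 7 k 0 0 : ℝ) - P.sg * (p k).im| ≤ 1

theorem Holds.congr {Q : Fin P.M → Matrix (Fin P.d) (Fin P.d) ℂ} {p : Fin P.M → ℂ} {s' : State}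
    (h : Holds P Q p s) (h' : ∀ a, 4 ≤ a → a ≤ 7 → s'.mem a = s.mem a) : Holds P Q p s' := by
  refine ⟨?_, ?_, ?_, ?_⟩
  · rw [h' 4 (by norm_num) (by norm_num)]; exact h.re_Q
  · rw [h' 5 (by norm_num) (by norm_num)]; exact h.im_Q
  · rw [h' 6 (by norm_num) (by norm_num)]; exact h.re_p
  · rw [h' 7 (by norm_num) (by norm_num)]; exact h.im_p

/-- The approximations of the operators. -/
noncomputable def opHat (P : Par) (s : State) (k : Fin P.M) : Matrix (Fin P.d) (Fin P.d) ℂ :=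
  fun i j => fx P.sg (s.mem 4 k i j) (s.mem 5 k i j)

/-- The vector whose real and imaginary parts are in the arrays `a` and `a + 1`. -/
noncomputable def vec (P : Par) (s : State) (a : ℕ) (D : ℝ) (k : Fin P.M) : ℂ :=
  fx D (s.mem a k 0 0) (s.mem (a + 1) k 0 0)

variable {Q : Fin P.M → Matrix (Fin P.d) (Fin P.d) ℂ} {p : Fin P.M → ℂ}

theorem Holds.opHat_sub_le (h : Holds P Q p s) (hP : P.Ok) (k : Fin P.M) (i j : Fin P.d) :
    ‖opHat P s k i j - Q k i j‖ ≤ 2 / P.sg := by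
  simpa [opHat] using norm_fx_sub_le (by exact_mod_cast hP.sg_pos) (h.re_Q k i j) (h.im_Q k i j)

theorem Holds.vec_sub_le (h : Holds P Q p s) (hP : P.Ok) (k : Fin P.M) :
    ‖vec P s 6 P.sg k - p k‖ ≤ 2 / P.sg := by
  simpa [vec] using norm_fx_sub_le (by exact_mod_cast hP.sg_pos) (h.re_p k) (h.im_p k)

theorem abs_le_of_norm_fx_le {D c : ℝ} (hD : 0 < D) {x y : ℤ} (h : ‖fx D x y‖ ≤ c) :
    |(x : ℝ)| ≤ c * D ∧ |(y : ℝ)| ≤ c * D := by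
  constructor
  · have h2 := (Complex.abs_re_le_norm _).trans h
    rwa [fx_re, abs_div, abs_of_pos hD, div_le_iff₀ hD] at h2
  · have h2 := (Complex.abs_im_le_norm _).trans h
    rwa [fx_im, abs_div, abs_of_pos hD, div_le_iff₀ hD] at h2

theorem Par.Fine.mul_le_sg (hP : P.Fine n) :
    100 * (P.d : ℝ) ^ 2 * P.M ^ 2 * P.W ^ 2 * P.E * n ≤ P.sg := by
  have hn : (8 : ℝ) ≤ n := by exact_mod_cast hP.n_ge
  have h1 : (P.d : ℝ) ≤ n := by exact_mod_cast hP.d_le'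
  have h2 : (P.M : ℝ) ≤ n := by exact_mod_cast hP.M_le'
  have h3 : (P.W : ℝ) ≤ n := by exact_mod_cast hP.W_le'
  have h4 : (P.E : ℝ) ≤ n := by exact_mod_cast hP.E_le'
  have h5 : (n : ℝ) ^ 11 ≤ P.sg := by exact_mod_cast hP.pow_le_sg (k := 11) (by norm_num)
  have h6 : (100 : ℝ) ≤ n ^ 3 := by
    calc (100 : ℝ) ≤ 8 ^ 3 := by norm_num
      _ ≤ n ^ 3 := by gcongr
  calc _ ≤ (n : ℝ) ^ 3 * n ^ 2 * n ^ 2 * n ^ 2 * n * n := by gcongr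
    _ = n ^ 11 := by ring
    _ ≤ _ := h5

/-- A convenient upper bound for the rounding errors. -/
theorem Par.Fine.small (hP : P.Fine n) {c : ℝ} (hc : c ≤ 100 * n) :
    c * (P.d ^ 2 * P.M ^ 2 * P.W ^ 2 * P.E) ≤ P.sg := by
  refine le_trans ?_ hP.mul_le_sg
  calc c * (P.d ^ 2 * P.M ^ 2 * P.W ^ 2 * P.E : ℝ)
      ≤ 100 * n * (P.d ^ 2 * P.M ^ 2 * P.W ^ 2 * P.E) := by gcongr
    _ = _ := by ring

theorem Par.Fine.small_dW (hP : P.Fine n) : 20 * (P.d ^ 2 * P.W : ℝ) ≤ P.sg := by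
  have h1 : (1 : ℝ) ≤ P.M := by exact_mod_cast hP.M_pos
  have h2 : (1 : ℝ) ≤ P.W := by exact_mod_cast hP.W_pos
  have h3 : (1 : ℝ) ≤ P.E := by exact_mod_cast hP.E_pos
  have hn : (8 : ℝ) ≤ n := by exact_mod_cast hP.n_ge
  refine le_trans ?_ (hP.small (c := 20) (by linarith))
  have h4 : (1 : ℝ) ≤ P.M ^ 2 := one_le_pow₀ h1
  calc 20 * (P.d ^ 2 * P.W : ℝ) = 20 * (P.d ^ 2 * 1 * (P.W * 1) * 1) := by ring
    _ ≤ 20 * (P.d ^ 2 * P.M ^ 2 * (P.W * P.W) * P.E) := by gcongr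
    _ = _ := by ring

/-- Given the computed ρ, only the rounding of the input and the shift that makes the numerators odd
matter: 2/sg from p, 4d²/sg from the operators, 1/(2 sg²) from the shift. -/
theorem zCmd_spec (hP : P.Fine n) (h : Inv P s) (hin : Holds P Q p s)
    (hQ : IsInstance P.W Q p) (hρ : ∀ i j, ‖mat P s 14 P.sg i j‖ ≤ 2) :
    (∀ k, ‖vec P (zCmd.run s).state 20 (2 * P.sg ^ 2) k
      - (p - qvec Q (mat P s 14 P.sg)) k‖ ≤ 7 * P.d ^ 2 / P.sg) ∧
    (∀ k : Fin P.M, |(zCmd.run s).state.mem 20 k 0 0| ≤ P.sg ^ 4 ∧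
      |(zCmd.run s).state.mem 21 k 0 0| ≤ P.sg ^ 4 ∧ (zCmd.run s).state.mem 20 k 0 0 ≠ 0) ∧
    ∀ a, (a < 16 ∨ 21 < a) → (zCmd.run s).state.mem a = s.mem a := by
  have hOk := hP.toOk
  have hd1 : (1 : ℝ) ≤ P.d := by exact_mod_cast hP.d_pos
  have hW1 : (1 : ℝ) ≤ P.W := by exact_mod_cast hP.W_pos
  have hsg8 : (8 : ℝ) ≤ P.sg := by exact_mod_cast hP.eight_le_sg
  have hsg0 : (0 : ℝ) < P.sg := by linarith
  have hdW := hP.small_dW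
  have hd2 : (1 : ℝ) ≤ (P.d : ℝ) ^ 2 := one_le_pow₀ hd1
  have hWsg : (P.W : ℝ) + 1 ≤ P.sg := by nlinarith
  have hdiv : (2 : ℝ) / P.sg ≤ 1 := by rw [div_le_one hsg0]; linarith
  have bQ : ∀ k i j, ‖opHat P s k i j‖ ≤ P.sg := fun k i j => by
    have h1 := norm_add_le (opHat P s k i j - Q k i j) (Q k i j)
    rw [sub_add_cancel] at h1
    have h2 := hin.opHat_sub_le hOk k i j
    have h3 := (norm_entry_le_norm (Q k) i j).trans (hQ.1 k)
    linarith
  have bp : ∀ k, ‖vec P s 6 P.sg k‖ ≤ P.sg := fun k => by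
    have h1 := norm_add_le (vec P s 6 P.sg k - p k) (p k)
    rw [sub_add_cancel] at h1
    have h2 := hin.vec_sub_le hOk k
    have h3 := hQ.2 k
    linarith
  have up : ∀ {x : ℤ} {c : ℝ}, c ≤ P.sg → |(x : ℝ)| ≤ c * P.sg → |x| ≤ (P.sg : ℤ) ^ 2 := by
    intro x c hc hx
    have : |(x : ℝ)| ≤ (P.sg : ℝ) ^ 2 := hx.trans (by rw [sq]; gcongr)
    exact_mod_cast this
  obtain ⟨hm, hf⟩ := zCmd_mem hP h
    (fun k i j hk hi hj => by
      have := abs_le_of_norm_fx_le hsg0 (bQ ⟨k, hk⟩ ⟨i, hi⟩ ⟨j, hj⟩)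
      exact ⟨up le_rfl this.1, up le_rfl this.2⟩)
    (fun k hk => by
      have := abs_le_of_norm_fx_le hsg0 (bp ⟨k, hk⟩)
      exact ⟨up le_rfl this.1, up le_rfl this.2⟩)
    (fun i j hi hj => by
      have := abs_le_of_norm_fx_le hsg0 (hρ ⟨i, hi⟩ ⟨j, hj⟩)
      exact ⟨up (by linarith) this.1, up (by linarith) this.2⟩)
  set s' := (zCmd.run s).state with hs'
  set ρ := mat P s 14 P.sg with hρdef
  have hz : ∀ k : Fin P.M, vec P s' 20 (2 * P.sg ^ 2) k
      = vec P s 6 P.sg k - ((opHat P s k)ᴴ * ρ).trace + ((1 / (2 * P.sg ^ 2) : ℝ) : ℂ) := by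
    intro k
    have e : ((opHat P s k)ᴴ * ρ).trace = ∑ i : Fin P.d, ∑ j : Fin P.d,
        star (opHat P s k i j) * ρ i j := by
      rw [Finset.sum_comm]
      simp only [Matrix.trace, Matrix.diag_apply, Matrix.mul_apply, Matrix.conjTranspose_apply]
    obtain ⟨m1, m2⟩ := hm k k.2
    rw [← Fin.sum_univ_eq_sum_range (fun i => ∑ j ∈ Finset.range P.d, _)] at m1 m2
    simp only [← Fin.sum_univ_eq_sum_range (fun j => s.mem 4 k _ j * _ + _),
      ← Fin.sum_univ_eq_sum_range (fun j => s.mem 4 k _ j * _ - _)] at m1 m2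
    rw [e]
    apply Complex.ext
    · rw [vec, fx_re, m1, Complex.add_re, Complex.sub_re, Complex.re_sum, Complex.ofReal_re, vec,
        fx_re]
      simp only [Complex.re_sum, Complex.mul_re, Complex.star_def, Complex.conj_re,
        Complex.conj_im, opHat, hρdef, mat, fx_re, fx_im]
      push_cast
      have : ∀ i j : Fin P.d, (s.mem 4 k i j : ℝ) / P.sg * (s.mem 14 i j 0 / P.sg)
          - -(s.mem 5 k i j / P.sg) * (s.mem 15 i j 0 / P.sg)
          = (s.mem 4 k i j * s.mem 14 i j 0 + s.mem 5 k i j * s.mem 15 i j 0) / P.sg ^ 2 := by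
        intro i j; field_simp; ring
      simp only [this, ← Finset.sum_div]
      field_simp
    · rw [vec, fx_im, m2, Complex.add_im, Complex.sub_im, Complex.im_sum, Complex.ofReal_im, vec,
        fx_im]
      simp only [Complex.im_sum, Complex.mul_im, Complex.star_def, Complex.conj_re,
        Complex.conj_im, opHat, hρdef, mat, fx_re, fx_im]
      push_cast
      have : ∀ i j : Fin P.d, (s.mem 4 k i j : ℝ) / P.sg * (s.mem 15 i j 0 / P.sg)
          + -(s.mem 5 k i j / P.sg) * (s.mem 14 i j 0 / P.sg)
          = (s.mem 4 k i j * s.mem 15 i j 0 - s.mem 5 k i j * s.mem 14 i j 0) / P.sg ^ 2 := by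
        intro i j; field_simp; ring
      simp only [this, ← Finset.sum_div]
      field_simp
      ring
  have herr : ∀ k, ‖vec P s' 20 (2 * P.sg ^ 2) k - (p - qvec Q ρ) k‖ ≤ 7 * P.d ^ 2 / P.sg := by
    intro k
    have e : vec P s' 20 (2 * P.sg ^ 2) k - (p - qvec Q ρ) k
        = (vec P s 6 P.sg k - p k) - ((opHat P s k - Q k)ᴴ * ρ).trace
          + ((1 / (2 * P.sg ^ 2) : ℝ) : ℂ) := by
      rw [hz, Matrix.conjTranspose_sub, Matrix.sub_mul, Matrix.trace_sub, Pi.sub_apply, qvec]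
      ring
    rw [e]
    refine (norm_add_le _ _).trans ?_
    have h1 := norm_sub_le (vec P s 6 P.sg k - p k) ((opHat P s k - Q k)ᴴ * ρ).trace
    have h2 := hin.vec_sub_le hOk k
    have h3 := norm_trace_conjTranspose_mul_le (A := opHat P s k - Q k) (hin.opHat_sub_le hOk k) hρ
    have h4 : ‖((1 / (2 * P.sg ^ 2) : ℝ) : ℂ)‖ ≤ 1 / P.sg := by
      rw [Complex.norm_real, Real.norm_of_nonneg (by positivity)]
      rw [div_le_div_iff_of_pos_left one_pos (by positivity) hsg0]
      nlinarith
    have h5 : (2 : ℝ) / P.sg + P.d ^ 2 * (2 / P.sg * 2) + 1 / P.sg ≤ 7 * P.d ^ 2 / P.sg := by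
      have : (2 : ℝ) / P.sg + P.d ^ 2 * (2 / P.sg * 2) + 1 / P.sg
        = (4 * P.d ^ 2 + 3) / P.sg := by ring
      rw [this]
      gcongr
      linarith
    linarith
  refine ⟨herr, fun k => ?_, hf⟩
  have hb : ‖vec P s' 20 (2 * P.sg ^ 2) k‖ ≤ P.sg := by
    have h1 := norm_add_le (vec P s' 20 (2 * P.sg ^ 2) k - (p - qvec Q ρ) k) ((p - qvec Q ρ) k)
    rw [sub_add_cancel] at h1
    have h2 := herr k
    have h3 := norm_sub_le (p k) (qvec Q ρ k)
    have h4 := hQ.2 k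
    have h5 := norm_trace_conjTranspose_mul_le
      (fun i j => (norm_entry_le_norm (Q k) i j).trans (hQ.1 k)) hρ
    have h6 : 7 * (P.d : ℝ) ^ 2 / P.sg ≤ 7 * P.d ^ 2 := div_le_self (by positivity) (by linarith)
    have h7 : (P.d : ℝ) ^ 2 ≤ P.d ^ 2 * P.W := le_mul_of_one_le_right (by positivity) hW1
    have h8 : (P.W : ℝ) ≤ P.d ^ 2 * P.W := le_mul_of_one_le_left (by positivity) hd2
    rw [Pi.sub_apply] at h1 h2
    have h9 : ‖qvec Q ρ k‖ ≤ P.d ^ 2 * (P.W * 2) := h5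
    linarith
  have h1 := abs_le_of_norm_fx_le (by positivity) hb
  have h2 : (P.sg : ℝ) * (2 * P.sg ^ 2) ≤ P.sg ^ 4 := by
    calc (P.sg : ℝ) * (2 * P.sg ^ 2) ≤ P.sg * (P.sg * P.sg ^ 2) := by gcongr; linarith
      _ = _ := by ring
  refine ⟨by exact_mod_cast h1.1.trans h2, by exact_mod_cast h1.2.trans h2, ?_⟩
  rw [(hm k k.2).1]
  omega

end ResidualSpec

/-! ### Newton's square root and the phases. -/

section Phases

variable {P : Par} {s : State} {n : ℕ}

/-- One Newton step for the square root of `H`. -/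
def newton (H r : ℤ) : ℤ := (r + H / r) / 2

/-- r + H/r ≥ 2q by the inequality of the means; the two integer divisions together lose less than
one. -/
theorem newton_gt {q : ℝ} {H r : ℤ} (hr : 1 ≤ r) (hH : (H : ℝ) = q ^ 2) :
    q - 1 < newton H r := by
  have hr0 : (0 : ℝ) < r := by exact_mod_cast hr
  have h1 : (H : ℝ) / r < (H / r : ℤ) + 1 := by
    have h2 := Int.lt_ediv_add_one_mul_self H (show 0 < r by omega)
    rw [div_lt_iff₀ hr0]
    exact_mod_cast h2
  have h2 : (r : ℝ) + H / r ≥ 2 * q := by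
    have : (r : ℝ) + H / r - 2 * q = (r - q) ^ 2 / r := by rw [hH]; field_simp; ring
    have h3 : 0 ≤ (r - q) ^ 2 / r := by positivity
    linarith
  have h3 : ((r + H / r : ℤ) : ℝ) ≤ 2 * newton H r + 1 := by
    have : r + H / r ≤ 2 * newton H r + 1 := by rw [newton]; omega
    exact_mod_cast this
  push_cast at h3
  linarith

/-- The exact step has excess (r − q)²/(2r), at most half of the previous excess if r ≥ q. The
constant 1/2 covers iterates that have fallen below q, by less than one, through rounding. -/
theorem newton_sub_le {q c : ℝ} {H r : ℤ} (hr : 1 ≤ r) (hH : (H : ℝ) = q ^ 2) (hq : 0 ≤ q)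
    (hl : q - 1 < r) (hu : r - q ≤ 1 / 2 + c) (hc : 0 ≤ c) :
    newton H r - q ≤ 1 / 2 + c / 2 := by
  have hr1 : (1 : ℝ) ≤ r := by exact_mod_cast hr
  have hr0 : (0 : ℝ) < r := by linarith
  have h1 : ((H / r : ℤ) : ℝ) ≤ H / r := by
    rw [le_div_iff₀ hr0]
    exact_mod_cast Int.ediv_mul_le H (show r ≠ 0 by omega)
  have h3 : (2 * newton H r : ℝ) ≤ ((r + H / r : ℤ) : ℝ) := by
    have : 2 * newton H r ≤ r + H / r := by rw [newton]; omega
    exact_mod_cast this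
  push_cast at h3
  have h2 : (r : ℝ) + H / r - 2 * q = (r - q) ^ 2 / r := by rw [hH]; field_simp; ring
  have h4 : (r - q) ^ 2 / r ≤ 1 + c := by
    rw [div_le_iff₀ hr0]
    rcases le_total q r with h | h
    · nlinarith
    · nlinarith
  linarith

/-- Computes `sg` times the modulus of the residuals by Newton's method, and the phases. -/
def uCmd : Cmd :=
  .seq (pm 22 .num .one .one (.reg 14)) <|
  .seq (.loop 8 (.reg 12) (pm 22 .num .one .one ((.load 22 ix1 0 0 + .reg 13 * .reg 13 *
    (.load 20 ix1 0 0 * .load 20 ix1 0 0 + .load 21 ix1 0 0 * .load 21 ix1 0 0)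
      / .load 22 ix1 0 0) / 2))) <|
  .seq (pm 23 .num .one .one (.load 20 ix1 0 0 * .reg 13 * .reg 13 / .load 22 ix1 0 0)) <|
  pm 24 .num .one .one (.load 21 ix1 0 0 * .reg 13 * .reg 13 / .load 22 ix1 0 0)

theorem cheap_uCmd : Cheap uCmd :=
  (Cheap.pm (by simp) rfl).seq <|
  (Cheap.loop (by norm_num) (by norm_num) (by norm_num) (Cheap.pm (by simp) rfl)).seq <|
  (Cheap.pm (by simp) rfl).seq (Cheap.pm (by simp) rfl)

theorem loop_step (hP : P.Ok) (h : Inv P s) {x r N : ℕ} {c : Cmd} (hr : s.reg r = N)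
    (hN : N ≤ P.lam) (hx : 7 ≤ x) (hx' : x ≤ 10) (hc : Cheap c) :
    ((Cmd.loop x (.reg r) c).run s).state = loopState x c s N ∧
    (∀ m ≤ N, Inv P (loopState x c s m)) ∧
    ∀ m < N, Inv P ((loopState x c s m).setReg x m) := by
  have hinv : ∀ m ≤ N, Inv P (loopState x c s m) := fun m hm =>
    h.loopState hP hc (by omega) hx' hN hm
  refine ⟨?_, hinv, fun m hm => (hinv m hm.le).setReg (by omega) hx'
    (hP.bits_le_len (hm.le.trans hN))⟩
  rw [loop_state]
  have : (Expr.reg r).eval s = N := hr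
  rw [this, Int.toNat_natCast]

/-- Newton's method for q = sg √(x² + y²) starts at λ ≥ q and runs l steps. The part of the excess
that halves starts at λ = 2^l and ends at 1. -/
theorem uCmd_mem (hP : P.Fine n) (h : Inv P s)
    (hz : ∀ k : ℕ, k < P.M → |s.mem 20 k 0 0| ≤ P.sg ^ 4 ∧ |s.mem 21 k 0 0| ≤ P.sg ^ 4 ∧
      s.mem 20 k 0 0 ≠ 0) :
    (∀ k : ℕ, k < P.M → ∃ r : ℤ, 1 ≤ r ∧
      |(r : ℝ) - P.sg * √((s.mem 20 k 0 0 : ℝ) ^ 2 + (s.mem 21 k 0 0 : ℝ) ^ 2)| ≤ 2 ∧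
      (uCmd.run s).state.mem 22 k 0 0 = r ∧
      (uCmd.run s).state.mem 23 k 0 0 = s.mem 20 k 0 0 * P.sg * P.sg / r ∧
      (uCmd.run s).state.mem 24 k 0 0 = s.mem 21 k 0 0 * P.sg * P.sg / r) ∧
    ∀ a, (a < 22 ∨ 24 < a) → (uCmd.run s).state.mem a = s.mem a := by
  have hOk := hP.toOk
  have hcap : (P.sg : ℤ) ^ 8 < P.cap := hP.sg_pow_lt_cap
  have hsg8 : (8 : ℤ) ≤ P.sg := by exact_mod_cast hP.eight_le_sg
  have hsgR : (8 : ℝ) ≤ P.sg := by exact_mod_cast hP.eight_le_sg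
  have hlamR : (P.sg : ℝ) ^ 8 ≤ P.lam := by exact_mod_cast hP.sg_pow_le_lam
  have hlam0 : (0 : ℝ) < P.lam := lt_of_lt_of_le (by positivity) hlamR
  have hcap2 : 4 * (P.lam : ℝ) ^ 3 < P.cap := by
    have h1 : (P.lam : ℝ) ^ 16 ≤ P.scale := by exact_mod_cast hP.lam_pow_le_scale
    have h2 : (P.scale : ℝ) ≤ P.cap := by exact_mod_cast P.scale_le_cap
    have h3 : (8 : ℝ) ≤ P.lam := le_trans (by nlinarith [pow_le_pow_right₀ (show (1:ℝ) ≤ P.sg by linarith) (show 1 ≤ 8 by norm_num)]) hlamR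
    calc 4 * (P.lam : ℝ) ^ 3 < (P.lam : ℝ) * (P.lam : ℝ) ^ 3 := by gcongr; linarith
      _ = (P.lam : ℝ) ^ 4 := by ring
      _ ≤ (P.lam : ℝ) ^ 16 := pow_le_pow_right₀ (by linarith) (by norm_num)
      _ ≤ _ := h1.trans h2
  set body := pm 22 .num .one .one ((.load 22 ix1 0 0 + .reg 13 * .reg 13 *
    (.load 20 ix1 0 0 * .load 20 ix1 0 0 + .load 21 ix1 0 0 * .load 21 ix1 0 0)
      / .load 22 ix1 0 0) / 2) with hbody
  have hcb : Cheap body := Cheap.pm (by simp) rfl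
  simp only [uCmd, run_seq_state]
  obtain ⟨s1, e1, i1, v1, f1⟩ := pm_step hOk h 22 .num .one .one (.reg 14) (by simp) rfl
  rw [e1]; clear e1
  obtain ⟨e2, i2, j2⟩ := loop_step hOk i1 (x := 8) i1.r12 P.l_le_lam (by norm_num) (by norm_num) hcb
  rw [e2]; clear e2
  have key : ∀ m ≤ P.l, (∀ k : ℕ, k < P.M → ∃ r : ℤ, (loopState 8 body s1 m).mem 22 k 0 0 = r ∧
      1 ≤ r ∧ P.sg * √((s.mem 20 k 0 0 : ℝ) ^ 2 + (s.mem 21 k 0 0 : ℝ) ^ 2) - 1 < r ∧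
      r - P.sg * √((s.mem 20 k 0 0 : ℝ) ^ 2 + (s.mem 21 k 0 0 : ℝ) ^ 2)
        ≤ 1 / 2 + P.lam / 2 ^ m) ∧
      ∀ a, a ≠ 22 → (loopState 8 body s1 m).mem a = s.mem a := by
    intro m
    induction m with
    | zero =>
      intro _
      refine ⟨fun k hk => ⟨P.lam, ?_, ?_, ?_, ?_⟩, fun a ha => f1 a ha⟩
      · have e : Expr.eval (s.branch k (0 : ℕ) (0 : ℕ)) (.reg 14) = P.lam := h.r14
        have := v1 k 0 0 hk Nat.one_pos Nat.one_pos (by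
          rw [e, Nat.abs_cast]
          have h3 : (1 : ℝ) ≤ P.lam := by exact_mod_cast P.lam_pos
          have : (P.lam : ℝ) < P.cap := by nlinarith [sq_nonneg ((P.lam : ℝ) - 1)]
          exact_mod_cast this)
        rw [e] at this
        exact this
      · exact_mod_cast P.lam_pos
      · have h1 : √((s.mem 20 k 0 0 : ℝ) ^ 2 + (s.mem 21 k 0 0 : ℝ) ^ 2) ≤ 2 * P.sg ^ 4 := by
          rw [Real.sqrt_le_left (by positivity)]
          have h1 : |(s.mem 20 k 0 0 : ℝ)| ≤ (P.sg : ℝ) ^ 4 := by exact_mod_cast (hz k hk).1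
          have h2 : |(s.mem 21 k 0 0 : ℝ)| ≤ (P.sg : ℝ) ^ 4 := by exact_mod_cast (hz k hk).2.1
          rw [← sq_abs, ← sq_abs (s.mem 21 k 0 0 : ℝ)]
          have h3 : |(s.mem 20 k 0 0 : ℝ)| ^ 2 ≤ ((P.sg : ℝ) ^ 4) ^ 2 := by gcongr
          have h4 : |(s.mem 21 k 0 0 : ℝ)| ^ 2 ≤ ((P.sg : ℝ) ^ 4) ^ 2 := by gcongr
          nlinarith [sq_nonneg ((P.sg : ℝ) ^ 4)]
        have h2 : P.sg * (2 * (P.sg : ℝ) ^ 4) ≤ P.sg ^ 8 := by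
          calc P.sg * (2 * (P.sg : ℝ) ^ 4) = 2 * P.sg ^ 5 := by ring
            _ ≤ (P.sg : ℝ) * (P.sg : ℝ) ^ 5 := by gcongr; linarith
            _ = (P.sg : ℝ) ^ 6 := by ring
            _ ≤ _ := pow_le_pow_right₀ (by linarith) (by norm_num)
        have h3 : (P.sg : ℝ) * √((s.mem 20 k 0 0 : ℝ) ^ 2 + (s.mem 21 k 0 0 : ℝ) ^ 2)
          ≤ P.sg * (2 * (P.sg : ℝ) ^ 4) := by gcongr
        push_cast
        linarith
      · have : 0 ≤ (P.sg : ℝ) * √((s.mem 20 k 0 0 : ℝ) ^ 2 + (s.mem 21 k 0 0 : ℝ) ^ 2) := by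
          positivity
        push_cast
        simp only [pow_zero, div_one]
        linarith
    | succ m ih =>
      intro hm
      obtain ⟨ih1, ih2⟩ := ih (by omega)
      obtain ⟨s', e', -, v', f'⟩ := pm_step hOk (j2 m (by omega)) 22 .num .one .one
        ((.load 22 ix1 0 0 + .reg 13 * .reg 13 *
        (.load 20 ix1 0 0 * .load 20 ix1 0 0 + .load 21 ix1 0 0 * .load 21 ix1 0 0)
        / .load 22 ix1 0 0) / 2) (by simp) rfl
      have hl : loopState 8 body s1 (m + 1) = s' := e'
      rw [hl]
      refine ⟨fun k hk => ?_, fun a ha => by rw [f' a ha]; exact ih2 a ha⟩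
      obtain ⟨r, hr, hr1, hrl, hru⟩ := ih1 k hk
      set x : ℤ := s.mem 20 k 0 0 with hx
      set y : ℤ := s.mem 21 k 0 0 with hy
      set H : ℤ := P.sg * P.sg * (x * x + y * y) with hH
      set q : ℝ := P.sg * √((x : ℝ) ^ 2 + (y : ℝ) ^ 2) with hq
      have hq0 : 0 ≤ q := by positivity
      have hHq : (H : ℝ) = q ^ 2 := by
        rw [hq, mul_pow, Real.sq_sqrt (by positivity), hH]; push_cast; ring
      have e : Expr.eval (((loopState 8 body s1 m).setReg 8 m).branch k (0 : ℕ) (0 : ℕ))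
          ((.load 22 ix1 0 0 + .reg 13 * .reg 13 *
          (.load 20 ix1 0 0 * .load 20 ix1 0 0 + .load 21 ix1 0 0 * .load 21 ix1 0 0)
          / .load 22 ix1 0 0) / 2) = newton H r := by
        change ((loopState 8 body s1 m).mem 22 k 0 0
          + (loopState 8 body s1 m).reg 13 * (loopState 8 body s1 m).reg 13 *
          ((loopState 8 body s1 m).mem 20 k 0 0 * (loopState 8 body s1 m).mem 20 k 0 0 +
            (loopState 8 body s1 m).mem 21 k 0 0 * (loopState 8 body s1 m).mem 21 k 0 0) /
            (loopState 8 body s1 m).mem 22 k 0 0) / 2 = _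
        rw [(i2 m (by omega)).r13, hr, ih2 20 (by norm_num), ih2 21 (by norm_num)]
        rfl
      have hx2 : 1 ≤ x * x + y * y := by
        have h1 : 0 < x * x := mul_self_pos.2 (hz k hk).2.2
        have h2 : 0 ≤ y * y := mul_self_nonneg y
        omega
      -- Since the numerators do not both vanish, q ≥ sg ≥ 8. Hence the iterates, which exceed q −
      -- 1, stay positive and the divisions are meaningful.
      have hq8 : 8 ≤ q := by
        have : 1 ≤ √((x : ℝ) ^ 2 + (y : ℝ) ^ 2) := by
          rw [Real.one_le_sqrt]
          have : (1 : ℝ) ≤ x * x + y * y := by exact_mod_cast hx2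
          nlinarith
        rw [hq]
        nlinarith
      have hn1 := newton_gt hr1 hHq
      have hn2 := newton_sub_le hr1 hHq hq0 hrl hru (by positivity)
      have hn3 : (1 : ℤ) ≤ newton H r := by
        have : (0 : ℝ) < newton H r := by linarith
        exact_mod_cast this
      have hqlam : q ≤ P.lam := by
        have h1 : |(x : ℝ)| ≤ (P.sg : ℝ) ^ 4 := by exact_mod_cast (hz k hk).1
        have h2 : |(y : ℝ)| ≤ (P.sg : ℝ) ^ 4 := by exact_mod_cast (hz k hk).2.1
        refine le_trans ?_ hlamR
        have h3 : √((x : ℝ) ^ 2 + (y : ℝ) ^ 2) ≤ 2 * P.sg ^ 4 := by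
          rw [Real.sqrt_le_left (by positivity)]
          rw [← sq_abs, ← sq_abs (y : ℝ)]
          have h3 : |(x : ℝ)| ^ 2 ≤ ((P.sg : ℝ) ^ 4) ^ 2 := by gcongr
          have h4 : |(y : ℝ)| ^ 2 ≤ ((P.sg : ℝ) ^ 4) ^ 2 := by gcongr
          nlinarith [sq_nonneg ((P.sg : ℝ) ^ 4)]
        calc q ≤ P.sg * (2 * P.sg ^ 4) := by rw [hq]; gcongr
          _ = 2 * (P.sg : ℝ) ^ 5 := by ring
          _ ≤ (P.sg : ℝ) * (P.sg : ℝ) ^ 5 := by gcongr; linarith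
          _ = (P.sg : ℝ) ^ 6 := by ring
          _ ≤ _ := pow_le_pow_right₀ (by linarith) (by norm_num)
      refine ⟨newton H r, ?_, hn3, hn1, ?_⟩
      · have := v' k 0 0 hk Nat.one_pos Nat.one_pos (by
          rw [e, abs_of_nonneg (by omega)]
          have h1 : (P.lam : ℝ) / 2 ^ m / 2 ≤ P.lam := by
            rw [div_div]
            refine div_le_self hlam0.le ?_
            have : (1 : ℝ) ≤ 2 ^ m := one_le_pow₀ (by norm_num)
            linarith
          have h3 : (1 : ℝ) ≤ P.lam := by exact_mod_cast P.lam_pos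
          have h4 : (P.lam : ℝ) ≤ P.lam ^ 3 := le_self_pow₀ h3 (by norm_num)
          have : (newton H r : ℝ) < P.cap := by linarith
          exact_mod_cast this)
        rw [e] at this
        exact this
      · have : (P.lam : ℝ) / 2 ^ (m + 1) = P.lam / 2 ^ m / 2 := by rw [pow_succ]; field_simp
        rw [this]; exact hn2
  obtain ⟨k1, k2⟩ := key P.l le_rfl
  set s2 := loopState 8 body s1 P.l with hs2
  obtain ⟨s3, e3, i3, v3, f3⟩ := pm_step hOk (i2 P.l le_rfl) 23 .num .one .one
    (.load 20 ix1 0 0 * .reg 13 * .reg 13 / .load 22 ix1 0 0) (by simp) rfl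
  rw [e3]; clear e3
  obtain ⟨s4, e4, -, v4, f4⟩ := pm_step hOk i3 24 .num .one .one
    (.load 21 ix1 0 0 * .reg 13 * .reg 13 / .load 22 ix1 0 0) (by simp) rfl
  rw [e4]; clear e4
  have hb : ∀ x r : ℤ, |x| ≤ P.sg ^ 4 → |x * P.sg * P.sg / r| < P.cap := fun x r hx => by
    refine (abs_intDiv_le _ _).trans_lt (lt_of_le_of_lt ?_ hcap)
    rw [abs_mul, abs_mul, Nat.abs_cast]
    calc |x| * P.sg * P.sg ≤ (P.sg : ℤ) ^ 4 * P.sg * P.sg := by gcongr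
      _ = (P.sg : ℤ) ^ 6 := by ring
      _ ≤ _ := pow_le_pow_right₀ (by omega) (by norm_num)
  refine ⟨fun k hk => ?_, fun a ha => ?_⟩
  · obtain ⟨r, hr, hr1, hrl, hru⟩ := k1 k hk
    -- The final excess is at most 1/2 + 1, which fits into the tolerance 2.
    have hl1 : (P.lam : ℝ) / 2 ^ P.l = 1 := by
      rw [Par.lam]; push_cast; exact div_self (by positivity)
    rw [hl1] at hru
    refine ⟨r, hr1, abs_le.2 ⟨by linarith, by linarith⟩, ?_, ?_, ?_⟩
    · rw [f4 22 (by norm_num), f3 22 (by norm_num), hr]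
    · rw [f4 23 (by norm_num)]
      have e : Expr.eval (s2.branch k (0 : ℕ) (0 : ℕ))
          (.load 20 ix1 0 0 * .reg 13 * .reg 13 / .load 22 ix1 0 0)
          = s.mem 20 k 0 0 * P.sg * P.sg / r := by
        change s2.mem 20 k 0 0 * s2.reg 13 * s2.reg 13 / s2.mem 22 k 0 0 = _
        rw [k2 20 (by norm_num), hr, (i2 P.l le_rfl).r13]
      have := v3 k 0 0 hk Nat.one_pos Nat.one_pos (by rw [e]; exact hb _ _ (hz k hk).1)
      rw [e] at this
      exact this
    · have e : Expr.eval (s3.branch k (0 : ℕ) (0 : ℕ))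
          (.load 21 ix1 0 0 * .reg 13 * .reg 13 / .load 22 ix1 0 0)
          = s.mem 21 k 0 0 * P.sg * P.sg / r := by
        change s3.mem 21 k 0 0 * s3.reg 13 * s3.reg 13 / s3.mem 22 k 0 0 = _
        rw [f3 21 (by norm_num), f3 22 (by norm_num), k2 21 (by norm_num), hr, i3.r13]
      have := v4 k 0 0 hk Nat.one_pos Nat.one_pos (by rw [e]; exact hb _ _ (hz k hk).2.1)
      rw [e] at this
      exact this
  · rw [f4 a (by omega), f3 a (by omega), k2 a (by omega)]

theorem norm_fx_eq {D : ℝ} (hD : 0 < D) (x y : ℤ) :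
    ‖fx D x y‖ = √((x : ℝ) ^ 2 + (y : ℝ) ^ 2) / D := by
  rw [Complex.norm_def, Complex.normSq_apply, fx_re, fx_im]
  have : (x : ℝ) / D * (x / D) + y / D * (y / D) = (x ^ 2 + y ^ 2) / D ^ 2 := by field_simp
  rw [this, Real.sqrt_div (by positivity), Real.sqrt_sq hD.le]

/-- The phases of the approximate residuals. -/
noncomputable def phase (P : Par) (s : State) (k : Fin P.M) : ℝ :=
  (vec P s 20 (2 * P.sg ^ 2) k).arg

/-- The modulus of the residual is √(x² + y²)/(2 sg²), so r/(2 sg³) approximates it; sg²(x, y)/r is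
the unit vector of the phase at scale sg. -/
theorem uCmd_spec (hP : P.Fine n) (h : Inv P s)
    (hz : ∀ k : Fin P.M, |s.mem 20 k 0 0| ≤ P.sg ^ 4 ∧ |s.mem 21 k 0 0| ≤ P.sg ^ 4 ∧
      s.mem 20 k 0 0 ≠ 0) :
    (∀ k : Fin P.M,
      ‖vec P (uCmd.run s).state 23 P.sg k - Complex.exp (phase P s k * Complex.I)‖ ≤ 8 / P.sg ∧
      |((uCmd.run s).state.mem 22 k 0 0 : ℝ) / (2 * P.sg ^ 3)
        - ‖vec P s 20 (2 * P.sg ^ 2) k‖| ≤ 1 / (P.sg : ℝ)) ∧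
    ∀ a, (a < 22 ∨ 24 < a) → (uCmd.run s).state.mem a = s.mem a := by
  have hsgR : (8 : ℝ) ≤ P.sg := by exact_mod_cast hP.eight_le_sg
  have hsg0 : (0 : ℝ) < P.sg := by linarith
  obtain ⟨hm, hf⟩ := uCmd_mem hP h fun k hk => hz ⟨k, hk⟩
  refine ⟨fun k => ?_, hf⟩
  obtain ⟨r, hr1, hr, m22, m23, m24⟩ := hm k k.2
  set x : ℤ := s.mem 20 k 0 0 with hx
  set y : ℤ := s.mem 21 k 0 0 with hy
  set a : ℝ := √((x : ℝ) ^ 2 + (y : ℝ) ^ 2) with ha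
  have ha1 : 1 ≤ a := by
    rw [ha, Real.one_le_sqrt]
    have h1 : 0 < x * x := mul_self_pos.2 (hz k).2.2
    have h2 : 0 ≤ y * y := mul_self_nonneg y
    have : (1 : ℝ) ≤ x * x + y * y := by exact_mod_cast (by omega : 1 ≤ x * x + y * y)
    nlinarith
  have hxa : |(x : ℝ)| ≤ a := Real.abs_le_sqrt (by nlinarith [sq_nonneg (y : ℝ)])
  have hya : |(y : ℝ)| ≤ a := Real.abs_le_sqrt (by nlinarith [sq_nonneg (x : ℝ)])
  set z := vec P s 20 (2 * P.sg ^ 2) k with hzdef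
  have hzn : ‖z‖ = a / (2 * P.sg ^ 2) := norm_fx_eq (by positivity) _ _
  have hr0 : (0 : ℝ) < r := by exact_mod_cast hr1
  -- An absolute error of 2 is at most a quarter of sg · a ≥ 8.
  have hrl : P.sg * a * (3 / 4) ≤ r := by
    have := (abs_le.1 hr).1
    nlinarith
  constructor
  · have hu : Complex.exp (phase P s k * Complex.I) = ⟨x / a, y / a⟩ := by
      have h1 := Complex.norm_mul_exp_arg_mul_I z
      have h2 : (‖z‖ : ℂ) ≠ 0 := by
        rw [hzn, Complex.ofReal_ne_zero]
        have : 0 < a := by linarith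
        positivity
      have h3 : z = (‖z‖ : ℂ) * ⟨x / a, y / a⟩ := by
        apply Complex.ext
        · rw [Complex.re_ofReal_mul, hzn]
          change (x : ℝ) / (2 * P.sg ^ 2) = _
          field_simp
        · rw [Complex.im_ofReal_mul, hzn]
          change (y : ℝ) / (2 * P.sg ^ 2) = _
          field_simp
      exact mul_left_cancel₀ h2 (h1.trans h3)
    -- Replacing sg · a by r costs at most (4/3) · 2 < 3, the integer division one more.
    have hc : ∀ t : ℤ, |(t : ℝ)| ≤ a →
        |((t * P.sg * P.sg / r : ℤ) : ℝ) - P.sg * (t / a)| ≤ 4 := by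
      intro t ht
      have h1 := abs_intDiv_sub_le (t * P.sg * P.sg) (show 0 < r by omega)
      have h2 : |((t * P.sg * P.sg : ℤ) : ℝ) / r - P.sg * (t / a)| ≤ 3 := by
        have e : ((t * P.sg * P.sg : ℤ) : ℝ) / r - P.sg * (t / a)
            = -((t / a) * (P.sg / r) * (r - P.sg * a)) := by
          push_cast; field_simp; ring
        rw [e, abs_neg, abs_mul, abs_mul]
        have h3 : |(t : ℝ) / a| ≤ 1 := by
          rw [abs_div, abs_of_pos (show 0 < a by linarith)]
          exact div_le_one_of_le₀ ht (by linarith)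
        have h4 : |(P.sg : ℝ) / r| ≤ 4 / 3 := by
          rw [abs_of_pos (by positivity), div_le_iff₀ hr0]
          nlinarith
        calc |(t : ℝ) / a| * |(P.sg : ℝ) / r| * |(r : ℝ) - P.sg * a| ≤ 1 * (4 / 3) * 2 := by gcongr
          _ ≤ (3 : ℝ) := by norm_num
      refine (abs_sub_le _ (((t * P.sg * P.sg : ℤ) : ℝ) / r) _).trans ?_
      linarith
    rw [hu]
    refine (norm_fx_sub_le hsg0 (c := 4) ?_ ?_).trans (by norm_num)
    · rw [m23]; exact hc x hxa
    · rw [m24]; exact hc y hya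
  · rw [m22, hzn]
    have : (r : ℝ) / (2 * P.sg ^ 3) - a / (2 * P.sg ^ 2) = (r - P.sg * a) / (2 * P.sg ^ 3) := by
      field_simp
    rw [this, abs_div, abs_of_pos (show (0 : ℝ) < 2 * P.sg ^ 3 by positivity),
      div_le_div_iff₀ (by positivity) hsg0]
    have : (P.sg : ℝ) ≤ P.sg ^ 3 := le_self_pow₀ (by linarith) (by norm_num)
    nlinarith

end Phases

/-! ### Accumulating the loss matrix. -/

section Accumulation

variable {P : Par} {s : State} {n : ℕ}

/-- Numerators with denominator 2 sg²; the 2 clears the half in (S + S*)/2. The shift 2Mw is spread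
over the operators as 2W each, i.e. 4W sg² in the numerator. -/
def lossReExpr : Expr :=
  .load 8 ix1 ix2 0 + eqExpr ix1 ix2 * (2 * (.load 6 (.reg 9) 0 0 * .load 23 (.reg 9) 0 0
      + .load 7 (.reg 9) 0 0 * .load 24 (.reg 9) 0 0) + 4 * .reg 2 * .reg 13 * .reg 13)
    - (.load 23 (.reg 9) 0 0 * .load 4 (.reg 9) ix1 ix2
      - .load 24 (.reg 9) 0 0 * .load 5 (.reg 9) ix1 ix2)
    - (.load 23 (.reg 9) 0 0 * .load 4 (.reg 9) ix2 ix1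
      - .load 24 (.reg 9) 0 0 * .load 5 (.reg 9) ix2 ix1)

def lossImExpr : Expr :=
  .load 9 ix1 ix2 0
    - (.load 23 (.reg 9) 0 0 * .load 5 (.reg 9) ix1 ix2
      + .load 24 (.reg 9) 0 0 * .load 4 (.reg 9) ix1 ix2)
    + (.load 23 (.reg 9) 0 0 * .load 5 (.reg 9) ix2 ix1
      + .load 24 (.reg 9) 0 0 * .load 4 (.reg 9) ix2 ix1)

def accStep : Cmd :=
  .seq (pm 25 .one .one .one (.load 25 0 0 0 + .load 22 (.reg 9) 0 0)) <|
  .seq (pm 8 .dim .dim .one lossReExpr) <|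
  pm 9 .dim .dim .one lossImExpr

/-- Adds the loss matrix to the arrays `8` and `9`, and the moduli of the residuals to the array
`25`. -/
def accCmd : Cmd := .loop 9 (.reg 1) accStep

theorem cheap_accStep : Cheap accStep :=
  (Cheap.pm (by simp) rfl).seq <| (Cheap.pm (by simp) rfl).seq (Cheap.pm (by simp) rfl)

theorem cheap_accCmd : Cheap accCmd :=
  Cheap.loop (by norm_num) (by norm_num) (by norm_num) cheap_accStep

/-- The contribution of the `k`-th operator to the real part of the loss matrix. -/
def lossRe (P : Par) (s : State) (k i j : ℕ) : ℤ :=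
  (if (i : ℤ) = j then 1 else 0) * (2 * (s.mem 6 k 0 0 * s.mem 23 k 0 0
      + s.mem 7 k 0 0 * s.mem 24 k 0 0) + 4 * P.W * P.sg * P.sg)
    - (s.mem 23 k 0 0 * s.mem 4 k i j - s.mem 24 k 0 0 * s.mem 5 k i j)
    - (s.mem 23 k 0 0 * s.mem 4 k j i - s.mem 24 k 0 0 * s.mem 5 k j i)

/-- The contribution of the `k`-th operator to the imaginary part of the loss matrix. -/
def lossIm (s : State) (k i j : ℕ) : ℤ :=
  -(s.mem 23 k 0 0 * s.mem 5 k i j + s.mem 24 k 0 0 * s.mem 4 k i j)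
    + (s.mem 23 k 0 0 * s.mem 5 k j i + s.mem 24 k 0 0 * s.mem 4 k j i)

/-- One operator changes each accumulator by at most sg⁶. B is the bound inherited from earlier
rounds, so clamping stays inactive as long as B + M sg⁶ is below `cap`. -/
theorem accCmd_mem (hP : P.Fine n) (h : Inv P s) {B : ℤ} (hBc : B + P.M * P.sg ^ 6 < P.cap)
    (hQ : ∀ k i j : ℕ, k < P.M → i < P.d → j < P.d →
      |s.mem 4 k i j| ≤ P.sg ^ 2 ∧ |s.mem 5 k i j| ≤ P.sg ^ 2)
    (hp : ∀ k : ℕ, k < P.M → |s.mem 6 k 0 0| ≤ P.sg ^ 2 ∧ |s.mem 7 k 0 0| ≤ P.sg ^ 2)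
    (hu : ∀ k : ℕ, k < P.M → |s.mem 23 k 0 0| ≤ P.sg ^ 2 ∧ |s.mem 24 k 0 0| ≤ P.sg ^ 2)
    (hr : ∀ k : ℕ, k < P.M → |s.mem 22 k 0 0| ≤ P.sg ^ 6)
    (hB : ∀ i j : ℕ, i < P.d → j < P.d → |s.mem 8 i j 0| ≤ B ∧ |s.mem 9 i j 0| ≤ B)
    (hB' : |s.mem 25 0 0 0| ≤ B) :
    (∀ i j : ℕ, i < P.d → j < P.d →
      (accCmd.run s).state.mem 8 i j 0
        = s.mem 8 i j 0 + ∑ k ∈ Finset.range P.M, lossRe P s k i j ∧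
      (accCmd.run s).state.mem 9 i j 0
        = s.mem 9 i j 0 + ∑ k ∈ Finset.range P.M, lossIm s k i j ∧
      |(accCmd.run s).state.mem 8 i j 0| ≤ B + P.M * P.sg ^ 6 ∧
      |(accCmd.run s).state.mem 9 i j 0| ≤ B + P.M * P.sg ^ 6) ∧
    (accCmd.run s).state.mem 25 0 0 0
        = s.mem 25 0 0 0 + ∑ k ∈ Finset.range P.M, s.mem 22 k 0 0 ∧
    |(accCmd.run s).state.mem 25 0 0 0| ≤ B + P.M * P.sg ^ 6 ∧
    ∀ a, a ≠ 8 → a ≠ 9 → a ≠ 25 → (accCmd.run s).state.mem a = s.mem a := by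
  have hOk := hP.toOk
  have hsg8 : (8 : ℤ) ≤ P.sg := by exact_mod_cast hP.eight_le_sg
  have hW : (P.W : ℤ) ≤ P.sg := by exact_mod_cast hP.W_le'.trans hP.n_le_sg
  set g : ℤ := (P.sg : ℤ) with hg
  have hm : ∀ {x y : ℤ}, |x| ≤ g ^ 2 → |y| ≤ g ^ 2 → |x * y| ≤ g ^ 4 := fun {x y} hx hy => by
    rw [abs_mul, show g ^ 4 = g ^ 2 * g ^ 2 by ring]
    exact mul_le_mul hx hy (abs_nonneg _) (by positivity)
  have h46 : 64 * g ^ 4 ≤ g ^ 6 := by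
    calc 64 * g ^ 4 ≤ g * g * g ^ 4 := by gcongr; nlinarith
      _ = g ^ 6 := by ring
  have h04 : 0 ≤ g ^ 4 := by positivity
  have hWg : 4 * P.W * g * g ≤ 4 * g ^ 4 := by
    calc 4 * P.W * g * g ≤ 4 * g * g * g := by gcongr
      _ = 4 * g ^ 3 := by ring
      _ ≤ 4 * g ^ 4 := by gcongr <;> omega
  have hWg0 : 0 ≤ 4 * P.W * g * g := by positivity
  have bre : ∀ k i j : ℕ, k < P.M → i < P.d → j < P.d → |lossRe P s k i j| ≤ g ^ 6 := by
    intro k i j hk hi hj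
    have a1 := abs_le.1 (hm (hp k hk).1 (hu k hk).1)
    have a2 := abs_le.1 (hm (hp k hk).2 (hu k hk).2)
    have a3 := abs_le.1 (hm (hu k hk).1 (hQ k i j hk hi hj).1)
    have a4 := abs_le.1 (hm (hu k hk).2 (hQ k i j hk hi hj).2)
    have a5 := abs_le.1 (hm (hu k hk).1 (hQ k j i hk hj hi).1)
    have a6 := abs_le.1 (hm (hu k hk).2 (hQ k j i hk hj hi).2)
    rw [lossRe, abs_le]
    split_ifs <;> constructor <;> linarith
  have bim : ∀ k i j : ℕ, k < P.M → i < P.d → j < P.d → |lossIm s k i j| ≤ g ^ 6 := by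
    intro k i j hk hi hj
    have a3 := abs_le.1 (hm (hu k hk).1 (hQ k i j hk hi hj).2)
    have a4 := abs_le.1 (hm (hu k hk).2 (hQ k i j hk hi hj).1)
    have a5 := abs_le.1 (hm (hu k hk).1 (hQ k j i hk hj hi).2)
    have a6 := abs_le.1 (hm (hu k hk).2 (hQ k j i hk hj hi).1)
    rw [lossIm, abs_le]
    constructor <;> linarith
  obtain ⟨e, i1, j1⟩ := loop_step hOk h (x := 9) h.r1 hOk.M_le (by norm_num) (by norm_num)
    cheap_accStep
  have e' : (accCmd.run s).state = loopState 9 accStep s P.M := e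
  rw [e']
  have key : ∀ m ≤ P.M, (∀ i j : ℕ, i < P.d → j < P.d →
      (loopState 9 accStep s m).mem 8 i j 0
        = s.mem 8 i j 0 + ∑ k ∈ Finset.range m, lossRe P s k i j ∧
      (loopState 9 accStep s m).mem 9 i j 0
        = s.mem 9 i j 0 + ∑ k ∈ Finset.range m, lossIm s k i j ∧
      |(loopState 9 accStep s m).mem 8 i j 0| ≤ B + m * g ^ 6 ∧
      |(loopState 9 accStep s m).mem 9 i j 0| ≤ B + m * g ^ 6) ∧
    (loopState 9 accStep s m).mem 25 0 0 0
        = s.mem 25 0 0 0 + ∑ k ∈ Finset.range m, s.mem 22 k 0 0 ∧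
    |(loopState 9 accStep s m).mem 25 0 0 0| ≤ B + m * g ^ 6 ∧
    ∀ a, a ≠ 8 → a ≠ 9 → a ≠ 25 → (loopState 9 accStep s m).mem a = s.mem a := by
    intro m
    induction m with
    | zero =>
      intro _
      refine ⟨fun i j hi hj => ⟨?_, ?_, ?_, ?_⟩, ?_, ?_, fun a _ _ _ => rfl⟩
      · simp [loopState]
      · simp [loopState]
      · simpa [loopState] using (hB i j hi hj).1
      · simpa [loopState] using (hB i j hi hj).2
      · simp [loopState]
      · simpa [loopState] using hB'
    | succ m ih =>
      intro hmM
      obtain ⟨ih1, ih2, ih3, ih4⟩ := ih (by omega)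
      have hmlt : m < P.M := by omega
      have hcapm : B + (m + 1 : ℕ) * g ^ 6 < P.cap := by
        refine lt_of_le_of_lt ?_ hBc
        gcongr
      have hstep : B + (m + 1 : ℕ) * g ^ 6 = B + m * g ^ 6 + g ^ 6 := by push_cast; ring
      have hJ := j1 m hmlt
      set t := loopState 9 accStep s m with ht
      have hreg9 : (t.setReg 9 m).reg 9 = m := by simp [State.setReg]
      have hl : loopState 9 accStep s (m + 1) = (accStep.run (t.setReg 9 m)).state := rfl
      rw [hl]
      simp only [accStep, run_seq_state]
      obtain ⟨s1, e1, i1', v1, f1⟩ := pm_step hOk hJ 25 .one .one .one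
        (.load 25 0 0 0 + .load 22 (.reg 9) 0 0) (by simp) rfl
      obtain ⟨r1, hr1⟩ : ∃ r, s1.reg = r := ⟨_, rfl⟩
      have g1 : s1.reg = (t.setReg 9 m).reg := by rw [← e1]; exact pmap_reg _ _ _ _ _ _
      rw [e1]; clear e1
      obtain ⟨s2, e2, i2, v2, f2⟩ := pm_step hOk i1' 8 .dim .dim .one lossReExpr (by simp) rfl
      have g2 : s2.reg = (t.setReg 9 m).reg := by
        rw [← e2, ← g1]; exact pmap_reg _ _ _ _ _ _
      rw [e2]; clear e2
      obtain ⟨s3, e3, i3, v3, f3⟩ := pm_step hOk i2 9 .dim .dim .one lossImExpr (by simp) rfl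
      rw [e3]; clear e3
      have q1 : ∀ a, a ≠ 8 → a ≠ 9 → a ≠ 25 → s1.mem a = s.mem a := fun a h8 h9 h25 => by
        rw [f1 a h25]; exact ih4 a h8 h9 h25
      have q2 : ∀ a, a ≠ 8 → a ≠ 9 → a ≠ 25 → s2.mem a = s.mem a := fun a h8 h9 h25 => by
        rw [f2 a h8]; exact q1 a h8 h9 h25
      have w1 : s1.mem 25 0 0 0
          = s.mem 25 0 0 0 + ∑ k ∈ Finset.range (m + 1), s.mem 22 k 0 0 ∧
          |s1.mem 25 0 0 0| ≤ B + (m + 1 : ℕ) * g ^ 6 := by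
        have e : Expr.eval ((t.setReg 9 m).branch (0 : ℕ) (0 : ℕ) (0 : ℕ))
            (.load 25 0 0 0 + .load 22 (.reg 9) 0 0)
            = t.mem 25 0 0 0 + s.mem 22 m 0 0 := by
          change t.mem 25 0 0 0 + t.mem 22 ((t.setReg 9 m).reg 9) 0 0 = _
          rw [hreg9, ih4 22 (by norm_num) (by norm_num) (by norm_num)]
        have hb : |t.mem 25 0 0 0 + s.mem 22 m 0 0| ≤ B + (m + 1 : ℕ) * g ^ 6 := by
          rw [hstep]
          exact (abs_add_le _ _).trans (add_le_add ih3 (hr m hmlt))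
        have := v1 0 0 0 Nat.one_pos Nat.one_pos Nat.one_pos (by rw [e]; exact hb.trans_lt hcapm)
        rw [e] at this
        have hv : s1.mem 25 0 0 0 = t.mem 25 0 0 0 + s.mem 22 m 0 0 := this
        rw [hv]
        exact ⟨by rw [ih2, Finset.sum_range_succ, add_assoc], hb⟩
      have w2 : ∀ i j : ℕ, i < P.d → j < P.d → s2.mem 8 i j 0
          = s.mem 8 i j 0 + ∑ k ∈ Finset.range (m + 1), lossRe P s k i j ∧
          |s2.mem 8 i j 0| ≤ B + (m + 1 : ℕ) * g ^ 6 := by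
        intro i j hi hj
        have e : Expr.eval (s1.branch i j (0 : ℕ)) lossReExpr
            = t.mem 8 i j 0 + lossRe P s m i j := by
          have e0 : Expr.eval (s1.branch i j (0 : ℕ)) (eqExpr ix1 ix2)
            = if (i : ℤ) = j then 1 else 0 := eval_eqExpr _ _ _
          have e9 : (s1.branch i j (0 : ℕ)).reg 9 = m := by
            rw [State.branch_reg _ _ _ _ (by decide), g1, hreg9]
          have e13 : (s1.branch i j (0 : ℕ)).reg 13 = g := by
            rw [State.branch_reg _ _ _ _ (by decide), i1'.r13]
          have e2 : (s1.branch i j (0 : ℕ)).reg 2 = P.W := by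
            rw [State.branch_reg _ _ _ _ (by decide), i1'.r2]
          have z : ∀ k : ℕ, (OfNat.ofNat k : Expr).eval (s1.branch i j (0 : ℕ)) = k :=
            fun _ => rfl
          simp only [lossReExpr, Expr.eval_add, Expr.eval_sub, Expr.eval_mul, Expr.eval_load,
            Expr.eval_reg, e0, e9, e13, e2, State.branch_mem, State.branch_reg4,
            State.branch_reg5]
          change s1.mem 8 i j 0 + (if (i : ℤ) = j then 1 else 0) * (2 * (s1.mem 6 m 0 0 *
            s1.mem 23 m 0 0 + s1.mem 7 m 0 0 * s1.mem 24 m 0 0) + 4 * P.W * g * g) -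
            (s1.mem 23 m 0 0 * s1.mem 4 m i j - s1.mem 24 m 0 0 * s1.mem 5 m i j) -
            (s1.mem 23 m 0 0 * s1.mem 4 m j i - s1.mem 24 m 0 0 * s1.mem 5 m j i) = _
          rw [f1 8 (by norm_num), q1 6 (by norm_num) (by norm_num) (by norm_num),
            q1 23 (by norm_num) (by norm_num) (by norm_num),
            q1 7 (by norm_num) (by norm_num) (by norm_num),
            q1 24 (by norm_num) (by norm_num) (by norm_num),
            q1 4 (by norm_num) (by norm_num) (by norm_num),
            q1 5 (by norm_num) (by norm_num) (by norm_num), lossRe, State.setReg_mem]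
          ring
        have hb : |t.mem 8 i j 0 + lossRe P s m i j| ≤ B + (m + 1 : ℕ) * g ^ 6 := by
          rw [hstep]
          exact (abs_add_le _ _).trans (add_le_add (ih1 i j hi hj).2.2.1 (bre m i j hmlt hi hj))
        have := v2 i j 0 hi hj Nat.one_pos (by rw [e]; exact hb.trans_lt hcapm)
        rw [e] at this
        have hv : s2.mem 8 i j 0 = t.mem 8 i j 0 + lossRe P s m i j := this
        rw [hv]
        exact ⟨by rw [(ih1 i j hi hj).1, Finset.sum_range_succ, add_assoc], hb⟩
      have w3 : ∀ i j : ℕ, i < P.d → j < P.d → s3.mem 9 i j 0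
          = s.mem 9 i j 0 + ∑ k ∈ Finset.range (m + 1), lossIm s k i j ∧
          |s3.mem 9 i j 0| ≤ B + (m + 1 : ℕ) * g ^ 6 := by
        intro i j hi hj
        have e : Expr.eval (s2.branch i j (0 : ℕ)) lossImExpr
            = t.mem 9 i j 0 + lossIm s m i j := by
          have e9 : (s2.branch i j (0 : ℕ)).reg 9 = m := by
            rw [State.branch_reg _ _ _ _ (by decide), g2, hreg9]
          simp only [lossImExpr, Expr.eval_add, Expr.eval_sub, Expr.eval_mul, Expr.eval_load,
            Expr.eval_reg, e9, State.branch_mem, State.branch_reg4,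
            State.branch_reg5]
          change s2.mem 9 i j 0 -
            (s2.mem 23 m 0 0 * s2.mem 5 m i j + s2.mem 24 m 0 0 * s2.mem 4 m i j) +
            (s2.mem 23 m 0 0 * s2.mem 5 m j i + s2.mem 24 m 0 0 * s2.mem 4 m j i) = _
          rw [f2 9 (by norm_num), f1 9 (by norm_num),
            q2 23 (by norm_num) (by norm_num) (by norm_num),
            q2 24 (by norm_num) (by norm_num) (by norm_num),
            q2 4 (by norm_num) (by norm_num) (by norm_num),
            q2 5 (by norm_num) (by norm_num) (by norm_num), lossIm, State.setReg_mem]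
          ring
        have hb : |t.mem 9 i j 0 + lossIm s m i j| ≤ B + (m + 1 : ℕ) * g ^ 6 := by
          rw [hstep]
          exact (abs_add_le _ _).trans (add_le_add (ih1 i j hi hj).2.2.2 (bim m i j hmlt hi hj))
        have := v3 i j 0 hi hj Nat.one_pos (by rw [e]; exact hb.trans_lt hcapm)
        rw [e] at this
        have hv : s3.mem 9 i j 0 = t.mem 9 i j 0 + lossIm s m i j := this
        rw [hv]
        exact ⟨by rw [(ih1 i j hi hj).2.1, Finset.sum_range_succ, add_assoc], hb⟩
      refine ⟨fun i j hi hj => ⟨?_, (w3 i j hi hj).1, ?_, (w3 i j hi hj).2⟩, ?_, ?_,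
        fun a h8 h9 h25 => by rw [f3 a h9]; exact q2 a h8 h9 h25⟩
      · rw [f3 8 (by norm_num)]; exact (w2 i j hi hj).1
      · rw [f3 8 (by norm_num)]; exact (w2 i j hi hj).2
      · rw [f3 25 (by norm_num), f2 25 (by norm_num)]; exact w1.1
      · rw [f3 25 (by norm_num), f2 25 (by norm_num)]; exact w1.2
  exact key P.M le_rfl

end Accumulation

/-! ### Accuracy of the loss matrix. -/

section LossSpec

open scoped Matrix.Norms.L2Operator
open Matrix

/-- The loss matrix for the numbers `u` in place of the `e ^ (iφ)`. -/
noncomputable def lossAt {d M : ℕ} (Q : Fin M → Matrix (Fin d) (Fin d) ℂ) (p : Fin M → ℂ) (w : ℝ)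
    (u : Fin M → ℂ) : Matrix (Fin d) (Fin d) ℂ :=
  (((∑ k, p k * star (u k)).re : ℝ) : ℂ) • 1
    - (1 / 2 : ℂ) • ((∑ k, u k • Q k) + (∑ k, u k • Q k)ᴴ) + ((2 * M * w : ℝ) : ℂ) • 1

section General

variable {d M : ℕ} {Q Q' : Fin M → Matrix (Fin d) (Fin d) ℂ} {p p' u u' : Fin M → ℂ} {w : ℝ}

theorem lossAt_exp (Q : Fin M → Matrix (Fin d) (Fin d) ℂ) (p : Fin M → ℂ) (w : ℝ)
    (φ : Fin M → ℝ) : lossAt Q p w (fun k => Complex.exp (φ k * Complex.I)) = loss Q p w φ := by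
  have : ∀ k, star (Complex.exp (φ k * Complex.I)) = Complex.exp (-(φ k * Complex.I)) := fun k => by
    rw [Complex.star_def, ← Complex.exp_conj]; simp
  simp only [lossAt, this]
  rfl

/-- The numbers u need not have modulus one. Hence the computed losses are exactly Hermitian and the
regret bound applies to them without any correction. -/
theorem isHermitian_lossAt : (lossAt Q p w u).IsHermitian := by
  refine ((isHermitian_ofReal_smul_one _).sub ?_).add (isHermitian_ofReal_smul_one _)
  have h : (1 / 2 : ℂ) = ((1 / 2 : ℝ) : ℂ) := by push_cast; rfl
  rw [IsHermitian, h, conjTranspose_smul, (isHermitian_add_transpose_self _).eq]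
  simp

theorem norm_mul_sub_mul_le {x x' y y' : ℂ} {a b : ℝ} (hx : ‖x' - x‖ ≤ a) (hy : ‖y' - y‖ ≤ a)
    (hx' : ‖x'‖ ≤ b) (hy1 : ‖y‖ ≤ 1) : ‖x' * y' - x * y‖ ≤ (b + 1) * a := by
  have e : x' * y' - x * y = x' * (y' - y) + (x' - x) * y := by ring
  have ha : 0 ≤ a := (norm_nonneg _).trans hx
  have hb : 0 ≤ b := (norm_nonneg _).trans hx'
  rw [e]
  refine (norm_add_le _ _).trans ?_
  rw [norm_mul, norm_mul]
  have h1 : ‖x'‖ * ‖y' - y‖ ≤ b * a := by gcongr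
  have h2 : ‖x' - x‖ * ‖y‖ ≤ a * 1 := by gcongr
  linarith

theorem norm_lossAt_sub_le {a b : ℝ} (hQ : ∀ k i j, ‖Q' k i j - Q k i j‖ ≤ a)
    (hp : ∀ k, ‖p' k - p k‖ ≤ a) (hu : ∀ k, ‖u' k - u k‖ ≤ a) (hu1 : ∀ k, ‖u k‖ ≤ 1)
    (hQ' : ∀ k i j, ‖Q' k i j‖ ≤ b) (hp' : ∀ k, ‖p' k‖ ≤ b) (i j : Fin d) :
    ‖(lossAt Q' p' w u' - lossAt Q p w u) i j‖ ≤ 2 * M * ((b + 1) * a) := by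
  set S := ∑ k, u k • Q k with hS
  set S' := ∑ k, u' k • Q' k with hS'
  have h1 : ∀ i j, ‖S' i j - S i j‖ ≤ M * ((b + 1) * a) := by
    intro i j
    rw [hS, hS', Matrix.sum_apply, Matrix.sum_apply, ← Finset.sum_sub_distrib]
    refine (norm_sum_le _ _).trans ?_
    calc _ ≤ ∑ k : Fin M, (b + 1) * a := Finset.sum_le_sum fun k _ => by
          have := norm_mul_sub_mul_le (hQ k i j) (hu k) (hQ' k i j) (hu1 k)
          simpa [mul_comm] using this
      _ = _ := by simp
  have h2 : |(∑ k, p' k * star (u' k)).re - (∑ k, p k * star (u k)).re| ≤ M * ((b + 1) * a) := by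
    rw [← Complex.sub_re, ← Finset.sum_sub_distrib]
    refine (Complex.abs_re_le_norm _).trans ((norm_sum_le _ _).trans ?_)
    calc _ ≤ ∑ k : Fin M, (b + 1) * a := Finset.sum_le_sum fun k _ =>
          norm_mul_sub_mul_le (hp k) (by rw [← star_sub, norm_star]; exact hu k) (hp' k)
            (by rw [norm_star]; exact hu1 k)
      _ = _ := by simp
  have e : (lossAt Q' p' w u' - lossAt Q p w u) i j
      = (((∑ k, p' k * star (u' k)).re - (∑ k, p k * star (u k)).re : ℝ) : ℂ)
          * (1 : Matrix (Fin d) (Fin d) ℂ) i j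
        - 1 / 2 * ((S' i j - S i j) + star (S' j i - S j i)) := by
    simp only [lossAt, ← hS, ← hS', Matrix.sub_apply, Matrix.add_apply, Matrix.smul_apply,
      smul_eq_mul, conjTranspose_apply, star_sub]
    push_cast
    ring
  rw [e]
  refine (norm_sub_le _ _).trans ?_
  have h3 : ‖(((∑ k, p' k * star (u' k)).re - (∑ k, p k * star (u k)).re : ℝ) : ℂ)
      * (1 : Matrix (Fin d) (Fin d) ℂ) i j‖ ≤ M * ((b + 1) * a) := by
    rw [norm_mul, Complex.norm_real, Real.norm_eq_abs]
    refine (mul_le_of_le_one_right (abs_nonneg _) ?_).trans h2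
    rw [Matrix.one_apply]; split_ifs <;> simp
  have h4 : ‖1 / 2 * ((S' i j - S i j) + star (S' j i - S j i))‖ ≤ M * ((b + 1) * a) := by
    rw [norm_mul]
    have h5 := norm_add_le (S' i j - S i j) (star (S' j i - S j i))
    rw [norm_star] at h5
    have h6 := h1 i j
    have h7 := h1 j i
    have h8 : ‖(1 / 2 : ℂ)‖ = 1 / 2 := by norm_num
    rw [h8]
    linarith
  linarith

end General

variable {P : Par} {s : State} {n : ℕ} {Q : Fin P.M → Matrix (Fin P.d) (Fin P.d) ℂ}
  {p : Fin P.M → ℂ}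

theorem abs_le_sq_of_norm_fx_le (hsg : 1 ≤ P.sg) {x y : ℤ} {c : ℝ} (hc : c ≤ P.sg)
    (h : ‖fx P.sg x y‖ ≤ c) : |x| ≤ (P.sg : ℤ) ^ 2 ∧ |y| ≤ (P.sg : ℤ) ^ 2 := by
  have hsg0 : (0 : ℝ) < P.sg := by exact_mod_cast hsg
  have h1 := abs_le_of_norm_fx_le hsg0 h
  have h2 : c * P.sg ≤ (P.sg : ℝ) ^ 2 := by rw [sq]; gcongr
  exact ⟨by exact_mod_cast h1.1.trans h2, by exact_mod_cast h1.2.trans h2⟩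

theorem Holds.norm_opHat_le (hin : Holds P Q p s) (hP : P.Fine n) (hQ : IsInstance P.W Q p)
    (k : Fin P.M) (i j : Fin P.d) : ‖opHat P s k i j‖ ≤ P.W + 1 := by
  have h1 := norm_add_le (opHat P s k i j - Q k i j) (Q k i j)
  rw [sub_add_cancel] at h1
  have h2 := hin.opHat_sub_le hP.toOk k i j
  have h3 := (norm_entry_le_norm (Q k) i j).trans (hQ.1 k)
  have hsg8 : (8 : ℝ) ≤ P.sg := by exact_mod_cast hP.eight_le_sg
  have hdiv : (2 : ℝ) / P.sg ≤ 1 := by rw [div_le_one (by linarith)]; linarith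
  linarith

theorem Holds.norm_vec_le (hin : Holds P Q p s) (hP : P.Fine n) (hQ : IsInstance P.W Q p)
    (k : Fin P.M) : ‖vec P s 6 P.sg k‖ ≤ P.W + 1 := by
  have h1 := norm_add_le (vec P s 6 P.sg k - p k) (p k)
  rw [sub_add_cancel] at h1
  have h2 := hin.vec_sub_le hP.toOk k
  have h3 := hQ.2 k
  have hsg8 : (8 : ℝ) ≤ P.sg := by exact_mod_cast hP.eight_le_sg
  have hdiv : (2 : ℝ) / P.sg ≤ 1 := by rw [div_le_one (by linarith)]; linarith
  linarith

/-- Accumulation involves no rounding: the increments form exactly the loss matrix of the rounded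
operators, the rounded point and the rounded phases. -/
theorem sum_lossRe_lossIm (hP : P.Ok) (i j : Fin P.d) :
    fx (2 * P.sg ^ 2) (∑ k ∈ Finset.range P.M, lossRe P s k i j)
      (∑ k ∈ Finset.range P.M, lossIm s k i j)
      = lossAt (opHat P s) (vec P s 6 P.sg) P.W (vec P s 23 P.sg) i j := by
  have hsg : (P.sg : ℝ) ≠ 0 := by have := hP.sg_pos; positivity
  rw [← Fin.sum_univ_eq_sum_range (fun k => lossRe P s k i j),
    ← Fin.sum_univ_eq_sum_range (fun k => lossIm s k i j)]
  have hij : ((i : ℕ) : ℤ) = ((j : ℕ) : ℤ) ↔ i = j := by rw [Nat.cast_inj, Fin.ext_iff]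
  have hM : ((2 * P.M * P.W : ℝ) : ℂ) = ∑ k : Fin P.M, ((2 * P.W : ℝ) : ℂ) := by
    simp; ring
  have e : lossAt (opHat P s) (vec P s 6 P.sg) P.W (vec P s 23 P.sg) i j
      = ∑ k : Fin P.M, (((((vec P s 6 P.sg k * star (vec P s 23 P.sg k)).re : ℝ) : ℂ)
          + ((2 * P.W : ℝ) : ℂ)) * (1 : Matrix (Fin P.d) (Fin P.d) ℂ) i j
        - 1 / 2 * (vec P s 23 P.sg k * opHat P s k i j
          + star (vec P s 23 P.sg k * opHat P s k j i))) := by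
    simp only [lossAt, Matrix.sub_apply, Matrix.add_apply, Matrix.smul_apply, smul_eq_mul,
      conjTranspose_apply, Matrix.sum_apply, hM, Complex.re_sum, Complex.ofReal_sum,
      Finset.sum_sub_distrib, ← Finset.mul_sum, Finset.sum_add_distrib, ← Finset.sum_mul, star_sum]
    ring
  rw [e]
  apply Complex.ext
  · rw [fx_re, Complex.re_sum]
    rw [Int.cast_sum, Finset.sum_div]
    refine Finset.sum_congr rfl fun k _ => ?_
    have h1 : ((1 : Matrix (Fin P.d) (Fin P.d) ℂ) i j) = ((if i = j then 1 else 0 : ℝ) : ℂ) := by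
      rw [Matrix.one_apply]; split_ifs <;> simp
    have h2 : (1 / 2 : ℂ) = ((1 / 2 : ℝ) : ℂ) := by push_cast; rfl
    rw [h1, h2, Complex.sub_re, ← Complex.ofReal_add, ← Complex.ofReal_mul, Complex.ofReal_re,
      Complex.re_ofReal_mul]
    simp only [lossRe, hij, Complex.add_re, Complex.mul_re, Complex.star_def, Complex.conj_re,
      Complex.conj_im, vec, opHat, fx_re, fx_im]
    push_cast
    field_simp
    split_ifs <;> ring
  · rw [fx_im, Complex.im_sum]
    rw [Int.cast_sum, Finset.sum_div]
    refine Finset.sum_congr rfl fun k _ => ?_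
    have h1 : ((1 : Matrix (Fin P.d) (Fin P.d) ℂ) i j) = ((if i = j then 1 else 0 : ℝ) : ℂ) := by
      rw [Matrix.one_apply]; split_ifs <;> simp
    have h2 : (1 / 2 : ℂ) = ((1 / 2 : ℝ) : ℂ) := by push_cast; rfl
    rw [h1, h2, Complex.sub_im, ← Complex.ofReal_add, ← Complex.ofReal_mul, Complex.ofReal_im,
      Complex.im_ofReal_mul]
    simp only [lossIm, Complex.add_im, Complex.mul_im, Complex.star_def, Complex.conj_im, vec,
      opHat, fx_re, fx_im]
    push_cast
    field_simp
    ring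

/-- Operators, point and phases are accurate to 8/sg, and each product of two of them to (W + 2) ·
8/sg ≤ 24W/sg. The M products enter once in the scalar part and once in (S + S*)/2. -/
theorem accCmd_spec (hP : P.Fine n) (h : Inv P s) (hin : Holds P Q p s) (hQ : IsInstance P.W Q p)
    {B : ℤ} (hBc : B + P.M * P.sg ^ 6 < P.cap) {φ : Fin P.M → ℝ}
    (hu : ∀ k, ‖vec P s 23 P.sg k - Complex.exp (φ k * Complex.I)‖ ≤ 8 / P.sg)
    (hr : ∀ k : Fin P.M, |s.mem 22 k 0 0| ≤ P.sg ^ 6)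
    (hB : ∀ i j : ℕ, i < P.d → j < P.d → |s.mem 8 i j 0| ≤ B ∧ |s.mem 9 i j 0| ≤ B)
    (hB' : |s.mem 25 0 0 0| ≤ B) :
    (mat P (accCmd.run s).state 8 (2 * P.sg ^ 2) - mat P s 8 (2 * P.sg ^ 2)).IsHermitian ∧
    (∀ i j, ‖(mat P (accCmd.run s).state 8 (2 * P.sg ^ 2) - mat P s 8 (2 * P.sg ^ 2)
      - loss Q p P.W φ) i j‖ ≤ 48 * P.M * P.W / P.sg) ∧
    (accCmd.run s).state.mem 25 0 0 0 = s.mem 25 0 0 0 + ∑ k : Fin P.M, s.mem 22 k 0 0 ∧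
    (∀ i j : ℕ, i < P.d → j < P.d → |(accCmd.run s).state.mem 8 i j 0| ≤ B + P.M * P.sg ^ 6 ∧
      |(accCmd.run s).state.mem 9 i j 0| ≤ B + P.M * P.sg ^ 6) ∧
    |(accCmd.run s).state.mem 25 0 0 0| ≤ B + P.M * P.sg ^ 6 ∧
    ∀ a, a ≠ 8 → a ≠ 9 → a ≠ 25 → (accCmd.run s).state.mem a = s.mem a := by
  have hOk := hP.toOk
  have hsg8 : (8 : ℝ) ≤ P.sg := by exact_mod_cast hP.eight_le_sg
  have hsg0 : (0 : ℝ) < P.sg := by linarith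
  have hd1 : (1 : ℝ) ≤ (P.d : ℝ) ^ 2 := one_le_pow₀ (by exact_mod_cast hP.d_pos)
  have hW1 : (1 : ℝ) ≤ P.W := by exact_mod_cast hP.W_pos
  have hdW := hP.small_dW
  have hWsg : (P.W : ℝ) + 1 ≤ P.sg := by nlinarith
  have bu : ∀ k, ‖vec P s 23 P.sg k‖ ≤ 2 := fun k => by
    have h1 := norm_add_le (vec P s 23 P.sg k - Complex.exp (φ k * Complex.I))
      (Complex.exp (φ k * Complex.I))
    rw [sub_add_cancel, Complex.norm_exp_ofReal_mul_I] at h1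
    have h2 : (8 : ℝ) / P.sg ≤ 1 := by rw [div_le_one hsg0]; linarith
    linarith [hu k]
  obtain ⟨m1, m2, m3, m4⟩ := accCmd_mem hP h hBc
    (fun k i j hk hi hj => abs_le_sq_of_norm_fx_le hP.sg_pos hWsg
      (hin.norm_opHat_le hP hQ ⟨k, hk⟩ ⟨i, hi⟩ ⟨j, hj⟩))
    (fun k hk => abs_le_sq_of_norm_fx_le hP.sg_pos hWsg (hin.norm_vec_le hP hQ ⟨k, hk⟩))
    (fun k hk => abs_le_sq_of_norm_fx_le hP.sg_pos (c := 2) (by linarith) (bu ⟨k, hk⟩))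
    (fun k hk => hr ⟨k, hk⟩) hB hB'
  set s' := (accCmd.run s).state with hs'
  have e : mat P s' 8 (2 * P.sg ^ 2) - mat P s 8 (2 * P.sg ^ 2)
      = lossAt (opHat P s) (vec P s 6 P.sg) P.W (vec P s 23 P.sg) := by
    ext i j
    rw [← sum_lossRe_lossIm hOk, Matrix.sub_apply, mat, mat, (m1 i j i.2 j.2).1,
      (m1 i j i.2 j.2).2.1]
    apply Complex.ext
    · simp only [Complex.sub_re, fx_re]; push_cast; ring
    · simp only [Complex.sub_im, fx_im]; push_cast; ring
  refine ⟨?_, fun i j => ?_, ?_, fun i j hi hj => ⟨(m1 i j hi hj).2.2.1, (m1 i j hi hj).2.2.2⟩,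
    m3, m4⟩
  · rw [e]; exact isHermitian_lossAt
  · rw [e, ← lossAt_exp]
    have h28 : (2 : ℝ) / P.sg ≤ 8 / P.sg := by gcongr; norm_num
    refine (norm_lossAt_sub_le (a := 8 / P.sg) (b := P.W + 1)
      (fun k i j => (hin.opHat_sub_le hOk k i j).trans h28)
      (fun k => (hin.vec_sub_le hOk k).trans h28) hu
      (fun k => (Complex.norm_exp_ofReal_mul_I _).le)
      (fun k i j => hin.norm_opHat_le hP hQ k i j) (fun k => hin.norm_vec_le hP hQ k) i j).trans ?_
    calc 2 * (P.M : ℝ) * ((P.W + 1 + 1) * (8 / P.sg)) ≤ 2 * P.M * ((3 * P.W) * (8 / P.sg)) := by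
          gcongr; linarith
      _ = _ := by ring
  · rw [m2, ← Fin.sum_univ_eq_sum_range (fun k => s.mem 22 k 0 0)]

end LossSpec

/-! ### One round. -/

section Round

open scoped Matrix.Norms.L2Operator
open Matrix

variable {P : Par} {s : State} {n : ℕ} {Q : Fin P.M → Matrix (Fin P.d) (Fin P.d) ℂ}
  {p : Fin P.M → ℂ}

/-- One round of the algorithm. -/
def roundCmd : Cmd := .seq expCmd <| .seq rhoCmd <| .seq zCmd <| .seq uCmd accCmd

theorem cheap_roundCmd : Cheap roundCmd :=
  cheap_expCmd.seq <| cheap_rhoCmd.seq <| cheap_zCmd.seq <| cheap_uCmd.seq cheap_accCmd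

/-- The phase of a nearby number serves as a phase of z; this includes z = 0, where any phase is
admissible. -/
theorem norm_sub_polar_le {z z' : ℂ} {e : ℝ} (h : ‖z' - z‖ ≤ e) :
    ‖z - ‖z‖ * Complex.exp (z'.arg * Complex.I)‖ ≤ 2 * e := by
  have h1 : z - ‖z‖ * Complex.exp (z'.arg * Complex.I)
      = (z - z') + ((‖z'‖ - ‖z‖ : ℝ) : ℂ) * Complex.exp (z'.arg * Complex.I) := by
    conv_rhs => rw [← Complex.norm_mul_exp_arg_mul_I z']
    simp only [Complex.norm_mul_exp_arg_mul_I]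
    push_cast
    linear_combination -(1 : ℂ) * (Complex.norm_mul_exp_arg_mul_I z')
  rw [h1]
  refine (norm_add_le _ _).trans ?_
  rw [norm_mul, Complex.norm_exp_ofReal_mul_I, mul_one, Complex.norm_real, Real.norm_eq_abs,
    norm_sub_rev]
  have := abs_norm_sub_norm_le z' z
  linarith

/-- Justifies returning the moduli instead of a trace: the phases are the arguments of z, so ∑ ‖z k‖
is the real part of ∑ z_k e^{-iφ_k}, which is close to the payoff of σ and hence to the trace with
the computed ρ and N. -/
theorem abs_sum_norm_sub_rtr_le {d M : ℕ} {Q : Fin M → Matrix (Fin d) (Fin d) ℂ} {p z : Fin M → ℂ}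
    {W e a c : ℝ} {ρ σ N : Matrix (Fin d) (Fin d) ℂ} (hQ : IsInstance W Q p) (hσ : IsDensity σ)
    (hρ : ∀ i j, ‖(ρ - σ) i j‖ ≤ a) (hz : ∀ k, ‖z k - (p - qvec Q ρ) k‖ ≤ e)
    (hN : ∀ i j, ‖(N - loss Q p W fun k => (z k).arg) i j‖ ≤ c)
    (hσ1 : ∀ i j, ‖σ i j‖ ≤ 1) :
    |∑ k, ‖z k‖ - ((ρᴴ * (N - ((2 * M * W : ℝ) : ℂ) • 1)).trace).re|
      ≤ M * (e + d ^ 2 * (W * a)) + d ^ 2 * (a * (2 * M * W + c)) + d ^ 2 * c := by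
  set φ : Fin M → ℝ := fun k => (z k).arg with hφ
  set C := centeredLoss Q p φ with hC
  set N₀ := N - ((2 * M * W : ℝ) : ℂ) • 1 with hN₀
  have hNC : ∀ i j, ‖(N₀ - C) i j‖ ≤ c := fun i j => by
    have := hN i j
    rw [loss_eq] at this
    rwa [hN₀, hC, sub_sub, add_comm (_ • 1)]
  have hCn : ∀ i j, ‖C i j‖ ≤ 2 * M * W := fun i j =>
    (norm_entry_le_norm C i j).trans (norm_centeredLoss_le hQ φ)
  have hN₀n : ∀ i j, ‖N₀ i j‖ ≤ 2 * M * W + c := fun i j => by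
    have := norm_add_le (C i j) ((N₀ - C) i j)
    rw [Matrix.sub_apply, add_sub_cancel] at this
    have h2 := hNC i j
    rw [Matrix.sub_apply] at h2
    linarith [hCn i j]
  have e1 : ((ρᴴ * N₀).trace).re - ((σᴴ * C).trace).re
      = (((ρ - σ)ᴴ * N₀).trace).re + ((σᴴ * (N₀ - C)).trace).re := by
    rw [conjTranspose_sub, Matrix.sub_mul, Matrix.mul_sub σᴴ N₀ C, trace_sub, trace_sub, Complex.sub_re,
      Complex.sub_re]
    ring
  have h1 := (Complex.abs_re_le_norm _).trans
    (norm_trace_conjTranspose_mul_le (A := ρ - σ) hρ hN₀n)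
  have h2 := (Complex.abs_re_le_norm _).trans
    (norm_trace_conjTranspose_mul_le (B := N₀ - C) hσ1 hNC)
  have e2 : ((σᴴ * C).trace).re
      = (∑ k, (p - qvec Q σ) k * Complex.exp (-(φ k * Complex.I))).re := by
    rw [hσ.1.1.eq]; exact rtr_density_mul_centeredLoss hσ φ
  have e3 : ∑ k, ‖z k‖ = (∑ k, z k * Complex.exp (-(φ k * Complex.I))).re := by
    rw [Complex.re_sum]
    refine Finset.sum_congr rfl fun k _ => ?_
    have h3 : z k * Complex.exp (-(φ k * Complex.I)) = ‖z k‖ := by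
      conv_lhs => rw [← Complex.norm_mul_exp_arg_mul_I (z k)]
      rw [mul_assoc, ← Complex.exp_add, hφ, add_neg_cancel, Complex.exp_zero, mul_one]
    rw [h3, Complex.ofReal_re]
  have h4 : |∑ k, ‖z k‖ - ((σᴴ * C).trace).re| ≤ M * (e + d ^ 2 * (W * a)) := by
    rw [e3, e2, ← Complex.sub_re, ← Finset.sum_sub_distrib]
    refine (Complex.abs_re_le_norm _).trans ((norm_sum_le _ _).trans ?_)
    calc _ ≤ ∑ k : Fin M, (e + d ^ 2 * (W * a)) := Finset.sum_le_sum fun k _ => by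
          rw [← sub_mul, norm_mul, norm_exp_mul_I, mul_one]
          have h5 := norm_trace_conjTranspose_mul_le (B := ρ - σ)
            (fun i j => (norm_entry_le_norm (Q k) i j).trans (hQ.1 k)) hρ
          have h6 : z k - (p - qvec Q σ) k
              = (z k - (p - qvec Q ρ) k) - ((Q k)ᴴ * (ρ - σ)).trace := by
            rw [Matrix.mul_sub, trace_sub, Pi.sub_apply, Pi.sub_apply, qvec, qvec]; ring
          rw [h6]
          exact (norm_sub_le _ _).trans (add_le_add (hz k) h5)
      _ = _ := by simp [mul_add]
  rw [abs_le] at h1 h2 h4 ⊢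
  constructor <;> linarith

theorem round_error_le {D M W g : ℝ} (hD : 1 ≤ D) (hM : 1 ≤ M) (hW : 1 ≤ W) (hg : 8 ≤ g) :
    M * (1 / g) + (M * (7 * D ^ 2 / g + D ^ 2 * (W * (3 / g)))
      + D ^ 2 * (3 / g * (2 * M * W + 48 * M * W / g)) + D ^ 2 * (48 * M * W / g))
      ≤ 100 * D ^ 2 * M * W / g := by
  have hg0 : 0 < g := by linarith
  have h3 : 48 * M * W / g ≤ 6 * M * W := by
    rw [div_le_iff₀ hg0]
    have : 0 ≤ M * W := by positivity
    nlinarith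
  have hd2 : 1 ≤ D ^ 2 := one_le_pow₀ hD
  have h4 : 1 ≤ D ^ 2 * W := one_le_mul_of_one_le_of_one_le hd2 hW
  calc M * (1 / g) + (M * (7 * D ^ 2 / g + D ^ 2 * (W * (3 / g)))
        + D ^ 2 * (3 / g * (2 * M * W + 48 * M * W / g)) + D ^ 2 * (48 * M * W / g))
      ≤ M * (1 / g) + (M * (7 * D ^ 2 / g + D ^ 2 * (W * (3 / g)))
        + D ^ 2 * (3 / g * (2 * M * W + 6 * M * W)) + D ^ 2 * (48 * M * W / g)) := by gcongr
    _ = (M * 1 + 7 * (M * (D ^ 2 * 1)) + 75 * (M * (D ^ 2 * W))) / g := by ring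
    _ ≤ (M * (D ^ 2 * W) + 7 * (M * (D ^ 2 * W)) + 75 * (M * (D ^ 2 * W))) / g := by gcongr
    _ = 83 * (M * (D ^ 2 * W)) / g := by ring
    _ ≤ 100 * (M * (D ^ 2 * W)) / g := by gcongr; norm_num
    _ = _ := by ring

theorem modulus_le {g v : ℝ} {x y r : ℤ} (hg : 8 ≤ g) (hx : |(x : ℝ)| ≤ g ^ 4)
    (hy : |(y : ℝ)| ≤ g ^ 4) (hv : v = ‖fx (2 * g ^ 2) x y‖)
    (hr : |(r : ℝ) / (2 * g ^ 3) - v| ≤ 1 / g) : |(r : ℝ)| ≤ g ^ 6 := by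
  have hg0 : 0 < g := by linarith
  have h2 : v ≤ g ^ 2 := by
    rw [hv]
    refine (Complex.norm_le_abs_re_add_abs_im _).trans ?_
    rw [fx_re, fx_im, abs_div, abs_div, abs_of_pos (show 0 < 2 * g ^ 2 by positivity),
      ← add_div, div_le_iff₀ (by positivity)]
    calc |(x : ℝ)| + |(y : ℝ)| ≤ g ^ 4 + g ^ 4 := add_le_add hx hy
      _ = _ := by ring
  have h3 : |(r : ℝ) / (2 * g ^ 3)| ≤ 2 * g ^ 2 := by
    have h5 : 1 / g ≤ 1 := by rw [div_le_one hg0]; linarith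
    have h6 := abs_le.1 hr
    have h7 : 1 ≤ g ^ 2 := one_le_pow₀ (by linarith)
    have h8 : 0 ≤ v := hv ▸ norm_nonneg _
    exact abs_le.2 ⟨by linarith, by linarith⟩
  rw [abs_div, abs_of_pos (show 0 < 2 * g ^ 3 by positivity), div_le_iff₀ (by positivity)] at h3
  refine h3.trans ?_
  calc (2 * g ^ 2) * (2 * g ^ 3) = 4 * g ^ 5 := by ring
    _ ≤ g * g ^ 5 := by gcongr; linarith
    _ = g ^ 6 := by ring

-- The phases are those of the approximate residual of the same round, and the loss is measured
-- against exactly these phases; an approximate run asks for no more. The arrays of the input, of ρ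
-- and of the residual survive the later stages, so that all claims can be made about the final
-- state.
set_option maxHeartbeats 800000 in
theorem roundCmd_spec (hP : P.Fine n) (h : Inv P s) (hin : Holds P Q p s) (hQ : IsInstance P.W Q p)
    {B : ℤ} (hBc : B + P.M * P.sg ^ 6 < P.cap)
    (hB : ∀ i j : ℕ, i < P.d → j < P.d → |s.mem 8 i j 0| ≤ B ∧ |s.mem 9 i j 0| ≤ B)
    (hB' : |s.mem 25 0 0 0| ≤ B) (hAh : (exponent P s).IsHermitian)
    (hA : ‖exponent P s‖ ≤ P.T) {s' : State} (hs' : (roundCmd.run s).state = s') :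
    (∀ i j, ‖(mat P s' 14 P.sg - gibbs (exponent P s)) i j‖ ≤ 3 / P.sg) ∧
    (∀ k, ‖(p - qvec Q (mat P s' 14 P.sg)) k - ‖(p - qvec Q (mat P s' 14 P.sg)) k‖
      * Complex.exp (phase P s' k * Complex.I)‖ ≤ 14 * P.d ^ 2 / P.sg) ∧
    (mat P s' 8 (2 * P.sg ^ 2) - mat P s 8 (2 * P.sg ^ 2)).IsHermitian ∧
    (∀ i j, ‖(mat P s' 8 (2 * P.sg ^ 2) - mat P s 8 (2 * P.sg ^ 2)
      - loss Q p P.W (phase P s')) i j‖ ≤ 48 * P.M * P.W / P.sg) ∧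
    |((s'.mem 25 0 0 0 : ℝ) - s.mem 25 0 0 0) / (2 * P.sg ^ 3)
      - (((mat P s' 14 P.sg)ᴴ * (mat P s' 8 (2 * P.sg ^ 2) - mat P s 8 (2 * P.sg ^ 2)
          - ((2 * P.M * P.W : ℝ) : ℂ) • 1)).trace).re| ≤ (100 : ℝ) * P.d ^ 2 * P.M * P.W / P.sg ∧
    Holds P Q p s' ∧
    (∀ i j : ℕ, i < P.d → j < P.d → |s'.mem 8 i j 0| ≤ B + P.M * P.sg ^ 6 ∧
      |s'.mem 9 i j 0| ≤ B + P.M * P.sg ^ 6) ∧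
    |s'.mem 25 0 0 0| ≤ B + P.M * P.sg ^ 6 := by
  have hOk := hP.toOk
  have hsg8 : (8 : ℝ) ≤ P.sg := by exact_mod_cast hP.eight_le_sg
  have hsg0 : (0 : ℝ) < P.sg := by linarith
  have hd2 : (1 : ℝ) ≤ (P.d : ℝ) ^ 2 := one_le_pow₀ (by exact_mod_cast hP.d_pos)
  have hW1 : (1 : ℝ) ≤ P.W := by exact_mod_cast hP.W_pos
  have hM1 : (1 : ℝ) ≤ P.M := by exact_mod_cast hP.M_pos
  simp only [roundCmd, run_seq_state] at hs'
  obtain ⟨a1, a2⟩ := expCmd_spec hP h hA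
  have i1 := cheap_expCmd.inv hOk h
  set s1 := (expCmd.run s).state with hs1
  obtain ⟨b1, b2⟩ := rhoCmd_spec hP i1 hAh hA a1
  have i2 := cheap_rhoCmd.inv hOk i1
  set s2 := (rhoCmd.run s1).state with hs2
  have f2 : ∀ a, a < 10 ∨ 15 < a → s2.mem a = s.mem a := fun a ha => by
    rw [b2 a (by omega) (by omega) (by omega), a2 a (by omega) (by omega) (by omega) (by omega)]
  have hin2 : Holds P Q p s2 := hin.congr fun a h4 h7 => f2 a (by omega)
  have hσ := isDensity_gibbs hAh hP.d_pos
  have hσ1 := norm_density_entry_le hσ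
  have hρ2 : ∀ i j, ‖mat P s2 14 P.sg i j‖ ≤ 2 := fun i j => by
    have h1 := norm_add_le (mat P s2 14 P.sg i j - gibbs (exponent P s) i j)
      (gibbs (exponent P s) i j)
    rw [sub_add_cancel] at h1
    have h2 : (3 : ℝ) / P.sg ≤ 1 := by rw [div_le_one hsg0]; linarith
    linarith [b1 i j, hσ1 i j]
  obtain ⟨c1, c2, c3⟩ := zCmd_spec hP i2 hin2 hQ hρ2
  have i3 := cheap_zCmd.inv hOk i2
  set s3 := (zCmd.run s2).state with hs3
  obtain ⟨d1, d2⟩ := uCmd_spec hP i3 c2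
  have i4 := cheap_uCmd.inv hOk i3
  set s4 := (uCmd.run s3).state with hs4
  have f4 : ∀ a, a < 10 ∨ 24 < a → s4.mem a = s.mem a := fun a ha => by
    rw [d2 a (by omega), c3 a (by omega), f2 a (by omega)]
  have hin4 : Holds P Q p s4 := hin.congr fun a h4 h7 => f4 a (by omega)
  have hr : ∀ k : Fin P.M, |s4.mem 22 k 0 0| ≤ P.sg ^ 6 := by
    intro k
    have := modulus_le hsg8 (by exact_mod_cast (c2 k).1) (by exact_mod_cast (c2 k).2.1) rfl
      (d1 k).2
    exact_mod_cast this
  have hB4 : ∀ i j : ℕ, i < P.d → j < P.d → |s4.mem 8 i j 0| ≤ B ∧ |s4.mem 9 i j 0| ≤ B := by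
    rw [f4 8 (by norm_num), f4 9 (by norm_num)]; exact hB
  obtain ⟨e1, e2, e3, e4, e5, e6⟩ := accCmd_spec hP i4 hin4 hQ hBc (φ := phase P s3)
    (fun k => (d1 k).1) hr hB4 (by rw [f4 25 (by norm_num)]; exact hB')
  rw [hs'] at e1 e2 e3 e4 e5 e6
  have m8 : mat P s4 8 (2 * P.sg ^ 2) = mat P s 8 (2 * P.sg ^ 2) :=
    mat_congr (f4 8 (by norm_num)) (f4 9 (by norm_num))
  have m14 : mat P s' 14 P.sg = mat P s2 14 P.sg := by
    refine mat_congr ?_ ?_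
    · rw [e6 14 (by norm_num) (by norm_num) (by norm_num), d2 14 (by norm_num),
        c3 14 (by norm_num)]
    · rw [e6 _ (by norm_num) (by norm_num) (by norm_num), d2 _ (by norm_num),
        c3 _ (by norm_num)]
  have hph : phase P s' = phase P s3 := by
    funext k
    rw [phase, phase, vec, vec, e6 20 (by norm_num) (by norm_num) (by norm_num),
      e6 (20 + 1) (by norm_num) (by norm_num) (by norm_num), d2 20 (by norm_num),
      d2 (20 + 1) (by norm_num)]
  rw [m8] at e1 e2
  rw [m14, hph]
  refine ⟨b1, fun k => ?_, e1, e2, ?_, hin4.congr fun a h4 h7 => e6 a (by omega) (by omega)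
    (by omega), e4, e5⟩
  · refine (norm_sub_polar_le (c1 k)).trans (le_of_eq ?_)
    ring
  · have h1 := abs_sum_norm_sub_rtr_le hQ hσ (ρ := mat P s2 14 P.sg) b1 c1 e2 hσ1
    rw [e3, f4 25 (by norm_num)]
    rw [Int.cast_add, Int.cast_sum, add_sub_cancel_left, Finset.sum_div]
    have h2 : |∑ k : Fin P.M, (s4.mem 22 k 0 0 : ℝ) / (2 * P.sg ^ 3)
        - ∑ k, ‖vec P s3 20 (2 * P.sg ^ 2) k‖| ≤ P.M * (1 / P.sg) := by
      rw [← Finset.sum_sub_distrib]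
      refine (Finset.abs_sum_le_sum_abs _ _).trans ?_
      calc _ ≤ ∑ k : Fin P.M, (1 : ℝ) / P.sg := Finset.sum_le_sum fun k _ => (d1 k).2
        _ = _ := by simp
    refine (abs_sub_le _ _ _).trans ((add_le_add h2 h1).trans ?_)
    exact round_error_le (by exact_mod_cast hP.d_pos) hM1 hW1 hsg8

end Round

/-! ### All rounds together. -/

section MainLoop

open scoped Matrix.Norms.L2Operator
open Matrix

variable {P : Par} {s : State} {n : ℕ} {Q : Fin P.M → Matrix (Fin P.d) (Fin P.d) ℂ}
  {p : Fin P.M → ℂ}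

/-- All rounds of the algorithm. -/
def mainCmd : Cmd := .loop 7 (.reg 11) roundCmd

theorem cheap_mainCmd : Cheap mainCmd :=
  Cheap.loop (by norm_num) (by norm_num) (by norm_num) cheap_roundCmd

/-- The accuracy that is required of the finite precision run. -/
noncomputable def Par.eta (P : Par) : ℝ := 1 / (100 * (P.d : ℝ) ^ 2 * P.M * P.W * P.E)

/-- The ratio of the error to η is at most n^14/sg, and sg = n^20. -/
theorem Par.Fine.error_le_eta (hP : P.Fine n) : (100 : ℝ) * P.d ^ 2 * P.M * P.W / P.sg ≤ P.eta := by
  have hsg8 : (8 : ℝ) ≤ P.sg := by exact_mod_cast hP.eight_le_sg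
  have hn : (8 : ℝ) ≤ n := by exact_mod_cast hP.n_ge
  have h1 : (P.d : ℝ) ≤ n := by exact_mod_cast hP.d_le'
  have h2 : (P.M : ℝ) ≤ n := by exact_mod_cast hP.M_le'
  have h3 : (P.W : ℝ) ≤ n := by exact_mod_cast hP.W_le'
  have h4 : (P.E : ℝ) ≤ n := by exact_mod_cast hP.E_le'
  have h5 : (n : ℝ) ^ 14 ≤ P.sg := by exact_mod_cast hP.pow_le_sg (k := 14) (by norm_num)
  have h6 : (10000 : ℝ) ≤ n ^ 5 := by
    calc (10000 : ℝ) ≤ 8 ^ 5 := by norm_num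
      _ ≤ n ^ 5 := by gcongr
  have d1 : (1 : ℝ) ≤ P.d := by exact_mod_cast hP.d_pos
  have d2 : (1 : ℝ) ≤ P.M := by exact_mod_cast hP.M_pos
  have d3 : (1 : ℝ) ≤ P.W := by exact_mod_cast hP.W_pos
  have d4 : (1 : ℝ) ≤ P.E := by exact_mod_cast hP.E_pos
  rw [Par.eta, div_le_div_iff₀ (by linarith) (by positivity), one_mul]
  refine le_trans ?_ h5
  calc (100 : ℝ) * P.d ^ 2 * P.M * P.W * (100 * (P.d : ℝ) ^ 2 * P.M * P.W * P.E)
      = 10000 * P.d ^ 4 * P.M ^ 2 * P.W ^ 2 * P.E := by ring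
    _ ≤ (n : ℝ) ^ 5 * (n : ℝ) ^ 4 * (n : ℝ) ^ 2 * (n : ℝ) ^ 2 * n := by gcongr
    _ = (n : ℝ) ^ 14 := by ring

theorem Par.Fine.sum_lt_cap (hP : P.Fine n) : (P.T : ℤ) * (P.M * P.sg ^ 6) < P.cap := by
  have h1 := hP.lam_pow_le_scale
  have h2 : 2 ≤ P.lam := (show 2 ≤ P.sg ^ 8 from
    le_trans (by have := hP.eight_le_sg; omega) (Nat.le_self_pow (by norm_num) _)).trans
      hP.sg_pow_le_lam
  have h3 : P.sg ^ 6 ≤ P.lam :=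
    (Nat.pow_le_pow_right hP.sg_pos (by norm_num)).trans hP.sg_pow_le_lam
  have : P.T * (P.M * P.sg ^ 6) < P.cap := by
    calc P.T * (P.M * P.sg ^ 6) ≤ P.lam * (P.lam * P.lam) :=
          Nat.mul_le_mul hP.T_le (Nat.mul_le_mul hP.M_le h3)
      _ = P.lam ^ 3 := by ring
      _ < P.lam ^ 16 := Nat.pow_lt_pow_right (by omega) (by norm_num)
      _ ≤ P.scale := h1
      _ ≤ _ := P.scale_le_cap
  exact_mod_cast this

theorem norm_loss_le {d M : ℕ} {Q : Fin M → Matrix (Fin d) (Fin d) ℂ} {p : Fin M → ℂ} {w : ℝ}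
    (hw : 0 ≤ w) (h : IsInstance w Q p) (φ : Fin M → ℝ) : ‖loss Q p w φ‖ ≤ 4 * M * w := by
  rw [loss_eq]
  refine (norm_add_le _ _).trans ?_
  have h1 := norm_centeredLoss_le h φ
  have h2 := norm_smul_one_le (d := d) ((2 * M * w : ℝ) : ℂ)
  rw [Complex.norm_real, Real.norm_of_nonneg (by positivity)] at h2
  linarith

/-- The states between the rounds. -/
def roundState (s : State) (t : ℕ) : State := loopState 7 roundCmd s t

/-- The loss matrices that the program computes. -/
noncomputable def roundLoss (P : Par) (s : State) (t : ℕ) : Matrix (Fin P.d) (Fin P.d) ℂ :=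
  mat P (roundState s (t + 1)) 8 (2 * P.sg ^ 2) - mat P (roundState s t) 8 (2 * P.sg ^ 2)

/-- The arrays hold the running sum of the losses, which are defined as its increments; the sum
telescopes. -/
theorem exponent_roundState (h0 : ∀ a, a = 8 ∨ a = 9 → ∀ i j, s.mem a i j 0 = 0) (t : ℕ) :
    exponent P (roundState s t) = -((1 / (64 * P.E * P.M ^ 2 * P.W ^ 2) : ℝ) : ℂ) •
      ∑ r ∈ Finset.range t, roundLoss P s r := by
  have : mat P (roundState s 0) 8 (2 * P.sg ^ 2) = 0 := by
    ext i j
    change fx _ (s.mem 8 i j 0) (s.mem 9 i j 0) = 0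
    rw [h0 8 (by simp), h0 9 (by simp)]
    apply Complex.ext <;> simp
  rw [exponent]
  simp only [roundLoss]
  rw [Finset.sum_range_sub (fun t => mat P (roundState s t) 8 (2 * P.sg ^ 2)), this, sub_zero]

/-- The properties of the first `t` rounds. -/
structure Rounds (P : Par) (Q : Fin P.M → Matrix (Fin P.d) (Fin P.d) ℂ) (p : Fin P.M → ℂ)
    (s : State) (t : ℕ) : Prop where
  holds : Holds P Q p (roundState s t)
  mem_le : ∀ i j : ℕ, i < P.d → j < P.d →
    |(roundState s t).mem 8 i j 0| ≤ t * (P.M * P.sg ^ 6) ∧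
    |(roundState s t).mem 9 i j 0| ≤ t * (P.M * P.sg ^ 6)
  mem_le' : |(roundState s t).mem 25 0 0 0| ≤ t * (P.M * P.sg ^ 6)
  density : ∀ r < t, ∀ i j,
    ‖(mat P (roundState s (r + 1)) 14 P.sg - gibbs (exponent P (roundState s r))) i j‖ ≤ P.eta
  polar : ∀ r < t, ∀ k, ‖(p - qvec Q (mat P (roundState s (r + 1)) 14 P.sg)) k
    - ‖(p - qvec Q (mat P (roundState s (r + 1)) 14 P.sg)) k‖
      * Complex.exp (phase P (roundState s (r + 1)) k * Complex.I)‖ ≤ P.eta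
  herm : ∀ r < t, (roundLoss P s r).IsHermitian
  loss : ∀ r < t, ∀ i j,
    ‖(roundLoss P s r - QDist.loss Q p P.W (phase P (roundState s (r + 1)))) i j‖ ≤ P.eta
  norm_le : ∀ r < t, ‖roundLoss P s r‖ ≤ 5 * P.M * P.W
  result : ∀ r < t, |(((roundState s (r + 1)).mem 25 0 0 0 : ℝ) - (roundState s r).mem 25 0 0 0)
      / (2 * P.sg ^ 3) - (((mat P (roundState s (r + 1)) 14 P.sg)ᴴ *
        (roundLoss P s r - ((2 * P.M * P.W : ℝ) : ℂ) • 1)).trace).re| ≤ P.eta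

theorem error_bounds {D M W E g : ℝ} (hD : 1 ≤ D) (hM : 1 ≤ M) (hW : 1 ≤ W) (hE : 1 ≤ E)
    (hg : 0 < g) : 3 / g ≤ 100 * D ^ 2 * M * W / g ∧ 14 * D ^ 2 / g ≤ 100 * D ^ 2 * M * W / g ∧
    48 * M * W / g ≤ 100 * D ^ 2 * M * W / g ∧ D ^ 2 * (1 / (100 * D ^ 2 * M * W * E)) ≤ 1 := by
  have hD2 : 1 ≤ D ^ 2 := one_le_pow₀ hD
  have hMW : 1 ≤ M * W := one_le_mul_of_one_le_of_one_le hM hW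
  have h1 : 1 ≤ D ^ 2 * (M * W) := one_le_mul_of_one_le_of_one_le hD2 hMW
  have h2 : D ^ 2 ≤ D ^ 2 * (M * W) := le_mul_of_one_le_right (by positivity) hMW
  have h3 : M * W ≤ D ^ 2 * (M * W) := le_mul_of_one_le_left (by positivity) hD2
  have h4 : D ^ 2 * (M * W) ≤ D ^ 2 * (M * W) * E := le_mul_of_one_le_right (by positivity) hE
  refine ⟨?_, ?_, ?_, ?_⟩
  · exact div_le_div_of_nonneg_right (by linarith) hg.le
  · exact div_le_div_of_nonneg_right (by linarith) hg.le
  · exact div_le_div_of_nonneg_right (by linarith) hg.le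
  · rw [mul_one_div, div_le_one (by positivity)]
    linarith

/-- The induction also carries the Hermitian symmetry and the norms of the losses: together they
give a Hermitian exponent of norm at most T, which the exponential of the next round requires. -/
theorem rounds_spec (hP : P.Fine n) (h : Inv P s) (hin : Holds P Q p s) (hQ : IsInstance P.W Q p)
    (h0 : ∀ a, a = 8 ∨ a = 9 ∨ a = 25 → ∀ i j, s.mem a i j 0 = 0) :
    ∀ t ≤ P.T, Rounds P Q p s t := by
  have hOk := hP.toOk
  have hsg8 : (8 : ℝ) ≤ P.sg := by exact_mod_cast hP.eight_le_sg
  have hsg0 : (0 : ℝ) < P.sg := by linarith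
  have d1 : (1 : ℝ) ≤ P.d := by exact_mod_cast hP.d_pos
  have d2 : (1 : ℝ) ≤ P.M := by exact_mod_cast hP.M_pos
  have d3 : (1 : ℝ) ≤ P.W := by exact_mod_cast hP.W_pos
  have d4 : (1 : ℝ) ≤ P.E := by exact_mod_cast hP.E_pos
  have hMW : (1 : ℝ) ≤ P.M * P.W := one_le_mul_of_one_le_of_one_le d2 d3
  have hdd : (1 : ℝ) ≤ (P.d : ℝ) ^ 2 := one_le_pow₀ d1
  have herr := hP.error_le_eta
  obtain ⟨hη1, hη2, hη3, hηd⟩ := error_bounds d1 d2 d3 d4 hsg0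
  replace hη1 := hη1.trans herr
  replace hη2 := hη2.trans herr
  replace hη3 := hη3.trans herr
  change P.d ^ 2 * P.eta ≤ 1 at hηd
  intro t
  induction t with
  | zero =>
    intro _
    refine ⟨hin, fun i j _ _ => ?_, ?_, ?_, ?_, ?_, ?_, ?_, ?_⟩
    · change |s.mem 8 i j 0| ≤ _ ∧ |s.mem 9 i j 0| ≤ _
      rw [h0 8 (by simp), h0 9 (by simp)]; simp
    · change |s.mem 25 0 0 0| ≤ _
      rw [h0 25 (by simp)]; simp
    all_goals intro r hr; exact absurd hr (by omega)
  | succ t ih =>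
    intro ht
    have ih := ih (by omega)
    have hI : Inv P ((roundState s t).setReg 7 t) :=
      (h.loopState hOk cheap_roundCmd (by norm_num) (by norm_num) hP.T_le
        (show t ≤ P.T by omega)).setReg (by norm_num) (by norm_num)
        (hOk.bits_le_len ((show t ≤ P.T by omega).trans hP.T_le))
    have hexp := exponent_roundState (P := P) (s := s)
      (fun a ha => h0 a (by tauto)) t
    have hAh : (exponent P (roundState s t)).IsHermitian := by
      have h1 : (∑ r ∈ Finset.range t, roundLoss P s r).IsHermitian := by
        rw [IsHermitian, conjTranspose_sum]
        exact Finset.sum_congr rfl fun r hr => (ih.herm r (Finset.mem_range.1 hr)).eq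
      rw [hexp, IsHermitian, conjTranspose_smul, h1.eq]
      simp
    have hA : ‖exponent P (roundState s t)‖ ≤ P.T := by
      rw [hexp, norm_smul, norm_neg, Complex.norm_real, Real.norm_of_nonneg (by positivity)]
      have h1 : ‖∑ r ∈ Finset.range t, roundLoss P s r‖ ≤ t * (5 * P.M * P.W) := by
        refine (norm_sum_le _ _).trans ((Finset.sum_le_sum fun r hr =>
          ih.norm_le r (Finset.mem_range.1 hr)).trans ?_)
        simp
      have h2 : (1 : ℝ) / (64 * P.E * P.M ^ 2 * P.W ^ 2) * (5 * P.M * P.W) ≤ 1 := by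
        rw [one_div_mul_eq_div, div_le_one (by positivity)]
        calc 5 * (P.M : ℝ) * P.W = 5 * 1 * 1 * (P.M * P.W) := by ring
          _ ≤ 64 * P.E * (P.M * P.W) * (P.M * P.W) := by gcongr; norm_num
          _ = _ := by ring
      have h3 : (t : ℝ) ≤ P.T := by exact_mod_cast (show t ≤ P.T by omega)
      calc (1 : ℝ) / (64 * P.E * P.M ^ 2 * P.W ^ 2) * ‖∑ r ∈ Finset.range t, roundLoss P s r‖
          ≤ (1 : ℝ) / (64 * P.E * P.M ^ 2 * P.W ^ 2) * (t * (5 * P.M * P.W)) := by gcongr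
        _ = (1 : ℝ) / (64 * P.E * P.M ^ 2 * P.W ^ 2) * (5 * P.M * P.W) * t := by ring
        _ ≤ 1 * P.T := by gcongr
        _ = _ := one_mul _
    have hstep : ((t : ℤ) * (P.M * P.sg ^ 6)) + P.M * P.sg ^ 6
        = ((t + 1 : ℕ) : ℤ) * (P.M * P.sg ^ 6) := by push_cast; ring
    obtain ⟨c1, c2, c3, c4, c5, c6, c7, c8⟩ := roundCmd_spec hP hI
      (ih.holds.congr fun _ _ _ => rfl) hQ (B := t * (P.M * P.sg ^ 6)) (by
        rw [hstep]
        refine lt_of_le_of_lt ?_ hP.sum_lt_cap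
        gcongr) ih.mem_le ih.mem_le' hAh hA (s' := roundState s (t + 1)) rfl
    rw [hstep] at c7 c8
    have hlast : ∀ {q : ℕ → Prop}, (∀ r < t, q r) → q t → ∀ r < t + 1, q r := by
      intro q h1 h2 r hr
      rcases Nat.lt_succ_iff_lt_or_eq.1 hr with h3 | rfl
      · exact h1 r h3
      · exact h2
    have hloss : ∀ i j, ‖(roundLoss P s t
        - QDist.loss Q p P.W (phase P (roundState s (t + 1)))) i j‖ ≤ P.eta :=
      fun i j => (c4 i j).trans hη3
    refine ⟨c6, c7, c8, hlast ih.density fun i j => (c1 i j).trans hη1,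
      hlast ih.polar fun k => (c2 k).trans hη2, hlast ih.herm c3, hlast ih.loss hloss,
      hlast ih.norm_le ?_, hlast ih.result (c5.trans herr)⟩
    -- The norm is at most 4MW + d²η ≤ 4MW + 1 ≤ 5MW.
    have h1 := norm_le_of_entry_le hloss
    have h2 := norm_add_le (roundLoss P s t - QDist.loss Q p P.W (phase P (roundState s (t + 1))))
      (QDist.loss Q p P.W (phase P (roundState s (t + 1))))
    rw [sub_add_cancel] at h2
    have h3 := norm_loss_le (by linarith) hQ (phase P (roundState s (t + 1)))
    linarith

theorem mainCmd_spec (hP : P.Fine n) (h : Inv P s) (hin : Holds P Q p s) (hQ : IsInstance P.W Q p)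
    (h0 : ∀ a, a = 8 ∨ a = 9 ∨ a = 25 → ∀ i j, s.mem a i j 0 = 0) :
    ∃ ρ φ N, (∀ t < P.T, (N t).IsHermitian) ∧
      IsRun Q p P.W (1 / (2 * P.E)) P.T (1 / (100 * (P.d : ℝ) ^ 2 * P.M * P.W * P.E)) ρ φ N
        (((mainCmd.run s).state.mem 25 0 0 0 : ℝ) / (2 * P.sg ^ 3 * P.T)) := by
  have hR := rounds_spec hP h hin hQ h0 P.T le_rfl
  have hsg0 : (0 : ℝ) < P.sg := by exact_mod_cast hP.sg_pos
  have hT0 : (0 : ℝ) < P.T := by exact_mod_cast hP.T_pos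
  have d2 : (0 : ℝ) < P.M := by exact_mod_cast hP.M_pos
  have d3 : (0 : ℝ) < P.W := by exact_mod_cast hP.W_pos
  have d4 : (0 : ℝ) < P.E := by exact_mod_cast hP.E_pos
  have hrun : (mainCmd.run s).state = roundState s P.T :=
    (loop_step hP.toOk h (x := 7) h.r11 hP.T_le (by norm_num) (by norm_num) cheap_roundCmd).1
  refine ⟨fun t => mat P (roundState s (t + 1)) 14 P.sg,
    fun t => phase P (roundState s (t + 1)), roundLoss P s, hR.herm, ?_, hR.polar, hR.loss, ?_⟩
  · intro t ht i j
    have h1 := hR.density t ht i j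
    rw [exponent_roundState (fun a ha => h0 a (by tauto))] at h1
    -- For ε = 1/(2E) the rate is γ = 1/(16EMW).
    have h2 : rate P.M P.W (1 / (2 * P.E)) / (4 * P.M * P.W)
        = 1 / (64 * P.E * P.M ^ 2 * P.W ^ 2) := by
      rw [rate]; field_simp; norm_num
    rw [h2]
    exact h1
  · rw [hrun]
    set f : ℕ → ℝ := fun t => ((roundState s t).mem 25 0 0 0 : ℝ) with hf
    -- The accumulated moduli telescope from zero, so the returned quotient is the average of the
    -- contributions of the rounds.
    have e : f P.T / (2 * P.sg ^ 3 * P.T)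
        = 1 / P.T * ∑ t ∈ Finset.range P.T, (f (t + 1) - f t) / (2 * P.sg ^ 3) := by
      rw [← Finset.sum_div, Finset.sum_range_sub]
      have : f 0 = 0 := by
        change ((s.mem 25 0 0 0 : ℤ) : ℝ) = 0
        rw [h0 25 (by simp)]; simp
      rw [this, sub_zero]
      field_simp
    change |f P.T / (2 * P.sg ^ 3 * P.T) - _| ≤ _
    rw [e, ← mul_sub, ← Finset.sum_sub_distrib, abs_mul, abs_of_pos (by positivity)]
    have h1 : |∑ t ∈ Finset.range P.T, ((f (t + 1) - f t) / (2 * P.sg ^ 3)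
        - (((mat P (roundState s (t + 1)) 14 P.sg)ᴴ *
        (roundLoss P s t - ((2 * P.M * P.W : ℝ) : ℂ) • 1)).trace).re)| ≤ P.T * P.eta := by
      refine (Finset.abs_sum_le_sum_abs _ _).trans ((Finset.sum_le_sum fun t ht =>
        hR.result t (Finset.mem_range.1 ht)).trans ?_)
      simp
    calc 1 / (P.T : ℝ) * _ ≤ 1 / P.T * (P.T * P.eta) := by gcongr
      _ = P.eta := by field_simp
      _ = _ := rfl

end MainLoop

/-! ### Computing the number of rounds. -/

section NumberOfRounds

/-- The inverse of the square of the learning rate. -/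
def invRateSq (M W E : ℕ) : ℕ := 256 * (E * M * W) * (E * M * W)

/-- The bit length of `d` to the power `invRateSq`. -/
def powLen (d M W E : ℕ) : ℕ := (d ^ invRateSq M W E).size

/-- An approximation of `p * log 2`. -/
def logTwoSum (p m : ℕ) : ℕ := ∑ k ∈ Finset.range m, p / ((k + 1) * 2 ^ (k + 1))

/-- The number of rounds that the program executes. -/
def numRounds (d M W E : ℕ) : ℕ :=
  let L := powLen d M W E
  let m := L + 8
  let p := 16 * m * L
  L * (logTwoSum p m + 2 * m) / p + 1

/-- The series of −ln(1 − 1/2) has a tail of at most 2^{-m} after m terms; each of the m integer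
divisions loses at most one. -/
theorem logTwoSum_bounds {p m : ℕ} : (logTwoSum p m : ℝ) ≤ p * Real.log 2 + p / 2 ^ m ∧
    p * Real.log 2 - p / 2 ^ m - m ≤ logTwoSum p m := by
  have hx : |(1 / 2 : ℝ)| < 1 := by rw [abs_of_pos] <;> norm_num
  have h := Real.abs_log_sub_add_sum_range_le hx m
  have e1 : Real.log (1 - 1 / 2) = -Real.log 2 := by
    rw [← Real.log_inv]; norm_num
  have e2 : |(1 / 2 : ℝ)| ^ (m + 1) / (1 - |(1 / 2 : ℝ)|) = 1 / 2 ^ m := by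
    rw [abs_of_pos (by norm_num), pow_succ, div_pow, one_pow]; norm_num
  have e3 : ∑ i ∈ Finset.range m, (1 / 2 : ℝ) ^ (i + 1) / (i + 1)
      = ∑ k ∈ Finset.range m, 1 / (((k : ℝ) + 1) * 2 ^ (k + 1)) :=
    Finset.sum_congr rfl fun k _ => by rw [div_pow, one_pow]; field_simp
  rw [e1, e2, e3] at h
  set S := ∑ k ∈ Finset.range m, 1 / (((k : ℝ) + 1) * 2 ^ (k + 1)) with hS
  have hp0 : (0 : ℝ) ≤ p := by positivity
  have h' : |(p : ℝ) * S - p * Real.log 2| ≤ p / 2 ^ m := by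
    rw [← mul_sub, abs_mul, abs_of_nonneg hp0, div_eq_mul_one_div]
    refine mul_le_mul_of_nonneg_left ?_ hp0
    rwa [sub_eq_add_neg]
  have hu : (logTwoSum p m : ℝ) ≤ p * S := by
    rw [logTwoSum, hS, Finset.mul_sum]
    push_cast
    refine Finset.sum_le_sum fun k _ => Nat.cast_div_le.trans (le_of_eq ?_)
    push_cast; ring
  have hl : p * S - m ≤ logTwoSum p m := by
    have : p * S ≤ ∑ k ∈ Finset.range m, ((p / ((k + 1) * 2 ^ (k + 1)) : ℕ) + 1 : ℝ) := by
      rw [hS, Finset.mul_sum]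
      refine Finset.sum_le_sum fun k _ => ?_
      have h2 := Nat.lt_floor_add_one ((p : ℝ) / (((k + 1) * 2 ^ (k + 1) : ℕ) : ℝ))
      rw [Nat.floor_div_natCast, Nat.floor_natCast] at h2
      push_cast at h2 ⊢
      rw [mul_one_div]
      exact h2.le
    rw [Finset.sum_add_distrib] at this
    simp only [Finset.sum_const, Finset.card_range, nsmul_eq_mul, mul_one] at this
    rw [logTwoSum]
    push_cast at this ⊢
    linarith
  rw [abs_le] at h'
  constructor <;> linarith

theorem log_size_bounds {x : ℕ} (hx : 1 ≤ x) :
    ((x.size : ℝ) - 1) * Real.log 2 ≤ Real.log x ∧ Real.log x ≤ x.size * Real.log 2 := by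
  have hx0 : (0 : ℝ) < x := by exact_mod_cast hx
  have hs : 1 ≤ x.size := Nat.size_pos.2 hx
  constructor
  · have h1 : 2 ^ (x.size - 1) ≤ x := Nat.lt_size.1 (by omega)
    have h2 : (2 : ℝ) ^ (x.size - 1) ≤ x := by exact_mod_cast h1
    have := Real.log_le_log (by positivity) h2
    rwa [Real.log_pow, Nat.cast_sub hs, Nat.cast_one] at this
  · have h1 : x < 2 ^ x.size := Nat.lt_size_self x
    have h2 : (x : ℝ) ≤ 2 ^ x.size := by exact_mod_cast h1.le
    have := Real.log_le_log hx0 h2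
    rwa [Real.log_pow] at this

/-- 1/γ² = 256(EMW)² is an integer, so ln d/γ² is the logarithm of an integer power of d, whose bit
length can be computed. -/
theorem rounds_eq {d M W E : ℕ} (hM : 1 ≤ M) (hW : 1 ≤ W) (hE : 1 ≤ E) :
    rounds d M W (1 / (2 * E)) = max 1 ⌈Real.log ((d ^ invRateSq M W E : ℕ) : ℝ)⌉₊ := by
  have h1 : (M : ℝ) ≠ 0 := by positivity
  have h2 : (W : ℝ) ≠ 0 := by positivity
  have h3 : (E : ℝ) ≠ 0 := by positivity
  have e : Real.log d / rate M W (1 / (2 * E)) ^ 2 = Real.log ((d ^ invRateSq M W E : ℕ) : ℝ) := by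
    rw [Nat.cast_pow, Real.log_pow, rate, invRateSq]
    push_cast
    field_simp
    ring
  rw [rounds, e]

/-- For an integer of bit length L, L ln 2 exceeds its logarithm by at most ln 2. The numerical
error is one-sided and at most 3/16, and ln 2 + 3/16 < 1, so the result is off by at most one. -/
theorem numRounds_bounds {d M W E : ℕ} (hd : 1 ≤ d) (hM : 1 ≤ M) (hW : 1 ≤ W) (hE : 1 ≤ E) :
    rounds d M W (1 / (2 * E)) ≤ numRounds d M W E ∧
    numRounds d M W E ≤ rounds d M W (1 / (2 * E)) + 1 := by
  rw [rounds_eq hM hW hE]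
  have hx : 1 ≤ d ^ invRateSq M W E := Nat.one_le_pow _ _ hd
  obtain ⟨y1, y2⟩ := log_size_bounds hx
  rw [numRounds]
  set y := Real.log ((d ^ invRateSq M W E : ℕ) : ℝ) with hy
  change ((powLen d M W E : ℕ) - 1 : ℝ) * _ ≤ y at y1
  change y ≤ (powLen d M W E : ℕ) * _ at y2
  have hL1 : 1 ≤ powLen d M W E := Nat.size_pos.2 hx
  generalize powLen d M W E = L at *
  set m := L + 8 with hm
  set p := 16 * m * L with hp
  obtain ⟨s1, s2⟩ := logTwoSum_bounds (p := p) (m := m)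
  have hL0 : (0 : ℝ) < L := by exact_mod_cast hL1
  have hm0 : (0 : ℝ) < m := by exact_mod_cast (show 0 < m by omega)
  have hpR : (p : ℝ) = 16 * m * L := by rw [hp]; push_cast; rfl
  have hp0 : (0 : ℝ) < p := by rw [hpR]; positivity
  -- The summand 8 in m = L + 8 gives 2^8 and thus beats the 16 in p; 2^L beats L.
  have htail : (p : ℝ) / 2 ^ m ≤ m / 16 := by
    have h1 : (L : ℝ) ≤ 2 ^ L := by exact_mod_cast Nat.lt_two_pow_self.le
    rw [div_le_iff₀ (by positivity), hpR, hm, pow_add]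
    calc (16 : ℝ) * (L + 8 : ℕ) * L ≤ 16 * (L + 8 : ℕ) * 2 ^ L := by gcongr
      _ = _ := by ring
  set q := logTwoSum p m with hq
  have hT : (L : ℝ) * (q + 2 * m) / p < (L * (q + 2 * m) / p : ℕ) + 1 ∧
      ((L * (q + 2 * m) / p : ℕ) : ℝ) ≤ (L : ℝ) * (q + 2 * m) / p := by
    constructor
    · have h2 := Nat.lt_floor_add_one (((L * (q + 2 * m) : ℕ) : ℝ) / (p : ℝ))
      rw [Nat.floor_div_natCast, Nat.floor_natCast] at h2
      push_cast at h2 ⊢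
      exact h2
    · refine Nat.cast_div_le.trans (le_of_eq ?_)
      push_cast; ring
  -- Adding 2m to the sum outweighs its possible deficit m/16 + m.
  have hlow : L * Real.log 2 ≤ (L : ℝ) * (q + 2 * m) / p := by
    rw [le_div_iff₀ hp0]
    calc (L : ℝ) * Real.log 2 * p = L * (p * Real.log 2) := by ring
      _ ≤ L * (q + 2 * m) := mul_le_mul_of_nonneg_left (by linarith) hL0.le
  have hhigh : (L : ℝ) * (q + 2 * m) / p ≤ L * Real.log 2 + 3 / 16 := by
    rw [div_le_iff₀ hp0]
    calc (L : ℝ) * (q + 2 * m) ≤ L * (p * Real.log 2 + 3 * m) :=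
          mul_le_mul_of_nonneg_left (by linarith) hL0.le
      _ = (L * Real.log 2 + 3 / 16) * p := by rw [hpR]; ring
  have hl2 := Real.log_two_lt_d9
  constructor
  · refine max_le (Nat.le_add_left _ _) (Nat.ceil_le.2 ?_)
    push_cast
    linarith [hT.1]
  · have h1 : y ≤ ⌈y⌉₊ := Nat.le_ceil y
    have h2 : (⌈y⌉₊ : ℝ) ≤ (max 1 ⌈y⌉₊ : ℕ) := by exact_mod_cast le_max_right _ _
    have h3 : ((L * (q + 2 * m) / p + 1 : ℕ) : ℝ) < ((max 1 ⌈y⌉₊ + 2 : ℕ) : ℝ) := by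
      push_cast at h2 ⊢
      linarith [hT.2]
    have h4 : L * (q + 2 * m) / p + 1 < max 1 ⌈y⌉₊ + 2 := by exact_mod_cast h3
    omega

theorem logTwoSum_le (p m : ℕ) : logTwoSum p m ≤ m * p := by
  rw [logTwoSum]
  refine (Finset.sum_le_sum fun k _ => Nat.div_le_self _ _).trans ?_
  simp

end NumberOfRounds

/-! ### Sequential register programs. -/

section Registers

/-- `c` turns the state `s` into `s'`, with work and depth at most `K * Y`. -/
structure Runs (c : Cmd) (s s' : State) (K Y : ℕ) : Prop where
  state : (c.run s).state = s'
  work : (c.run s).work ≤ K * Y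
  depth : (c.run s).depth ≤ K * Y

theorem Runs.seq {c c' : Cmd} {s s' s'' : State} {K K' Y : ℕ} (h : Runs c s s' K Y)
    (h' : Runs c' s' s'' K' Y) : Runs (.seq c c') s s'' (K + K') Y := by
  refine ⟨?_, ?_, ?_⟩
  · rw [run_seq_state, h.state, h'.state]
  · simp only [Cmd.run, h.state, add_mul]; exact add_le_add h.work h'.work
  · simp only [Cmd.run, h.state, add_mul]; exact add_le_add h.depth h'.depth

theorem Runs.mono {c : Cmd} {s s' : State} {K Y Y' : ℕ} (h : Runs c s s' K Y) (hY : Y ≤ Y') :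
    Runs c s s' K Y' :=
  ⟨h.state, h.work.trans (Nat.mul_le_mul_left _ hY), h.depth.trans (Nat.mul_le_mul_left _ hY)⟩

/-- All registers have at most `X` bits. -/
def State.Bounded (s : State) (X : ℕ) : Prop := ∀ x, bits (s.reg x) ≤ X

theorem State.reg_setReg (s : State) (x y : ℕ) (v : ℤ) :
    (s.setReg x v).reg y = if y = x then v else s.reg y := Function.update_apply _ _ _ _

theorem State.setReg_self {s : State} {x : ℕ} {v : ℤ} (h : s.reg x = v) : s.setReg x v = s := by
  subst h; simp [State.setReg]

theorem State.setReg_setReg (s : State) (x : ℕ) (u v : ℤ) :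
    (s.setReg x u).setReg x v = s.setReg x v := by
  simp [State.setReg]

theorem State.setReg_comm (s : State) {x y : ℕ} (h : x ≠ y) (u v : ℤ) :
    (s.setReg x u).setReg y v = (s.setReg y v).setReg x u := by
  simp only [State.setReg]
  rw [Function.update_comm h]

theorem State.Bounded.setReg {s : State} {X : ℕ} (h : s.Bounded X) (x : ℕ) {v : ℤ}
    (hv : bits v ≤ X) : (s.setReg x v).Bounded X := fun y => by
  rw [State.reg_setReg]; split_ifs
  · exact hv
  · exact h y

/-- Expressions that do not refer to the memory. -/
def Expr.Pure : Expr → Bool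
  | .const _ => true
  | .reg _ => true
  | .load _ _ _ _ => false
  | .add e f => e.Pure && f.Pure
  | .sub e f => e.Pure && f.Pure
  | .mul e f => e.Pure && f.Pure
  | .div e f => e.Pure && f.Pure
  | .len e => e.Pure

theorem Expr.cost_le_of_pure {s : State} {X : ℕ} (h : s.Bounded X) (e : Expr)
    (he : e.Pure = true) : e.cost s ≤ e.weight * (X + 1) := by
  induction e with
  | const n => simp only [Expr.cost, Expr.weight]; nlinarith [Nat.zero_le (bits n * X)]
  | reg x =>
    have := h x
    simp only [Expr.cost, Expr.weight]; omega
  | load a i j k => simp [Expr.Pure] at he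
  | len e h1 =>
    have h1 := h1 he
    have b1 := e.one_add_bits_eval_le_cost s
    have := bits_bits_le (e.eval s)
    simp only [Expr.cost, Expr.weight, Expr.eval]
    rw [mul_assoc]; omega
  | _ e f h1 h2 =>
    simp only [Expr.Pure, Bool.and_eq_true] at he
    have h1 := h1 he.1
    have h2 := h2 he.2
    have b1 := e.one_add_bits_eval_le_cost s
    have b2 := f.one_add_bits_eval_le_cost s
    have := bits_add_le (e.eval s) (f.eval s)
    have := bits_sub_le (e.eval s) (f.eval s)
    have := bits_mul_le (e.eval s) (f.eval s)
    have := bits_div_le (e.eval s) (f.eval s)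
    simp only [Expr.cost, Expr.weight, Expr.eval]
    rw [mul_assoc, add_mul]; omega

theorem runs_set {s : State} {X : ℕ} (h : s.Bounded X) (x : ℕ) {e : Expr} (he : e.Pure = true)
    {v : ℤ} (hv : e.eval s = v) : Runs (.set x e) s (s.setReg x v) (e.weight + 1) (X + 1) := by
  have := Expr.cost_le_of_pure h e he
  refine ⟨by simp only [Cmd.run, hv], ?_, ?_⟩ <;> simp only [Cmd.run, add_mul] <;> omega

/-- A loop with counter `20`, which is reset at the end. -/
def repeatCmd (e : Expr) (c : Cmd) : Cmd := .seq (.loop 20 e c) (.set 20 (.const 0))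

/-- The states f i are described without the counter; this is why the counter is zero before and
reset to zero after the loop. -/
theorem runs_repeat {c : Cmd} {e : Expr} {s : State} (f : ℕ → State) {n K X : ℕ} (h0 : f 0 = s)
    (hs : s.Bounded X) (he : e.Pure = true) (hn : e.eval s = n) (hnX : n ≤ X)
    (h20 : ∀ i ≤ n, (f i).reg 20 = 0)
    (hc : ∀ i < n, Runs c ((f i).setReg 20 i) ((f (i + 1)).setReg 20 i) K (X + 1)) :
    Runs (repeatCmd e c) s (f n) (e.weight + K + 4) ((X + 1) ^ 2) := by
  have key : ∀ i ≤ n, ∃ u : ℤ, loopState 20 c s i = (f i).setReg 20 u := by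
    intro i
    induction i with
    | zero => intro _; exact ⟨0, by rw [State.setReg_self (h20 0 (by omega)), h0]; rfl⟩
    | succ i ih =>
      intro hi
      obtain ⟨u, hu⟩ := ih (by omega)
      refine ⟨i, ?_⟩
      rw [loopState, hu, State.setReg_setReg, (hc i (by omega)).state]
  have hcost := loop_cost (x := 20) (e := e) (c := c) (s := s) (w := (K + 1) * (X + 1))
    (δ := (K + 1) * (X + 1)) (by
      intro i hi
      rw [hn, Int.toNat_natCast] at hi
      obtain ⟨u, hu⟩ := key i hi.le
      have hb : bits (i : ℤ) ≤ i := Nat.size_le.2 (by simpa using Nat.lt_two_pow_self)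
      have h1 := (hc i hi).work
      have h2 := (hc i hi).depth
      rw [hu, State.setReg_setReg, add_mul]
      omega)
  rw [hn, Int.toNat_natCast] at hcost
  have h1 := Expr.cost_le_of_pure hs e he
  have h2 : n * ((K + 1) * (X + 1)) ≤ X * ((K + 1) * (X + 1)) := Nat.mul_le_mul_right _ hnX
  have h3 : 1 + e.cost s + n * ((K + 1) * (X + 1)) + 3 ≤ (e.weight + K + 4) * (X + 1) ^ 2 := by
    have e1 : (e.weight + K + 4) * (X + 1) ^ 2 = e.weight * (X + 1) + X * ((K + 1) * (X + 1))
      + (e.weight * X * (X + 1) + (K + 1) * (X + 1) + 3 * X ^ 2 + 6 * X + 3) := by ring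
    have h4 : 1 ≤ (K + 1) * (X + 1) := Nat.mul_pos (by omega) (by omega)
    rw [e1]
    have := Nat.zero_le (e.weight * X * (X + 1))
    omega
  have h5 : bits 0 = 0 := rfl
  refine ⟨?_, ?_, ?_⟩
  · obtain ⟨u, hu⟩ := key n le_rfl
    rw [repeatCmd, run_seq_state, loop_state, hn, Int.toNat_natCast, hu]
    change ((f n).setReg 20 u).setReg 20 0 = _
    rw [State.setReg_setReg, State.setReg_self (h20 n le_rfl)]
  · change ((Cmd.loop 20 e c).run s).work + (1 + (1 + bits 0)) ≤ _
    omega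
  · change ((Cmd.loop 20 e c).run s).depth + (1 + (1 + bits 0)) ≤ _
    omega

/-- Register `y` becomes `b ^ e`. -/
def powCmd (y : ℕ) (b e : Expr) : Cmd :=
  .seq (.set y (.const 1)) (repeatCmd e (.set y (.mul (.reg y) b)))

/-- Multiplication by the base n times suffices, since all exponents that occur are small compared
with the permitted cost. Intermediate powers are no longer than the last one because β ≥ 1. -/
theorem runs_pow {y : ℕ} {b e : Expr} {s : State} {n β X : ℕ} (hy : y ≠ 20) (hs : s.Bounded X)
    (h20 : s.reg 20 = 0) (hb : b.Pure = true) (he : e.Pure = true)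
    (hn : ∀ u, e.eval (s.setReg y u) = n) (hnX : n ≤ X)
    (hβ : ∀ u v, b.eval ((s.setReg y u).setReg 20 v) = β) (hβ1 : 1 ≤ β)
    (hX : bits ((β ^ n : ℕ) : ℤ) ≤ X) :
    Runs (powCmd y b e) s (s.setReg y ((β ^ n : ℕ) : ℤ)) (e.weight + 2 * b.weight + 10)
      ((X + 1) ^ 2) := by
  have hbit : ∀ i ≤ n, bits ((β ^ i : ℕ) : ℤ) ≤ X := fun i hi =>
    (bits_natCast_mono (Nat.pow_le_pow_right hβ1 hi)).trans hX
  have h1 : bits 1 = 1 := rfl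
  have hX1 : bits 1 ≤ X := by simpa using hbit 0 (by omega)
  have r1 := (runs_set hs y (e := .const 1) rfl rfl).mono
    (show X + 1 ≤ (X + 1) ^ 2 from Nat.le_self_pow two_ne_zero _)
  have hs1 := hs.setReg y hX1
  have r2 := runs_repeat (c := .set y (.mul (.reg y) b)) (e := e) (s := s.setReg y 1) (X := X)
    (K := 2 * (1 + b.weight) + 1) (fun i => s.setReg y ((β ^ i : ℕ) : ℤ)) (n := n) (by simp) hs1
    he (hn 1) hnX (fun i _ => by rw [State.reg_setReg, if_neg (Ne.symm hy), h20])
    (fun i hi => by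
      have hi' : bits (i : ℤ) ≤ X :=
        (Nat.size_le.2 (by simpa using Nat.lt_two_pow_self (n := i))).trans (hi.le.trans hnX)
      have := runs_set ((hs.setReg y (hbit i hi.le)).setReg 20 hi') y
        (e := .mul (.reg y) b) (by simp [Expr.Pure, hb]) (v := ((β ^ (i + 1) : ℕ) : ℤ)) (by
          simp only [Expr.eval]
          rw [hβ, State.reg_setReg, if_neg hy, State.reg_setReg, if_pos rfl, pow_succ]
          push_cast; rfl)
      rwa [← State.setReg_comm _ hy, State.setReg_setReg] at this)
  have := r1.seq r2
  refine ⟨this.state, this.work.trans (Nat.mul_le_mul_right _ ?_),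
    this.depth.trans (Nat.mul_le_mul_right _ ?_)⟩ <;> simp only [Expr.weight, h1] <;> omega

end Registers

/-! ### Computing the parameters of the main part. -/

section Parameters

theorem bits_natCast_le (n : ℕ) : bits (n : ℤ) ≤ n :=
  Nat.size_le.2 (by simpa using Nat.lt_two_pow_self)

theorem bits_two_pow (k : ℕ) : bits ((2 ^ k : ℕ) : ℤ) = k + 1 := by
  rw [bits, Int.natAbs_natCast, Nat.size_pow]

@[simp] theorem Expr.eval_one (s : State) : (1 : Expr).eval s = 1 := rfl
@[simp] theorem Expr.eval_two (s : State) : (2 : Expr).eval s = 2 := rfl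
@[simp] theorem Expr.eval_eight (s : State) : (8 : Expr).eval s = 8 := rfl
@[simp] theorem Expr.eval_sixteen (s : State) : (16 : Expr).eval s = 16 := rfl
@[simp] theorem Expr.eval_twenty (s : State) : (20 : Expr).eval s = 20 := rfl
@[simp] theorem Expr.eval_160 (s : State) : (160 : Expr).eval s = 160 := rfl
@[simp] theorem Expr.eval_256 (s : State) : (256 : Expr).eval s = 256 := rfl

theorem runs_sumStep {s : State} {X p m i : ℕ} (hs : s.Bounded X) (h23 : s.reg 23 = p)
    (hi : i < m) (hX : m * p + m + 2 ≤ X) :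
    Runs (.seq (.set 24 (.reg 24 + .reg 23 / ((.reg 20 + 1) * .reg 25)))
        (.set 25 (2 * .reg 25)))
      (((s.setReg 24 (logTwoSum p i : ℕ)).setReg 25 ((2 ^ (i + 1) : ℕ) : ℤ)).setReg 20 i)
      (((s.setReg 24 (logTwoSum p (i + 1) : ℕ)).setReg 25 ((2 ^ (i + 2) : ℕ) : ℤ)).setReg 20 i)
      (((Expr.reg 24 + .reg 23 / ((.reg 20 + 1) * .reg 25)).weight + 1) +
        ((2 * Expr.reg 25).weight + 1)) (X + 1) := by
  have hq : ∀ j ≤ m, bits (logTwoSum p j : ℕ) ≤ X := fun j hj => by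
    refine (bits_natCast_le _).trans ((logTwoSum_le p j).trans ?_)
    exact (Nat.mul_le_mul_right p hj).trans (by omega)
  have ht : ∀ j ≤ m, bits ((2 ^ (j + 1) : ℕ) : ℤ) ≤ X := fun j hj => by
    rw [bits_two_pow]; omega
  have hb := ((hs.setReg 24 (hq i hi.le)).setReg 25 (ht i hi.le)).setReg 20
    ((bits_natCast_le i).trans (by omega))
  have r1 := runs_set hb 24 (e := .reg 24 + .reg 23 / ((.reg 20 + 1) * .reg 25)) rfl
    (v := (logTwoSum p (i + 1) : ℕ)) (by
      simp only [Expr.eval_add, Expr.eval_div, Expr.eval_mul, Expr.eval_reg, Expr.eval_one,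
        State.reg_setReg, h23, logTwoSum, Finset.sum_range_succ _ i]
      norm_num)
  have r2 := runs_set (hb.setReg 24 (hq (i + 1) hi)) 25 (e := 2 * .reg 25) rfl
    (v := ((2 ^ (i + 2) : ℕ) : ℤ)) (by
      simp only [Expr.eval_mul, Expr.eval_reg, Expr.eval_two, State.reg_setReg]
      norm_num
      ring)
  convert r1.seq r2 using 1
  simp only [State.setReg, State.mk.injEq, and_true]
  funext y
  simp only [Function.update_apply]
  split_ifs <;> first | rfl | omega

/-- Computes the number of rounds. -/
def roundsCmd : Cmd :=
  .seq (.set 18 (256 * (.reg 3 * .reg 1 * .reg 2) * (.reg 3 * .reg 1 * .reg 2))) <|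
  .seq (powCmd 19 (.reg 0) (.reg 18)) <|
  .seq (.set 21 (.len (.reg 19))) <|
  .seq (.set 22 (.reg 21 + 8)) <|
  .seq (.set 23 (16 * .reg 22 * .reg 21)) <|
  .seq (.set 24 0) <|
  .seq (.set 25 2) <|
  .seq (repeatCmd (.reg 22) (.seq (.set 24 (.reg 24 + .reg 23 / ((.reg 20 + 1) * .reg 25)))
        (.set 25 (2 * .reg 25)))) <|
  .set 11 (.reg 21 * (.reg 24 + 2 * .reg 22) / .reg 23 + 1)

theorem exists_runs_roundsCmd : ∃ K : ℕ, ∀ {d M W E X : ℕ} {s : State}, s.Bounded X → 1 ≤ d →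
    s.reg 0 = d → s.reg 1 = M → s.reg 2 = W → s.reg 3 = E → s.reg 20 = 0 →
    invRateSq M W E + 16 * (powLen d M W E + 8) * powLen d M W E + powLen d M W E +
      (powLen d M W E + 8) * (16 * (powLen d M W E + 8) * powLen d M W E) +
      numRounds d M W E + 10 ≤ X →
    ∃ s', Runs roundsCmd s s' K ((X + 1) ^ 2) ∧ s'.mem = s.mem ∧ s'.Bounded X ∧ s'.reg 20 = 0 ∧
      s'.reg 11 = numRounds d M W E ∧ ∀ x ≤ 10, s'.reg x = s.reg x := by
  -- The constant stays open and is determined by composing the costs of the single commands, none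
  -- of which depends on the parameters.
  apply Exists.intro
  intro d M W E X s hs hd h0 h1 h2 h3 h20 hX
  have hY : X + 1 ≤ (X + 1) ^ 2 := Nat.le_self_pow two_ne_zero _
  have hT := numRounds.eq_1 d M W E
  have hLdef : bits ((d ^ invRateSq M W E : ℕ) : ℤ) = powLen d M W E := by
    rw [bits, Int.natAbs_natCast, powLen]
  have hGdef := invRateSq.eq_1 M W E
  generalize numRounds d M W E = T at *
  generalize powLen d M W E = L at *
  generalize invRateSq M W E = G at *
  generalize hm : L + 8 = m at *
  generalize hp : 16 * m * L = p at *
  have nb : ∀ k : ℕ, k ≤ X → bits (k : ℤ) ≤ X := fun k hk => (bits_natCast_le k).trans hk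
  have hpm := logTwoSum_le p m
  have r1 := (runs_set hs 18 (e := 256 * (.reg 3 * .reg 1 * .reg 2) * (.reg 3 * .reg 1 * .reg 2))
    rfl (v := G) (by
      simp only [Expr.eval_mul, Expr.eval_reg, Expr.eval_256, h1, h2, h3, hGdef]
      push_cast; rfl)).mono hY
  have b1 := hs.setReg 18 (nb G (by omega))
  have r2 := runs_pow (y := 19) (b := .reg 0) (e := .reg 18) (n := G) (β := d) (by norm_num) b1
    (by simp [State.reg_setReg, h20]) rfl rfl (by simp [State.reg_setReg]) (by omega)
    (by simp [State.reg_setReg, h0]) hd (by omega)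
  have b2 := b1.setReg 19 (v := ((d ^ G : ℕ) : ℤ)) (by omega)
  have r3 := (runs_set b2 21 (e := .len (.reg 19)) rfl (v := L) (by
      simp only [Expr.eval, State.reg_setReg, if_true, hLdef])).mono hY
  have b3 := b2.setReg 21 (nb L (by omega))
  have r4 := (runs_set b3 22 (e := .reg 21 + 8) rfl (v := m) (by
      simp [State.reg_setReg, ← hm])).mono hY
  have b4 := b3.setReg 22 (nb m (by omega))
  have r5 := (runs_set b4 23 (e := 16 * .reg 22 * .reg 21) rfl (v := p) (by
      simp [State.reg_setReg, ← hp])).mono hY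
  have b5 := b4.setReg 23 (nb p (by omega))
  have r6 := (runs_set b5 24 (e := 0) rfl (v := 0) rfl).mono hY
  have b6 := b5.setReg 24 (v := 0) (Nat.zero_le _)
  have r7 := (runs_set b6 25 (e := 2) rfl (v := 2) rfl).mono hY
  have b7 := b6.setReg 25 (v := 2) ((show bits 2 = 2 from rfl).le.trans (by omega))
  generalize h5 : ((((((s.setReg 18 G).setReg 19 ((d ^ G : ℕ) : ℤ)).setReg 21 L).setReg 22 m).setReg
    23 p)) = s5 at *
  have e11 : ∀ x ≤ 10, s5.reg x = s.reg x := fun x hx => by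
    rw [← h5]; simp only [State.reg_setReg]; split_ifs <;> omega
  have e20 : s5.reg 20 = 0 := by rw [← h5]; simp [State.reg_setReg, h20]
  have e21 : s5.reg 21 = L := by rw [← h5]; simp [State.reg_setReg]
  have e22 : s5.reg 22 = m := by rw [← h5]; simp [State.reg_setReg]
  have e23 : s5.reg 23 = p := by rw [← h5]; simp [State.reg_setReg]
  have em : s5.mem = s.mem := by rw [← h5]; rfl
  have r8 := runs_repeat (X := X) (s := (s5.setReg 24 0).setReg 25 2) (e := .reg 22)
    (fun i => (s5.setReg 24 (logTwoSum p i : ℕ)).setReg 25 ((2 ^ (i + 1) : ℕ) : ℤ)) (n := m)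
    (by simp [logTwoSum]) b7 rfl (by simp [State.reg_setReg, e22]) (by omega)
    (fun i _ => by simp [State.reg_setReg, e20])
    (fun i hi => runs_sumStep (m := m) b5 e23 hi (by omega))
  have b8 := (b5.setReg 24 (nb (logTwoSum p m) (by omega))).setReg 25
    (v := ((2 ^ (m + 1) : ℕ) : ℤ)) (by rw [bits_two_pow]; omega)
  have r9 := (runs_set b8 11 (e := .reg 21 * (.reg 24 + 2 * .reg 22) / .reg 23 + 1) rfl
    (v := T) (by
      simp only [Expr.eval_add, Expr.eval_div, Expr.eval_mul, Expr.eval_reg, Expr.eval_one, Expr.eval_two,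
        State.reg_setReg, hT, e21, e22, e23]
      norm_num)).mono hY
  refine ⟨_, r1.seq (r2.seq (r3.seq (r4.seq (r5.seq (r6.seq (r7.seq (r8.seq r9))))))), ?_,
    b8.setReg 11 (nb T (by omega)), ?_, ?_, fun x hx => ?_⟩
  · exact em
  · simp [State.reg_setReg, e20]
  · simp [State.reg_setReg]
  · rw [← e11 x hx]; simp only [State.reg_setReg]; split_ifs <;> omega

/-- The parameters of the program, for `n = 2 ^ z`. -/
def params (d M W E z : ℕ) : Par where
  d := d
  M := M
  W := W
  E := E
  T := numRounds d M W E
  l := 16 * numRounds d M W E + 160 * z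
  sg := 2 ^ (20 * z)

/-- Computes the remaining parameters. -/
def scalesCmd : Cmd :=
  .seq (.set 26 (.len (.reg 0 + .reg 1 + .reg 2 + .reg 3))) <|
  .seq (.set 12 (16 * .reg 11 + 160 * .reg 26)) <|
  .seq (powCmd 13 2 (20 * .reg 26)) <|
  .seq (powCmd 14 2 (.reg 12)) <|
  .seq (powCmd 15 (.reg 14) (2 * .reg 12)) <|
  .seq (.set 16 (.reg 15 * .reg 15 * .reg 15 * .reg 15)) <|
  .set 17 (2 * .reg 16)

theorem exists_runs_scalesCmd : ∃ K : ℕ, ∀ {P : Par} {z X : ℕ} {s : State}, s.Bounded X →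
    s.reg 0 = P.d → s.reg 1 = P.M → s.reg 2 = P.W → s.reg 3 = P.E → s.reg 20 = 0 →
    s.reg 11 = P.T → z = (P.d + P.M + P.W + P.E).size → P.l = 16 * P.T + 160 * z →
    P.sg = 2 ^ (20 * z) → 1 ≤ z → P.T + 8 * P.l ^ 2 + 2 ≤ X →
    ∃ s', Runs scalesCmd s s' K ((X + 1) ^ 2) ∧ s'.mem = s.mem ∧ s'.Bounded X ∧
      s'.reg 0 = P.d ∧ s'.reg 1 = P.M ∧ s'.reg 2 = P.W ∧ s'.reg 3 = P.E ∧
      s'.reg 11 = P.T ∧ s'.reg 12 = P.l ∧ s'.reg 13 = P.sg ∧ s'.reg 14 = P.lam ∧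
      s'.reg 15 = P.scale ∧ s'.reg 16 = P.cap ∧ s'.reg 17 = 2 * P.cap ∧
      ∀ x, 4 ≤ x → x ≤ 10 → s'.reg x = s.reg x := by
  apply Exists.intro
  intro P z X s hs h0 h1 h2 h3 h20 h11 hz hl hsg hz1 hX
  have hY : X + 1 ≤ (X + 1) ^ 2 := Nat.le_self_pow two_ne_zero _
  have nb : ∀ k : ℕ, k ≤ X → bits (k : ℤ) ≤ X := fun k hk => (bits_natCast_le k).trans hk
  have hsq : P.l ≤ P.l ^ 2 := Nat.le_self_pow two_ne_zero _
  have e1 : P.scale = 2 ^ (2 * P.l ^ 2) := by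
    rw [Par.scale, Par.lam, ← pow_mul]; congr 1; ring
  have e2 : P.cap = 2 ^ (8 * P.l ^ 2) := by
    rw [Par.cap, e1, ← pow_mul]; congr 1; ring
  have e3 : 2 * P.cap = 2 ^ (8 * P.l ^ 2 + 1) := by rw [e2]; ring
  have r1 := (runs_set hs 26 (e := .len (.reg 0 + .reg 1 + .reg 2 + .reg 3)) rfl
    (v := z) (by
      change ((bits (s.reg 0 + s.reg 1 + s.reg 2 + s.reg 3) : ℕ) : ℤ) = z
      rw [h0, h1, h2, h3, hz, bits]
      norm_cast)).mono hY
  have b1 := hs.setReg 26 (nb z (by omega))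
  have r2 := (runs_set b1 12 (e := 16 * .reg 11 + 160 * .reg 26) rfl
    (v := P.l) (by simp [State.reg_setReg, h11, hl])).mono hY
  have b2 := b1.setReg 12 (nb P.l (by omega))
  have r3 := runs_pow (y := 13) (b := 2) (e := 20 * .reg 26) (n := 20 * z) (β := 2)
    (by norm_num) b2 (by simp [State.reg_setReg, h20]) rfl rfl (by simp [State.reg_setReg])
    (by omega) (by simp) (by norm_num) (by rw [bits_two_pow]; omega)
  have b3 := b2.setReg 13 (v := ((2 ^ (20 * z) : ℕ) : ℤ)) (by rw [bits_two_pow]; omega)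
  have r4 := runs_pow (y := 14) (b := 2) (e := .reg 12) (n := P.l) (β := 2)
    (by norm_num) b3 (by simp [State.reg_setReg, h20]) rfl rfl (by simp [State.reg_setReg])
    (by omega) (by simp) (by norm_num) (by rw [bits_two_pow]; omega)
  have b4 := b3.setReg 14 (v := ((2 ^ P.l : ℕ) : ℤ)) (by rw [bits_two_pow]; omega)
  have r5 := runs_pow (y := 15) (b := .reg 14) (e := 2 * .reg 12) (n := 2 * P.l) (β := P.lam)
    (by norm_num) b4 (by simp [State.reg_setReg, h20]) rfl rfl (by simp [State.reg_setReg])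
    (by omega) (by simp [State.reg_setReg, Par.lam]) P.lam_pos (by
      change bits (P.scale : ℤ) ≤ X
      rw [e1, bits_two_pow]; omega)
  have b5 := b4.setReg 15 (v := ((P.lam ^ (2 * P.l) : ℕ) : ℤ)) (by
      change bits (P.scale : ℤ) ≤ X
      rw [e1, bits_two_pow]; omega)
  have r6 := (runs_set b5 16 (e := .reg 15 * .reg 15 * .reg 15 * .reg 15) rfl
    (v := P.cap) (by simp [State.reg_setReg, Par.cap, Par.scale]; ring)).mono hY
  have b6 := b5.setReg 16 (v := (P.cap : ℤ)) (by rw [e2, bits_two_pow]; omega)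
  have r7 := (runs_set b6 17 (e := 2 * .reg 16) rfl
    (v := ((2 * P.cap : ℕ) : ℤ)) (by simp [State.reg_setReg])).mono hY
  have b7 := b6.setReg 17 (v := ((2 * P.cap : ℕ) : ℤ)) (by rw [e3, bits_two_pow]; omega)
  refine ⟨_, r1.seq (r2.seq (r3.seq (r4.seq (r5.seq (r6.seq r7))))), rfl, b7, ?_, ?_, ?_, ?_, ?_,
    ?_, ?_, ?_, ?_, ?_, ?_, fun x hx hx' => ?_⟩
  · simpa [State.reg_setReg] using h0
  · simpa [State.reg_setReg] using h1
  · simpa [State.reg_setReg] using h2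
  · simpa [State.reg_setReg] using h3
  · simpa [State.reg_setReg] using h11
  · simp [State.reg_setReg]
  · simp [State.reg_setReg, hsg]
  · simp [State.reg_setReg, Par.lam]
  · simp [State.reg_setReg, Par.scale]
  · simp [State.reg_setReg]
  · simp [State.reg_setReg]
  · simp only [State.reg_setReg]; split_ifs <;> omega

end Parameters

/-! ### Copying the input. -/

section Copy

variable {P : Par} {s : State} {n : ℕ}

theorem Par.Ok.sg_mul_W_lt_cap (hP : P.Ok) : P.sg * P.W + 1 ≤ P.cap := by
  have h1 : P.sg * P.W ≤ P.lam ^ 2 := by rw [sq]; exact Nat.mul_le_mul hP.sg_le hP.W_le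
  have h2 : P.lam ^ 2 ≤ P.scale :=
    Nat.pow_le_pow_right P.lam_pos (by have := hP.l_pos; omega)
  have h3 : 2 ≤ P.lam := Nat.le_self_pow (by have := hP.l_pos; omega) 2
  have h4 : 2 ≤ P.scale := h3.trans hP.lam_le_scale
  have h5 : P.scale ≤ P.scale ^ 3 := Nat.le_self_pow (by norm_num) _
  have h6 : P.scale * 2 ≤ P.cap := by
    rw [Par.cap, pow_succ']; exact Nat.mul_le_mul_left _ (h4.trans h5)
  omega

theorem Par.Ok.bits_le_len_of_abs_sub (hP : P.Ok) {v : ℤ} {x : ℝ} (hv : |(v : ℝ) - P.sg * x| ≤ 1)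
    (hx : |x| ≤ P.W) : bits v ≤ P.len := by
  have h0 : (0 : ℝ) ≤ P.sg := Nat.cast_nonneg _
  have h1 : |(v : ℝ)| ≤ P.sg * P.W + 1 := by
    calc |(v : ℝ)| = |(v - P.sg * x) + P.sg * x| := by rw [sub_add_cancel]
      _ ≤ |(v : ℝ) - P.sg * x| + |(P.sg : ℝ) * x| := abs_add_le _ _
      _ ≤ 1 + P.sg * P.W := by
        rw [abs_mul, abs_of_nonneg h0]
        exact add_le_add hv (mul_le_mul_of_nonneg_left hx h0)
      _ = _ := add_comm _ _
  have h2 : ((v.natAbs : ℕ) : ℝ) = |(v : ℝ)| := by rw [Nat.cast_natAbs]; push_cast; rfl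
  have h3 : v.natAbs ≤ P.sg * P.W + 1 := by
    rw [← h2] at h1; exact_mod_cast h1
  have h4 := Par.bits_le_len (P := P) (h3.trans hP.sg_mul_W_lt_cap)
  exact h4

/-- Copies array `b` to array `a`. -/
def copyArray (a b : ℕ) (n₂ n₃ : Dim) : Cmd := pmap a .num n₂ n₃ (.load b ix1 ix2 ix3)

/-- The input arrays may hold anything outside of the index range, so they cannot satisfy the
invariant; copying the relevant cells to zeroed arrays establishes it. No clamp is needed because
the sizes are assumed. -/
theorem copyArray_spec (hP : P.Ok) (h : Inv P s) (a b : ℕ) {n₂ n₃ : Dim} (hn : n₃ ≠ .num)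
    (hb : ∀ i j k : ℕ, i < P.M → j < n₂.size P → k < n₃.size P →
      bits (s.mem b i j k) ≤ P.len) :
    ∃ s', ((copyArray a b n₂ n₃).run s).state = s' ∧ Inv P s' ∧
      (∀ i j k : ℕ, i < P.M → j < n₂.size P → k < n₃.size P → s'.mem a i j k = s.mem b i j k) ∧
      (∀ a', a' ≠ a → s'.mem a' = s.mem a') ∧
      ((copyArray a b n₂ n₃).run s).work ≤ 400 * (P.len + 1) * (P.d + P.M + 1) ^ 3 ∧
      ((copyArray a b n₂ n₃).run s).depth ≤ 400 * (P.len + 1) := by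
  have hmem := pmap_mem a .num n₂ n₃ (.load b ix1 ix2 ix3) s
  simp only [Dim.eval_eq h] at hmem
  have hval : ∀ i j k : ℤ, (Expr.load b ix1 ix2 ix3).eval (s.branch i j k) = s.mem b i j k :=
    fun i j k => rfl
  have bd : ∀ (m : Dim) (i : ℕ), i < (m.expr.eval s).toNat → bits i ≤ P.len := by
    intro m i hi
    rw [Dim.eval_eq h, Int.toNat_natCast] at hi
    refine hP.bits_le_len (hi.le.trans ?_)
    cases m
    · exact P.lam_pos
    · exact hP.d_le
    · exact hP.M_le
  have hcost := pmap_cost (a := a) (n₁ := .num) (n₂ := n₂) (n₃ := n₃)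
    (e := .load b ix1 ix2 ix3) (s := s) (X := 3 + P.len) (w := 4 * (P.len + 1))
    (N := P.d + P.M + 1)
    (by have := h.reg_le hP (x := 0) (by norm_num); omega)
    (by have := h.reg_le hP (x := 1) (by norm_num); omega) (by omega)
    (Dim.eval_le h _) (Dim.eval_le h _) (Dim.eval_le h _)
    (fun i j k hi hj hk => by
      have h1 := bd _ _ hi
      have h2 := bd _ _ hj
      have h3 := bd _ _ hk
      simp only [Dim.eval_eq h, Int.toNat_natCast] at hi hj hk
      have h4 := hb i j k hi hj hk
      change 1 + bits (s.mem b i j k) + (1 + bits (i : ℤ)) + (1 + bits (j : ℤ))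
        + (1 + bits (k : ℤ)) ≤ _
      omega)
  refine ⟨_, rfl, ⟨h.r0, h.r1, h.r2, h.r3, h.r11, h.r12, h.r13, h.r14, h.r15, h.r16, h.r17, h.idx,
    fun a' ha' i j k => ?_, fun a' ha' i j k hk => ?_⟩, fun i j k hi hj hk => ?_,
    fun a' ha' => ?_, hcost.1.trans ?_, hcost.2.trans (by omega)⟩
  · rw [copyArray, hmem]
    split_ifs with hc
    · obtain ⟨-, ⟨h1, h2⟩, ⟨h3, h4⟩, h5, h6⟩ := hc
      lift i to ℕ using h1
      lift j to ℕ using h3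
      lift k to ℕ using h5
      rw [hval]
      exact hb i j k (by exact_mod_cast h2) (by exact_mod_cast h4) (by exact_mod_cast h6)
    · exact h.mem_le a' ha' i j k
  · rw [copyArray, hmem, if_neg, h.mem_zero a' ha' i j k hk]
    rintro ⟨-, -, -, h5, h6⟩
    have hd := hP.d_pos
    cases n₃
    · simp [Dim.size] at h6; omega
    · simp [Dim.size] at h6; omega
    · exact hn rfl
  · rw [copyArray, hmem, if_pos, hval]
    exact ⟨rfl, ⟨by positivity, by exact_mod_cast hi⟩, ⟨by positivity, by exact_mod_cast hj⟩,
      by positivity, by exact_mod_cast hk⟩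
  · funext i j k
    rw [copyArray, hmem, if_neg (by tauto)]
  · have : (P.d + P.M + 1 + 1) ^ 3 ≤ 8 * (P.d + P.M + 1) ^ 3 := by
      calc _ ≤ (2 * (P.d + P.M + 1)) ^ 3 := Nat.pow_le_pow_left (by omega) 3
        _ = _ := by ring
    calc _ ≤ (8 * (P.d + P.M + 1) ^ 3) * (50 * (P.len + 1)) :=
          Nat.mul_le_mul this (by omega)
      _ = _ := by ring

/-- Copies the input to the arrays `4` to `7`. -/
def copyCmd : Cmd :=
  .seq (copyArray 4 0 .dim .dim) <| .seq (copyArray 5 1 .dim .dim) <|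
  .seq (copyArray 6 2 .one .one) (copyArray 7 3 .one .one)

theorem copyCmd_spec {Q : Fin P.M → Matrix (Fin P.d) (Fin P.d) ℂ} {p : Fin P.M → ℂ}
    (hP : P.Ok) (h : Inv P s) (hQ : IsInstance P.W Q p)
    (h0 : ∀ (k : Fin P.M) (i j : Fin P.d), |(s.mem 0 k i j : ℝ) - P.sg * (Q k i j).re| ≤ 1)
    (h1 : ∀ (k : Fin P.M) (i j : Fin P.d), |(s.mem 1 k i j : ℝ) - P.sg * (Q k i j).im| ≤ 1)
    (h2 : ∀ k : Fin P.M, |(s.mem 2 k 0 0 : ℝ) - P.sg * (p k).re| ≤ 1)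
    (h3 : ∀ k : Fin P.M, |(s.mem 3 k 0 0 : ℝ) - P.sg * (p k).im| ≤ 1) :
    ∃ s', (copyCmd.run s).state = s' ∧ Inv P s' ∧ Holds P Q p s' ∧
      (∀ a, 8 ≤ a → s'.mem a = s.mem a) ∧
      (copyCmd.run s).work ≤ 1600 * (P.len + 1) * (P.d + P.M + 1) ^ 3 ∧
      (copyCmd.run s).depth ≤ 1600 * (P.len + 1) := by
  have hq : ∀ (k : Fin P.M) (i j : Fin P.d), ‖Q k i j‖ ≤ P.W :=
    fun k i j => (norm_entry_le_norm (Q k) i j).trans (hQ.1 k)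
  have b0 : ∀ i j k : ℕ, i < P.M → j < P.d → k < P.d → bits (s.mem 0 i j k) ≤ P.len :=
    fun i j k hi hj hk => hP.bits_le_len_of_abs_sub (h0 ⟨i, hi⟩ ⟨j, hj⟩ ⟨k, hk⟩)
      ((Complex.abs_re_le_norm _).trans (hq _ _ _))
  have b1 : ∀ i j k : ℕ, i < P.M → j < P.d → k < P.d → bits (s.mem 1 i j k) ≤ P.len :=
    fun i j k hi hj hk => hP.bits_le_len_of_abs_sub (h1 ⟨i, hi⟩ ⟨j, hj⟩ ⟨k, hk⟩)
      ((Complex.abs_im_le_norm _).trans (hq _ _ _))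
  have b2 : ∀ i j k : ℕ, i < P.M → j < 1 → k < 1 → bits (s.mem 2 i j k) ≤ P.len := by
    intro i j k hi hj hk
    obtain rfl : j = 0 := by omega
    obtain rfl : k = 0 := by omega
    exact hP.bits_le_len_of_abs_sub (h2 ⟨i, hi⟩) ((Complex.abs_re_le_norm _).trans (hQ.2 _))
  have b3 : ∀ i j k : ℕ, i < P.M → j < 1 → k < 1 → bits (s.mem 3 i j k) ≤ P.len := by
    intro i j k hi hj hk
    obtain rfl : j = 0 := by omega
    obtain rfl : k = 0 := by omega
    exact hP.bits_le_len_of_abs_sub (h3 ⟨i, hi⟩) ((Complex.abs_im_le_norm _).trans (hQ.2 _))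
  obtain ⟨s1, e1, i1, m1, o1, w1, d1⟩ :=
    copyArray_spec hP h 4 0 (n₂ := .dim) (n₃ := .dim) (by simp) b0
  obtain ⟨s2, e2, i2, m2, o2, w2, d2⟩ :=
    copyArray_spec hP i1 5 1 (n₂ := .dim) (n₃ := .dim) (by simp)
      (by rw [o1 1 (by norm_num)]; exact b1)
  obtain ⟨s3, e3, i3, m3, o3, w3, d3⟩ :=
    copyArray_spec hP i2 6 2 (n₂ := .one) (n₃ := .one) (by simp)
      (by rw [o2 2 (by norm_num), o1 2 (by norm_num)]; exact b2)
  obtain ⟨s4, e4, i4, m4, o4, w4, d4⟩ :=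
    copyArray_spec hP i3 7 3 (n₂ := .one) (n₃ := .one) (by simp)
      (by rw [o3 3 (by norm_num), o2 3 (by norm_num), o1 3 (by norm_num)]; exact b3)
  refine ⟨s4, ?_, i4, ⟨?_, ?_, ?_, ?_⟩, ?_, ?_, ?_⟩
  · simp only [copyCmd, run_seq_state, e1, e2, e3, e4]
  · intro k i j
    rw [o4 4 (by norm_num), o3 4 (by norm_num), o2 4 (by norm_num), m1 _ _ _ k.2 i.2 j.2]
    exact h0 k i j
  · intro k i j
    rw [o4 5 (by norm_num), o3 5 (by norm_num), m2 _ _ _ k.2 i.2 j.2, o1 1 (by norm_num)]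
    exact h1 k i j
  · intro k
    have := m3 k 0 0 k.2 one_pos one_pos
    rw [Nat.cast_zero] at this
    rw [o4 6 (by norm_num), this, o2 2 (by norm_num), o1 2 (by norm_num)]
    exact h2 k
  · intro k
    have := m4 k 0 0 k.2 one_pos one_pos
    rw [Nat.cast_zero] at this
    rw [this, o3 3 (by norm_num), o2 3 (by norm_num), o1 3 (by norm_num)]
    exact h3 k
  · intro a ha
    rw [o4 a (by omega), o3 a (by omega), o2 a (by omega), o1 a (by omega)]
  · have : (copyCmd.run s).work = ((copyArray 4 0 .dim .dim).run s).work +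
        (((copyArray 5 1 .dim .dim).run s1).work + (((copyArray 6 2 .one .one).run s2).work +
          ((copyArray 7 3 .one .one).run s3).work)) := by
      simp only [copyCmd, Cmd.run, e1, e2, e3]
    linarith
  · have : (copyCmd.run s).depth = ((copyArray 4 0 .dim .dim).run s).depth +
        (((copyArray 5 1 .dim .dim).run s1).depth + (((copyArray 6 2 .one .one).run s2).depth +
          ((copyArray 7 3 .one .one).run s3).depth)) := by
      simp only [copyCmd, Cmd.run, e1, e2, e3]
    omega

end Copy

/-! ### Correctness and cost of the whole program. -/

section Correctness

/-- n = 2^z exceeds the sum of the parameters, and sg = n^20 is exactly the input precision of 20 z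
binary places. With l = 16T + 160z one gets λ = 2^{16T} sg⁸. -/
theorem params_fine {d M W E z : ℕ} (hd : 1 ≤ d) (hM : 1 ≤ M) (hW : 1 ≤ W) (hE : 1 ≤ E)
    (hz : z = (d + M + W + E).size) : (params d M W E z).Fine (2 ^ z) := by
  have h1 : d + M + W + E < 2 ^ z := by rw [hz]; exact Nat.lt_size_self _
  have h2 : 2 < z := by rw [hz, Nat.lt_size]; omega
  have hT : 1 ≤ numRounds d M W E := Nat.le_add_left _ _
  have hl : (params d M W E z).l = 16 * numRounds d M W E + 160 * z := rfl
  have h3 : 2 ^ z ≤ (params d M W E z).lam := by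
    rw [Par.lam, hl]; exact Nat.pow_le_pow_right two_pos (by omega)
  have h4 : (params d M W E z).sg ≤ (params d M W E z).lam := by
    rw [Par.lam, hl]; exact Nat.pow_le_pow_right two_pos (by omega)
  have h5 : 2 ^ 3 ≤ 2 ^ z := Nat.pow_le_pow_right two_pos h2
  have h6 : (params d M W E z).T ≤ (params d M W E z).lam :=
    le_trans (by rw [hl]; change numRounds d M W E ≤ _; omega) (Par.l_le_lam _)
  exact
    { d_pos := hd
      M_pos := hM
      W_pos := hW
      E_pos := hE
      T_pos := hT
      l_pos := by rw [hl]; omega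
      sg_pos := Nat.one_le_two_pow
      d_le := le_trans (by change d ≤ _; omega) h3
      M_le := le_trans (by change M ≤ _; omega) h3
      W_le := le_trans (by change W ≤ _; omega) h3
      E_le := le_trans (by change E ≤ _; omega) h3
      T_le := h6
      sg_le := h4
      d_le' := by change d ≤ _; omega
      M_le' := by change M ≤ _; omega
      W_le' := by change W ≤ _; omega
      E_le' := by change E ≤ _; omega
      n_ge := by omega
      sg_eq := by change 2 ^ (20 * z) = _; rw [← pow_mul, mul_comm]
      lam_eq := by
        change 2 ^ (16 * numRounds d M W E + 160 * z)
          = 2 ^ (16 * numRounds d M W E) * (2 ^ (20 * z)) ^ 8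
        rw [← pow_mul, pow_add]; congr 2; ring
      l_ge := by rw [hl]; change 16 * numRounds d M W E + 8 ≤ _; omega }

/-- The parameters that belong to the input. -/
abbrev inputParams (d M W E : ℕ) : Par := params d M W E (d + M + W + E).size

/-- A bound for the bit lengths of all numbers in the computation. -/
def bitBound (d M W E : ℕ) : ℕ :=
  invRateSq M W E + 16 * (powLen d M W E + 8) * powLen d M W E + powLen d M W E +
    (powLen d M W E + 8) * (16 * (powLen d M W E + 8) * powLen d M W E) +
    numRounds d M W E + 9 * (inputParams d M W E).l ^ 2 + 10

/-- The length of all numbers is quadratic in l, hence polynomial in T and z. -/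
theorem Par.len_eq (P : Par) : P.len = 8 * P.l ^ 2 + 2 := by
  have : 2 * P.cap = 2 ^ (8 * P.l ^ 2 + 1) := by
    rw [Par.cap, Par.scale, Par.lam, ← pow_mul, ← pow_mul, ← pow_succ']; congr 1; ring
  rw [Par.len, this, bits_two_pow]

/-- The whole program. -/
def program : Cmd :=
  .seq roundsCmd <| .seq scalesCmd <| .seq copyCmd <| .seq mainCmd <|
  .seq (.set 0 (.load 25 0 0 0)) (.set 1 (2 * .reg 13 * .reg 13 * .reg 13 * .reg 11))

theorem setup_spec : ∃ K : ℕ, ∀ {d M W E : ℕ} {s : State}, 1 ≤ d → 1 ≤ M → 1 ≤ W → 1 ≤ E →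
    s.reg 0 = d → s.reg 1 = M → s.reg 2 = W → s.reg 3 = E → (∀ x, 4 ≤ x → s.reg x = 0) →
    (∀ a i j k, 4 ≤ a → s.mem a i j k = 0) →
    ∃ s', Runs (.seq roundsCmd scalesCmd) s s' K ((bitBound d M W E + 1) ^ 2) ∧
      s'.mem = s.mem ∧ Inv (inputParams d M W E) s' := by
  obtain ⟨K₁, h₁⟩ := exists_runs_roundsCmd
  obtain ⟨K₂, h₂⟩ := exists_runs_scalesCmd
  refine ⟨K₁ + K₂, fun {d M W E s} hd hM hW hE r0 r1 r2 r3 hr hm => ?_⟩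
  have hF := params_fine hd hM hW hE rfl
  have hlen := (inputParams d M W E).len_eq
  have hX : 8 * (inputParams d M W E).l ^ 2 + numRounds d M W E + 10 ≤ bitBound d M W E := by
    rw [bitBound]; omega
  have hlX : (inputParams d M W E).len ≤ bitBound d M W E := by omega
  have hs : s.Bounded (bitBound d M W E) := by
    intro x
    refine le_trans ?_ hlX
    rcases le_or_gt 4 x with h4 | h4
    · rw [hr x h4]; exact Nat.zero_le _
    · interval_cases x
      · rw [r0]; exact hF.bits_le_len hF.d_le
      · rw [r1]; exact hF.bits_le_len hF.M_le
      · rw [r2]; exact hF.bits_le_len hF.W_le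
      · rw [r3]; exact hF.bits_le_len hF.E_le
  obtain ⟨s1, c1, m1, b1, e20, e11, e⟩ := h₁ hs hd r0 r1 r2 r3 (hr 20 (by norm_num))
    (by rw [bitBound]; omega)
  obtain ⟨s2, c2, m2, b2, f0, f1, f2, f3, f11, f12, f13, f14, f15, f16, f17, f⟩ :=
    h₂ (P := inputParams d M W E) (z := (d + M + W + E).size) b1 ((e 0 (by norm_num)).trans r0)
      ((e 1 (by norm_num)).trans r1) ((e 2 (by norm_num)).trans r2)
      ((e 3 (by norm_num)).trans r3) e20 e11 rfl rfl rfl (Nat.size_pos.2 (by omega))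
      (by change numRounds d M W E + _ + 2 ≤ _; omega)
  refine ⟨s2, c1.seq c2, m2.trans m1, ⟨f0, f1, f2, f3, f11, f12, f13, f14, f15, f16, f17,
    fun x h4 h10 => ?_, fun a ha i j k => ?_, fun a ha i j k _ => ?_⟩⟩
  · rw [f x h4 h10, e x h10, hr x h4]; exact Nat.zero_le _
  · rw [m2, m1, hm a i j k ha]; exact Nat.zero_le _
  · rw [m2, m1, hm a i j k ha]

/-- The denominator combines the scale 2 sg² of the residuals, the factor sg of the square roots and
the average over T rounds. -/
theorem finish_spec {P : Par} {s : State} (hP : P.Ok) (h : Inv P s) :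
    let r := (Cmd.seq (.set 0 (.load 25 0 0 0))
      (.set 1 (2 * .reg 13 * .reg 13 * .reg 13 * .reg 11))).run s
    r.state.reg 0 = s.mem 25 0 0 0 ∧ r.state.reg 1 = ((2 * P.sg ^ 3 * P.T : ℕ) : ℤ) ∧
    r.work ≤ 200 * (P.len + 1) ∧ r.depth ≤ 200 * (P.len + 1) := by
  have c0 := Expr.cost_le hP h (.load 25 0 0 0) rfl
  have c1 := Expr.cost_le hP h (2 * .reg 13 * .reg 13 * .reg 13 * .reg 11) rfl
  have w0 : (Expr.load 25 0 0 0).weight = 4 := rfl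
  have w1 : (2 * Expr.reg 13 * .reg 13 * .reg 13 * .reg 11).weight = 78 := rfl
  rw [w0] at c0
  rw [w1] at c1
  set s1 := s.setReg 0 (s.mem 25 0 0 0) with hs1
  have hc : (2 * Expr.reg 13 * .reg 13 * .reg 13 * .reg 11).cost s1
      = (2 * Expr.reg 13 * .reg 13 * .reg 13 * .reg 11).cost s := rfl
  refine ⟨rfl, ?_, ?_, ?_⟩
  · change 2 * s.reg 13 * s.reg 13 * s.reg 13 * s.reg 11 = _
    rw [h.r13, h.r11]; push_cast; ring
  · change 1 + (Expr.load 25 0 0 0).cost s +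
      (1 + (2 * Expr.reg 13 * .reg 13 * .reg 13 * .reg 11).cost s1) ≤ _
    omega
  · change 1 + (Expr.load 25 0 0 0).cost s +
      (1 + (2 * Expr.reg 13 * .reg 13 * .reg 13 * .reg 11).cost s1) ≤ _
    omega

theorem program_spec : ∃ K q : ℕ, ∀ {d M W E : ℕ} {w ε : ℝ} {s : State}
    {Q : Fin M → Matrix (Fin d) (Fin d) ℂ} {p : Fin M → ℂ}, 1 ≤ d → 1 ≤ M → 1 ≤ W → 1 ≤ E →
    ⌈w⌉₊ = W → ⌈1 / ε⌉₊ = E → IsInstance W Q p → Encodes 20 w ε Q p s →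
    0 < (program.run s).state.reg 1 ∧
    (∃ ρ φ N, (∀ t < numRounds d M W E, (N t).IsHermitian) ∧
      IsRun Q p W (1 / (2 * E)) (numRounds d M W E) (1 / (100 * (d : ℝ) ^ 2 * M * W * E)) ρ φ N
        (program.run s).value) ∧
    (program.run s).work ≤ K * (bitBound d M W E + M + 1) ^ q * (d + M + 1) ^ 3 ∧
    (program.run s).depth ≤ K * (bitBound d M W E + M + 1) ^ q := by
  obtain ⟨K₁, h₁⟩ := setup_spec
  obtain ⟨K₂, q, h₂⟩ := cheap_mainCmd
  refine ⟨K₁ + 1600 + K₂ + 200, q + 2, fun {d M W E w ε s Q p} hd hM hW hE ew eE hQ hs => ?_⟩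
  obtain ⟨s1, c1, m1, i1⟩ := h₁ hd hM hW hE hs.reg0 hs.reg1 (by rw [hs.reg2, ew])
    (by rw [hs.reg3, eE]) hs.reg_rest hs.mem_rest
  set P := inputParams d M W E with hP
  have hF : P.Fine (2 ^ (d + M + W + E).size) := params_fine hd hM hW hE rfl
  have hsg : (2 : ℝ) ^ (20 * (d + M + ⌈w⌉₊ + ⌈1 / ε⌉₊).size) = P.sg := by
    rw [ew, eE]; change _ = (((2 : ℕ) ^ (20 * (d + M + W + E).size) : ℕ) : ℝ); push_cast; rfl
  obtain ⟨s2, e2, i2, hol, o2, w2, d2⟩ := copyCmd_spec (P := P) (Q := Q) (p := p) hF.toOk i1 hQ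
    (by rw [m1, ← hsg]; exact hs.re_Q) (by rw [m1, ← hsg]; exact hs.im_Q)
    (by rw [m1, ← hsg]; exact hs.re_p) (by rw [m1, ← hsg]; exact hs.im_p)
  obtain ⟨i3, w3, d3⟩ := h₂ P hF.toOk s2 i2
  obtain ⟨ρ, φ, N, hN, hrun⟩ := mainCmd_spec hF i2 hol hQ (fun a ha i j => by
    rw [o2 a (by omega), m1, hs.mem_rest a i j 0 (by omega)])
  obtain ⟨g0, g1, w4, d4⟩ := finish_spec hF.toOk i3
  set fin : Cmd := .seq (.set 0 (.load 25 0 0 0))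
    (.set 1 (2 * .reg 13 * .reg 13 * .reg 13 * .reg 11)) with hfin
  have hc1 := c1.state
  rw [run_seq_state] at hc1
  have hst : (program.run s).state = (fin.run (mainCmd.run s2).state).state := by
    rw [program, run_seq_state, run_seq_state, hc1, run_seq_state, e2, run_seq_state]
  have hwork : (program.run s).work = ((Cmd.seq roundsCmd scalesCmd).run s).work +
      ((copyCmd.run s1).work + ((mainCmd.run s2).work +
        (fin.run (mainCmd.run s2).state).work)) := by
    rw [← e2, ← hc1]; simp only [program, Cmd.run, hfin]; ring
  have hdepth : (program.run s).depth = ((Cmd.seq roundsCmd scalesCmd).run s).depth +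
      ((copyCmd.run s1).depth + ((mainCmd.run s2).depth +
        (fin.run (mainCmd.run s2).state).depth)) := by
    rw [← e2, ← hc1]; simp only [program, Cmd.run, hfin]; ring
  have hX : P.len + P.l + P.T ≤ bitBound d M W E := by
    have hl : P.l ≤ P.l ^ 2 := Nat.le_self_pow two_ne_zero _
    rw [P.len_eq, bitBound, ← hP]
    change 8 * P.l ^ 2 + 2 + P.l + numRounds d M W E ≤ _
    omega
  set Y := bitBound d M W E + M + 1 with hY
  have hY1 : 1 ≤ Y := by omega
  set D := (d + M + 1) ^ 3 with hD
  have hD1 : 1 ≤ D := Nat.one_le_pow _ _ (by omega)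
  have p1 : (bitBound d M W E + 1) ^ 2 ≤ Y ^ (q + 2) :=
    (Nat.pow_le_pow_left (by omega) 2).trans (Nat.pow_le_pow_right hY1 (by omega))
  have p2 : P.len + 1 ≤ Y ^ (q + 2) :=
    (show P.len + 1 ≤ Y by omega).trans (Nat.le_self_pow (by omega) _)
  have p3 : (P.len + 1) * (P.T + P.l + P.M + 1) ^ q ≤ Y ^ (q + 2) := by
    have : (P.T + P.l + P.M + 1) ^ q ≤ Y ^ q :=
      Nat.pow_le_pow_left (by change P.T + P.l + M + 1 ≤ _; omega) q
    calc _ ≤ Y ^ 2 * Y ^ q := Nat.mul_le_mul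
          ((show P.len + 1 ≤ Y by omega).trans (Nat.le_self_pow (by omega) _)) this
      _ = _ := by ring
  generalize Y ^ (q + 2) = Z at *
  refine ⟨?_, ⟨ρ, φ, N, hN, ?_⟩, ?_, ?_⟩
  · rw [hst, g1]
    exact Int.natCast_pos.2 (Nat.mul_pos (Nat.mul_pos two_pos (Nat.pow_pos hF.sg_pos)) hF.T_pos)
  · have hv : (program.run s).value
        = ((mainCmd.run s2).state.mem 25 0 0 0 : ℝ) / (2 * P.sg ^ 3 * P.T) := by
      rw [Outcome.value, hst, g0, g1]; push_cast; rfl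
    rw [hv]
    exact hrun
  · rw [hwork]
    have e1 : (K₁ + 1600 + K₂ + 200) * Z * D = K₁ * Z * D + 1600 * Z * D + K₂ * Z * D
      + 200 * Z * D := by ring
    have hZD : ∀ k x : ℕ, x ≤ Z → k * x ≤ k * Z * D := fun k x hx =>
      (Nat.mul_le_mul_left k hx).trans (Nat.le_mul_of_pos_right _ hD1)
    have a1 := c1.work.trans (hZD _ _ p1)
    have a2 : (copyCmd.run s1).work ≤ 1600 * Z * D :=
      w2.trans (Nat.mul_le_mul_right _ (Nat.mul_le_mul_left _ p2))
    have a3 : (mainCmd.run s2).work ≤ K₂ * Z * D := by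
      refine w3.trans (le_trans (le_of_eq ?_)
        (Nat.mul_le_mul_right D (Nat.mul_le_mul_left K₂ p3)))
      change K₂ * (P.len + 1) * D * _ = _
      ring
    have a4 := w4.trans (hZD _ _ p2)
    omega
  · rw [hdepth]
    have e1 : (K₁ + 1600 + K₂ + 200) * Z = K₁ * Z + 1600 * Z + K₂ * Z + 200 * Z := by ring
    have a1 := c1.depth.trans (Nat.mul_le_mul_left _ p1)
    have a2 := d2.trans (Nat.mul_le_mul_left _ p2)
    have a3 : (mainCmd.run s2).depth ≤ K₂ * Z := by
      refine d3.trans (le_trans (le_of_eq ?_) (Nat.mul_le_mul_left K₂ p3))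
      ring
    have a4 := d4.trans (Nat.mul_le_mul_left _ p2)
    omega

end Correctness

/-! ### Polynomial bounds in the parameters and the bit length of d. -/

section PolynomialBounds

/-- `f` is polynomial in the last three arguments and the bit length of the first one. -/
def PolyBounded (f : ℕ → ℕ → ℕ → ℕ → ℕ) : Prop :=
  ∃ C k : ℕ, ∀ d M W E, f d M W E ≤ C * (M + W + E + d.size + 1) ^ k

theorem PolyBounded.mono {f g : ℕ → ℕ → ℕ → ℕ → ℕ} (hg : PolyBounded g)
    (h : ∀ d M W E, f d M W E ≤ g d M W E) : PolyBounded f := by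
  obtain ⟨C, k, hC⟩ := hg
  exact ⟨C, k, fun d M W E => (h d M W E).trans (hC d M W E)⟩

theorem PolyBounded.const (c : ℕ) : PolyBounded fun _ _ _ _ => c := ⟨c, 0, by simp⟩

theorem PolyBounded.sum : PolyBounded fun d M W E => M + W + E + d.size :=
  ⟨1, 1, fun d M W E => by dsimp only; rw [pow_one]; omega⟩

theorem PolyBounded.add {f g : ℕ → ℕ → ℕ → ℕ → ℕ} (hf : PolyBounded f) (hg : PolyBounded g) :
    PolyBounded fun d M W E => f d M W E + g d M W E := by
  obtain ⟨C, k, hC⟩ := hf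
  obtain ⟨C', k', hC'⟩ := hg
  refine ⟨C + C', k + k', fun d M W E => ?_⟩
  rw [add_mul]
  exact add_le_add
    ((hC d M W E).trans (Nat.mul_le_mul_left _ (Nat.pow_le_pow_right (by omega) (by omega))))
    ((hC' d M W E).trans (Nat.mul_le_mul_left _ (Nat.pow_le_pow_right (by omega) (by omega))))

theorem PolyBounded.mul {f g : ℕ → ℕ → ℕ → ℕ → ℕ} (hf : PolyBounded f) (hg : PolyBounded g) :
    PolyBounded fun d M W E => f d M W E * g d M W E := by
  obtain ⟨C, k, hC⟩ := hf
  obtain ⟨C', k', hC'⟩ := hg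
  refine ⟨C * C', k + k', fun d M W E => ?_⟩
  refine (Nat.mul_le_mul (hC d M W E) (hC' d M W E)).trans (le_of_eq ?_)
  ring

theorem PolyBounded.pow {f : ℕ → ℕ → ℕ → ℕ → ℕ} (hf : PolyBounded f) (n : ℕ) :
    PolyBounded fun d M W E => f d M W E ^ n := by
  obtain ⟨C, k, hC⟩ := hf
  refine ⟨C ^ n, k * n, fun d M W E => ?_⟩
  refine (Nat.pow_le_pow_left (hC d M W E) n).trans (le_of_eq ?_)
  rw [mul_pow, pow_mul]

theorem polyBounded_invRateSq : PolyBounded fun _ M W E => invRateSq M W E := by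
  refine ((PolyBounded.const 256).mul (PolyBounded.sum.pow 6)).mono fun d M W E => ?_
  have h : E * M * W ≤ (M + W + E + d.size) ^ 3 := by
    calc E * M * W ≤ (M + W + E + d.size) * (M + W + E + d.size) * (M + W + E + d.size) :=
          Nat.mul_le_mul (Nat.mul_le_mul (by omega) (by omega)) (by omega)
      _ = _ := by ring
  calc invRateSq M W E = 256 * ((E * M * W) * (E * M * W)) := by rw [invRateSq]; ring
    _ ≤ 256 * ((M + W + E + d.size) ^ 3 * (M + W + E + d.size) ^ 3) := by gcongr
    _ = _ := by ring

/-- The power of d is huge, but its bit length is at most about the exponent times the bit length of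
d. -/
theorem polyBounded_powLen : PolyBounded powLen := by
  refine ((PolyBounded.sum.mul polyBounded_invRateSq).add (PolyBounded.const 1)).mono
    fun d M W E => ?_
  rw [powLen, Nat.size_le]
  calc d ^ invRateSq M W E ≤ (2 ^ d.size) ^ invRateSq M W E :=
        Nat.pow_le_pow_left (Nat.lt_size_self d).le _
    _ = 2 ^ (d.size * invRateSq M W E) := by rw [← pow_mul]
    _ < 2 ^ ((M + W + E + d.size) * invRateSq M W E + 1) :=
        Nat.pow_lt_pow_right one_lt_two
          (Nat.lt_succ_of_le (Nat.mul_le_mul_right _ (by omega)))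

theorem polyBounded_numRounds : PolyBounded numRounds := by
  have hm : PolyBounded fun d M W E => powLen d M W E + 8 :=
    polyBounded_powLen.add (PolyBounded.const 8)
  have hp : PolyBounded fun d M W E => 16 * (powLen d M W E + 8) * powLen d M W E :=
    ((PolyBounded.const 16).mul hm).mul polyBounded_powLen
  refine ((polyBounded_powLen.mul ((hm.mul hp).add ((PolyBounded.const 2).mul hm))).add
    (PolyBounded.const 1)).mono fun d M W E => ?_
  refine Nat.add_le_add_right ((Nat.div_le_self _ _).trans (Nat.mul_le_mul_left _ ?_)) 1
  exact Nat.add_le_add_right (logTwoSum_le _ _) _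

theorem polyBounded_size : PolyBounded fun d M W E => (d + M + W + E).size := by
  refine (PolyBounded.sum.add (PolyBounded.const 1)).mono fun d M W E => ?_
  rw [Nat.size_le]
  have h1 : d < 2 ^ d.size := Nat.lt_size_self d
  have h2 : M + W + E < 2 ^ (M + W + E) := Nat.lt_two_pow_self
  have h3 : 2 ^ d.size ≤ 2 ^ (M + W + E + d.size) := Nat.pow_le_pow_right two_pos (by omega)
  have h4 : 2 ^ (M + W + E) ≤ 2 ^ (M + W + E + d.size) := Nat.pow_le_pow_right two_pos (by omega)
  rw [pow_succ]
  omega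

theorem polyBounded_bitBound : PolyBounded bitBound := by
  have hm : PolyBounded fun d M W E => powLen d M W E + 8 :=
    polyBounded_powLen.add (PolyBounded.const 8)
  have hp : PolyBounded fun d M W E => 16 * (powLen d M W E + 8) * powLen d M W E :=
    ((PolyBounded.const 16).mul hm).mul polyBounded_powLen
  have hl : PolyBounded fun d M W E => (inputParams d M W E).l :=
    ((PolyBounded.const 16).mul polyBounded_numRounds).add
      ((PolyBounded.const 160).mul polyBounded_size)
  exact (((((polyBounded_invRateSq.add hp).add polyBounded_powLen).add (hm.mul hp)).add
    polyBounded_numRounds).add ((PolyBounded.const 9).mul (hl.pow 2))).add (PolyBounded.const 10)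

/-- The dimension enters the depth only through its bit length; both complexity claims follow from
this bound. -/
theorem program_cost : ∃ K q : ℕ, ∀ {d M : ℕ} {w ε : ℝ}, 1 ≤ d → 1 ≤ M → 0 < w → 0 < ε →
    ∀ s ∈ inputs 20 d M w ε,
    (program.run s).work ≤ K * (M + ⌈w⌉₊ + ⌈1 / ε⌉₊ + d.size + 1) ^ q * (d + M + 1) ^ 3 ∧
    (program.run s).depth ≤ K * (M + ⌈w⌉₊ + ⌈1 / ε⌉₊ + d.size + 1) ^ q := by
  obtain ⟨K, q, h⟩ := program_spec
  obtain ⟨C, k, hC⟩ := (PolyBounded.const K).mul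
    (((polyBounded_bitBound.add PolyBounded.sum).add (PolyBounded.const 1)).pow q)
  refine ⟨C, k, fun {d M w ε} hd hM hw hε s hs => ?_⟩
  obtain ⟨Q, p, hQ, henc⟩ := hs
  have hQ' : IsInstance (⌈w⌉₊ : ℝ) Q p :=
    ⟨fun k => (hQ.1 k).trans (Nat.le_ceil w), fun k => (hQ.2 k).trans (Nat.le_ceil w)⟩
  obtain ⟨-, -, h1, h2⟩ := h hd hM (Nat.ceil_pos.2 hw) (Nat.ceil_pos.2 (one_div_pos.2 hε)) rfl rfl
    hQ' henc
  have h3 : K * (bitBound d M ⌈w⌉₊ ⌈1 / ε⌉₊ + M + 1) ^ q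
      ≤ C * (M + ⌈w⌉₊ + ⌈1 / ε⌉₊ + d.size + 1) ^ k := by
    refine le_trans (Nat.mul_le_mul_left _ (Nat.pow_le_pow_left ?_ q)) (hC d M ⌈w⌉₊ ⌈1 / ε⌉₊)
    omega
  exact ⟨h1.trans (Nat.mul_le_mul_right _ h3), h2.trans h3⟩

theorem program_work_le : ∃ (C : ℝ) (k : ℕ), ∀ (d M : ℕ) (w ε : ℝ), 1 ≤ d → 1 ≤ M → 0 < w →
    0 < ε → ∀ s ∈ inputs 20 d M w ε,
    ((program.run s).work : ℝ) ≤ C * ((d : ℝ) + M + w + 1 / ε) ^ k := by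
  obtain ⟨K, q, h⟩ := program_cost
  refine ⟨K * 3 ^ (q + 3), q + 3, fun d M w ε hd hM hw hε s hs => ?_⟩
  have hd' : (1 : ℝ) ≤ d := by exact_mod_cast hd
  have hM' : (1 : ℝ) ≤ M := by exact_mod_cast hM
  have hε' : 0 < 1 / ε := one_div_pos.2 hε
  have h1 : (⌈w⌉₊ : ℝ) < w + 1 := Nat.ceil_lt_add_one hw.le
  have h2 : (⌈1 / ε⌉₊ : ℝ) < 1 / ε + 1 := Nat.ceil_lt_add_one hε'.le
  have h3 : (d.size : ℝ) ≤ d := by exact_mod_cast Nat.size_le.2 Nat.lt_two_pow_self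
  set B : ℝ := (d : ℝ) + M + w + 1 / ε with hB
  have h4 : ((M : ℝ) + ⌈w⌉₊ + ⌈1 / ε⌉₊ + d.size + 1) ≤ 3 * B := by linarith
  have h5 : ((d : ℝ) + M + 1) ≤ 3 * B := by linarith
  have h6 : ((program.run s).work : ℝ)
      ≤ K * ((M : ℝ) + ⌈w⌉₊ + ⌈1 / ε⌉₊ + d.size + 1) ^ q * ((d : ℝ) + M + 1) ^ 3 := by
    exact_mod_cast (h hd hM hw hε s hs).1
  calc _ ≤ _ := h6
    _ ≤ K * (3 * B) ^ q * (3 * B) ^ 3 := by gcongr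
    _ = _ := by rw [mul_assoc, ← pow_add, mul_pow]; ring

end PolynomialBounds

/-! ### Polylogarithmic parameters and the class NC. -/

section Parallel

theorem isBigO_log_pow_mono {a b : ℕ} (h : a ≤ b) :
    (fun n : ℕ => Real.log n ^ a) =O[Filter.atTop] fun n : ℕ => Real.log n ^ b := by
  refine Asymptotics.IsBigO.of_bound 1 ?_
  have : ∀ᶠ n : ℕ in Filter.atTop, 1 ≤ Real.log n :=
    (Real.tendsto_log_atTop.comp tendsto_natCast_atTop_atTop).eventually_ge_atTop 1
  filter_upwards [this] with n hn
  rw [one_mul, Real.norm_of_nonneg (by positivity), Real.norm_of_nonneg (by positivity)]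
  exact pow_le_pow_right₀ hn h

theorem PolyLog.add {f g : ℕ → ℝ} (hf : PolyLog f) (hg : PolyLog g) :
    PolyLog fun n => f n + g n := by
  obtain ⟨a, ha⟩ := hf
  obtain ⟨b, hb⟩ := hg
  exact ⟨a + b, (ha.trans (isBigO_log_pow_mono (by omega))).add
    (hb.trans (isBigO_log_pow_mono (by omega)))⟩

theorem PolyLog.mono {f g : ℕ → ℝ} (hg : PolyLog g) (h : ∀ n, 2 ≤ n → |f n| ≤ g n) :
    PolyLog f := by
  obtain ⟨a, ha⟩ := hg
  refine ⟨a, Asymptotics.IsBigO.trans (Asymptotics.IsBigO.of_bound 1 ?_) ha⟩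
  filter_upwards [Filter.eventually_ge_atTop 2] with n hn
  rw [one_mul, Real.norm_eq_abs, Real.norm_eq_abs]
  exact (h n hn).trans (le_abs_self _)

theorem polyLog_one : PolyLog fun _ => 1 := ⟨0, by simpa using Asymptotics.isBigO_refl (fun _ : ℕ => (1 : ℝ)) Filter.atTop⟩

theorem polyLog_size : PolyLog fun n => (n.size : ℝ) := by
  have h : PolyLog fun n : ℕ => 2 * Real.log n :=
    ⟨1, by simpa using (Asymptotics.isBigO_refl (fun n : ℕ => Real.log n) _).const_mul_left 2⟩
  refine (h.add polyLog_one).mono fun n hn => ?_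
  rw [abs_of_nonneg (Nat.cast_nonneg _)]
  have h1 : 2 ^ (n.size - 1) ≤ n :=
    Nat.lt_size.1 (Nat.sub_lt (Nat.size_pos.2 (by omega)) one_pos)
  have h2 : ((n.size - 1 : ℕ) : ℝ) * Real.log 2 ≤ Real.log n := by
    rw [← Real.log_pow]
    exact Real.log_le_log (by positivity) (by exact_mod_cast h1)
  have h3 : (n.size : ℝ) ≤ ((n.size - 1 : ℕ) : ℝ) + 1 := by
    exact_mod_cast (show n.size ≤ n.size - 1 + 1 by omega)
  have h4 := Real.log_two_gt_d9
  nlinarith [(Nat.cast_nonneg (n.size - 1) : (0 : ℝ) ≤ ((n.size - 1 : ℕ) : ℝ))]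

/-- An asymptotic bound on ℕ holds from n = 2 on after enlarging the constant, because ln n > 0
there. Raising the exponent by one guarantees a ≥ 1. -/
theorem PolyLog.bound {f : ℕ → ℝ} (hf : PolyLog f) :
    ∃ (C : ℝ) (a : ℕ), 0 < C ∧ 1 ≤ a ∧ ∀ n, 2 ≤ n → f n ≤ C * Real.log n ^ a := by
  obtain ⟨a, ha⟩ := hf
  obtain ⟨C, hC, h⟩ := Asymptotics.bound_of_isBigO_nat_atTop
    (ha.trans (isBigO_log_pow_mono (Nat.le_succ a)))
  refine ⟨C, a + 1, hC, by omega, fun n hn => ?_⟩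
  have hlog : 0 < Real.log n := Real.log_pos (by exact_mod_cast hn)
  have := h (x := n) (pow_pos hlog _).ne'
  rw [Real.norm_of_nonneg (pow_pos hlog _).le] at this
  exact (le_abs_self _).trans this

theorem Cmd.runsInNC_of_bound {P : Cmd} {c K q : ℕ} {M : ℕ → ℕ} {w ε : ℕ → ℝ}
    (h : ∀ {d M : ℕ} {w ε : ℝ}, 1 ≤ d → 1 ≤ M → 0 < w → 0 < ε → ∀ s ∈ inputs c d M w ε,
      (P.run s).work ≤ K * (M + ⌈w⌉₊ + ⌈1 / ε⌉₊ + d.size + 1) ^ q * (d + M + 1) ^ 3 ∧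
      (P.run s).depth ≤ K * (M + ⌈w⌉₊ + ⌈1 / ε⌉₊ + d.size + 1) ^ q)
    (hM : ∀ d, 1 ≤ M d) (hw : ∀ d, 0 < w d) (hε : ∀ d, 0 < ε d) (pM : PolyLog fun d => (M d : ℝ))
    (pw : PolyLog w) (pε : PolyLog fun d => 1 / ε d) :
    P.RunsInNC fun d => inputs c d (M d) (w d) (ε d) := by
  set g : ℕ → ℝ := fun d => (M d : ℝ) + ⌈w d⌉₊ + ⌈1 / ε d⌉₊ + d.size + 1 with hg
  have hceil : ∀ {x : ℕ → ℝ}, (∀ d, 0 < x d) → PolyLog x → PolyLog fun d => (⌈x d⌉₊ : ℝ) :=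
    fun hx px => (px.add polyLog_one).mono fun n _ => by
      rw [abs_of_nonneg (Nat.cast_nonneg _)]
      exact (Nat.ceil_lt_add_one (hx n).le).le
  have pg : PolyLog g := (((pM.add (hceil hw pw)).add
    (hceil (fun d => one_div_pos.2 (hε d)) pε)).add polyLog_size).add polyLog_one
  obtain ⟨C, a, hC, ha, hb⟩ := pg.bound
  -- One exponent a · k has to serve for work and depth. It exceeds a(q + 3) + 3, needed for the
  -- work, and k ≥ q, needed for the depth.
  set k := a * (q + 3) + 3 + q with hk
  refine ⟨K * C ^ (q + 3) + K * C ^ k, a * k, fun n hn s hs => ?_⟩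
  obtain ⟨h1, h2⟩ := h (by omega) (hM n) (hw n) (hε n) s hs
  have h1' : ((P.run s).work : ℝ) ≤ K * g n ^ q * ((n : ℝ) + M n + 1) ^ 3 := by
    simp only [hg]
    exact_mod_cast h1
  have h2' : ((P.run s).depth : ℝ) ≤ K * g n ^ q := by
    simp only [hg]
    exact_mod_cast h2
  have hn' : (2 : ℝ) ≤ n := by exact_mod_cast hn
  have hM' : (1 : ℝ) ≤ M n := by exact_mod_cast hM n
  have hs1 : (1 : ℝ) ≤ n.size := by exact_mod_cast Nat.size_pos.2 (by omega)
  have hg1 : (M n : ℝ) + 2 ≤ g n := by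
    have e1 : (0 : ℝ) ≤ ⌈w n⌉₊ := Nat.cast_nonneg _
    have e2 : (0 : ℝ) ≤ ⌈1 / ε n⌉₊ := Nat.cast_nonneg _
    simp only [hg]
    linarith
  have hlog0 : 0 ≤ Real.log n := Real.log_nonneg (by linarith)
  have hlog : Real.log n ≤ n := (Real.log_le_sub_one_of_pos (by linarith)).trans (by linarith)
  have hbn := hb n hn
  have hg0 : 0 ≤ g n := by linarith
  constructor
  · have e1 : (n : ℝ) + M n + 1 ≤ g n * n := by nlinarith
    calc _ ≤ _ := h1'
      _ ≤ K * g n ^ q * (g n * n) ^ 3 := by gcongr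
      _ = K * g n ^ (q + 3) * n ^ 3 := by ring
      _ ≤ K * (C * Real.log n ^ a) ^ (q + 3) * n ^ 3 := by gcongr
      _ ≤ K * (C * (n : ℝ) ^ a) ^ (q + 3) * n ^ 3 := by gcongr
      _ = K * C ^ (q + 3) * (n : ℝ) ^ (a * (q + 3) + 3) := by
        rw [mul_pow, ← pow_mul, pow_add]; ring
      _ ≤ K * C ^ (q + 3) * (n : ℝ) ^ (a * k) := by
        have : a * (q + 3) + 3 ≤ a * k :=
          le_trans (show a * (q + 3) + 3 ≤ k by omega) (Nat.le_mul_of_pos_left _ ha)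
        gcongr
        linarith
      _ ≤ _ := by
        gcongr
        exact le_add_of_nonneg_right (by positivity)
  -- The exponent is raised on g n ≥ 1 and not on the logarithm, since ln 2 < 1.
  · have e1 : g n ^ q ≤ g n ^ k := pow_le_pow_right₀ (by linarith) (by omega)
    calc _ ≤ _ := h2'
      _ ≤ K * g n ^ k := by gcongr
      _ ≤ K * (C * Real.log n ^ a) ^ k := by gcongr
      _ = K * C ^ k * Real.log n ^ (a * k) := by rw [mul_pow, ← pow_mul]; ring
      _ ≤ _ := by
        gcongr
        exact le_add_of_nonneg_left (by positivity)

end Parallel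

end QDist

theorem lemma2p1 :
    -- correctness of the algorithm, in exact arithmetic and for every choice of the phases
    (∀ (d M : ℕ) (w ε : ℝ), 1 ≤ d → 1 ≤ M → 0 < w → 0 < ε →
      ∀ (Q : Fin M → Matrix (Fin d) (Fin d) ℂ) (p : Fin M → ℂ), QDist.IsInstance w Q p →
        IsLeast ((fun q => QDist.l1 (p - q)) '' QDist.qSpace Q) (QDist.dis Q p) ∧
        (∃ ρ φ N v, QDist.IsRun Q p w ε (QDist.rounds d M w ε) 0 ρ φ N v) ∧
        (∀ ρ φ N v, QDist.IsRun Q p w ε (QDist.rounds d M w ε) 0 ρ φ N v →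
          v - ε ≤ QDist.dis Q p ∧ QDist.dis Q p ≤ v + ε)) ∧
    -- the implementation `P` of the algorithm and its efficiency
    (∃ (P : QDist.Cmd) (c : ℕ),
      (∀ (d M : ℕ) (w ε : ℝ), 1 ≤ d → 1 ≤ M → 0 < w → 0 < ε →
        ∀ (Q : Fin M → Matrix (Fin d) (Fin d) ℂ) (p : Fin M → ℂ), QDist.IsInstance w Q p →
          ∀ s : QDist.State, QDist.Encodes c w ε Q p s →
            0 < (P.run s).state.reg 1 ∧
            (P.run s).value - ε ≤ QDist.dis Q p ∧ QDist.dis Q p ≤ (P.run s).value + ε ∧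
            -- `P` executes the algorithm in finite precision, for the accuracy `1 / (2 ⌈1/ε⌉)`
            ∃ T ρ φ N,
              QDist.rounds d M (⌈w⌉₊ : ℝ) (1 / (2 * (⌈1 / ε⌉₊ : ℝ))) ≤ T ∧
              T ≤ QDist.rounds d M (⌈w⌉₊ : ℝ) (1 / (2 * (⌈1 / ε⌉₊ : ℝ))) + 1 ∧
              QDist.IsRun Q p (⌈w⌉₊ : ℝ) (1 / (2 * (⌈1 / ε⌉₊ : ℝ))) T
                (1 / (100 * (d : ℝ) ^ 2 * M * ⌈w⌉₊ * ⌈1 / ε⌉₊)) ρ φ N (P.run s).value) ∧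
      -- polynomial time
      (∃ (C : ℝ) (k : ℕ), ∀ (d M : ℕ) (w ε : ℝ), 1 ≤ d → 1 ≤ M → 0 < w → 0 < ε →
        ∀ s ∈ QDist.inputs c d M w ε,
          ((P.run s).work : ℝ) ≤ C * ((d : ℝ) + M + w + 1 / ε) ^ k) ∧
      -- efficiency in parallel, with input size `d`
      (∀ (M : ℕ → ℕ) (w ε : ℕ → ℝ), (∀ d, 1 ≤ M d) → (∀ d, 0 < w d) → (∀ d, 0 < ε d) →
        QDist.PolyLog (fun d => (M d : ℝ)) → QDist.PolyLog w → QDist.PolyLog (fun d => 1 / ε d) →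
        P.RunsInNC (fun d => QDist.inputs c d (M d) (w d) (ε d)))) := by
  refine ⟨fun d M w ε hd hM hw hε Q p hQ => ⟨QDist.isLeast_dis hd Q p,
      QDist.exists_exact_run Q p w ε _, fun ρ φ N v hrun => hrun.exact_bounds hd hM hw hε hQ⟩,
    QDist.program, 20, fun d M w ε hd hM hw hε Q p hQ s hs => ?_, QDist.program_work_le,
    fun M w ε hM hw hε pM pw pε => ?_⟩
  · obtain ⟨K, q, h⟩ := QDist.program_spec
    have hW1 : 1 ≤ ⌈w⌉₊ := Nat.ceil_pos.2 hw
    have hE1 : 1 ≤ ⌈1 / ε⌉₊ := Nat.ceil_pos.2 (one_div_pos.2 hε)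
    have hQ' : QDist.IsInstance (⌈w⌉₊ : ℝ) Q p :=
      ⟨fun k => (hQ.1 k).trans (Nat.le_ceil w), fun k => (hQ.2 k).trans (Nat.le_ceil w)⟩
    obtain ⟨h1, ⟨ρ, φ, N, hN, hrun⟩, -⟩ := h hd hM hW1 hE1 rfl rfl hQ' hs
    obtain ⟨t1, t2⟩ := QDist.numRounds_bounds hd hM hW1 hE1
    obtain ⟨v1, v2⟩ := hrun.approx_bounds hd hM hW1 hE1 hQ' t1 hN
    have hle : 1 / (⌈1 / ε⌉₊ : ℝ) ≤ ε := by
      rw [one_div_le (by exact_mod_cast hE1) hε]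
      exact Nat.le_ceil _
    exact ⟨h1, by linarith, by linarith, _, ρ, φ, N, t1, t2, hrun⟩
  · obtain ⟨K, q, h⟩ := QDist.program_cost
    exact QDist.Cmd.runsInNC_of_bound h hM hw hε pM pw pε
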